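/- Let $B^3\subset\mathbb R^3$ be the closed unit ball. An $m$-tangle ($m\ge 0$) is a subset $\tau\subset B^3$ that is the image of an embedding of the disjoint union of $m$ arcs and finitely many circles (possibly none) which meets $\partial B^3$ exactly in the $2m$ endpoints of the arcs. It is tame if some ambient isotopy of $B^3$, fixed on $\partial B^3$, carries $\tau$ to a finite union of straight line segments. Let $T_0,\dots,T_{10}$ be the eleven standard mosaic tiles: the empty tile $T_0$; the single arcs $T_1,\dots,T_6$ joining two of the four side midpoints (W–S, S–E, E–N, N–W, W–E, N–S); the tiles $T_7=\{\text{W–S},\text{E–N}\}$, $T_8=\{\text{S–E},\text{N–W}\}$ with two disjoint arcs; and the two crossings $T_9,T_{10}$ of a W–E arc and an N–S arc. A tangle $n$-mosaic ($n\ge1$) is an $n\times n$ matrix $L$ of such tiles that is suitably connected: any two adjacent tiles either both have or both lack a connection point (arc endpoint) on their common edge; connection points on the boundary of the $n\times n$ square are allowed. $\mathbb L^{(n)}$ is the set of tangle $n$-mosaics. The geometric realization $|L|\subset[0,n]^2\times[0,1]$ is the union of the tile arcs, drawn as polygonal arcs in the unit cubes over the tiles: arc endpoints are the centres of lateral faces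 of these cubes, arc interiors lie in the open cubes, and at a crossing tile the over-strand passes above the under-strand. **Proposition.** Let $\tau\subset B^3$ be a tame $m$-tangle. 1. There are $n\ge 1$ and $L\in\mathbb L^{(n)}$ with exactly $2m$ connection points on the boundary of the square such that $L$ represents $\tau$: some ambient isotopy of $\mathbb R^3$ carries $B^3$ onto $[0,n]^2\times[0,1]$ and $\tau$ onto $|L|$. 2. If moreover the endpoints of $\tau$ lie on the equator $\partial B^3\cap\{z=0\}$, and $p$ is any point of the equator that is not an endpoint of $\tau$, then $n$, $L$ and the ambient isotopy in 1 can be chosen so that its final map $\Phi_1$ carries the closed upper hemisphere of $\partial B^3$ onto $\partial([0,n]^2\times[0,1])\cap\{z\ge\frac12\}$ and $p$ to the corner $(0,0,\frac12)$. In particular, the equator goes to $\partial([0,n]^2)\times\{\frac12\}$, and the endpoints of $\tau$, read counterclockwise from $p$, go to the boundary connection points of $L$, read counterclockwise from that corner. -/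

import Mathlib

noncomputable section

/-- Euclidean three-space. -/
abbrev E3 : Type := EuclideanSpace ℝ (Fin 3)

/-! ### Tangles in the unit ball -/

/-- The closed unit ball. -/
def unitBall : Set E3 := Metric.closedBall 0 1

/-- `T` is (the underlying set of) an `m`-tangle in the unit ball: the image of an embedding of `m`
arcs and finitely many circles into the ball, which meets the boundary sphere exactly in the `2 * m`
endpoints of the arcs. -/
def IsTangle (m : ℕ) (T : Set E3) : Prop :=
  ∃ (c : ℕ) (f : (Fin m × unitInterval) ⊕ (Fin c × Circle) → E3),
    Topology.IsEmbedding f ∧ Set.range f = T ∧ T ⊆ unitBall ∧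
      ∀ x, ‖f x‖ = 1 ↔ ∃ i : Fin m, x = Sum.inl (i, 0) ∨ x = Sum.inl (i, 1)

/-- An ambient isotopy of `ℝ³`: a continuous one-parameter family of self-homeomorphisms,
starting at the identity. -/
structure AmbientIsotopy where
  /-- the homeomorphism at time `t` -/
  map : unitInterval → (E3 ≃ₜ E3)
  continuous_map : Continuous fun p : unitInterval × E3 => map p.1 p.2
  map_zero : map 0 = Homeomorph.refl E3

/-- A finite union of straight line segments. -/
def IsPolygonal (P : Set E3) : Prop :=
  ∃ S : Set (E3 × E3), S.Finite ∧ P = ⋃ p ∈ S, segment ℝ p.1 p.2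

/-- A tangle in the unit ball is tame if an ambient isotopy of the ball, keeping the boundary sphere
(and the exterior) pointwise fixed, carries it to a finite union of line segments. -/
def IsTame (T : Set E3) : Prop :=
  ∃ Φ : AmbientIsotopy, (∀ t x, 1 ≤ ‖x‖ → Φ.map t x = x) ∧ IsPolygonal (Φ.map 1 '' T)

/-- The closed upper half of the unit sphere. -/
def upperHemisphere : Set E3 := {x | ‖x‖ = 1 ∧ 0 ≤ x 2}

/-- The equator of the unit sphere. -/
def equator : Set E3 := {x | ‖x‖ = 1 ∧ x 2 = 0}

/-! ### Mosaics -/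

/-- The four sides of a tile. -/
inductive Side : Type
  | N | S | E | W

/-- The eleven standard mosaic tiles. -/
inductive Tile : Type
  | T0 | T1 | T2 | T3 | T4 | T5 | T6 | T7 | T8 | T9 | T10

/-- The strands of a tile: the two sides that a strand connects, and the height of its middle point
inside the unit cube. In the crossing tiles `T9` and `T10` the strand of greater height passes
over the other one. -/
def Tile.strands : Tile → List (Side × Side × ℝ)
  | .T0 => []
  | .T1 => [(.W, .S, 1 / 2)]
  | .T2 => [(.S, .E, 1 / 2)]
  | .T3 => [(.E, .N, 1 / 2)]
  | .T4 => [(.N, .W, 1 / 2)]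
  | .T5 => [(.W, .E, 1 / 2)]
  | .T6 => [(.N, .S, 1 / 2)]
  | .T7 => [(.W, .S, 1 / 2), (.E, .N, 1 / 2)]
  | .T8 => [(.S, .E, 1 / 2), (.N, .W, 1 / 2)]
  | .T9 => [(.W, .E, 3 / 4), (.N, .S, 1 / 4)]
  | .T10 => [(.W, .E, 1 / 4), (.N, .S, 3 / 4)]

/-- The tile has a connection point on side `s`. -/
def Tile.Connects (τ : Tile) (s : Side) : Prop :=
  ∃ a ∈ τ.strands, a.1 = s ∨ a.2.1 = s

/-- An `n`-mosaic: an `n × n` matrix of tiles. As usual for matrices, the first index is the row,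
counted from the top (north), and the second one is the column, counted from the left (west). -/
abbrev Mosaic (n : ℕ) : Type := Matrix (Fin n) (Fin n) Tile

/-- A mosaic is suitably connected if any two contiguous tiles either both have or both lack a
connection point on their common edge. There is no condition along the boundary of the mosaic:
a suitably connected `n`-mosaic is a tangle `n`-mosaic. -/
def Mosaic.IsTangleMosaic {n : ℕ} (L : Mosaic n) : Prop :=
  (∀ i j j' : Fin n, j.val + 1 = j'.val → ((L i j).Connects .E ↔ (L i j').Connects .W)) ∧
  (∀ i i' j : Fin n, i.val + 1 = i'.val → ((L i j).Connects .S ↔ (L i' j).Connects .N))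

/-- Side `s` of the tile in row `i` and column `j` lies on the boundary of the `n × n` square. -/
def OnBoundary {n : ℕ} (i j : Fin n) : Side → Prop
  | .N => i.val = 0
  | .S => i.val + 1 = n
  | .E => j.val + 1 = n
  | .W => j.val = 0

/-- The connection points on the boundary of the mosaic, each given by its tile and its side. -/
def Mosaic.boundaryPoints {n : ℕ} (L : Mosaic n) : Set (Fin n × Fin n × Side) :=
  {q | OnBoundary q.1 q.2.1 q.2.2 ∧ (L q.1 q.2.1).Connects q.2.2}

/-! ### Geometric realization -/

/-- The four connection points of a tile, as centres of the lateral faces of the unit cube. -/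
def Side.point : Side → E3
  | .N => !₂[1 / 2, 1, 1 / 2]
  | .S => !₂[1 / 2, 0, 1 / 2]
  | .E => !₂[1, 1 / 2, 1 / 2]
  | .W => !₂[0, 1 / 2, 1 / 2]

/-- The strand from side `a` to side `b` with middle height `h`: the polygonal path from the one
connection point to the other through the point of height `h` over (or under) their midpoint. -/
def strandSet (a b : Side) (h : ℝ) : Set E3 :=
  let c : E3 := !₂[(a.point 0 + b.point 0) / 2, (a.point 1 + b.point 1) / 2, h]
  segment ℝ a.point c ∪ segment ℝ c b.point

/-- The realization of a tile in the unit cube. -/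
def Tile.realization (τ : Tile) : Set E3 :=
  ⋃ a ∈ τ.strands, strandSet a.1 a.2.1 a.2.2

/-- The lower south-west corner of the unit cube that the tile in row `i`, column `j` occupies. -/
def tileCorner {n : ℕ} (i j : Fin n) : E3 :=
  !₂[(j.val : ℝ), (n : ℝ) - 1 - (i.val : ℝ), 0]

/-- The geometric realization `|L|` of a mosaic, a subset of `[0,n]² × [0,1]`. -/
def Mosaic.realization {n : ℕ} (L : Mosaic n) : Set E3 :=
  ⋃ (i : Fin n) (j : Fin n), (fun x => tileCorner i j + x) '' (L i j).realization

/-- The box `[0,n]² × [0,1]`. -/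
def box (n : ℕ) : Set E3 :=
  {x | x 0 ∈ Set.Icc (0 : ℝ) n ∧ x 1 ∈ Set.Icc (0 : ℝ) n ∧ x 2 ∈ Set.Icc (0 : ℝ) 1}

/-- The upper half of the boundary of the box: the points of height at least `1/2`. -/
def upperBoundary (n : ℕ) : Set E3 := {x ∈ frontier (box n) | 1 / 2 ≤ x 2}

/-! ### Representatives -/

/-- `L` represents the tangle `T` in the unit ball: an ambient isotopy of `ℝ³` carries the
ball onto the box and `T` onto the realization of `L`. -/
def Mosaic.Represents {n : ℕ} (L : Mosaic n) (T : Set E3) : Prop :=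
  ∃ Φ : AmbientIsotopy, Φ.map 1 '' unitBall = box n ∧ Φ.map 1 '' T = L.realization

/-- For a tangle `T` with endpoints on the equator and a point `p` of the equator which is not
an endpoint: `L` represents `T` with the endpoints kept in place. That is, the isotopy can be chosen
such that the upper half of the sphere goes to the upper half of the boundary of the box (so that the
equator goes to the boundary of the square) and `p` goes to the south-west corner of the square. In
particular the endpoints of `T`, read counterclockwise from `p`, go to the boundary connection
points of `L`, read counterclockwise from that corner. -/
def Mosaic.RepresentsFrom {n : ℕ} (L : Mosaic n) (T : Set E3) (p : E3) : Prop :=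
  ∃ Φ : AmbientIsotopy, Φ.map 1 '' unitBall = box n ∧ Φ.map 1 '' T = L.realization ∧
    Φ.map 1 '' upperHemisphere = upperBoundary n ∧ Φ.map 1 p = !₂[0, 0, 1 / 2]

end

noncomputable section
open Set Filter Topology

/-! ### Ambient isotopies -/

@[ext] theorem E3.ext {x y : E3} (h0 : x 0 = y 0) (h1 : x 1 = y 1) (h2 : x 2 = y 2) : x = y := by
  ext i; fin_cases i <;> assumption

theorem E3.abs_coord_le (x : E3) (i : Fin 3) : |x i| ≤ ‖x‖ := PiLp.norm_apply_le x i

theorem E3.norm_le_sum (x : E3) : ‖x‖ ≤ |x 0| + |x 1| + |x 2| := by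
  rw [EuclideanSpace.norm_eq]
  apply Real.sqrt_le_iff.2
  refine ⟨by positivity, ?_⟩
  rw [Fin.sum_univ_three]
  simp only [Real.norm_eq_abs]
  nlinarith [mul_nonneg (abs_nonneg (x 0)) (abs_nonneg (x 1)),
    mul_nonneg (abs_nonneg (x 0)) (abs_nonneg (x 2)),
    mul_nonneg (abs_nonneg (x 1)) (abs_nonneg (x 2))]

/-- A homeomorphism of space which is the end of an ambient isotopy. -/
def Isotopic (h : E3 ≃ₜ E3) : Prop := ∃ Φ : AmbientIsotopy, Φ.map 1 = h

theorem Isotopic.trans {h k : E3 ≃ₜ E3} (hh : Isotopic h) (hk : Isotopic k) :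
    Isotopic (h.trans k) := by
  obtain ⟨Φ, rfl⟩ := hh
  obtain ⟨Ψ, rfl⟩ := hk
  refine ⟨⟨fun t => (Φ.map t).trans (Ψ.map t), ?_, ?_⟩, rfl⟩
  · exact Ψ.continuous_map.comp (continuous_fst.prodMk Φ.continuous_map)
  · rw [Φ.map_zero, Ψ.map_zero]; rfl

/-- A family of pairs of mutually inverse maps. -/
theorem isotopic_of_family (f g : ℝ → E3 → E3) (hf : Continuous fun p : ℝ × E3 => f p.1 p.2)
    (hg : ∀ t ∈ Icc (0 : ℝ) 1, Continuous (g t)) (h0 : ∀ x, f 0 x = x)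
    (hgf : ∀ t ∈ Icc (0 : ℝ) 1, ∀ x, g t (f t x) = x)
    (hfg : ∀ t ∈ Icc (0 : ℝ) 1, ∀ x, f t (g t x) = x) :
    ∃ h : E3 ≃ₜ E3, Isotopic h ∧ ∀ x, h x = f 1 x := by
  let Φ : AmbientIsotopy :=
    { map := fun t =>
        { toFun := f t, invFun := g t, left_inv := hgf t t.2, right_inv := hfg t t.2
          continuous_toFun := hf.comp (continuous_const.prodMk continuous_id)
          continuous_invFun := hg t t.2 }
      continuous_map := hf.comp
        ((continuous_subtype_val.comp continuous_fst).prodMk continuous_snd)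
      map_zero := by ext1 x; exact h0 x }
  exact ⟨Φ.map 1, ⟨Φ, rfl⟩, fun x => rfl⟩

/-- The Alexander trick. -/
theorem isotopic_of_bounded (h : E3 ≃ₜ E3) (C : ℝ) (hC : ∀ x, ‖h x - x‖ ≤ C) : Isotopic h := by
  let f : ℝ → E3 → E3 := fun t x => if t = 0 then x else t • h (t⁻¹ • x)
  let g : ℝ → E3 → E3 := fun t x => if t = 0 then x else t • h.symm (t⁻¹ • x)
  have key : ∀ t x, ‖f t x - x‖ ≤ |t| * C := by
    intro t x
    by_cases ht : t = 0
    · simp [f, ht]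
    · have : f t x - x = t • (h (t⁻¹ • x) - t⁻¹ • x) := by
        simp [f, ht, smul_sub, smul_smul]
      rw [this, norm_smul, Real.norm_eq_abs]
      exact mul_le_mul_of_nonneg_left (hC _) (abs_nonneg t)
  suffices H : ∃ k : E3 ≃ₜ E3, Isotopic k ∧ ∀ x, k x = f 1 x by
    obtain ⟨k, hk, hk1⟩ := H
    have : k = h := by ext1 x; rw [hk1]; simp [f]
    rwa [this] at hk
  refine isotopic_of_family f g ?_ ?_ ?_ ?_ ?_
  · rw [continuous_iff_continuousAt]
    rintro ⟨t, x⟩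
    by_cases ht : t = 0
    · subst ht
      have h2 : Tendsto (fun p : ℝ × E3 => f p.1 p.2 - p.2) (𝓝 (0, x)) (𝓝 0) := by
        refine squeeze_zero_norm (fun p => key p.1 p.2) ?_
        have : Continuous fun p : ℝ × E3 => |p.1| * C := by fun_prop
        simpa using this.tendsto (0, x)
      have h3 := h2.add (continuous_snd.tendsto ((0 : ℝ), x))
      simpa [ContinuousAt, f] using h3
    · have h1 : ContinuousAt (fun p : ℝ × E3 => p.1 • h (p.1⁻¹ • p.2)) (t, x) := by
        apply ContinuousAt.smul continuousAt_fst
        apply h.continuous.continuousAt.comp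
        exact (continuousAt_fst.inv₀ ht).smul continuousAt_snd
      apply h1.congr
      have : ∀ᶠ p : ℝ × E3 in 𝓝 (t, x), p.1 ≠ 0 := continuousAt_fst.eventually_ne ht
      filter_upwards [this] with p hp
      simp [f, hp]
  · intro t _
    by_cases ht : t = 0
    · simp only [g, ht, if_true]; exact continuous_id
    · simp only [g, ht, if_false]
      have := h.symm.continuous
      fun_prop
  · intro x; simp [f]
  · intro t _ x
    by_cases ht : t = 0 <;> simp [f, g, ht, smul_smul]
  · intro t _ x
    by_cases ht : t = 0 <;> simp [f, g, ht, smul_smul]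

theorem exists_homeomorph_of_bounded (f : E3 → E3) (hf : Continuous f) (hb : f.Bijective) (C : ℝ)
    (hC : ∀ x, ‖f x - x‖ ≤ C) : ∃ h : E3 ≃ₜ E3, Isotopic h ∧ ∀ x, h x = f x := by
  have hp : IsProperMap f := by
    rw [isProperMap_iff_tendsto_cocompact]
    refine ⟨hf, ?_⟩
    rw [← Metric.cobounded_eq_cocompact]
    rw [← tendsto_norm_atTop_iff_cobounded]
    have h1 : Tendsto (fun x : E3 => ‖x‖ + (-C)) (Bornology.cobounded E3) atTop :=
      tendsto_atTop_add_const_right _ _ tendsto_norm_cobounded_atTop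
    refine tendsto_atTop_mono (fun x => ?_) h1
    have h2 := norm_sub_norm_le x (x - f x)
    have h3 := hC x
    rw [norm_sub_rev] at h3
    rw [sub_sub_cancel] at h2
    linarith
  have hh : IsHomeomorph f :=
    isHomeomorph_iff_continuous_isClosedMap_bijective.2 ⟨hf, hp.isClosedMap, hb⟩
  refine ⟨hh.homeomorph, isotopic_of_bounded _ C hC, fun x => rfl⟩

theorem isotopic_of_eqOn_compl {O : Set E3} (hO : Bornology.IsBounded O) (h : E3 ≃ₜ E3)
    (hid : ∀ x, x ∉ O → h x = x) : Isotopic h := by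
  obtain ⟨R, hR⟩ := hO.exists_norm_le
  refine isotopic_of_bounded h (2 * |R|) fun x => ?_
  by_cases hx : x ∈ O
  · have hy : h x ∈ O := by
      by_contra hy
      have := h.injective (hid _ hy)
      exact hy (this.symm ▸ hx)
    have h1 := hR _ hx
    have h2 := hR _ hy
    have := norm_sub_le (h x) x
    have := le_abs_self R
    linarith
  · rw [hid x hx, sub_self, norm_zero]; positivity

theorem image_eq_of_eqOn_compl {O : Set E3} (h : E3 ≃ₜ E3) (hid : ∀ x, x ∉ O → h x = x) :
    h '' O = O := by
  have h1 : h '' Oᶜ = Oᶜ := by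
    ext y; constructor
    · rintro ⟨x, hx, rfl⟩; rw [hid x hx]; exact hx
    · intro hy; exact ⟨y, hy, hid y hy⟩
  have h2 := image_compl_eq h.bijective (s := O)
  rw [h1] at h2
  exact (compl_injective h2).symm

theorem isotopic_affine (a b c κ a0 b0 c0 : ℝ) (ha : 0 < a) (hb : 0 < b) (hc : 0 < c) :
    ∃ h : E3 ≃ₜ E3, Isotopic h ∧
      ∀ x, h x = !₂[a * x 0 + a0, b * x 1 + κ * x 2 + b0, c * x 2 + c0] := by
  have pos : ∀ r : ℝ, 0 < r → ∀ t ∈ Icc (0 : ℝ) 1, 1 - t + t * r ≠ 0 := by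
    intro r hr t ht
    rcases eq_or_lt_of_le ht.1 with h | h
    · rw [← h]; norm_num
    · have := mul_pos h hr
      have := ht.2
      intro h; linarith
  refine Exists.imp (fun h (hh : _ ∧ _) => And.imp_right (fun h2 x => ?_) hh) (isotopic_of_family
    (fun t x => !₂[(1 - t + t * a) * x 0 + t * a0,
      (1 - t + t * b) * x 1 + t * κ * x 2 + t * b0, (1 - t + t * c) * x 2 + t * c0])
    (fun t x => !₂[(x 0 - t * a0) / (1 - t + t * a),
      (x 1 - t * b0 - t * κ * ((x 2 - t * c0) / (1 - t + t * c))) / (1 - t + t * b),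
      (x 2 - t * c0) / (1 - t + t * c)])
    (by fun_prop) (fun t _ => by fun_prop) (fun x => by ext <;> simp) ?_ ?_)
  · rw [h2]; ext <;> simp
  · intro t ht x
    have := pos a ha t ht
    have := pos b hb t ht
    have := pos c hc t ht
    ext <;> simp <;> field_simp <;> ring
  · intro t ht x
    have := pos a ha t ht
    have := pos b hb t ht
    have := pos c hc t ht
    ext <;> simp <;> field_simp <;> ring

theorem isotopic_rotation (θ : ℝ) :
    ∃ h : E3 ≃ₜ E3, Isotopic h ∧ ∀ x, h x =
      !₂[Real.cos θ * x 0 - Real.sin θ * x 1, Real.sin θ * x 0 + Real.cos θ * x 1, x 2] := by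
  refine Exists.imp (fun h (hh : _ ∧ _) => And.imp_right (fun h2 x => ?_) hh) (isotopic_of_family
    (fun t x => !₂[Real.cos (t * θ) * x 0 - Real.sin (t * θ) * x 1,
      Real.sin (t * θ) * x 0 + Real.cos (t * θ) * x 1, x 2])
    (fun t x => !₂[Real.cos (t * θ) * x 0 + Real.sin (t * θ) * x 1,
      - Real.sin (t * θ) * x 0 + Real.cos (t * θ) * x 1, x 2])
    (by fun_prop) (fun t _ => by fun_prop) (fun x => by ext <;> simp) ?_ ?_)
  · rw [h2]; ext <;> simp
  · intro t _ x
    have := Real.sin_sq_add_cos_sq (t * θ)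
    ext <;> simp
    · linear_combination x 0 * this
    · linear_combination x 1 * this
  · intro t _ x
    have := Real.sin_sq_add_cos_sq (t * θ)
    ext <;> simp
    · linear_combination x 0 * this
    · linear_combination x 1 * this

/-- The order isomorphisms from the identity to a given one. -/
theorem exists_orderIso_convexComb (φ : ℝ ≃o ℝ) (t : ℝ) (ht : t ∈ Icc (0 : ℝ) 1) :
    ∃ ψ : ℝ ≃o ℝ, ∀ x, ψ x = (1 - t) * x + t * φ x := by
  have hc : Continuous φ := φ.continuous
  have hm : StrictMono fun x => (1 - t) * x + t * φ x := by
    intro x y hxy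
    have := φ.strictMono hxy
    have h1 := ht.1
    have h2 := ht.2
    rcases eq_or_lt_of_le h1 with h | h
    · simp only [← h]; linarith
    · have := mul_lt_mul_of_pos_left this h
      have := mul_le_mul_of_nonneg_left hxy.le (sub_nonneg.2 h2)
      simp only; linarith
  have hs : Function.Surjective fun x => (1 - t) * x + t * φ x := by
    apply Continuous.surjective (by fun_prop)
    · rcases eq_or_lt_of_le ht.1 with h | h
      · simp only [← h, sub_zero, one_mul, zero_mul, add_zero]; exact tendsto_id
      · have h1 : Tendsto (fun x => t * φ x) atTop atTop :=
          φ.tendsto_atTop.const_mul_atTop h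
        rcases eq_or_lt_of_le ht.2 with h' | h'
        · simpa [h'] using h1
        · exact (tendsto_id.const_mul_atTop (sub_pos.2 h')).atTop_add_atTop h1
    · rcases eq_or_lt_of_le ht.1 with h | h
      · simp only [← h, sub_zero, one_mul, zero_mul, add_zero]; exact tendsto_id
      · have h1 : Tendsto (fun x => t * φ x) atBot atBot :=
          φ.tendsto_atBot.const_mul_atBot h
        rcases eq_or_lt_of_le ht.2 with h' | h'
        · simpa [h'] using h1
        · exact (tendsto_id.const_mul_atBot (sub_pos.2 h')).atBot_add_atBot h1
  exact ⟨hm.orderIsoOfSurjective _ hs, fun x => rfl⟩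

theorem isotopic_prod (φ ψ : ℝ ≃o ℝ) :
    ∃ h : E3 ≃ₜ E3, Isotopic h ∧ ∀ x, h x = !₂[φ (x 0), ψ (x 1), x 2] := by
  classical
  choose P hP using exists_orderIso_convexComb
  let Φ : ℝ → ℝ ≃o ℝ := fun t => if h : t ∈ Icc (0 : ℝ) 1 then P φ t h else φ
  let Ψ : ℝ → ℝ ≃o ℝ := fun t => if h : t ∈ Icc (0 : ℝ) 1 then P ψ t h else ψ
  have hΦ : ∀ t ∈ Icc (0 : ℝ) 1, ∀ x, Φ t x = (1 - t) * x + t * φ x := by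
    intro t ht x; simp only [Φ, dif_pos ht, hP]
  have hΨ : ∀ t ∈ Icc (0 : ℝ) 1, ∀ x, Ψ t x = (1 - t) * x + t * ψ x := by
    intro t ht x; simp only [Ψ, dif_pos ht, hP]
  have c1 : Continuous φ := φ.continuous
  have c2 : Continuous ψ := ψ.continuous
  refine Exists.imp (fun h (hh : _ ∧ _) => And.imp_right (fun h2 x => ?_) hh) (isotopic_of_family
    (fun t x => !₂[(1 - t) * x 0 + t * φ (x 0), (1 - t) * x 1 + t * ψ (x 1), x 2])
    (fun t x => !₂[(Φ t).symm (x 0), (Ψ t).symm (x 1), x 2])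
    (by fun_prop) (fun t _ => ?_) (fun x => by ext <;> simp) ?_ ?_)
  · rw [h2]; ext <;> simp
  · have := (Φ t).symm.continuous
    have := (Ψ t).symm.continuous
    fun_prop
  · intro t ht x
    ext <;> simp [← hΦ t ht, ← hΨ t ht]
  · intro t ht x
    ext <;> simp [← hΦ t ht, ← hΨ t ht]

end

noncomputable section
open Set Filter Topology

/-! ### Isotopies of embedded polygons -/

/-- A map on a family of points whose displacement has a small Lipschitz constant extends to a
homeomorphism of space. -/
theorem exists_homeomorph_of_lipschitz_displacement {ι : Type*} (x y : ι → E3) (c : ℝ)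
    (hc0 : 0 ≤ c) (hc : c ≤ 1 / 4)
    (h : ∀ i j, ‖(y i - x i) - (y j - x j)‖ ≤ c * ‖x i - x j‖) :
    ∃ H : E3 ≃ₜ E3, ∀ i, H (x i) = y i := by
  let d : E3 → E3 := Function.extend x (fun i => y i - x i) 0
  have hfac : Function.FactorsThrough (fun i => y i - x i) x := by
    intro i j hij
    have := h i j
    have h0 : ‖x i - x j‖ = 0 := by rw [hij, sub_self, norm_zero]
    rw [h0, mul_zero] at this
    exact sub_eq_zero.1 (norm_le_zero_iff.1 this)
  have hd : ∀ i, d (x i) = y i - x i := fun i => hfac.extend_apply _ i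
  have hl : ∀ k : Fin 3, ∃ g : E3 → ℝ, LipschitzWith ⟨c, hc0⟩ g ∧
      EqOn (fun z => d z k) g (range x) := by
    intro k
    apply LipschitzOnWith.extend_real
    apply LipschitzOnWith.of_dist_le_mul
    rintro _ ⟨i, rfl⟩ _ ⟨j, rfl⟩
    rw [hd, hd, Real.dist_eq, dist_eq_norm]
    exact (E3.abs_coord_le ((y i - x i) - (y j - x j)) k).trans (h i j)
  choose g hg hgd using hl
  let G : E3 → E3 := fun z => !₂[g 0 z, g 1 z, g 2 z]
  have hG : ∀ z w, ‖G z - G w‖ ≤ 3 / 4 * ‖z - w‖ := by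
    intro z w
    have h1 : ∀ k, |g k z - g k w| ≤ 1 / 4 * ‖z - w‖ := by
      intro k
      have := (hg k).dist_le_mul z w
      rw [Real.dist_eq, dist_eq_norm] at this
      exact this.trans (mul_le_mul_of_nonneg_right hc (norm_nonneg _))
    have h2 := E3.norm_le_sum (G z - G w)
    have e0 : (G z - G w) 0 = g 0 z - g 0 w := by simp [G]
    have e1 : (G z - G w) 1 = g 1 z - g 1 w := by simp [G]
    have e2 : (G z - G w) 2 = g 2 z - g 2 w := by simp [G]
    rw [e0, e1, e2] at h2
    linarith [h1 0, h1 1, h1 2]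
  have happ : ApproximatesLinearOn (fun z => z + G z)
      ((ContinuousLinearEquiv.refl ℝ E3 : E3 ≃L[ℝ] E3) : E3 →L[ℝ] E3) univ
      (3 / 4 : NNReal) := by
    intro z _ w _
    have : z + G z - (w + G w) - (ContinuousLinearEquiv.refl ℝ E3) (z - w) = G z - G w := by
      simp only [ContinuousLinearEquiv.refl_apply]; abel
    simp only [ContinuousLinearEquiv.coe_coe]
    rw [this]
    exact (hG z w).trans (by norm_num)
  let H := happ.toHomeomorph _ (by
    right
    have : ‖(((ContinuousLinearEquiv.refl ℝ E3).symm : E3 ≃L[ℝ] E3) : E3 →L[ℝ] E3)‖₊ = 1 := by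
      have := ContinuousLinearMap.nnnorm_id (𝕜 := ℝ) (E := E3)
      exact this
    rw [this, inv_one, ← NNReal.coe_lt_coe]
    push_cast; norm_num)
  refine ⟨H, fun i => ?_⟩
  change x i + G (x i) = y i
  have hk : ∀ k, g k (x i) = (y i - x i) k := by
    intro k
    rw [← hgd k ⟨i, rfl⟩]; simp only [hd]
  have : G (x i) = y i - x i := by
    ext <;> simp [G, hk]
  rw [this]; abel

variable {V : Type*}

/-- The point with parameter `s` on the edge `e` of a polygon with vertices `p`. -/
def along (p : V → E3) (e : V × V) (s : ℝ) : E3 := (1 - s) • p e.1 + s • p e.2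

theorem mem_segment_iff_along {p : V → E3} {e : V × V} {x : E3} :
    x ∈ segment ℝ (p e.1) (p e.2) ↔ ∃ s ∈ Icc (0 : ℝ) 1, along p e s = x := by
  rw [segment_eq_image]; rfl

theorem along_mem_segment (p : V → E3) (e : V × V) {s : ℝ} (hs : s ∈ Icc (0 : ℝ) 1) :
    along p e s ∈ segment ℝ (p e.1) (p e.2) := mem_segment_iff_along.2 ⟨s, hs, rfl⟩

/-- The union of the edges of a polygon. -/
def carrier (E : Finset (V × V)) (p : V → E3) : Set E3 :=
  ⋃ e ∈ E, segment ℝ (p e.1) (p e.2)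

theorem mem_carrier {E : Finset (V × V)} {p : V → E3} {x : E3} :
    x ∈ carrier E p ↔ ∃ e ∈ E, x ∈ segment ℝ (p e.1) (p e.2) := by
  simp [carrier]

/-- The label `v` is an endpoint of the edge `e`. -/
def Inc (e : V × V) (v : V) : Prop := v = e.1 ∨ v = e.2

/-- The label `v` occurs in an edge. -/
def Used (E : Finset (V × V)) (v : V) : Prop := ∃ e ∈ E, Inc e v

/-- The edges of a polygon have their interiors in `O` and meet only in common vertices. -/
structure Emb (O : Set E3) (E : Finset (V × V)) (p : V → E3) : Prop where
  ne : ∀ e ∈ E, p e.1 ≠ p e.2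
  inter : ∀ e ∈ E, ∀ e' ∈ E, e ≠ e' → ∀ x ∈ segment ℝ (p e.1) (p e.2),
    x ∈ segment ℝ (p e'.1) (p e'.2) → ∃ v, Inc e v ∧ Inc e' v ∧ x = p v
  sub : ∀ e ∈ E, openSegment ℝ (p e.1) (p e.2) ⊆ O

/-- A homeomorphism fixed outside of `O` carries one polygon to another one edgewise. -/
def Moves (O : Set E3) (E : Finset (V × V)) (p p' : V → E3) : Prop :=
  ∃ h : E3 ≃ₜ E3, (∀ x, x ∉ O → h x = x) ∧
    ∀ e ∈ E, ∀ s ∈ Icc (0 : ℝ) 1, h (along p e s) = along p' e s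

theorem Inc.exists_other {e : V × V} {v : V} (h : Inc e v) : ∃ b, Inc e b ∧
    (e = (v, b) ∨ e = (b, v)) ∧ ∃ σ : ℝ → ℝ, (∀ s ∈ Icc (0 : ℝ) 1, σ s ∈ Icc (0 : ℝ) 1) ∧
      (∀ s, σ (σ s) = s) ∧
      ∀ (q : V → E3) s, along q e s = q v + σ s • (q b - q v) := by
  obtain ⟨a, b⟩ := e
  rcases h with rfl | rfl
  · refine ⟨b, Or.inr rfl, Or.inl rfl, id, fun s hs => hs, fun s => rfl, fun q s => ?_⟩
    simp only [along, id]; module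
  · refine ⟨a, Or.inl rfl, Or.inr rfl, fun s => 1 - s,
      fun s hs => ⟨by linarith [hs.2], by linarith [hs.1]⟩, fun s => by ring, fun q s => ?_⟩
    simp only [along]; module

theorem exists_angle_bound (a b c : E3) (hb : b ≠ a) (hc : c ≠ a)
    (h : ∀ x ∈ segment ℝ a b, x ∈ segment ℝ a c → x = a) :
    ∃ r > 0, ∀ s ≥ 0, ∀ s' ≥ 0, r * (s + s') ≤ ‖s • (b - a) - s' • (c - a)‖ := by
  obtain ⟨σ, hσ, hmin⟩ := isCompact_Icc.exists_isMinOn (nonempty_Icc.2 (zero_le_one (α := ℝ)))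
    (f := fun σ : ℝ => ‖σ • (b - a) - (1 - σ) • (c - a)‖) (by fun_prop)
  have hpos : 0 < ‖σ • (b - a) - (1 - σ) • (c - a)‖ := by
    rw [norm_pos_iff]
    intro h0
    have h1 : a + σ • (b - a) ∈ segment ℝ a b := by
      rw [segment_eq_image']; exact ⟨σ, hσ, rfl⟩
    have h2 : a + σ • (b - a) ∈ segment ℝ a c := by
      rw [segment_eq_image']
      exact ⟨1 - σ, ⟨by linarith [hσ.2], by linarith [hσ.1]⟩, by
        simp only; rw [← sub_eq_zero.1 h0]⟩
    have h3 : σ • (b - a) = 0 := by simpa using h _ h1 h2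
    rw [h3, zero_sub, neg_eq_zero] at h0
    have h4 := (smul_eq_zero.1 h3).resolve_right (sub_ne_zero.2 hb)
    have h5 := (smul_eq_zero.1 h0).resolve_right (sub_ne_zero.2 hc)
    linarith
  refine ⟨_, hpos, fun s hs s' hs' => ?_⟩
  rcases eq_or_lt_of_le (add_nonneg hs hs') with h0 | h0
  · rw [← h0, mul_zero]; exact norm_nonneg _
  have h1 : s / (s + s') ∈ Icc (0 : ℝ) 1 :=
    ⟨by positivity, by rw [div_le_one h0]; linarith⟩
  have h2 := hmin h1
  simp only [mem_ofPred_eq] at h2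
  have h3 : s • (b - a) - s' • (c - a) =
      (s + s') • ((s / (s + s')) • (b - a) - (1 - s / (s + s')) • (c - a)) := by
    have e1 : (s + s') * (s / (s + s')) = s := by field_simp
    have e2 : (s + s') * (1 - s / (s + s')) = s' := by field_simp; ring
    rw [smul_sub (s + s'), smul_smul, smul_smul, e1, e2]
  rw [h3, norm_smul, Real.norm_of_nonneg h0.le, mul_comm]
  exact mul_le_mul_of_nonneg_left h2 h0.le

theorem norm_along_le {d : V → E3} {e : V × V} {ε s : ℝ} (h1 : ‖d e.1‖ ≤ ε) (h2 : ‖d e.2‖ ≤ ε)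
    (hs : s ∈ Icc (0 : ℝ) 1) : ‖along d e s‖ ≤ ε := by
  have := norm_add_le ((1 - s) • d e.1) (s • d e.2)
  rw [norm_smul, norm_smul, Real.norm_of_nonneg hs.1,
    Real.norm_of_nonneg (sub_nonneg.2 hs.2)] at this
  have h3 := mul_le_mul_of_nonneg_left h1 (sub_nonneg.2 hs.2)
  have h4 := mul_le_mul_of_nonneg_left h2 hs.1
  unfold along
  linarith

theorem exists_dist_bound {A B : Set E3} (hA : IsCompact A) (hB : IsClosed B)
    (h : Disjoint A B) : ∃ r > 0, ∀ x ∈ A, ∀ y ∈ B, r ≤ ‖x - y‖ := by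
  obtain ⟨r, hr, h⟩ := Metric.exists_pos_forall_lt_edist hA hB h
  refine ⟨r, hr, fun x hx y hy => ?_⟩
  have := h x hx y hy
  rw [edist_nndist, ENNReal.coe_lt_coe] at this
  have h2 : (r : ℝ) < dist x y := by exact_mod_cast this
  rw [dist_eq_norm] at h2
  exact h2.le

theorem isCompact_segment (a b : E3) : IsCompact (segment ℝ a b) := by
  rw [segment_eq_image]
  exact isCompact_Icc.image (by fun_prop)

theorem Emb.pair_bound {O : Set E3} {E : Finset (V × V)} {p : V → E3} (h : Emb O E p)
    (e e' : V × V) (he : e ∈ E) (he' : e' ∈ E) :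
    ∃ C ≥ 0, ∀ (d : V → E3) (ε : ℝ), (∀ v, Used E v → ‖d v‖ ≤ ε) → ∀ s ∈ Icc (0 : ℝ) 1,
      ∀ s' ∈ Icc (0 : ℝ) 1, ‖along d e s - along d e' s'‖ ≤
        C * ε * ‖along p e s - along p e' s'‖ := by
  by_cases hee : e = e'
  · subst hee
    have hl : 0 < ‖p e.2 - p e.1‖ := norm_pos_iff.2 (sub_ne_zero.2 (h.ne e he).symm)
    refine ⟨2 / ‖p e.2 - p e.1‖, by positivity, fun d ε hd s hs s' hs' => ?_⟩
    have h1 : ∀ q : V → E3, along q e s - along q e s' = (s - s') • (q e.2 - q e.1) := by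
      intro q; simp only [along]; module
    rw [h1, h1, norm_smul, norm_smul]
    have h2 := norm_sub_le (d e.2) (d e.1)
    have h3 := hd _ ⟨e, he, Or.inl rfl⟩
    have h4 := hd _ ⟨e, he, Or.inr rfl⟩
    have : 2 / ‖p e.2 - p e.1‖ * ε * (‖s - s'‖ * ‖p e.2 - p e.1‖) = ‖s - s'‖ * (2 * ε) := by
      field_simp
    rw [this]
    exact mul_le_mul_of_nonneg_left (by linarith) (norm_nonneg _)
  by_cases hv : ∃ v, Inc e v ∧ Inc e' v
  · obtain ⟨v, hv, hv'⟩ := hv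
    obtain ⟨b, hb, hbe, σ, hσ, hσσ, hσe⟩ := hv.exists_other
    obtain ⟨c, hc, hce, σ', hσ', hσσ', hσe'⟩ := hv'.exists_other
    have hbv : p b ≠ p v := by
      rcases hbe with rfl | rfl
      · exact (h.ne _ he).symm
      · exact h.ne _ he
    have hcv : p c ≠ p v := by
      rcases hce with rfl | rfl
      · exact (h.ne _ he').symm
      · exact h.ne _ he'
    have hsb : segment ℝ (p e.1) (p e.2) = segment ℝ (p v) (p b) := by
      rcases hbe with rfl | rfl
      · rfl
      · exact segment_symm _ _ _
    have hsc : segment ℝ (p e'.1) (p e'.2) = segment ℝ (p v) (p c) := by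
      rcases hce with rfl | rfl
      · rfl
      · exact segment_symm _ _ _
    have hib : ∀ w, Inc e w → w = v ∨ w = b := by
      rintro w hw
      rcases hbe with rfl | rfl
      · exact hw
      · exact hw.symm
    have hic : ∀ w, Inc e' w → w = v ∨ w = c := by
      rintro w hw
      rcases hce with rfl | rfl
      · exact hw
      · exact hw.symm
    have hbc : b ≠ c := by
      rintro rfl
      have hm := midpoint_mem_segment (𝕜 := ℝ) (p v) (p b)
      obtain ⟨w, hw, -, hwm⟩ := h.inter e he e' he' hee _ (hsb ▸ hm) (hsc ▸ hm)
      rcases hib w hw with rfl | rfl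
      · exact hbv ((midpoint_eq_left_iff ℝ).1 hwm).symm
      · exact hbv ((midpoint_eq_right_iff ℝ).1 hwm).symm
    obtain ⟨r, hr, hrs⟩ := exists_angle_bound (p v) (p b) (p c) hbv hcv (by
      intro x hx hx'
      obtain ⟨w, hw, hw', hwm⟩ := h.inter e he e' he' hee _ (hsb ▸ hx) (hsc ▸ hx')
      rcases hib w hw with rfl | rfl
      · exact hwm
      · rcases hic w hw' with rfl | rfl
        · exact hwm
        · exact absurd rfl hbc)
    refine ⟨2 / r, by positivity, fun d ε hd s hs s' hs' => ?_⟩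
    have h1 : ∀ q : V → E3, along q e s - along q e' s' =
        σ s • (q b - q v) - σ' s' • (q c - q v) := by
      intro q; rw [hσe, hσe']; abel
    rw [h1, h1]
    have h2 := hrs _ (hσ s hs).1 _ (hσ' s' hs').1
    have d1 := hd v ⟨e, he, hv⟩
    have d2 := hd b ⟨e, he, hb⟩
    have d3 := hd c ⟨e', he', hc⟩
    have h3 := norm_sub_le (σ s • (d b - d v)) (σ' s' • (d c - d v))
    rw [norm_smul, norm_smul, Real.norm_of_nonneg (hσ s hs).1,
      Real.norm_of_nonneg (hσ' s' hs').1] at h3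
    have h4 := mul_le_mul_of_nonneg_left ((norm_sub_le (d b) (d v)).trans (add_le_add d2 d1))
      (hσ s hs).1
    have h5 := mul_le_mul_of_nonneg_left ((norm_sub_le (d c) (d v)).trans (add_le_add d3 d1))
      (hσ' s' hs').1
    have hε : 0 ≤ ε := (norm_nonneg _).trans d1
    have h6 := mul_le_mul_of_nonneg_left h2 (show 0 ≤ 2 / r * ε by positivity)
    have h7 : 2 / r * ε * (r * (σ s + σ' s')) = 2 * ε * (σ s + σ' s') := by field_simp
    rw [h7] at h6
    linarith
  · obtain ⟨r, hr, hrs⟩ := exists_dist_bound (isCompact_segment (p e.1) (p e.2))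
      (isCompact_segment (p e'.1) (p e'.2)).isClosed (by
        rw [Set.disjoint_left]
        intro x hx hx'
        obtain ⟨w, hw, hw', -⟩ := h.inter e he e' he' hee x hx hx'
        exact hv ⟨w, hw, hw'⟩)
    refine ⟨2 / r, by positivity, fun d ε hd s hs s' hs' => ?_⟩
    have h1 := hrs _ (along_mem_segment p e hs) _ (along_mem_segment p e' hs')
    have h2 : ‖along d e s‖ ≤ ε := norm_along_le (hd _ ⟨e, he, Or.inl rfl⟩)
      (hd _ ⟨e, he, Or.inr rfl⟩) hs
    have h3 : ‖along d e' s'‖ ≤ ε := norm_along_le (hd _ ⟨e', he', Or.inl rfl⟩)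
      (hd _ ⟨e', he', Or.inr rfl⟩) hs'
    have h4 := norm_sub_le (along d e s) (along d e' s')
    have hε : 0 ≤ ε := (norm_nonneg _).trans h2
    have h6 := mul_le_mul_of_nonneg_left h1 (show 0 ≤ 2 / r * ε by positivity)
    have h7 : 2 / r * ε * r = 2 * ε := by field_simp
    linarith

theorem Emb.boundary_bound {O : Set E3} (hO : IsOpen O) (hc : Convex ℝ O)
    {E : Finset (V × V)} {p : V → E3} (h : Emb O E p) (e : V × V) (he : e ∈ E) :
    ∃ C ≥ 0, ∀ (d : V → E3) (ε : ℝ), (∀ v, Used E v → ‖d v‖ ≤ ε) →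
      (∀ v, Used E v → p v ∉ O → d v = 0) → ∀ s ∈ Icc (0 : ℝ) 1,
      ∀ z, z ∉ O → ‖along d e s‖ ≤ C * ε * ‖along p e s - z‖ := by
  by_cases hin : p e.1 ∈ O ∧ p e.2 ∈ O
  · obtain ⟨r, hr, hrs⟩ := exists_dist_bound (isCompact_segment (p e.1) (p e.2))
      hO.isClosed_compl (disjoint_compl_right_iff_subset.2 (hc.segment_subset hin.1 hin.2))
    refine ⟨1 / r, by positivity, fun d ε hd _ s hs z hz => ?_⟩
    have h1 := hrs _ (along_mem_segment p e hs) z hz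
    have h2 : ‖along d e s‖ ≤ ε := norm_along_le (hd _ ⟨e, he, Or.inl rfl⟩)
      (hd _ ⟨e, he, Or.inr rfl⟩) hs
    have hε : 0 ≤ ε := (norm_nonneg _).trans h2
    have h6 := mul_le_mul_of_nonneg_left h1 (show 0 ≤ 1 / r * ε by positivity)
    have h7 : 1 / r * ε * r = ε := by field_simp
    linarith
  · have : ∃ v, Inc e v ∧ p v ∉ O := by
      by_contra! hcon
      exact hin ⟨hcon _ (Or.inl rfl), hcon _ (Or.inr rfl)⟩
    obtain ⟨v, hv, hvO⟩ := this
    obtain ⟨b, hb, hbe, σ, hσ, hσσ, hσe⟩ := hv.exists_other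
    by_cases hbO : p b ∈ O
    · obtain ⟨r, hr, hball⟩ := Metric.isOpen_iff.1 hO _ hbO
      refine ⟨1 / r, by positivity, fun d ε hd hd0 s hs z hz => ?_⟩
      rw [hσe, hσe, hd0 v ⟨e, he, hv⟩ hvO, zero_add, sub_zero, norm_smul,
        Real.norm_of_nonneg (hσ s hs).1]
      have d2 := hd b ⟨e, he, hb⟩
      have hε : 0 ≤ ε := (norm_nonneg _).trans d2
      have key : σ s * r ≤ ‖p v + σ s • (p b - p v) - z‖ := by
        rcases eq_or_lt_of_le (hσ s hs).1 with h0 | h0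
        · rw [← h0, zero_mul]; exact norm_nonneg _
        by_contra! hlt
        apply hz
        have hw : p b + (σ s)⁻¹ • (z - (p v + σ s • (p b - p v))) ∈ O := by
          apply hball
          rw [Metric.mem_ball, dist_eq_norm, add_sub_cancel_left, norm_smul, norm_inv,
            Real.norm_of_nonneg h0.le, norm_sub_rev, inv_mul_lt_iff₀ h0]
          exact hlt
        have hvc : p v ∈ closure O := by
          have : p v ∈ segment ℝ (p e.1) (p e.2) := by
            rcases hv with rfl | rfl
            · exact left_mem_segment _ _ _
            · exact right_mem_segment _ _ _
          exact closure_mono (h.sub e he) (segment_subset_closure_openSegment this)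
        have := hc.combo_interior_closure_mem_interior (hO.interior_eq.symm ▸ hw) hvc h0
          (sub_nonneg.2 (hσ s hs).2) (by ring)
        rw [hO.interior_eq] at this
        convert this using 1
        rw [smul_add, smul_smul, mul_inv_cancel₀ h0.ne']
        module
      have h6 := mul_le_mul_of_nonneg_left key (show 0 ≤ 1 / r * ε by positivity)
      have h7 : 1 / r * ε * (σ s * r) = σ s * ε := by field_simp
      have h8 := mul_le_mul_of_nonneg_left d2 (hσ s hs).1
      linarith
    · refine ⟨0, le_rfl, fun d ε _ hd0 s _ z _ => ?_⟩
      rw [hσe, hd0 v ⟨e, he, hv⟩ hvO, hd0 b ⟨e, he, hb⟩ hbO]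
      simp

/-- Small displacements of the vertices of an embedded polygon are realized by homeomorphisms. -/
theorem Emb.perturb {O : Set E3} (hO : IsOpen O) (hc : Convex ℝ O)
    {E : Finset (V × V)} {p : V → E3} (h : Emb O E p) :
    ∃ ε > 0, ∀ p' : V → E3, (∀ v, Used E v → ‖p' v - p v‖ ≤ ε) →
      (∀ v, Used E v → p v ∉ O → p' v = p v) → Moves O E p p' := by
  classical
  choose C hC0 hC using h.pair_bound
  choose D hD0 hD using h.boundary_bound hO hc
  let T : ℝ := ∑ q : E × E, C q.1.1 q.2.1 q.1.2 q.2.2 + ∑ e : E, D e.1 e.2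
  have hT0 : 0 ≤ T := add_nonneg (Finset.sum_nonneg fun q _ => hC0 _ _ _ _)
    (Finset.sum_nonneg fun e _ => hD0 _ _)
  have hCT : ∀ e e' he he', C e e' he he' ≤ T := by
    intro e e' he he'
    have := Finset.single_le_sum (f := fun q : E × E => C q.1.1 q.2.1 q.1.2 q.2.2)
      (fun q _ => hC0 _ _ _ _) (Finset.mem_univ (⟨e, he⟩, ⟨e', he'⟩))
    have h2 : 0 ≤ ∑ e : E, D e.1 e.2 := Finset.sum_nonneg fun e _ => hD0 _ _
    simp only [T]; simp only at this; linarith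
  have hDT : ∀ e he, D e he ≤ T := by
    intro e he
    have := Finset.single_le_sum (f := fun q : E => D q.1 q.2)
      (fun q _ => hD0 _ _) (Finset.mem_univ (⟨e, he⟩))
    have h2 : 0 ≤ ∑ q : E × E, C q.1.1 q.2.1 q.1.2 q.2.2 :=
      Finset.sum_nonneg fun e _ => hC0 _ _ _ _
    simp only [T]; simp only at this; linarith
  refine ⟨1 / (4 * (T + 1)), by positivity, fun p' hp' hfix => ?_⟩
  set ε := 1 / (4 * (T + 1)) with hε
  have hε0 : 0 < ε := by positivity
  have hTε : T * ε ≤ 1 / 4 := by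
    rw [hε, mul_one_div, div_le_iff₀ (by positivity)]; linarith
  let d : V → E3 := fun v => p' v - p v
  have hd0 : ∀ v, Used E v → p v ∉ O → d v = 0 := fun v hv hvO => sub_eq_zero.2 (hfix v hv hvO)
  let ι := {q : (V × V) × ℝ // q.1 ∈ E ∧ q.2 ∈ Icc (0 : ℝ) 1} ⊕ {x : E3 // x ∉ O}
  let x : ι → E3 := Sum.elim (fun q => along p q.1.1 q.1.2) (fun z => z.1)
  let y : ι → E3 := Sum.elim (fun q => along p' q.1.1 q.1.2) (fun z => z.1)
  have hdd : ∀ e s, along p' e s - along p e s = along d e s := by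
    intro e s; simp only [along, d]; module
  obtain ⟨H, hH⟩ := exists_homeomorph_of_lipschitz_displacement x y (T * ε) (by positivity) hTε (by
    rintro (⟨⟨e, s⟩, he, hs⟩ | ⟨z, hz⟩) (⟨⟨e', s'⟩, he', hs'⟩ | ⟨z', hz'⟩)
    · simp only [x, y, Sum.elim_inl, hdd]
      refine (hC e e' he he' d ε hp' s hs s' hs').trans ?_
      gcongr
      exact hCT _ _ _ _
    · simp only [x, y, Sum.elim_inl, Sum.elim_inr, hdd, sub_self, sub_zero]
      refine (hD e he d ε hp' hd0 s hs z' hz').trans ?_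
      gcongr
      exact hDT _ _
    · simp only [x, y, Sum.elim_inl, Sum.elim_inr, hdd, sub_self, zero_sub, norm_neg]
      rw [norm_sub_rev z]
      refine (hD e' he' d ε hp' hd0 s' hs' z hz).trans ?_
      gcongr
      exact hDT _ _
    · simp only [x, y, Sum.elim_inr, sub_self, norm_zero]
      positivity)
  exact ⟨H, fun z hz => hH (Sum.inr ⟨z, hz⟩), fun e he s hs => hH (Sum.inl ⟨(e, s), he, hs⟩)⟩

theorem Moves.symm {O : Set E3} {E : Finset (V × V)} {p p' : V → E3} (h : Moves O E p p') :
    Moves O E p' p := by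
  obtain ⟨H, h1, h2⟩ := h
  refine ⟨H.symm, fun x hx => ?_, fun e he s hs => ?_⟩
  · rw [H.symm_apply_eq, h1 x hx]
  · rw [H.symm_apply_eq, h2 e he s hs]

theorem Moves.trans {O : Set E3} {E : Finset (V × V)} {p p' p'' : V → E3} (h : Moves O E p p')
    (h' : Moves O E p' p'') : Moves O E p p'' := by
  obtain ⟨H, h1, h2⟩ := h
  obtain ⟨H', h1', h2'⟩ := h'
  refine ⟨H.trans H', fun x hx => ?_, fun e he s hs => ?_⟩
  · simp [h1 x hx, h1' x hx]
  · simp [h2 e he s hs, h2' e he s hs]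

theorem Moves.exists_image {O : Set E3} {E : Finset (V × V)} {p p' : V → E3}
    (h : Moves O E p p') :
    ∃ H : E3 ≃ₜ E3, (∀ x, x ∉ O → H x = x) ∧ H '' carrier E p = carrier E p' := by
  obtain ⟨H, h1, h2⟩ := h
  refine ⟨H, h1, ?_⟩
  ext y
  simp only [mem_image, mem_carrier, mem_segment_iff_along]
  constructor
  · rintro ⟨_, ⟨e, he, s, hs, rfl⟩, rfl⟩
    exact ⟨e, he, s, hs, (h2 e he s hs).symm⟩
  · rintro ⟨e, he, s, hs, rfl⟩
    exact ⟨_, ⟨e, he, s, hs, rfl⟩, h2 e he s hs⟩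

theorem along_zero (p : V → E3) (e : V × V) : along p e 0 = p e.1 := by simp [along]

theorem along_one (p : V → E3) (e : V × V) : along p e 1 = p e.2 := by simp [along]

theorem Emb.of_injective_map {O O' : Set E3} {E : Finset (V × V)} {p p' : V → E3}
    (hE : Emb O E p) (H : E3 → E3) (hH : Function.Injective H) (hO : ∀ x ∈ O, H x ∈ O')
    (h2 : ∀ e ∈ E, H '' segment ℝ (p e.1) (p e.2) = segment ℝ (p' e.1) (p' e.2))
    (h3 : ∀ v, Used E v → H (p v) = p' v) : Emb O' E p' := by
  have hu1 : ∀ e ∈ E, Used E e.1 := fun e he => ⟨e, he, Or.inl rfl⟩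
  have hu2 : ∀ e ∈ E, Used E e.2 := fun e he => ⟨e, he, Or.inr rfl⟩
  have hne : ∀ e ∈ E, p' e.1 ≠ p' e.2 := by
    intro e he h
    rw [← h3 _ (hu1 e he), ← h3 _ (hu2 e he)] at h
    exact hE.ne e he (hH h)
  refine ⟨hne, ?_, ?_⟩
  · intro e he e' he' hee x hx hx'
    rw [← h2 e he] at hx
    rw [← h2 e' he'] at hx'
    obtain ⟨y, hy, rfl⟩ := hx
    obtain ⟨y', hy', hyy⟩ := hx'
    obtain rfl := hH hyy
    obtain ⟨v, hv, hv', rfl⟩ := hE.inter e he e' he' hee y' hy hy'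
    exact ⟨v, hv, hv', h3 v ⟨e, he, hv⟩⟩
  · intro e he x hx
    have hx1 := openSegment_subset_segment _ _ _ hx
    rw [← h2 e he] at hx1
    obtain ⟨y, hy, rfl⟩ := hx1
    apply hO
    apply hE.sub e he
    rw [← insert_endpoints_openSegment] at hy
    rcases hy with rfl | rfl | hy
    · rw [h3 _ (hu1 e he), left_mem_openSegment_iff] at hx
      exact absurd hx (hne e he)
    · rw [h3 _ (hu2 e he), right_mem_openSegment_iff] at hx
      exact absurd hx (hne e he)
    · exact hy

theorem Moves.emb {O : Set E3} {E : Finset (V × V)} {p p' : V → E3} (h : Moves O E p p')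
    (hE : Emb O E p) : Emb O E p' := by
  obtain ⟨H, h1, h2⟩ := h
  refine hE.of_injective_map H H.injective ?_ ?_ ?_
  · intro x hx
    rw [← image_eq_of_eqOn_compl H h1]
    exact mem_image_of_mem _ hx
  · intro e he
    ext y
    simp only [mem_image, mem_segment_iff_along]
    constructor
    · rintro ⟨_, ⟨s, hs, rfl⟩, rfl⟩
      exact ⟨s, hs, (h2 e he s hs).symm⟩
    · rintro ⟨s, hs, rfl⟩
      exact ⟨_, ⟨s, hs, rfl⟩, h2 e he s hs⟩
  · rintro v ⟨e, he, rfl | rfl⟩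
    · have := h2 e he 0 (by simp)
      rwa [along_zero, along_zero] at this
    · have := h2 e he 1 (by simp)
      rwa [along_one, along_one] at this

/-- A continuous family of embedded polygons comes from homeomorphisms of space. -/
theorem moves_of_family {O : Set E3} (hO : IsOpen O) (hc : Convex ℝ O) {E : Finset (V × V)}
    (pos : ℝ → V → E3) (hcont : ∀ v, Used E v → Continuous fun t => pos t v)
    (hE : ∀ t ∈ Icc (0 : ℝ) 1, Emb O E (pos t))
    (hfix : ∀ v, Used E v → ∀ t ∈ Icc (0 : ℝ) 1, ∀ t' ∈ Icc (0 : ℝ) 1, pos t v ∉ O →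
      pos t' v = pos t v) :
    Moves O E (pos 0) (pos 1) := by
  classical
  refine (isPreconnected_Icc (a := (0 : ℝ)) (b := 1)).induction₂
    (fun t t' => Moves O E (pos t) (pos t')) ?_ ?_ ?_ (by simp) (by simp)
  · intro t ht
    obtain ⟨ε, hε, h⟩ := (hE t ht).perturb hO hc
    have h1 : ∀ v ∈ E.image Prod.fst ∪ E.image Prod.snd,
        ∀ᶠ t' in 𝓝[Icc (0 : ℝ) 1] t, ‖pos t' v - pos t v‖ ≤ ε := by
      intro v hv
      have hu : Used E v := by
        simp only [Finset.mem_union, Finset.mem_image] at hv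
        rcases hv with ⟨e, he, rfl⟩ | ⟨e, he, rfl⟩
        · exact ⟨e, he, Or.inl rfl⟩
        · exact ⟨e, he, Or.inr rfl⟩
      have : Tendsto (fun t' => ‖pos t' v - pos t v‖) (𝓝 t) (𝓝 0) := by
        have h2 : Continuous fun t' => ‖pos t' v - pos t v‖ :=
          ((hcont v hu).sub continuous_const).norm
        simpa using h2.tendsto t
      exact ((tendsto_order.1 this).2 ε hε).filter_mono nhdsWithin_le_nhds |>.mono
        fun _ h => le_of_lt h
    rw [← Filter.eventually_all_finset] at h1
    filter_upwards [h1, self_mem_nhdsWithin] with t' ht' hI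
    refine h _ (fun v hv => ht' v ?_) (fun v hv hvO => hfix v hv t ht t' hI hvO)
    obtain ⟨e, he, rfl | rfl⟩ := hv
    · exact Finset.mem_union_left _ (Finset.mem_image_of_mem _ he)
    · exact Finset.mem_union_right _ (Finset.mem_image_of_mem _ he)
  · intro x y z _ _ _ h1 h2; exact h1.trans h2
  · intro x y _ _ h; exact h.symm

end

noncomputable section
open Set Filter Topology

/-! ### Degrees of the vertices of a polygonal tangle -/

variable {V : Type*}

theorem Emb.inter_eq {O : Set E3} {E : Finset (V × V)} {p : V → E3} (h : Emb O E p)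
    {e e' : V × V} (he : e ∈ E) (he' : e' ∈ E) (hee : e ≠ e') {v : V} (hv : Inc e v)
    (hv' : Inc e' v) {x : E3} (hx : x ∈ segment ℝ (p e.1) (p e.2))
    (hx' : x ∈ segment ℝ (p e'.1) (p e'.2)) : x = p v := by
  obtain ⟨b, hb, hbe, σ, hσ, hσσ, hσe⟩ := hv.exists_other
  obtain ⟨c, hc, hce, σ', hσ', hσσ', hσe'⟩ := hv'.exists_other
  have hbv : p b ≠ p v := by
    rcases hbe with rfl | rfl
    · exact (h.ne _ he).symm
    · exact h.ne _ he
  have hib : ∀ w, Inc e w → w = v ∨ w = b := by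
    rintro w hw
    rcases hbe with rfl | rfl
    · exact hw
    · exact hw.symm
  have hic : ∀ w, Inc e' w → w = v ∨ w = c := by
    rintro w hw
    rcases hce with rfl | rfl
    · exact hw
    · exact hw.symm
  obtain ⟨w, hw, hw', rfl⟩ := h.inter e he e' he' hee x hx hx'
  rcases hib w hw with rfl | rfl
  · rfl
  rcases hic w hw' with rfl | rfl
  · rfl
  exfalso
  have hm := midpoint_mem_segment (𝕜 := ℝ) (p v) (p w)
  have hsb : segment ℝ (p e.1) (p e.2) = segment ℝ (p v) (p w) := by
    rcases hbe with rfl | rfl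
    · rfl
    · exact segment_symm _ _ _
  have hsc : segment ℝ (p e'.1) (p e'.2) = segment ℝ (p v) (p w) := by
    rcases hce with rfl | rfl
    · rfl
    · exact segment_symm _ _ _
  obtain ⟨u, hu, -, hum⟩ := h.inter e he e' he' hee _ (hsb ▸ hm) (hsc ▸ hm)
  rcases hib u hu with rfl | rfl
  · exact hbv ((midpoint_eq_left_iff ℝ).1 hum).symm
  · exact hbv ((midpoint_eq_right_iff ℝ).1 hum).symm

theorem Emb.inc_of_mem {O : Set E3} {E : Finset (V × V)} {p : V → E3} (h : Emb O E p)
    {v : V} (hv : Used E v) {e : V × V} (he : e ∈ E) (hx : p v ∈ segment ℝ (p e.1) (p e.2)) :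
    Inc e v := by
  obtain ⟨e', he', hv'⟩ := hv
  by_cases hee : e = e'
  · rwa [hee]
  have hx' : p v ∈ segment ℝ (p e'.1) (p e'.2) := by
    rcases hv' with rfl | rfl
    · exact left_mem_segment _ _ _
    · exact right_mem_segment _ _ _
  obtain ⟨w, hw, hw', hvw⟩ := h.inter e he e' he' hee _ hx hx'
  have := h.ne e' he'
  rcases hv' with rfl | rfl <;> rcases hw' with rfl | rfl
  · exact hw
  · exact absurd hvw this
  · exact absurd hvw.symm this
  · exact hw

theorem Emb.eventually_inc {O : Set E3} {E : Finset (V × V)} {p : V → E3} (h : Emb O E p)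
    {v : V} (hv : Used E v) : ∀ᶠ x in 𝓝 (p v), x ∈ carrier E p →
      ∃ e ∈ E, Inc e v ∧ x ∈ segment ℝ (p e.1) (p e.2) := by
  have h1 : ∀ e ∈ E, ∀ᶠ x in 𝓝 (p v), x ∈ segment ℝ (p e.1) (p e.2) → Inc e v := by
    intro e he
    by_cases hx : p v ∈ segment ℝ (p e.1) (p e.2)
    · exact Eventually.of_forall fun x _ => h.inc_of_mem hv he hx
    · filter_upwards [(isCompact_segment (p e.1) (p e.2)).isClosed.isOpen_compl.mem_nhds hx]
        with x hx h'
      exact absurd h' hx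
  rw [← Filter.eventually_all_finset] at h1
  filter_upwards [h1] with x hx hxc
  obtain ⟨e, he, hxe⟩ := mem_carrier.1 hxc
  exact ⟨e, he, hx e he hxe, hxe⟩

theorem Emb.exists_arm {O : Set E3} {E : Finset (V × V)} {p : V → E3} (h : Emb O E p)
    {v : V} {A : Set E3} (hA : IsPreconnected A) (hne : A.Nonempty) (hvA : p v ∉ A)
    (hsub : ∀ x ∈ A, ∃ e ∈ E, Inc e v ∧ x ∈ segment ℝ (p e.1) (p e.2)) :
    ∃ e ∈ E, Inc e v ∧ A ⊆ segment ℝ (p e.1) (p e.2) := by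
  classical
  obtain ⟨x, hx⟩ := hne
  obtain ⟨e, he, hev, hxe⟩ := hsub x hx
  refine ⟨e, he, hev, ?_⟩
  let R : Set E3 := ⋃ e' ∈ E.filter (fun e' => Inc e' v ∧ e' ≠ e), segment ℝ (p e'.1) (p e'.2)
  have hR : IsClosed R :=
    isClosed_biUnion_finset fun e' _ => (isCompact_segment _ _).isClosed
  have hmemR : ∀ y, y ∈ R ↔ ∃ e' ∈ E, Inc e' v ∧ e' ≠ e ∧ y ∈ segment ℝ (p e'.1) (p e'.2) := by
    intro y
    simp only [R, mem_iUnion, Finset.mem_filter, exists_prop]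
    constructor
    · rintro ⟨e', ⟨h1, h2, h3⟩, h4⟩; exact ⟨e', h1, h2, h3, h4⟩
    · rintro ⟨e', h1, h2, h3, h4⟩; exact ⟨e', ⟨h1, h2, h3⟩, h4⟩
  have hint : A ∩ (segment ℝ (p e.1) (p e.2) ∩ R) = ∅ := by
    rw [eq_empty_iff_forall_notMem]
    rintro y ⟨hy, hye, hyR⟩
    obtain ⟨e', he', hv', hee', hye'⟩ := (hmemR y).1 hyR
    have := h.inter_eq he he' hee'.symm hev hv' hye hye'
    exact hvA (this ▸ hy)
  rcases isPreconnected_iff_subset_of_disjoint_closed.1 hA _ R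
    (isCompact_segment (p e.1) (p e.2)).isClosed hR (by
      intro y hy
      obtain ⟨e', he', hv', hye'⟩ := hsub y hy
      by_cases hee : e' = e
      · left; rwa [← hee]
      · right; exact (hmemR y).2 ⟨e', he', hv', hee, hye'⟩) hint with h1 | h1
  · exact h1
  · exfalso
    rw [eq_empty_iff_forall_notMem] at hint
    exact hint x ⟨hx, hxe, h1 hx⟩

/-- A local parametrization of `P` near `v` by the set `J` of real numbers. -/
def HasChart (P : Set E3) (J : Set ℝ) (v : E3) : Prop :=
  ∃ g : ℝ → E3, ContinuousOn g J ∧ InjOn g J ∧ g 0 = v ∧ (∀ t ∈ J, g t ∈ P) ∧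
    ∀ δ > 0, ∀ᶠ x in 𝓝 v, x ∈ P → ∃ t ∈ J, |t| < δ ∧ g t = x

theorem Inc.exists_near {E : Finset (V × V)} {p : V → E3}
    {e : V × V} (he : e ∈ E) (hpe : p e.1 ≠ p e.2) {v : V} (hv : Inc e v) {Q : E3 → Prop}
    (hQ : ∀ᶠ x in 𝓝 (p v), x ∈ carrier E p → Q x) :
    ∃ x ∈ segment ℝ (p e.1) (p e.2), x ≠ p v ∧ Q x := by
  obtain ⟨b, hb, hbe, σ, hσ, hσσ, hσe⟩ := hv.exists_other
  have hbv : p b ≠ p v := by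
    rcases hbe with rfl | rfl
    · exact hpe.symm
    · exact hpe
  have hc : Tendsto (fun s : ℝ => p v + s • (p b - p v)) (𝓝[>] 0) (𝓝 (p v)) := by
    have : Continuous fun s : ℝ => p v + s • (p b - p v) := by fun_prop
    have h := this.tendsto 0
    simp only [zero_smul, add_zero] at h
    exact h.mono_left nhdsWithin_le_nhds
  have h1 := hc.eventually hQ
  have h2 : ∀ᶠ s : ℝ in 𝓝[>] 0, s ∈ Ioo (0 : ℝ) 1 := Ioo_mem_nhdsGT one_pos
  obtain ⟨s, hs, hs01⟩ := (h1.and h2).exists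
  have hmem : p v + s • (p b - p v) ∈ segment ℝ (p e.1) (p e.2) := by
    have := hσe p (σ s)
    rw [hσσ] at this
    rw [← this]
    exact along_mem_segment _ _ (hσ s ⟨hs01.1.le, hs01.2.le⟩)
  refine ⟨_, hmem, ?_, hs (mem_carrier.2 ⟨e, he, hmem⟩)⟩
  intro h0
  rw [add_eq_left, smul_eq_zero, sub_eq_zero] at h0
  rcases h0 with h0 | h0
  · exact hs01.1.ne' h0
  · exact hbv h0

/-- Preparation for the two degree lemmas: half of a chart runs along an edge. -/
theorem Emb.exists_half {O : Set E3} {E : Finset (V × V)} {p : V → E3} (h : Emb O E p)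
    {v : V} (hv : Used E v) {g : ℝ → E3} {J : Set ℝ} (hg : ContinuousOn g J) (hi : InjOn g J)
    (h0J : (0 : ℝ) ∈ J) (h0 : g 0 = p v) (hP : ∀ t ∈ J, g t ∈ carrier E p) :
    ∃ δ > 0, ∀ B ⊆ J, IsPreconnected B → B.Nonempty → (0 : ℝ) ∉ B → (∀ t ∈ B, |t| ≤ δ) →
      ∃ e ∈ E, Inc e v ∧ ∀ t ∈ B, g t ∈ segment ℝ (p e.1) (p e.2) := by
  have h1 := h.eventually_inc hv
  rw [← h0] at h1
  have h2 := (hg 0 h0J).eventually h1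
  obtain ⟨δ, hδ, h3⟩ := Metric.mem_nhdsWithin_iff.1 h2
  refine ⟨δ / 2, by positivity, fun B hBJ hB hBn hB0 hBδ => ?_⟩
  suffices H : ∃ e ∈ E, Inc e v ∧ g '' B ⊆ segment ℝ (p e.1) (p e.2) by
    obtain ⟨e, he, hev, hs⟩ := H
    exact ⟨e, he, hev, fun t ht => hs (mem_image_of_mem _ ht)⟩
  apply h.exists_arm (hB.image g (hg.mono hBJ)) (hBn.image g)
  · rintro ⟨t, ht, htv⟩
    have := hi (hBJ ht) h0J (htv.trans h0.symm)
    exact hB0 (this ▸ ht)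
  · rintro _ ⟨t, ht, rfl⟩
    have hm : t ∈ Metric.ball (0 : ℝ) δ ∩ J := by
      refine ⟨?_, hBJ ht⟩
      rw [Metric.mem_ball, dist_zero_right, Real.norm_eq_abs]
      exact lt_of_le_of_lt (hBδ t ht) (by linarith)
    exact h3 hm (hP t (hBJ ht))

theorem Emb.degree_one {O : Set E3} {E : Finset (V × V)} {p : V → E3} (h : Emb O E p)
    {v : V} (hv : Used E v) {ε : ℝ} (hε : 0 < ε) (hc : HasChart (carrier E p) (Ico 0 ε) (p v)) :
    ∃ e ∈ E, Inc e v ∧ ∀ e' ∈ E, Inc e' v → e' = e := by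
  obtain ⟨g, hg, hi, h0, hP, hloc⟩ := hc
  have h0J : (0 : ℝ) ∈ Ico 0 ε := ⟨le_rfl, hε⟩
  obtain ⟨δ, hδ, H⟩ := h.exists_half hv hg hi h0J h0 hP
  have hη : 0 < min δ (ε / 2) := lt_min hδ (by linarith)
  set η := min δ (ε / 2)
  have hηδ : η ≤ δ := min_le_left _ _
  have hηε : η ≤ ε / 2 := min_le_right _ _
  obtain ⟨e, he, hev, hs⟩ := H (Ioc 0 η) (fun t ht => ⟨ht.1.le, by linarith [ht.2]⟩)
    isPreconnected_Ioc ⟨η, hη, le_rfl⟩ (fun h => lt_irrefl _ h.1)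
    (fun t ht => by rw [abs_of_pos ht.1]; exact ht.2.trans hηδ)
  refine ⟨e, he, hev, fun e' he' hev' => ?_⟩
  by_contra hee
  obtain ⟨x, hx, hxv, t, htJ, htη, rfl⟩ := hev'.exists_near he' (h.ne e' he') (hloc η hη)
  have ht0 : t ≠ 0 := by rintro rfl; exact hxv h0
  have : t ∈ Ioc 0 η := ⟨lt_of_le_of_ne htJ.1 ht0.symm, ((le_abs_self t).trans_lt htη).le⟩
  exact hxv (h.inter_eq he' he hee hev' hev hx (hs t this))

theorem Emb.degree_two {O : Set E3} {E : Finset (V × V)} {p : V → E3} (h : Emb O E p)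
    {v : V} (hv : Used E v) {ε : ℝ} (hε : 0 < ε)
    (hc : HasChart (carrier E p) (Ioo (-ε) ε) (p v)) :
    ∃ e ∈ E, ∃ e' ∈ E, e ≠ e' ∧ Inc e v ∧ Inc e' v ∧ ∀ g ∈ E, Inc g v → g = e ∨ g = e' := by
  obtain ⟨g, hg, hi, h0, hP, hloc⟩ := hc
  have h0J : (0 : ℝ) ∈ Ioo (-ε) ε := ⟨by linarith, hε⟩
  obtain ⟨δ, hδ, H⟩ := h.exists_half hv hg hi h0J h0 hP
  have hη : 0 < min δ (ε / 2) := lt_min hδ (by linarith)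
  set η := min δ (ε / 2)
  have hηδ : η ≤ δ := min_le_left _ _
  have hηε : η ≤ ε / 2 := min_le_right _ _
  obtain ⟨e, he, hev, hs⟩ := H (Ioc 0 η) (fun t ht => ⟨by linarith [ht.1], by linarith [ht.2]⟩)
    isPreconnected_Ioc ⟨η, hη, le_rfl⟩ (fun h => lt_irrefl _ h.1)
    (fun t ht => by rw [abs_of_pos ht.1]; exact ht.2.trans hηδ)
  obtain ⟨e', he', hev', hs'⟩ := H (Ico (-η) 0)
    (fun t ht => ⟨by linarith [ht.1], by linarith [ht.2]⟩)
    isPreconnected_Ico ⟨-η, le_rfl, by linarith⟩ (fun h => lt_irrefl _ h.2)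
    (fun t ht => by rw [abs_of_neg ht.2]; linarith [ht.1])
  refine ⟨e, he, e', he', ?_, hev, hev', fun k hk hkv => ?_⟩
  · rintro rfl
    obtain ⟨b, hb, hbe, σ, hσ, hσσ, hσe⟩ := hev.exists_other
    have hbv : p b - p v ≠ 0 := by
      rw [sub_ne_zero]
      rcases hbe with rfl | rfl
      · exact (h.ne _ he).symm
      · exact h.ne _ he
    let τ : E3 → ℝ := fun x => inner ℝ (p b - p v) (x - p v)
    have hseg : ∀ x ∈ segment ℝ (p e.1) (p e.2), ∃ s, 0 ≤ s ∧ x = p v + s • (p b - p v) ∧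
        τ x = s * inner ℝ (p b - p v) (p b - p v) := by
      intro x hx
      obtain ⟨s, hs, rfl⟩ := mem_segment_iff_along.1 hx
      refine ⟨σ s, (hσ s hs).1, hσe p s, ?_⟩
      simp only [τ, hσe, add_sub_cancel_left, inner_smul_right]
    have hpos : 0 < inner ℝ (p b - p v) (p b - p v) := by
      rw [real_inner_self_eq_norm_sq]; positivity
    have hmem : ∀ t ∈ Icc (-η) η, g t ∈ segment ℝ (p e.1) (p e.2) := by
      intro t ht
      rcases lt_trichotomy t 0 with h1 | rfl | h1
      · exact hs' t ⟨ht.1, h1⟩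
      · rw [h0]
        rcases hev with rfl | rfl
        · exact left_mem_segment _ _ _
        · exact right_mem_segment _ _ _
      · exact hs t ⟨h1, ht.2⟩
    have hsubJ : Icc (-η) η ⊆ Ioo (-ε) ε := fun t ht => ⟨by linarith [ht.1], by linarith [ht.2]⟩
    have hcont : ContinuousOn (fun t => τ (g t)) (Icc (-η) η) := by
      have : Continuous τ := by fun_prop
      exact this.comp_continuousOn (hg.mono hsubJ)
    have hinj : InjOn (fun t => τ (g t)) (Icc (-η) η) := by
      intro t ht t' ht' htt
      obtain ⟨s, -, hs1, hs2⟩ := hseg _ (hmem t ht)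
      obtain ⟨s', -, hs1', hs2'⟩ := hseg _ (hmem t' ht')
      simp only [hs2, hs2'] at htt
      have : s = s' := mul_right_cancel₀ hpos.ne' htt
      exact hi (hsubJ ht) (hsubJ ht') (by rw [hs1, hs1', this])
    have hnn : ∀ t ∈ Icc (-η) η, 0 ≤ τ (g t) := by
      intro t ht
      obtain ⟨s, hs0, -, hs2⟩ := hseg _ (hmem t ht)
      rw [hs2]; positivity
    have hτ0 : τ (g 0) = 0 := by simp [τ, h0]
    rcases hcont.strictMonoOn_of_injOn_Icc' (by linarith) hinj with hm | hm
    · have := hm (a := -η) (b := 0) ⟨le_rfl, by linarith⟩ ⟨by linarith, hη.le⟩ (by linarith)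
      have h3 := hnn (-η) ⟨le_rfl, by linarith⟩
      simp only [hτ0] at this
      linarith
    · have := hm (a := 0) (b := η) ⟨by linarith, hη.le⟩ ⟨by linarith, le_rfl⟩ hη
      have h3 := hnn η ⟨by linarith, le_rfl⟩
      simp only [hτ0] at this
      linarith
  · by_contra! hee
    obtain ⟨x, hx, hxv, t, htJ, htη, rfl⟩ := hkv.exists_near hk (h.ne k hk) (hloc η hη)
    have ht0 : t ≠ 0 := by rintro rfl; exact hxv h0
    rcases lt_or_gt_of_ne ht0 with h1 | h1
    · have : t ∈ Ico (-η) 0 := ⟨by linarith [neg_abs_le t], h1⟩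
      exact hxv (h.inter_eq hk he' hee.2 hkv hev' hx (hs' t this))
    · have : t ∈ Ioc 0 η := ⟨h1, ((le_abs_self t).trans_lt htη).le⟩
      exact hxv (h.inter_eq hk he hee.1 hkv hev hx (hs t this))

theorem HasChart.infinite {P : Set E3} {J : Set ℝ} {v : E3} (hc : HasChart P J v) {ε : ℝ}
    (hε : 0 < ε) (hJ : Ico 0 ε ⊆ J) {F : Set E3} (hF : F.Finite) : v ∈ closure (P \ F) := by
  obtain ⟨g, hg, hi, h0, hP, -⟩ := hc
  have h1 : ContinuousWithinAt g (Ico 0 ε) 0 := (hg.mono hJ) 0 ⟨le_rfl, hε⟩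
  rw [mem_closure_iff_nhds]
  intro U hU
  rw [← h0] at hU
  obtain ⟨δ, hδ, h2⟩ := Metric.mem_nhdsWithin_iff.1 (h1 hU)
  have hinf : (g '' Ioo 0 (min δ ε)).Infinite := by
    apply Infinite.image
    · exact hi.mono fun t ht => hJ ⟨ht.1.le, ht.2.trans_le (min_le_right _ _)⟩
    · exact Ioo_infinite (lt_min hδ hε)
  obtain ⟨_, ⟨t, ht, rfl⟩, hx⟩ := (hinf.sdiff hF).nonempty
  have htJ : t ∈ Ico 0 ε := ⟨ht.1.le, ht.2.trans_le (min_le_right _ _)⟩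
  refine ⟨g t, h2 ⟨?_, htJ⟩, hP t (hJ htJ), hx⟩
  rw [Metric.mem_ball, dist_zero_right, Real.norm_of_nonneg ht.1.le]
  exact ht.2.trans_le (min_le_left _ _)

theorem hasChart_range {X : Type*} [TopologicalSpace X] {f : X → E3}
    (hf : Topology.IsEmbedding f) {J : Set ℝ} {x : X} (γ : ℝ → X) (hγ : ContinuousOn γ J)
    (hi : InjOn γ J) (h0 : γ 0 = x)
    (hloc : ∀ δ > 0, ∀ᶠ y in 𝓝 x, ∃ t ∈ J, |t| < δ ∧ γ t = y) :
    HasChart (range f) J (f x) := by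
  refine ⟨f ∘ γ, hf.continuous.comp_continuousOn hγ, fun t ht t' ht' h => hi ht ht' (hf.injective h),
    by simp [h0], fun t _ => mem_range_self _, fun δ hδ => ?_⟩
  have := hloc δ hδ
  rw [hf.isInducing.nhds_eq_comap, eventually_comap] at this
  filter_upwards [this] with y hy hyr
  obtain ⟨z, rfl⟩ := hyr
  obtain ⟨t, ht, htδ, htz⟩ := hy z rfl
  exact ⟨t, ht, htδ, by simp [htz]⟩

theorem hasChart_arc {m : ℕ} {Y : Type*} [TopologicalSpace Y]
    {f : (Fin m × unitInterval) ⊕ Y → E3} (hf : Topology.IsEmbedding f)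
    (i : Fin m) (a : unitInterval) (s : ℝ) (hs : s * s = 1) (J : Set ℝ) (h0 : (0 : ℝ) ∈ J)
    (hJ : ∀ t ∈ J, (a : ℝ) + s * t ∈ Icc (0 : ℝ) 1) (ε : ℝ) (hε : 0 < ε)
    (hJ' : ∀ y ∈ Icc (0 : ℝ) 1, |y - a| < ε → s * (y - a) ∈ J) :
    HasChart (range f) J (f (Sum.inl (i, a))) := by
  have habs : |s| = 1 := by
    have : |s| * |s| = 1 := by rw [← abs_mul, hs, abs_one]
    nlinarith [abs_nonneg s]
  apply hasChart_range hf (fun t => Sum.inl (i, projIcc 0 1 zero_le_one ((a : ℝ) + s * t)))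
  · apply Continuous.continuousOn
    apply continuous_inl.comp
    apply Continuous.prodMk continuous_const
    exact continuous_projIcc.comp (by fun_prop)
  · intro t ht t' ht' h
    simp only [Sum.inl.injEq, Prod.mk.injEq, true_and] at h
    rw [projIcc_of_mem _ (hJ t ht), projIcc_of_mem _ (hJ t' ht'), Subtype.mk.injEq] at h
    have h1 : s * (s * t) = s * (s * t') := by rw [add_left_cancel h]
    rwa [← mul_assoc, ← mul_assoc, hs, one_mul, one_mul] at h1
  · simp only [mul_zero, add_zero, projIcc_val]
  · intro δ hδ
    rw [nhds_inl, eventually_map]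
    have h1 : ∀ᶠ y : Fin m × unitInterval in 𝓝 (i, a), y.1 = i :=
      continuous_fst.continuousAt.eventually
        ((isOpen_discrete ({i} : Set (Fin m))).mem_nhds (rfl : ((i, a) : Fin m × unitInterval).1 = i))
    have h2 : ∀ᶠ y : Fin m × unitInterval in 𝓝 (i, a), |(y.2 : ℝ) - a| < min δ ε := by
      have hc : Continuous fun y : Fin m × unitInterval => |(y.2 : ℝ) - a| := by fun_prop
      exact hc.continuousAt.eventually (gt_mem_nhds (by simp [hδ, hε]))
    filter_upwards [h1, h2] with y hy1 hy2
    refine ⟨s * (y.2 - a), hJ' _ y.2.2 (hy2.trans_le (min_le_right _ _)), ?_, ?_⟩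
    · rw [abs_mul, habs, one_mul]
      exact hy2.trans_le (min_le_left _ _)
    · rw [← mul_assoc, hs, one_mul, add_sub_cancel, projIcc_val, ← hy1]

theorem hasChart_circle {c : ℕ} {Y : Type*} [TopologicalSpace Y]
    {f : Y ⊕ (Fin c × Circle) → E3} (hf : Topology.IsEmbedding f) (i : Fin c) (a : Circle) :
    HasChart (range f) (Ioo (-1) 1) (f (Sum.inr (i, a))) := by
  obtain ⟨θ, rfl⟩ : ∃ θ, Circle.exp θ = a := ⟨_, Circle.exp_arg a⟩
  have hpi := Real.pi_gt_three
  apply hasChart_range hf (fun t => Sum.inr (i, Circle.exp (θ + t)))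
  · apply Continuous.continuousOn
    apply continuous_inr.comp
    apply Continuous.prodMk continuous_const
    exact Circle.exp.continuous.comp (by fun_prop)
  · intro t ht t' ht' h
    simp only [Sum.inr.injEq, Prod.mk.injEq, true_and] at h
    have := Circle.exp_injOn_Icc (a := θ - 1) (b := θ + 1) (by linarith)
      ⟨by linarith [ht.1], by linarith [ht.2]⟩ ⟨by linarith [ht'.1], by linarith [ht'.2]⟩ h
    linarith
  · simp
  · intro δ hδ
    rw [nhds_inr, eventually_map]
    have h1 : ∀ᶠ y : Fin c × Circle in 𝓝 (i, Circle.exp θ), y.1 = i :=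
      continuous_fst.continuousAt.eventually
        ((isOpen_discrete ({i} : Set (Fin c))).mem_nhds
          (rfl : ((i, Circle.exp θ) : Fin c × Circle).1 = i))
    have h2 : ∀ᶠ y : Fin c × Circle in 𝓝 (i, Circle.exp θ),
        y.2 ∈ Circle.exp '' Metric.ball θ (min δ 1) := by
      have := isLocalHomeomorph_circleExp.isOpenMap.image_mem_nhds
        (Metric.ball_mem_nhds θ (lt_min hδ one_pos))
      exact continuous_snd.continuousAt.eventually this
    filter_upwards [h1, h2] with y hy1 hy2
    obtain ⟨τ, hτ, hτy⟩ := hy2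
    rw [Metric.mem_ball, Real.dist_eq] at hτ
    have h3 := abs_lt.1 (hτ.trans_le (min_le_right _ _))
    refine ⟨τ - θ, ⟨h3.1, h3.2⟩, hτ.trans_le (min_le_left _ _), ?_⟩
    rw [add_sub_cancel, hτy, ← hy1]

end

noncomputable section
open Set Filter Topology

/-! ### Subdivision of a finite union of segments -/

theorem exists_line_coord {a b x y u : E3} (hx : x ∈ segment ℝ a b) (hy : y ∈ segment ℝ a b)
    (hxy : y ≠ x) (hu : u ∈ segment ℝ a b) : ∃ t : ℝ, u = x + t • (y - x) := by
  rw [segment_eq_image'] at hx hy hu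
  obtain ⟨α, -, rfl⟩ := hx
  obtain ⟨β, -, rfl⟩ := hy
  obtain ⟨γ, -, rfl⟩ := hu
  have h : β - α ≠ 0 := by
    intro h
    apply hxy
    rw [sub_eq_zero.1 h]
  refine ⟨(γ - α) / (β - α), ?_⟩
  have : a + β • (b - a) - (a + α • (b - a)) = (β - α) • (b - a) := by module
  simp only [this, smul_smul, div_mul_cancel₀ _ h]
  module

theorem mem_openSegment_line {x d : E3} {s t r : ℝ} (h : s < r) (h' : r < t) :
    x + r • d ∈ openSegment ℝ (x + s • d) (x + t • d) := by
  have hst : 0 < t - s := by linarith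
  refine ⟨(t - r) / (t - s), (r - s) / (t - s), div_pos (by linarith) hst,
    div_pos (by linarith) hst, by field_simp; ring, ?_⟩
  have e : (t - r) / (t - s) + (r - s) / (t - s) = 1 := by field_simp; ring
  have e2 : (t - r) / (t - s) * s + (r - s) / (t - s) * t = r := by field_simp; ring
  calc _ = ((t - r) / (t - s) + (r - s) / (t - s)) • x +
      ((t - r) / (t - s) * s + (r - s) / (t - s) * t) • d := by module
    _ = _ := by rw [e, e2, one_smul]

theorem line_coord_openSegment {x d u w : E3} (hd : d ≠ 0) {s t : ℝ} (hu : u = x + s • d)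
    (hw : w = x + t • d) (huw : u ≠ w) (hx : x ∈ openSegment ℝ u w) :
    (s < 0 ∧ 0 < t) ∨ (t < 0 ∧ 0 < s) := by
  subst hu hw
  obtain ⟨α, β, hα, hβ, hαβ, h⟩ := hx
  have h1 : (α * s + β * t) • d = 0 := by
    have : α • (x + s • d) + β • (x + t • d) = (α + β) • x + (α * s + β * t) • d := by module
    rw [this, hαβ, one_smul, add_eq_left] at h
    exact h
  have h2 := (smul_eq_zero.1 h1).resolve_right hd
  rcases lt_trichotomy s 0 with hs | rfl | hs
  · left; refine ⟨hs, ?_⟩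
    by_contra! ht
    nlinarith
  · have : t = 0 := by
      rw [mul_zero, zero_add] at h2
      exact (mul_eq_zero.1 h2).resolve_left hβ.ne'
    exact absurd (by rw [this]) huw
  · right; refine ⟨?_, hs⟩
    by_contra! ht
    nlinarith

theorem openSegment_subset_ball {u w : E3} (hu : u ∈ Metric.closedBall (0 : E3) 1)
    (hw : w ∈ Metric.closedBall (0 : E3) 1) (h : u ≠ w) :
    openSegment ℝ u w ⊆ Metric.ball 0 1 := by
  have := (strictConvex_closedBall ℝ (0 : E3) 1).openSegment_subset hu hw h
  rwa [interior_closedBall _ one_ne_zero] at this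

theorem exists_emb_of_segments (S : Set (E3 × E3)) (hS : S.Finite)
    (hb : ∀ s ∈ S, s.1 ∈ Metric.closedBall (0 : E3) 1 ∧ s.2 ∈ Metric.closedBall (0 : E3) 1) :
    ∃ (E : Finset (E3 × E3)) (F : Set E3), F.Finite ∧ Emb (Metric.ball 0 1) E id ∧
      carrier E id ⊆ ⋃ s ∈ S, segment ℝ s.1 s.2 ∧
      (⋃ s ∈ S, segment ℝ s.1 s.2) \ F ⊆ carrier E id := by
  classical
  let F : Set E3 := (Prod.fst '' S ∪ Prod.snd '' S) ∪
    ⋃ s ∈ S, ⋃ s' ∈ S, {x | segment ℝ s.1 s.2 ∩ segment ℝ s'.1 s'.2 = {x}}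
  have hF : F.Finite := by
    refine ((hS.image _).union (hS.image _)).union ?_
    refine hS.biUnion fun s _ => hS.biUnion fun s' _ => ?_
    apply Set.Subsingleton.finite
    intro x hx y hy
    simp only [mem_ofPred_eq] at hx hy
    rw [hx] at hy
    exact singleton_eq_singleton_iff.1 hy
  have hpair : ∀ s ∈ S, ∀ s' ∈ S, ∀ x ∈ segment ℝ s.1 s.2, x ∈ segment ℝ s'.1 s'.2 → x ∉ F →
      ∃ y, y ≠ x ∧ y ∈ segment ℝ s.1 s.2 ∧ y ∈ segment ℝ s'.1 s'.2 := by
    intro s hs s' hs' x hx hx' hxF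
    by_contra! hcon
    apply hxF
    right
    simp only [mem_iUnion, mem_ofPred_eq]
    refine ⟨s, hs, s', hs', ?_⟩
    ext y
    constructor
    · intro hy
      by_contra hyx
      exact hcon y hyx hy.1 hy.2
    · rintro rfl
      exact ⟨hx, hx'⟩
  let E : Finset (E3 × E3) := (hF.toFinset ×ˢ hF.toFinset).filter fun e =>
    WellOrderingRel e.1 e.2 ∧ (∃ s ∈ S, e.1 ∈ segment ℝ s.1 s.2 ∧ e.2 ∈ segment ℝ s.1 s.2) ∧
      ∀ x ∈ openSegment ℝ e.1 e.2, x ∉ F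
  have hE : ∀ e, e ∈ E ↔ (e.1 ∈ F ∧ e.2 ∈ F) ∧ WellOrderingRel e.1 e.2 ∧
      (∃ s ∈ S, e.1 ∈ segment ℝ s.1 s.2 ∧ e.2 ∈ segment ℝ s.1 s.2) ∧
      ∀ x ∈ openSegment ℝ e.1 e.2, x ∉ F := by
    intro e
    simp [E]
  have hirr : ∀ x : E3, ¬ WellOrderingRel x x := fun x => irrefl x
  have hasym : ∀ x y : E3, WellOrderingRel x y → ¬ WellOrderingRel y x := fun x y => asymm
  have hseg : ∀ s : E3 × E3, ∀ u ∈ segment ℝ s.1 s.2, ∀ w ∈ segment ℝ s.1 s.2,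
      segment ℝ u w ⊆ segment ℝ s.1 s.2 := fun s u hu w hw =>
    (convex_segment _ _).segment_subset hu hw
  refine ⟨E, F, hF, ⟨?_, ?_, ?_⟩, ?_, ?_⟩
  · intro e he h
    have := ((hE e).1 he).2.1
    simp only [id] at h
    rw [h] at this
    exact hirr _ this
  · rintro ⟨u, w⟩ he ⟨u', w'⟩ he' hee x hx hx'
    obtain ⟨⟨huF, hwF⟩, hlt, ⟨s, hs, hus, hws⟩, hav⟩ := (hE _).1 he
    obtain ⟨⟨huF', hwF'⟩, hlt', ⟨s', hs', hus', hws'⟩, hav'⟩ := (hE _).1 he'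
    simp only [id] at *
    have huw : u ≠ w := by rintro rfl; exact hirr _ hlt
    have huw' : u' ≠ w' := by rintro rfl; exact hirr _ hlt'
    rw [← insert_endpoints_openSegment] at hx hx'
    by_cases hxF : x ∈ F
    · have h1 : Inc (u, w) x := by
        rcases hx with rfl | rfl | hx
        · exact Or.inl rfl
        · exact Or.inr rfl
        · exact absurd hxF (hav x hx)
      have h2 : Inc (u', w') x := by
        rcases hx' with rfl | rfl | hx
        · exact Or.inl rfl
        · exact Or.inr rfl
        · exact absurd hxF (hav' x hx)
      exact ⟨x, h1, h2, rfl⟩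
    · exfalso
      replace hx : x ∈ openSegment ℝ u w := by
        rcases hx with rfl | rfl | hx
        · exact absurd huF hxF
        · exact absurd hwF hxF
        · exact hx
      replace hx' : x ∈ openSegment ℝ u' w' := by
        rcases hx' with rfl | rfl | hx
        · exact absurd huF' hxF
        · exact absurd hwF' hxF
        · exact hx
      have hxs := hseg s u hus w hws (openSegment_subset_segment _ _ _ hx)
      have hxs' := hseg s' u' hus' w' hws' (openSegment_subset_segment _ _ _ hx')
      obtain ⟨y, hyx, hys, hys'⟩ := hpair s hs s' hs' x hxs hxs' hxF
      obtain ⟨a, ha⟩ := exists_line_coord hxs hys hyx hus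
      obtain ⟨b, hb⟩ := exists_line_coord hxs hys hyx hws
      obtain ⟨a', ha'⟩ := exists_line_coord hxs' hys' hyx hus'
      obtain ⟨b', hb'⟩ := exists_line_coord hxs' hys' hyx hws'
      have hd : y - x ≠ 0 := sub_ne_zero.2 hyx
      generalize y - x = d at *
      have key : ∀ (u w u' w' : E3) (a b a' b' : ℝ), u ∈ F → w ∈ F → u' ∈ F → w' ∈ F →
          (∀ x ∈ openSegment ℝ u w, x ∉ F) → (∀ x ∈ openSegment ℝ u' w', x ∉ F) →
          u = x + a • d → w = x + b • d → u' = x + a' • d → w' = x + b' • d →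
          a < 0 → 0 < b → a' < 0 → 0 < b' → u = u' ∧ w = w' := by
        intro u w u' w' a b a' b' h1 h2 h3 h4 h5 h6 h7 h8 h9 h10 h11 h12 h13 h14
        have i1 : a = a' := by
          rcases lt_trichotomy a a' with h | h | h
          · exact absurd h3 (h5 u' (by rw [h7, h8, h9]; exact mem_openSegment_line h (by linarith)))
          · exact h
          · exact absurd h1 (h6 u (by rw [h7, h10, h9]; exact mem_openSegment_line h (by linarith)))
        have i2 : b = b' := by
          rcases lt_trichotomy b b' with h | h | h
          · exact absurd h2 (h6 w (by rw [h8, h10, h9]; exact mem_openSegment_line (by linarith) h))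
          · exact h
          · exact absurd h4 (h5 w' (by rw [h7, h10, h8]; exact mem_openSegment_line (by linarith) h))
        exact ⟨by rw [h7, h9, i1], by rw [h8, h10, i2]⟩
      rcases line_coord_openSegment hd ha hb huw hx with ⟨p1, p2⟩ | ⟨p1, p2⟩ <;>
        rcases line_coord_openSegment hd ha' hb' huw' hx' with ⟨p3, p4⟩ | ⟨p3, p4⟩
      · obtain ⟨rfl, rfl⟩ := key u w u' w' a b a' b' huF hwF huF' hwF' hav hav' ha hb ha' hb'
          p1 p2 p3 p4
        exact hee rfl
      · obtain ⟨rfl, rfl⟩ := key u w w' u' a b b' a' huF hwF hwF' huF' hav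
          (by rwa [openSegment_symm]) ha hb hb' ha' p1 p2 p3 p4
        exact hasym _ _ hlt hlt'
      · obtain ⟨rfl, rfl⟩ := key w u u' w' b a a' b' hwF huF huF' hwF'
          (by rwa [openSegment_symm]) hav' hb ha ha' hb' p1 p2 p3 p4
        exact hasym _ _ hlt hlt'
      · obtain ⟨rfl, rfl⟩ := key w u w' u' b a b' a' hwF huF hwF' huF'
          (by rwa [openSegment_symm]) (by rwa [openSegment_symm]) hb ha hb' ha' p1 p2 p3 p4
        exact hee rfl
  · intro e he
    obtain ⟨-, hlt, ⟨s, hs, hus, hws⟩, -⟩ := (hE e).1 he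
    have hbs : segment ℝ s.1 s.2 ⊆ Metric.closedBall (0 : E3) 1 :=
      (convex_closedBall _ _).segment_subset (hb s hs).1 (hb s hs).2
    refine openSegment_subset_ball (hbs hus) (hbs hws) ?_
    simp only [id]
    intro h
    rw [h] at hlt
    exact hirr _ hlt
  · intro x hx
    obtain ⟨e, he, hxe⟩ := mem_carrier.1 hx
    obtain ⟨-, hlt, ⟨s, hs, hus, hws⟩, -⟩ := (hE e).1 he
    simp only [mem_iUnion, exists_prop]
    exact ⟨s, hs, hseg s _ hus _ hws hxe⟩
  · rintro x ⟨hx, hxF⟩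
    simp only [mem_iUnion, exists_prop] at hx
    obtain ⟨s, hs, hxs⟩ := hx
    have h1F : s.1 ∈ F := Or.inl (Or.inl (mem_image_of_mem _ hs))
    have h2F : s.2 ∈ F := Or.inl (Or.inr (mem_image_of_mem _ hs))
    have hd : s.2 - s.1 ≠ 0 := by
      intro h
      rw [sub_eq_zero] at h
      rw [h, segment_same, mem_singleton_iff] at hxs
      exact hxF (hxs ▸ h1F)
    rw [segment_eq_image'] at hxs
    obtain ⟨τ, hτ, rfl⟩ := hxs
    set c : ℝ → E3 := fun t => s.1 + t • (s.2 - s.1) with hc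
    have hcinj : Function.Injective c := by
      intro t t' h
      have h2 : (t - t') • (s.2 - s.1) = 0 := by
        rw [sub_smul, sub_eq_zero]; exact add_left_cancel h
      exact sub_eq_zero.1 ((smul_eq_zero.1 h2).resolve_right hd)
    have hcs : ∀ t ∈ Icc (0 : ℝ) 1, c t ∈ segment ℝ s.1 s.2 := by
      intro t ht; rw [segment_eq_image']; exact ⟨t, ht, rfl⟩
    let A : Set ℝ := c ⁻¹' F
    have hA : A.Finite := hF.preimage hcinj.injOn
    have h0A : (0 : ℝ) ∈ A := by simpa [A, hc] using h1F
    have h1A : (1 : ℝ) ∈ A := by simpa [A, hc] using h2F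
    have hτA : τ ∉ A := hxF
    obtain ⟨a, ⟨haA, haτ⟩, hamax⟩ := (hA.inter_of_left (Icc 0 τ)).exists_maximalFor id _
      ⟨0, h0A, le_rfl, hτ.1⟩
    obtain ⟨b, ⟨hbA, hbτ⟩, hbmin⟩ := (hA.inter_of_left (Icc τ 1)).exists_minimalFor id _
      ⟨1, h1A, hτ.2, le_rfl⟩
    have haτ' : a < τ := lt_of_le_of_ne haτ.2 fun h => hτA (h ▸ haA)
    have hbτ' : τ < b := lt_of_le_of_ne hbτ.1 fun h => hτA (h ▸ hbA)
    have hav : ∀ r ∈ Ioo a b, r ∉ A := by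
      intro r hr hrA
      rcases lt_trichotomy r τ with h | rfl | h
      · exact absurd (hamax (j := r) ⟨hrA, by linarith [haτ.1, hr.1], h.le⟩ hr.1.le) (not_le.2 hr.1)
      · exact hτA hrA
      · exact absurd (hbmin (j := r) ⟨hrA, h.le, by linarith [hbτ.2, hr.2]⟩ hr.2.le) (not_le.2 hr.2)
    have hopen : ∀ x ∈ openSegment ℝ (c a) (c b), x ∉ F := by
      intro x hx hxF'
      rw [openSegment_eq_image'] at hx
      obtain ⟨r, hr, rfl⟩ := hx
      have : c a + r • (c b - c a) = c (a + r * (b - a)) := by simp only [hc]; module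
      simp only [this] at hxF'
      exact hav _ ⟨by nlinarith [hr.1], by nlinarith [hr.2]⟩ hxF'
    have hm : c τ ∈ segment ℝ (c a) (c b) :=
      openSegment_subset_segment _ _ _ (mem_openSegment_line haτ' hbτ')
    have has := hcs a ⟨haτ.1, haτ.2.trans hτ.2⟩
    have hbs := hcs b ⟨hτ.1.trans hbτ.1, hbτ.2⟩
    have hne : c a ≠ c b := fun h => by have := hcinj h; linarith
    rw [mem_carrier]
    rcases trichotomous_of WellOrderingRel (c a) (c b) with h | h | h
    · exact ⟨(c a, c b), (hE _).2 ⟨⟨haA, hbA⟩, h, ⟨s, hs, has, hbs⟩, hopen⟩, hm⟩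
    · exact absurd h hne
    · exact ⟨(c b, c a), (hE _).2 ⟨⟨hbA, haA⟩, h, ⟨s, hs, hbs, has⟩,
        by rw [openSegment_symm]; exact hopen⟩, by rw [segment_symm]; exact hm⟩

variable {V : Type*}

/-- The degrees of the vertices are those of a tangle with boundary outside of `O`. -/
structure Deg (O : Set E3) (E : Finset (V × V)) (p : V → E3) : Prop where
  two : ∀ v, Used E v → p v ∈ O → ∃ e ∈ E, ∃ e' ∈ E, e ≠ e' ∧ Inc e v ∧ Inc e' v ∧
    ∀ g ∈ E, Inc g v → g = e ∨ g = e'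
  one : ∀ v, Used E v → p v ∉ O → ∃ e ∈ E, Inc e v ∧ ∀ g ∈ E, Inc g v → g = e

/-- Every point of `P` has a neighbourhood in `P` which is an open interval, or a half-open one if
the point is outside of `O`. -/
def TangleCharts (O P : Set E3) : Prop :=
  ∀ v ∈ P, (v ∈ O → ∃ ε > 0, HasChart P (Ioo (-ε) ε) v) ∧ (v ∉ O → ∃ ε > 0, HasChart P (Ico 0 ε) v)

theorem HasChart.image {P : Set E3} {J : Set ℝ} {v : E3} (h : HasChart P J v) (H : E3 ≃ₜ E3) :
    HasChart (H '' P) J (H v) := by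
  obtain ⟨g, hg, hi, h0, hP, hloc⟩ := h
  refine ⟨H ∘ g, H.continuous.comp_continuousOn hg, fun t ht t' ht' h => hi ht ht' (H.injective h),
    by simp [h0], fun t ht => mem_image_of_mem _ (hP t ht), fun δ hδ => ?_⟩
  have := hloc δ hδ
  rw [H.isInducing.nhds_eq_comap, eventually_comap] at this
  filter_upwards [this] with y hy hyP
  obtain ⟨x, hx, rfl⟩ := hyP
  obtain ⟨t, ht, htδ, htx⟩ := hy x rfl hx
  exact ⟨t, ht, htδ, by simp [htx]⟩

theorem TangleCharts.image {O O' P : Set E3} (h : TangleCharts O P) (H : E3 ≃ₜ E3)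
    (hO : ∀ x ∈ P, H x ∈ O' ↔ x ∈ O) : TangleCharts O' (H '' P) := by
  rintro _ ⟨x, hx, rfl⟩
  refine ⟨fun hxO => ?_, fun hxO => ?_⟩
  · obtain ⟨ε, hε, hc⟩ := (h x hx).1 ((hO x hx).1 hxO)
    exact ⟨ε, hε, hc.image H⟩
  · obtain ⟨ε, hε, hc⟩ := (h x hx).2 (fun h' => hxO ((hO x hx).2 h'))
    exact ⟨ε, hε, hc.image H⟩

theorem Used.mem_carrier {E : Finset (V × V)} {p : V → E3} {v : V} (hv : Used E v) :
    p v ∈ carrier E p := by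
  obtain ⟨e, he, hev⟩ := hv
  refine _root_.mem_carrier.2 ⟨e, he, ?_⟩
  rcases hev with rfl | rfl
  · exact left_mem_segment _ _ _
  · exact right_mem_segment _ _ _

theorem Emb.deg {O O' : Set E3} {E : Finset (V × V)} {p : V → E3} (hE : Emb O' E p)
    (hc : TangleCharts O (carrier E p)) : Deg O E p := by
  refine ⟨fun v hv hvO => ?_, fun v hv hvO => ?_⟩
  · obtain ⟨ε, hε, h⟩ := (hc _ hv.mem_carrier).1 hvO
    exact hE.degree_two hv hε h
  · obtain ⟨ε, hε, h⟩ := (hc _ hv.mem_carrier).2 hvO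
    exact hE.degree_one hv hε h

theorem IsTangle.charts {m : ℕ} {T : Set E3} (hT : IsTangle m T) :
    TangleCharts (Metric.ball 0 1) T := by
  obtain ⟨c, f, hf, rfl, hTb, hend⟩ := hT
  have hch1 : ∀ v ∈ range f, ‖v‖ = 1 → HasChart (range f) (Ico 0 1) v := by
    intro v hv hv1
    obtain ⟨x, rfl⟩ := hv
    obtain ⟨i, rfl | rfl⟩ := (hend x).1 hv1
    · refine hasChart_arc hf i 0 1 (by norm_num) _ ⟨le_rfl, one_pos⟩ ?_ 1 one_pos ?_
      · intro t ht
        exact ⟨by simpa using ht.1, by simpa using ht.2.le⟩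
      · intro y hy hy1
        simp only [Set.Icc.coe_zero, sub_zero, one_mul] at hy1 ⊢
        exact ⟨hy.1, (abs_lt.1 hy1).2⟩
    · refine hasChart_arc hf i 1 (-1) (by norm_num) _ ⟨le_rfl, one_pos⟩ ?_ 1 one_pos ?_
      · intro t ht
        have := ht.1
        have := ht.2
        constructor <;> simp <;> linarith
      · intro y hy hy1
        rw [abs_lt] at hy1
        simp only [Set.Icc.coe_one] at hy1 ⊢
        constructor <;> linarith [hy.2]
  have hch2 : ∀ v ∈ range f, ‖v‖ ≠ 1 → ∃ ε > 0, HasChart (range f) (Ioo (-ε) ε) v := by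
    intro v hv hv1
    obtain ⟨x, rfl⟩ := hv
    rcases x with ⟨i, a⟩ | ⟨i, a⟩
    · have ha0 : (0 : ℝ) < a := by
        rcases eq_or_lt_of_le a.2.1 with h | h
        · exact absurd ((hend _).2 ⟨i, Or.inl (by congr; exact Subtype.ext h.symm)⟩) hv1
        · exact h
      have ha1 : (a : ℝ) < 1 := by
        rcases eq_or_lt_of_le a.2.2 with h | h
        · exact absurd ((hend _).2 ⟨i, Or.inr (by congr; exact Subtype.ext h)⟩) hv1
        · exact h
      have hε : 0 < min (a : ℝ) (1 - a) := lt_min ha0 (by linarith)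
      refine ⟨_, hε, hasChart_arc hf i a 1 (by norm_num) _ ⟨by linarith, hε⟩ ?_ _ hε ?_⟩
      · intro t ht
        have h1 := ht.2.trans_le (min_le_right _ _)
        have h2 := min_le_left (a : ℝ) (1 - a)
        constructor <;> linarith [ht.1]
      · intro y hy hy1
        rw [one_mul]
        exact abs_lt.1 hy1
    · exact ⟨1, one_pos, hasChart_circle hf i a⟩
  intro v hv
  refine ⟨fun hvO => hch2 v hv (mem_ball_zero_iff.1 hvO).ne, fun hvO => ⟨1, one_pos, hch1 v hv ?_⟩⟩
  rw [mem_ball_zero_iff, not_lt] at hvO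
  exact le_antisymm (mem_closedBall_zero_iff.1 (hTb hv)) hvO

/-- A tame tangle is isotopic to a polygon, keeping the sphere fixed. -/
theorem exists_polygon (m : ℕ) (T : Set E3) (hT : IsTangle m T) (hTame : IsTame T) :
    ∃ (h : E3 ≃ₜ E3) (E : Finset (E3 × E3)), Isotopic h ∧ (∀ x, 1 ≤ ‖x‖ → h x = x) ∧
      h '' T = carrier E id ∧ carrier E id ⊆ Metric.closedBall 0 1 ∧
      Emb (Metric.ball 0 1) E id ∧ Deg (Metric.ball 0 1) E id ∧
      {v | Used E v ∧ v ∉ Metric.ball (0 : E3) 1} = T ∩ Metric.sphere 0 1 ∧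
      (T ∩ Metric.sphere 0 1).ncard = 2 * m := by
  have hT0 := hT
  obtain ⟨c, f, hf, hfT, hTb, hend⟩ := hT
  obtain ⟨Φ, hΦ, S, hS, hP⟩ := hTame
  set h := Φ.map 1 with hh
  have hfix : ∀ x, x ∉ Metric.ball (0 : E3) 1 → h x = x := by
    intro x hx
    rw [mem_ball_zero_iff, not_lt] at hx
    exact hΦ 1 x hx
  have hball := image_eq_of_eqOn_compl h hfix
  have hnorm : ∀ x, ‖h x‖ = 1 ↔ ‖x‖ = 1 := by
    intro x
    constructor
    · intro hx
      have h1 := hΦ 1 (h x) hx.ge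
      rw [← h.injective h1]; exact hx
    · intro hx
      rw [hΦ 1 x hx.ge]; exact hx
  have hle : ∀ x, ‖x‖ ≤ 1 → ‖h x‖ ≤ 1 := by
    intro x hx
    rcases eq_or_lt_of_le hx with h1 | h1
    · exact ((hnorm x).2 h1).le
    · have : h x ∈ Metric.ball (0 : E3) 1 := by
        rw [← hball]; exact mem_image_of_mem _ (mem_ball_zero_iff.2 h1)
      exact (mem_ball_zero_iff.1 this).le
  have hTle : ∀ x ∈ T, ‖x‖ ≤ 1 := fun x hx => mem_closedBall_zero_iff.1 (hTb hx)
  have hPle : ∀ x ∈ h '' T, x ∈ Metric.closedBall (0 : E3) 1 := by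
    rintro _ ⟨x, hx, rfl⟩
    exact mem_closedBall_zero_iff.2 (hle x (hTle x hx))
  obtain ⟨E, F, hF, hemb, hsub, hsup⟩ := exists_emb_of_segments S hS (by
    intro s hs
    have : segment ℝ s.1 s.2 ⊆ h '' T := by
      rw [hP]; exact subset_biUnion_of_mem (u := fun s : E3 × E3 => segment ℝ s.1 s.2) hs
    exact ⟨hPle _ (this (left_mem_segment _ _ _)), hPle _ (this (right_mem_segment _ _ _))⟩)
  rw [← hP] at hsub hsup
  have hcharts : TangleCharts (Metric.ball 0 1) (h '' T) :=
    hT0.charts.image h fun x hx => by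
      have h1 := h.injective.mem_set_image (s := Metric.ball 0 1) (a := x)
      rwa [hball] at h1
  have hcl : IsClosed (carrier E id) :=
    isClosed_biUnion_finset fun e _ => (isCompact_segment _ _).isClosed
  have hcar : carrier E id = h '' T := by
    apply hsub.antisymm
    intro v hv
    rw [← hcl.closure_eq]
    apply closure_mono hsup
    by_cases hvO : v ∈ Metric.ball (0 : E3) 1
    · obtain ⟨ε, hε, hc⟩ := (hcharts v hv).1 hvO
      exact hc.infinite hε (fun t ht => ⟨by linarith [ht.1], ht.2⟩) hF
    · obtain ⟨ε, hε, hc⟩ := (hcharts v hv).2 hvO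
      exact hc.infinite hε le_rfl hF
  have hTs : h '' T ∩ Metric.sphere 0 1 = T ∩ Metric.sphere 0 1 := by
    ext x
    constructor
    · rintro ⟨⟨y, hy, rfl⟩, hx⟩
      have h1 := (hnorm y).1 (mem_sphere_zero_iff_norm.1 hx)
      have h2 := hΦ 1 y h1.ge
      rw [h2]
      exact ⟨hy, mem_sphere_zero_iff_norm.2 h1⟩
    · rintro ⟨hx, hx1⟩
      exact ⟨⟨x, hx, hΦ 1 x (mem_sphere_zero_iff_norm.1 hx1).ge⟩, hx1⟩
  have hused : ∀ v, Used E v → v ∈ h '' T := by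
    rintro v ⟨e, he, hev⟩
    rw [← hcar, mem_carrier]
    refine ⟨e, he, ?_⟩
    rcases hev with rfl | rfl
    · exact left_mem_segment _ _ _
    · exact right_mem_segment _ _ _
  refine ⟨h, E, ⟨Φ, rfl⟩, hΦ 1, hcar.symm, fun x hx => hPle x (hcar ▸ hx), hemb,
    hemb.deg (hcar ▸ hcharts), ?_, ?_⟩
  · rw [← hTs, ← hcar]
    ext v
    constructor
    · rintro ⟨hv, hvO⟩
      have h0 := hused v hv
      refine ⟨hcar ▸ h0, mem_sphere_zero_iff_norm.2 (le_antisymm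
        (mem_closedBall_zero_iff.1 (hPle v h0)) (by simpa using hvO))⟩
    · rintro ⟨hv, hv1⟩
      have hvO : v ∉ Metric.ball (0 : E3) 1 := by
        rw [mem_ball_zero_iff, mem_sphere_zero_iff_norm.1 hv1]; exact lt_irrefl _
      refine ⟨?_, hvO⟩
      obtain ⟨e, he, hve⟩ := mem_carrier.1 hv
      rw [← insert_endpoints_openSegment] at hve
      rcases hve with rfl | rfl | hve
      · exact ⟨e, he, Or.inl rfl⟩
      · exact ⟨e, he, Or.inr rfl⟩
      · exact absurd (hemb.sub e he hve) hvO
  · have hset : T ∩ Metric.sphere 0 1 =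
        range fun q : Fin m × Bool => f (Sum.inl (q.1, if q.2 then 1 else 0)) := by
      ext x
      constructor
      · rintro ⟨hx, hx1⟩
        rw [← hfT] at hx
        obtain ⟨y, rfl⟩ := hx
        obtain ⟨i, rfl | rfl⟩ := (hend y).1 (mem_sphere_zero_iff_norm.1 hx1)
        · exact ⟨(i, false), by simp⟩
        · exact ⟨(i, true), by simp⟩
      · rintro ⟨⟨i, b⟩, rfl⟩
        refine ⟨hfT ▸ mem_range_self _, mem_sphere_zero_iff_norm.2 ((hend _).2 ⟨i, ?_⟩)⟩
        cases b <;> simp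
    rw [hset, ← image_univ, ncard_image_of_injective, ncard_univ, Nat.card_prod]
    · simp [mul_comm]
    · rintro ⟨i, b⟩ ⟨i', b'⟩ h
      have := hf.injective h
      simp only [Sum.inl.injEq, Prod.mk.injEq] at this
      obtain ⟨rfl, h2⟩ := this
      cases b <;> cases b' <;> simp at h2 ⊢

end

noncomputable section
open Set Filter Topology

/-! ### Straightening the ends of a polygonal tangle -/

variable {V : Type*}

theorem inner_lt_one {a x : E3} (ha : ‖a‖ = 1) (hx : ‖x‖ ≤ 1) (h : x ≠ a) :
    inner ℝ a x < (1 : ℝ) := by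
  have h1 : 0 < ‖a - x‖ := norm_pos_iff.2 (sub_ne_zero.2 h.symm)
  have h2 := norm_sub_sq_real a x
  rw [ha] at h2
  nlinarith [norm_nonneg x]

theorem Emb.mono {O O' : Set E3} {E : Finset (V × V)} {p : V → E3} (h : Emb O E p) (hO : O ⊆ O') :
    Emb O' E p := ⟨h.ne, h.inter, fun e he => (h.sub e he).trans hO⟩

theorem inc_inl {e : V × V} {v : V ⊕ V} (h : Inc (Sum.inl e.1, Sum.inl e.2) v) :
    ∃ w, Inc e w ∧ v = Sum.inl w := by
  rcases h with rfl | rfl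
  · exact ⟨e.1, Or.inl rfl, rfl⟩
  · exact ⟨e.2, Or.inr rfl, rfl⟩

theorem inc_inl_iff {e : V × V} {v : V} :
    Inc ((Sum.inl e.1, Sum.inl e.2) : (V ⊕ V) × (V ⊕ V)) (Sum.inl v) ↔ Inc e v := by
  simp [Inc]

theorem along_add_sub (p q : V → E3) (e : V × V) (s : ℝ) :
    along q e s = along p e s + along (fun v => q v - p v) e s := by
  simp only [along]; module

theorem straighten {E : Finset (V × V)} {p : V → E3}
    (hE : Emb (Metric.ball 0 1) E p) (hD : Deg (Metric.ball 0 1) E p)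
    (hcl : ∀ v, Used E v → ‖p v‖ ≤ 1) (o : E3) (ho : ‖o‖ < 1) :
    ∃ (E' : Finset ((V ⊕ V) × (V ⊕ V))) (p' : V ⊕ V → E3) (h : E3 ≃ₜ E3),
      (∀ x, x ∉ Metric.ball (0 : E3) 1 → h x = x) ∧ h '' carrier E p = carrier E' p' ∧
      Emb (Metric.ball 0 1) E' p' ∧
      {v | Used E' v ∧ p' v ∉ Metric.ball (0 : E3) 1} =
        Sum.inr '' {v | Used E v ∧ p v ∉ Metric.ball (0 : E3) 1} ∧
      (∀ v, p' (Sum.inr v) = p v) ∧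
      ∀ e ∈ E', (p' e.1 ∈ Metric.ball (0 : E3) 1 ∧ p' e.2 ∈ Metric.ball (0 : E3) 1) ∨
        ∃ (a : E3) (σ : ℝ), 0 < σ ∧ σ < 1 ∧ p' e.1 = a ∧ ‖a‖ = 1 ∧ p' e.2 = o + σ • (a - o) := by
  classical
  let O : Set E3 := Metric.ball 0 1
  have hmemO : ∀ x : E3, x ∈ O ↔ ‖x‖ < 1 := fun x => mem_ball_zero_iff
  have hOopen : IsOpen O := Metric.isOpen_ball
  have hOconv : Convex ℝ O := convex_ball _ _
  have hone : ∀ v, Used E v → p v ∉ O → ‖p v‖ = 1 := by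
    intro v hv hvO
    rw [hmemO, not_lt] at hvO
    exact le_antisymm (hcl v hv) hvO
  have hnb : ∀ v, ∃ b, Used E v → p v ∉ O → ∃ e ∈ E, (e = (v, b) ∨ e = (b, v)) ∧
      ∀ g ∈ E, Inc g v → g = e := by
    intro v
    by_cases hv : Used E v ∧ p v ∉ O
    · obtain ⟨e, he, hev, hg⟩ := hD.one v hv.1 hv.2
      obtain ⟨b, hb, hbe, -⟩ := hev.exists_other
      exact ⟨b, fun _ _ => ⟨e, he, hbe, hg⟩⟩
    · exact ⟨v, fun h1 h2 => absurd ⟨h1, h2⟩ hv⟩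
  choose nb hnb using hnb
  have hnbu : ∀ v, Used E v → p v ∉ O → Used E (nb v) ∧ p (nb v) ≠ p v := by
    intro v hv hvO
    obtain ⟨e, he, rfl | rfl, -⟩ := hnb v hv hvO
    · exact ⟨⟨_, he, Or.inr rfl⟩, (hE.ne _ he).symm⟩
    · exact ⟨⟨_, he, Or.inl rfl⟩, hE.ne _ he⟩
  let w : ℝ → V → E3 := fun t v => (1 - t) • p (nb v) + t • o
  let c : ℝ → ℝ → V → E3 := fun s t v => p v + s • (w t v - p v)
  let q : ℝ → ℝ → V → E3 := fun s t v => if p v ∈ O then p v else c s t v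
  let pos : ℝ → ℝ → V ⊕ V → E3 := fun s t => Sum.elim (q s t) p
  have hw1 : ∀ v, Used E v → p v ∉ O → ∀ t ∈ Icc (0 : ℝ) 1, ‖w t v‖ ≤ 1 := by
    intro v hv hvO t ht
    have := (convex_closedBall (0 : E3) 1) (mem_closedBall_zero_iff.2 (hcl _ (hnbu v hv hvO).1))
      (mem_closedBall_zero_iff.2 ho.le) (sub_nonneg.2 ht.2) ht.1 (by ring)
    exact mem_closedBall_zero_iff.1 this
  have hwin : ∀ v, Used E v → p v ∉ O → ∀ t ∈ Icc (0 : ℝ) 1, inner ℝ (p v) (w t v) < 1 := by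
    intro v hv hvO t ht
    have h1 := inner_lt_one (hone v hv hvO) (hcl _ (hnbu v hv hvO).1) (hnbu v hv hvO).2
    have h2 := inner_lt_one (hone v hv hvO) ho.le (x := o) (by
      intro h; have := hone v hv hvO; rw [h] at ho; linarith)
    simp only [w, inner_add_right, inner_smul_right]
    rcases eq_or_lt_of_le ht.1 with h | h
    · rw [← h]; linarith
    · nlinarith [ht.2]
  have hwne : ∀ v, Used E v → p v ∉ O → ∀ t ∈ Icc (0 : ℝ) 1, p v ≠ w t v := by
    intro v hv hvO t ht h
    have := hwin v hv hvO t ht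
    rw [← h, real_inner_self_eq_norm_sq, hone v hv hvO] at this
    norm_num at this
  have hwd : ∀ v, Used E v → p v ∉ O → ∀ t ∈ Icc (0 : ℝ) 1, ‖w t v - p v‖ ≤ 2 := by
    intro v hv hvO t ht
    have := norm_sub_le (w t v) (p v)
    linarith [hw1 v hv hvO t ht, hcl v hv]
  have hcO : ∀ v, Used E v → p v ∉ O → ∀ t ∈ Icc (0 : ℝ) 1, ∀ s ∈ Ioo (0 : ℝ) 1, c s t v ∈ O := by
    intro v hv hvO t ht s hs
    apply openSegment_subset_ball (mem_closedBall_zero_iff.2 (hcl v hv))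
      (mem_closedBall_zero_iff.2 (hw1 v hv hvO t ht)) (hwne v hv hvO t ht)
    rw [openSegment_eq_image']
    exact ⟨s, hs, rfl⟩
  have hqO : ∀ v, Used E v → ∀ t ∈ Icc (0 : ℝ) 1, ∀ s ∈ Ioo (0 : ℝ) 1, q s t v ∈ O := by
    intro v hv t ht s hs
    simp only [q]
    split_ifs with h
    · exact h
    · exact hcO v hv h t ht s hs
  have hqd : ∀ v, Used E v → ∀ t ∈ Icc (0 : ℝ) 1, ∀ s ∈ Ioo (0 : ℝ) 1, ‖q s t v - p v‖ ≤ 2 * s := by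
    intro v hv t ht s hs
    simp only [q]
    split_ifs with h
    · rw [sub_self, norm_zero]; linarith [hs.1]
    · simp only [c, add_sub_cancel_left, norm_smul, Real.norm_of_nonneg hs.1.le]
      nlinarith [hwd v hv h t ht, hs.1]
  let VE : Finset V := E.image Prod.fst ∪ E.image Prod.snd
  have hVE : ∀ v, v ∈ VE ↔ Used E v := by
    intro v
    simp only [VE, Finset.mem_union, Finset.mem_image]
    constructor
    · rintro (⟨e, he, rfl⟩ | ⟨e, he, rfl⟩)
      · exact ⟨e, he, Or.inl rfl⟩
      · exact ⟨e, he, Or.inr rfl⟩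
    · rintro ⟨e, he, rfl | rfl⟩
      · exact Or.inl ⟨e, he, rfl⟩
      · exact Or.inr ⟨e, he, rfl⟩
  have hinjp : ∀ v, Used E v → ∀ v', Used E v' → p v = p v' → v = v' := by
    rintro v ⟨e, he, hev⟩ v' hv' h
    have hx : p v' ∈ segment ℝ (p e.1) (p e.2) := by
      rw [← h]
      rcases hev with rfl | rfl
      · exact left_mem_segment _ _ _
      · exact right_mem_segment _ _ _
    have := hE.inc_of_mem hv' he hx
    have hne := hE.ne e he
    rcases hev with rfl | rfl <;> rcases this with rfl | rfl
    · rfl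
    · exact absurd h hne
    · exact absurd h.symm hne
    · rfl
  obtain ⟨ε, hε, hper⟩ := (hE.mono (subset_univ _)).perturb isOpen_univ convex_univ
  have ev1 : ∀ v ∈ VE, ∀ v' ∈ VE, ∀ᶠ s : ℝ in 𝓝[>] 0, v ≠ v' → 4 * s < ‖p v - p v'‖ := by
    intro v hv v' hv'
    by_cases h : v = v'
    · exact Eventually.of_forall fun s h' => absurd h h'
    have h1 : 0 < ‖p v - p v'‖ := norm_pos_iff.2 (sub_ne_zero.2 fun h' =>
      h (hinjp v ((hVE v).1 hv) v' ((hVE v').1 hv') h'))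
    filter_upwards [Ioo_mem_nhdsGT (show 0 < ‖p v - p v'‖ / 4 by positivity)] with s hs _
    linarith [hs.2]
  have ev2 : ∀ v ∈ VE, ∀ e ∈ E, ∀ᶠ s : ℝ in 𝓝[>] 0, ¬ Inc e v →
      ∀ x ∈ segment ℝ (p e.1) (p e.2), 4 * s < ‖p v - x‖ := by
    intro v hv e he
    by_cases h : Inc e v
    · exact Eventually.of_forall fun s h' => absurd h h'
    obtain ⟨r, hr, hrx⟩ := exists_dist_bound (isCompact_singleton (x := p v))
      (isCompact_segment (p e.1) (p e.2)).isClosed (by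
        rw [disjoint_singleton_left]
        exact fun h' => h (hE.inc_of_mem ((hVE v).1 hv) he h'))
    filter_upwards [Ioo_mem_nhdsGT (show 0 < r / 4 by positivity)] with s hs _ x hx
    linarith [hs.2, hrx _ rfl x hx]
  have ev3 : ∀ v ∈ VE, ∀ᶠ s : ℝ in 𝓝[>] 0, p v ∉ O → 4 * s < 1 - inner ℝ (p v) (p (nb v)) := by
    intro v hv
    by_cases h : p v ∈ O
    · exact Eventually.of_forall fun s h' => absurd h h'
    have hu := (hVE v).1 hv
    have h1 := inner_lt_one (hone v hu h) (hcl _ (hnbu v hu h).1) (hnbu v hu h).2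
    filter_upwards [Ioo_mem_nhdsGT (show 0 < (1 - inner ℝ (p v) (p (nb v))) / 4 by linarith)]
      with s hs _
    linarith [hs.2]
  have ev4 : ∀ᶠ s : ℝ in 𝓝[>] 0, s ∈ Ioo (0 : ℝ) (min (1 / 2) (ε / 2)) :=
    Ioo_mem_nhdsGT (by positivity)
  have ev1' := (Filter.eventually_all_finset _).2 fun v hv =>
    (Filter.eventually_all_finset _).2 (ev1 v hv)
  have ev2' := (Filter.eventually_all_finset _).2 fun v hv =>
    (Filter.eventually_all_finset _).2 (ev2 v hv)
  have ev3' := (Filter.eventually_all_finset _).2 ev3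
  obtain ⟨s, ⟨hs1, hs2⟩, hs3, hs4⟩ := ((ev1'.and ev2').and (ev3'.and ev4)).exists
  have hs0 : 0 < s := hs4.1
  have hs12 : s < 1 / 2 := hs4.2.trans_le (min_le_left _ _)
  have hsε : 2 * s ≤ ε := by linarith [hs4.2.trans_le (min_le_right (1 / 2) (ε / 2))]
  have hs01 : s ∈ Ioo (0 : ℝ) 1 := ⟨hs0, by linarith⟩
  have hmain : ∀ t ∈ Icc (0 : ℝ) 1, Emb univ E (q s t) := by
    intro t ht
    refine Moves.emb (hper (q s t) (fun v hv => (hqd v hv t ht s hs01).trans hsε)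
      fun v _ h => absurd (mem_univ _) h) (hE.mono (subset_univ _))
  let B : Finset V := VE.filter fun v => p v ∉ O
  have hB : ∀ v, v ∈ B ↔ Used E v ∧ p v ∉ O := by intro v; simp [B, hVE]
  let E' : Finset ((V ⊕ V) × (V ⊕ V)) :=
    E.image (fun e => (Sum.inl e.1, Sum.inl e.2)) ∪ B.image fun v => (Sum.inr v, Sum.inl v)
  have hE' : ∀ e, e ∈ E' ↔ (∃ e' ∈ E, e = (Sum.inl e'.1, Sum.inl e'.2)) ∨
      ∃ v, Used E v ∧ p v ∉ O ∧ e = (Sum.inr v, Sum.inl v) := by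
    intro e
    simp only [E', Finset.mem_union, Finset.mem_image, hB]
    constructor
    · rintro (⟨e', he', rfl⟩ | ⟨v, hv, rfl⟩)
      · exact Or.inl ⟨e', he', rfl⟩
      · exact Or.inr ⟨v, hv.1, hv.2, rfl⟩
    · rintro (⟨e', he', rfl⟩ | ⟨v, hv, hv', rfl⟩)
      · exact Or.inl ⟨e', he', rfl⟩
      · exact Or.inr ⟨v, ⟨hv, hv'⟩, rfl⟩
  have hqc : ∀ t v, p v ∉ O → q s t v = c s t v := by
    intro t v h; simp only [q, if_neg h]
  have hstub : ∀ t ∈ Icc (0 : ℝ) 1, ∀ v, Used E v → p v ∉ O → ∀ x ∈ segment ℝ (p v) (q s t v),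
      ‖x - p v‖ ≤ 2 * s ∧ inner ℝ (p v) (q s t v) ≤ inner ℝ (p v) x := by
    intro t ht v hv hvO x hx
    rw [segment_eq_image'] at hx
    obtain ⟨r, hr, rfl⟩ := hx
    have h1 := hqd v hv t ht s hs01
    constructor
    · simp only [add_sub_cancel_left, norm_smul, Real.norm_of_nonneg hr.1]
      nlinarith [hr.1, hr.2, norm_nonneg (q s t v - p v)]
    · have h2 := hone v hv hvO
      have h3 := hcO v hv hvO t ht s hs01
      rw [← hqc t v hvO, hmemO] at h3
      have h4 := real_inner_le_norm (p v) (q s t v)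
      rw [h2, one_mul] at h4
      simp only [inner_add_right, inner_smul_right, inner_sub_right, real_inner_self_eq_norm_sq, h2]
      nlinarith [hr.1, hr.2]
  have hedge : ∀ t ∈ Icc (0 : ℝ) 1, ∀ e ∈ E, ∀ x ∈ segment ℝ (q s t e.1) (q s t e.2),
      ∃ y ∈ segment ℝ (p e.1) (p e.2), ‖x - y‖ ≤ 2 * s := by
    intro t ht e he x hx
    obtain ⟨r, hr, rfl⟩ := mem_segment_iff_along.1 hx
    refine ⟨_, along_mem_segment p e hr, ?_⟩
    rw [along_add_sub p (q s t), add_sub_cancel_left]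
    exact norm_along_le (hqd _ ⟨e, he, Or.inl rfl⟩ t ht s hs01)
      (hqd _ ⟨e, he, Or.inr rfl⟩ t ht s hs01) hr
  have hstubmain : ∀ t ∈ Icc (0 : ℝ) 1, ∀ v, Used E v → p v ∉ O → ∀ e ∈ E,
      ∀ x ∈ segment ℝ (p v) (q s t v), x ∈ segment ℝ (q s t e.1) (q s t e.2) →
      Inc e v ∧ x = q s t v := by
    intro t ht v hv hvO e he x hx hxe
    obtain ⟨h1, h2⟩ := hstub t ht v hv hvO x hx
    have hinc : Inc e v := by
      by_contra hcon
      obtain ⟨y, hy, hxy⟩ := hedge t ht e he x hxe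
      have h3 := hs2 v ((hVE v).2 hv) e he hcon y hy
      have h4 := norm_sub_le_norm_sub_add_norm_sub (p v) x y
      rw [norm_sub_rev (p v) x] at h4
      linarith
    refine ⟨hinc, ?_⟩
    obtain ⟨e', he', hb, hu⟩ := hnb v hv hvO
    obtain rfl := hu e he hinc
    have hseg : segment ℝ (q s t e.1) (q s t e.2) = segment ℝ (q s t v) (q s t (nb v)) := by
      rcases hb with rfl | rfl
      · rfl
      · exact segment_symm _ _ _
    rw [hseg, segment_eq_image'] at hxe
    obtain ⟨r, hr, rfl⟩ := hxe
    simp only [inner_add_right, inner_smul_right, inner_sub_right] at h2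
    have hv1 := hone v hv hvO
    have h5 : inner ℝ (p v) (q s t (nb v)) ≤ inner ℝ (p v) (p (nb v)) + 2 * s := by
      have h6 := real_inner_le_norm (p v) (q s t (nb v) - p (nb v))
      rw [hv1, one_mul, inner_sub_right] at h6
      linarith [hqd _ (hnbu v hv hvO).1 t ht s hs01]
    have h7 : 1 - 2 * s ≤ inner ℝ (p v) (q s t v) := by
      have h6 := real_inner_le_norm (p v) (p v - q s t v)
      rw [hv1, one_mul, inner_sub_right, real_inner_self_eq_norm_sq, hv1, norm_sub_rev] at h6
      linarith [hqd _ hv t ht s hs01]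
    have h8 := hs3 v ((hVE v).2 hv) hvO
    have h9 : r = 0 := by
      by_contra hr0
      have : 0 < r := lt_of_le_of_ne hr.1 (Ne.symm hr0)
      nlinarith
    simp [h9]
  have hcb : ∀ t ∈ Icc (0 : ℝ) 1, ∀ v, Used E' v → pos s t v ∈ Metric.closedBall (0 : E3) 1 := by
    rintro t ht v ⟨e, he, hev⟩
    rw [mem_closedBall_zero_iff]
    rcases (hE' e).1 he with ⟨e', he', rfl⟩ | ⟨u, hu, huO, rfl⟩
    · obtain ⟨u, hu, rfl⟩ := inc_inl hev
      exact ((hmemO _).1 (hqO u ⟨e', he', hu⟩ t ht s hs01)).le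
    · rcases hev with rfl | rfl
      · exact hcl u hu
      · exact ((hmemO _).1 (hqO u hu t ht s hs01)).le
  have hne : ∀ t ∈ Icc (0 : ℝ) 1, ∀ e ∈ E', pos s t e.1 ≠ pos s t e.2 := by
    intro t ht e he
    rcases (hE' e).1 he with ⟨e', he', rfl⟩ | ⟨u, hu, huO, rfl⟩
    · exact (hmain t ht).ne e' he'
    · intro h
      apply huO
      simp only [pos, Sum.elim_inl, Sum.elim_inr] at h
      rw [h]
      exact hqO u hu t ht s hs01
  have hEmb : ∀ t ∈ Icc (0 : ℝ) 1, Emb O E' (pos s t) := by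
    intro t ht
    refine ⟨hne t ht, ?_, fun e he => openSegment_subset_ball (hcb t ht _ ⟨e, he, Or.inl rfl⟩)
      (hcb t ht _ ⟨e, he, Or.inr rfl⟩) (hne t ht e he)⟩
    intro e he e' he' hee x hx hx'
    rcases (hE' e).1 he with ⟨d, hd, rfl⟩ | ⟨u, hu, huO, rfl⟩ <;>
      rcases (hE' e').1 he' with ⟨d', hd', rfl⟩ | ⟨u', hu', huO', rfl⟩
    · obtain ⟨v, hv, hv', rfl⟩ := (hmain t ht).inter d hd d' hd'
        (by rintro rfl; exact hee rfl) x hx hx'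
      exact ⟨Sum.inl v, inc_inl_iff.2 hv, inc_inl_iff.2 hv', rfl⟩
    · obtain ⟨h1, rfl⟩ := hstubmain t ht u' hu' huO' d hd x hx' hx
      exact ⟨Sum.inl u', inc_inl_iff.2 h1, Or.inr rfl, rfl⟩
    · obtain ⟨h1, rfl⟩ := hstubmain t ht u hu huO d' hd' x hx hx'
      exact ⟨Sum.inl u, Or.inr rfl, inc_inl_iff.2 h1, rfl⟩
    · exfalso
      have huu : u ≠ u' := by rintro rfl; exact hee rfl
      have h1 := (hstub t ht u hu huO x hx).1
      have h2 := (hstub t ht u' hu' huO' x hx').1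
      have h3 := hs1 u ((hVE u).2 hu) u' ((hVE u').2 hu') huu
      have h4 := norm_sub_le_norm_sub_add_norm_sub (p u) x (p u')
      rw [norm_sub_rev (p u) x] at h4
      linarith
  have hmoves : Moves O E' (pos s 0) (pos s 1) := by
    apply moves_of_family hOopen hOconv (pos s) ?_ hEmb ?_
    · rintro (v | v) _
      · simp only [pos, Sum.elim_inl, q]
        split_ifs
        · exact continuous_const
        · simp only [c, w]; fun_prop
      · exact continuous_const
    · rintro (v | v) ⟨e, he, hev⟩ t ht t' ht' hO
      · exfalso
        apply hO
        rcases (hE' e).1 he with ⟨e', he', rfl⟩ | ⟨u, hu, huO, rfl⟩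
        · exact hqO v ⟨e', he', inc_inl_iff.1 hev⟩ t ht s hs01
        · rcases hev with h | h
          · cases h
          · cases h
            exact hqO v hu t ht s hs01
      · rfl
  have h00 : (0 : ℝ) ∈ Icc (0 : ℝ) 1 := by simp
  have hcar : carrier E' (pos s 0) = carrier E p := by
    have hend : ∀ e ∈ E, ∃ s1, ((p e.1 ∈ O ∧ s1 = 0) ∨ (p e.1 ∉ O ∧ s1 = s)) ∧
        q s 0 e.1 = along p e s1 := by
      intro e he
      by_cases h : p e.1 ∈ O
      · exact ⟨0, Or.inl ⟨h, rfl⟩, by simp only [q, if_pos h, along_zero]⟩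
      · refine ⟨s, Or.inr ⟨h, rfl⟩, ?_⟩
        obtain ⟨e', he', hb, hu⟩ := hnb e.1 ⟨e, he, Or.inl rfl⟩ h
        obtain rfl := hu e he (Or.inl rfl)
        have : nb e.1 = e.2 := by
          rcases hb with hb | hb
          · exact (congrArg Prod.snd hb).symm
          · have h1 := congrArg Prod.fst hb
            have h2 := congrArg Prod.snd hb
            exact absurd (by rw [h2]) (hE.ne e he)
        rw [hqc 0 _ h]
        simp only [c, w, this, along]
        module
    have hend' : ∀ e ∈ E, ∃ s1, ((p e.2 ∈ O ∧ s1 = 0) ∨ (p e.2 ∉ O ∧ s1 = s)) ∧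
        q s 0 e.2 = along p e (1 - s1) := by
      intro e he
      by_cases h : p e.2 ∈ O
      · exact ⟨0, Or.inl ⟨h, rfl⟩, by simp only [q, if_pos h, sub_zero, along_one]⟩
      · refine ⟨s, Or.inr ⟨h, rfl⟩, ?_⟩
        obtain ⟨e', he', hb, hu⟩ := hnb e.2 ⟨e, he, Or.inr rfl⟩ h
        obtain rfl := hu e he (Or.inr rfl)
        have : nb e.2 = e.1 := by
          rcases hb with hb | hb
          · have h1 := congrArg Prod.fst hb
            have h2 := congrArg Prod.snd hb
            exact absurd (by rw [h1]) (hE.ne e he)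
          · exact (congrArg Prod.fst hb).symm
        rw [hqc 0 _ h]
        simp only [c, w, this, along]
        module
    have hmid : ∀ (e : V × V) (α β τ : ℝ), α ≤ τ → τ ≤ β →
        along p e τ ∈ segment ℝ (along p e α) (along p e β) := by
      intro e α β τ h1 h2
      have h3 : ∀ r, along p e r = p e.1 + r • (p e.2 - p e.1) := by
        intro r; simp only [along]; module
      rw [h3, h3, h3]
      rcases eq_or_lt_of_le h1 with rfl | h1
      · exact left_mem_segment _ _ _
      rcases eq_or_lt_of_le h2 with rfl | h2
      · exact right_mem_segment _ _ _
      exact openSegment_subset_segment _ _ _ (mem_openSegment_line h1 h2)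
    ext x
    rw [mem_carrier, mem_carrier]
    constructor
    · rintro ⟨e, he, hx⟩
      rcases (hE' e).1 he with ⟨d, hd, rfl⟩ | ⟨u, hu, huO, rfl⟩
      · obtain ⟨s1, h1, h1'⟩ := hend d hd
        obtain ⟨s2, h2, h2'⟩ := hend' d hd
        refine ⟨d, hd, ?_⟩
        simp only [pos, Sum.elim_inl] at hx
        rw [h1', h2'] at hx
        refine (convex_segment _ _).segment_subset (along_mem_segment p d ?_)
          (along_mem_segment p d ?_) hx
        · rcases h1 with ⟨-, rfl⟩ | ⟨-, rfl⟩
          · simp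
          · exact ⟨hs0.le, by linarith⟩
        · rcases h2 with ⟨-, rfl⟩ | ⟨-, rfl⟩
          · simp
          · exact ⟨by linarith, by linarith⟩
      · simp only [pos, Sum.elim_inl, Sum.elim_inr] at hx
        obtain ⟨d, hd, hb, hg⟩ := hnb u hu huO
        refine ⟨d, hd, ?_⟩
        have hseg : segment ℝ (p d.1) (p d.2) = segment ℝ (p u) (p (nb u)) := by
          rcases hb with rfl | rfl
          · rfl
          · exact segment_symm _ _ _
        rw [hseg]
        refine (convex_segment _ _).segment_subset (left_mem_segment _ _ _) ?_ hx
        rw [hqc 0 u huO, segment_eq_image']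
        exact ⟨s, ⟨hs0.le, by linarith⟩, by simp [c, w]⟩
    · rintro ⟨d, hd, hx⟩
      obtain ⟨τ, hτ, rfl⟩ := mem_segment_iff_along.1 hx
      obtain ⟨s1, h1, h1'⟩ := hend d hd
      obtain ⟨s2, h2, h2'⟩ := hend' d hd
      by_cases hτ1 : τ < s1
      · rcases h1 with ⟨-, rfl⟩ | ⟨hO, hss⟩
        · exact absurd hτ1 (not_lt.2 hτ.1)
        · refine ⟨_, (hE' _).2 (Or.inr ⟨d.1, ⟨d, hd, Or.inl rfl⟩, hO, rfl⟩), ?_⟩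
          simp only [pos, Sum.elim_inl, Sum.elim_inr]
          rw [h1', hss]
          have := hmid d 0 s τ hτ.1 (hss ▸ hτ1.le)
          rwa [along_zero] at this
      by_cases hτ2 : 1 - s2 < τ
      · rcases h2 with ⟨-, rfl⟩ | ⟨hO, hss⟩
        · exact absurd hτ2 (by linarith [hτ.2])
        · refine ⟨_, (hE' _).2 (Or.inr ⟨d.2, ⟨d, hd, Or.inr rfl⟩, hO, rfl⟩), ?_⟩
          simp only [pos, Sum.elim_inl, Sum.elim_inr]
          rw [h2', segment_symm, hss]
          have := hmid d (1 - s) 1 τ (hss ▸ hτ2.le) hτ.2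
          rwa [along_one] at this
      · refine ⟨_, (hE' _).2 (Or.inl ⟨d, hd, rfl⟩), ?_⟩
        simp only [pos, Sum.elim_inl]
        rw [h1', h2']
        exact hmid d _ _ τ (not_lt.1 hτ1) (not_lt.1 hτ2)
  obtain ⟨H, hH, hHc⟩ := hmoves.exists_image
  have h11 : (1 : ℝ) ∈ Icc (0 : ℝ) 1 := by simp
  refine ⟨E', pos s 1, H, hH, by rw [← hcar, hHc], hEmb 1 h11, ?_, fun v => rfl, ?_⟩
  · ext v
    constructor
    · rintro ⟨⟨e, he, hev⟩, hO⟩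
      rcases (hE' e).1 he with ⟨e', he', rfl⟩ | ⟨u, hu, huO, rfl⟩
      · obtain ⟨u, hu, rfl⟩ := inc_inl hev
        exact absurd (hqO u ⟨e', he', hu⟩ 1 h11 s hs01) hO
      · rcases hev with rfl | rfl
        · exact ⟨u, ⟨hu, huO⟩, rfl⟩
        · exact absurd (hqO u hu 1 h11 s hs01) hO
    · rintro ⟨u, ⟨hu, huO⟩, rfl⟩
      exact ⟨⟨_, (hE' _).2 (Or.inr ⟨u, hu, huO, rfl⟩), Or.inl rfl⟩, huO⟩
  · intro e he
    rcases (hE' e).1 he with ⟨e', he', rfl⟩ | ⟨u, hu, huO, rfl⟩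
    · exact Or.inl ⟨hqO _ ⟨e', he', Or.inl rfl⟩ 1 h11 s hs01,
        hqO _ ⟨e', he', Or.inr rfl⟩ 1 h11 s hs01⟩
    · refine Or.inr ⟨p u, 1 - s, by linarith, by linarith, rfl, hone u hu huO, ?_⟩
      simp only [pos, Sum.elim_inl, hqc 1 u huO, c, w]
      module

end

noncomputable section
open Set Filter Topology

/-! ### From the ball to the cube -/

theorem exists_radial {C K : Set E3} (hC : Convex ℝ C) (hCc : IsClosed C) (hC0 : C ∈ 𝓝 0)
    (hCb : Bornology.IsBounded C) (hK : Convex ℝ K) (hKc : IsClosed K)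
    (hKb : Bornology.IsBounded K) (hCK : C ⊆ K) {η : ℝ} (hη : 0 < η) (hη1 : η < 1) :
    ∃ (h : E3 ≃ₜ E3) (μ : E3 → ℝ), Isotopic h ∧ (∀ x, gauge C x ≤ 1 - η → h x = x) ∧
      h '' C = K ∧ (∀ x, 0 < μ x) ∧ ∀ x, h x = μ x • x := by
  have hK0 : K ∈ 𝓝 0 := mem_of_superset hC0 hCK
  have hCa := absorbent_nhds_zero (𝕜 := ℝ) hC0
  have hKa := absorbent_nhds_zero (𝕜 := ℝ) hK0
  have hβc : Continuous (gauge C) := continuous_gauge hC hC0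
  have hκc : Continuous (gauge K) := continuous_gauge hK hK0
  have hβp : ∀ x, x ≠ 0 → 0 < gauge C x := fun x hx =>
    (gauge_pos hCa (NormedSpace.isVonNBounded_of_isBounded _ hCb)).2 hx
  have hκp : ∀ x, x ≠ 0 → 0 < gauge K x := fun x hx =>
    (gauge_pos hKa (NormedSpace.isVonNBounded_of_isBounded _ hKb)).2 hx
  have hκβ : ∀ x, gauge K x ≤ gauge C x := gauge_mono hCa hCK
  let φ : ℝ → ℝ := fun r => max 0 (min 1 ((r - (1 - η)) / η))
  have hφc : Continuous φ := by fun_prop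
  have hφm : Monotone φ := by
    intro r r' h
    exact max_le_max le_rfl (min_le_min le_rfl (by gcongr))
  have hφ0 : ∀ r, 0 ≤ φ r := fun r => le_max_left _ _
  have hφ1 : ∀ r, φ r ≤ 1 := fun r => max_le zero_le_one (min_le_left _ _)
  have hφs : ∀ r, r ≤ 1 - η → φ r = 0 := by
    intro r hr
    apply max_eq_left
    exact (min_le_right _ _).trans (div_nonpos_of_nonpos_of_nonneg (by linarith) hη.le)
  have hφl : ∀ r, 1 ≤ r → φ r = 1 := by
    intro r hr
    have : 1 ≤ (r - (1 - η)) / η := by rw [le_div_iff₀ hη]; linarith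
    simp only [φ, min_eq_left this, max_eq_right zero_le_one]
  let A : E3 → ℝ := fun x => (gauge K x)⁻¹ - (gauge C x)⁻¹
  have hA : ∀ x, x ≠ 0 → 0 ≤ A x := fun x hx =>
    sub_nonneg.2 (inv_anti₀ (hκp x hx) (hκβ x))
  let μ : E3 → ℝ := fun x => 1 + φ (gauge C x) * A x
  have hμ0 : μ 0 = 1 := by
    simp only [μ, gauge_zero, hφs 0 (by linarith), zero_mul, add_zero]
  have hμ : ∀ x, 1 ≤ μ x := by
    intro x
    by_cases hx : x = 0
    · rw [hx, hμ0]
    · have := mul_nonneg (hφ0 (gauge C x)) (hA x hx)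
      simp only [μ]; linarith
  let g : E3 → E3 := fun x => μ x • x
  have hsm : ∀ x, gauge C x ≤ 1 - η → g x = x := by
    intro x hx
    simp only [g, μ, hφs _ hx, zero_mul, add_zero, one_smul]
  have hgc : Continuous g := by
    rw [continuous_iff_continuousAt]
    intro x
    by_cases hx : x = 0
    · have : ∀ᶠ y in 𝓝 x, gauge C y < 1 - η := by
        apply hβc.continuousAt.eventually (gt_mem_nhds _)
        rw [hx, gauge_zero]; linarith
      exact continuousAt_id.congr (this.mono fun y hy => (hsm y hy.le).symm)
    · have h1 : ContinuousAt A x :=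
        (hκc.continuousAt.inv₀ (hκp x hx).ne').sub (hβc.continuousAt.inv₀ (hβp x hx).ne')
      have h2 : ContinuousAt μ x :=
        continuousAt_const.add ((hφc.comp hβc).continuousAt.mul h1)
      exact h2.smul continuousAt_id
  let M : E3 → ℝ → ℝ := fun x r => r + φ (r * gauge C x) * A x
  have hgM : ∀ x, ∀ r, 0 < r → g (r • x) = M x r • x := by
    intro x r hr
    simp only [g, μ, A, M, gauge_smul_of_nonneg hr.le, smul_eq_mul, smul_smul]
    congr 1
    by_cases hx : x = 0
    · simp [hx]
    · have := hβp x hx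
      have := hκp x hx
      field_simp
  have hMmono : ∀ x, x ≠ 0 → StrictMono (M x) := by
    intro x hx r r' h
    have h1 : φ (r * gauge C x) ≤ φ (r' * gauge C x) :=
      hφm (mul_le_mul_of_nonneg_right h.le (hβp x hx).le)
    have h2 := mul_le_mul_of_nonneg_right h1 (hA x hx)
    simp only [M]
    linarith
  have hinj : Function.Injective g := by
    intro x y hxy
    have h0 : ∀ z, g z = 0 → z = 0 := fun z hz =>
      (smul_eq_zero.1 hz).resolve_left (by linarith [hμ z])
    by_cases hx : x = 0
    · subst hx
      have : g 0 = 0 := smul_zero _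
      rw [this] at hxy
      exact (h0 y hxy.symm).symm
    · have hp : 0 < μ x := by linarith [hμ x]
      have hp' : 0 < μ y := by linarith [hμ y]
      have h1 : y = (μ x / μ y) • x := by
        have h2 : μ y • y = μ x • x := hxy.symm
        rw [div_eq_inv_mul, mul_smul, ← h2, smul_smul, inv_mul_cancel₀ hp'.ne', one_smul]
      have hr : 0 < μ x / μ y := div_pos hp hp'
      have h3 := hgM x 1 one_pos
      rw [one_smul, hxy] at h3
      have h4 := hgM x _ hr
      rw [← h1, h3] at h4
      have h5 : (M x 1 - M x (μ x / μ y)) • x = 0 := by rw [sub_smul, h4, sub_self]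
      have h6 := sub_eq_zero.1 ((smul_eq_zero.1 h5).resolve_right hx)
      have h7 := (hMmono x hx).injective h6
      rw [← h7, one_smul] at h1
      exact h1.symm
  have hsurj : Function.Surjective g := by
    intro y
    by_cases hy : y = 0
    · exact ⟨0, by simp [g, hy]⟩
    · have hM0 : M y 0 = 0 := by simp only [M, zero_mul, hφs 0 (by linarith), add_zero]
      have hM1 : 1 ≤ M y 1 := by
        have := mul_nonneg (hφ0 (1 * gauge C y)) (hA y hy)
        simp only [M]; linarith
      have hMc : Continuous (M y) := by
        have : Continuous fun r : ℝ => φ (r * gauge C y) := hφc.comp (by fun_prop)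
        exact continuous_id.add (this.mul continuous_const)
      obtain ⟨r, hr, hr1⟩ := intermediate_value_Icc zero_le_one hMc.continuousOn
        (⟨by rw [hM0]; norm_num, hM1⟩ : (1 : ℝ) ∈ Icc (M y 0) (M y 1))
      have hr0 : 0 < r := by
        rcases eq_or_lt_of_le hr.1 with h | h
        · rw [← h, hM0] at hr1; norm_num at hr1
        · exact h
      exact ⟨r • y, by rw [hgM y r hr0, hr1, one_smul]⟩
  obtain ⟨R, hR0, hR⟩ := hKb.exists_pos_norm_le
  have hbd : ∀ x, ‖g x - x‖ ≤ R := by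
    intro x
    by_cases hx : x = 0
    · have : g x - x = 0 := by simp [g, hx]
      rw [this, norm_zero]; exact hR0.le
    · have h1 : g x - x = (φ (gauge C x) * A x) • x := by simp only [g, μ]; module
      have h2 := le_gauge_of_subset_closedBall hKa hR0.le (fun z hz =>
        mem_closedBall_zero_iff.2 (hR z hz)) (x := x)
      have h3 : A x ≤ (gauge K x)⁻¹ := by
        have := inv_nonneg.2 (hβp x hx).le
        simp only [A]; linarith
      have h4 : φ (gauge C x) * A x ≤ (gauge K x)⁻¹ := by
        have := mul_le_mul_of_nonneg_right (hφ1 (gauge C x)) (hA x hx)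
        linarith
      rw [h1, norm_smul, Real.norm_of_nonneg (mul_nonneg (hφ0 _) (hA x hx))]
      have h5 := mul_le_mul_of_nonneg_right h4 (norm_nonneg x)
      rw [div_le_iff₀ hR0] at h2
      have h6 : (gauge K x)⁻¹ * ‖x‖ ≤ R := by
        rw [inv_mul_le_iff₀ (hκp x hx)]
        exact h2
      linarith
  have hCm : ∀ x, x ∈ C ↔ gauge C x ≤ 1 := by
    intro x
    rw [gauge_le_one_iff_mem_closure hC hC0, hCc.closure_eq]
  have hKm : ∀ x, x ∈ K ↔ gauge K x ≤ 1 := by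
    intro x
    rw [gauge_le_one_iff_mem_closure hK hK0, hKc.closure_eq]
  have hiff : ∀ x, x ∈ C ↔ g x ∈ K := by
    intro x
    rw [hCm, hKm]
    by_cases hx : x = 0
    · simp [hx, g]
    have hβ := hβp x hx
    have hκ := hκp x hx
    have h1 : gauge K (g x) = gauge K x + φ (gauge C x) * (1 - gauge K x / gauge C x) := by
      simp only [g, gauge_smul_of_nonneg (zero_le_one.trans (hμ x)), smul_eq_mul, μ, A]
      field_simp
    rw [h1]
    have h2 : gauge K x / gauge C x ≤ 1 := by rw [div_le_one hβ]; exact hκβ x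
    constructor
    · intro h
      have h3 : gauge K x ≤ gauge K x / gauge C x := by
        rw [le_div_iff₀ hβ]; nlinarith
      nlinarith [hφ1 (gauge C x), hφ0 (gauge C x)]
    · intro h
      by_contra! hlt
      rw [hφl _ hlt.le, one_mul] at h
      have h3 : gauge K x / gauge C x < gauge K x := by
        rw [div_lt_iff₀ hβ]; nlinarith
      linarith
  obtain ⟨h, hh, hhg⟩ := exists_homeomorph_of_bounded g hgc ⟨hinj, hsurj⟩ R hbd
  refine ⟨h, μ, hh, fun x hx => by rw [hhg, hsm x hx], ?_, fun x => by linarith [hμ x],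
    fun x => hhg x⟩
  ext y
  constructor
  · rintro ⟨x, hx, rfl⟩
    rw [hhg]; exact (hiff x).1 hx
  · intro hy
    obtain ⟨x, rfl⟩ := hsurj y
    exact ⟨x, (hiff x).2 hy, hhg x⟩

theorem radial_image_segment (h : E3 ≃ₜ E3) (μ : E3 → ℝ) (hμ : ∀ x, h x = μ x • x) (a : E3)
    (σ : ℝ) (hσ : σ ≤ 1) :
    h '' segment ℝ a (σ • a) = segment ℝ (h a) (h (σ • a)) := by
  by_cases ha : a = 0
  · simp [ha]
  have ha0 : 0 < ‖a‖ ^ 2 := by positivity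
  let M : ℝ → ℝ := fun s => inner ℝ a (h (s • a)) / ‖a‖ ^ 2
  have hM : ∀ s, h (s • a) = M s • a := by
    intro s
    have h1 : h (s • a) = (μ (s • a) * s) • a := by rw [hμ, smul_smul]
    have h2 : M s = μ (s • a) * s := by
      simp only [M]
      rw [h1, inner_smul_right, real_inner_self_eq_norm_sq]
      field_simp
    rw [h1, h2]
  have hMc : Continuous M := by
    have := h.continuous
    fun_prop
  have hMi : Function.Injective M := by
    intro s s' hs
    have h1 := hM s
    rw [hs, ← hM s'] at h1
    have h2 := h.injective h1
    have h3 : (s - s') • a = 0 := by rw [sub_smul, h2, sub_self]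
    exact sub_eq_zero.1 ((smul_eq_zero.1 h3).resolve_right ha)
  have himg : M '' segment ℝ 1 σ = segment ℝ (M 1) (M σ) := by
    rw [segment_symm, segment_symm ℝ (M 1)]
    rw [segment_eq_Icc hσ]
    rcases hMc.continuousOn.strictMonoOn_of_injOn_Icc' hσ hMi.injOn with hm | hm
    · rw [segment_eq_Icc (hm.monotoneOn ⟨le_rfl, hσ⟩ ⟨hσ, le_rfl⟩ hσ)]
      apply Subset.antisymm
      · rintro _ ⟨s, hs, rfl⟩
        exact ⟨hm.monotoneOn ⟨le_rfl, hσ⟩ hs hs.1, hm.monotoneOn hs ⟨hσ, le_rfl⟩ hs.2⟩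
      · exact intermediate_value_Icc hσ hMc.continuousOn
    · rw [segment_symm, segment_eq_Icc (hm.antitoneOn ⟨le_rfl, hσ⟩ ⟨hσ, le_rfl⟩ hσ)]
      apply Subset.antisymm
      · rintro _ ⟨s, hs, rfl⟩
        exact ⟨hm.antitoneOn hs ⟨hσ, le_rfl⟩ hs.2, hm.antitoneOn ⟨le_rfl, hσ⟩ hs hs.1⟩
      · exact intermediate_value_Icc' hσ hMc.continuousOn
  let l : ℝ →ᵃ[ℝ] E3 := (LinearMap.toSpanSingleton ℝ E3 a).toAffineMap
  have hl : ∀ s, l s = s • a := fun s => rfl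
  have e1 : segment ℝ a (σ • a) = l '' segment ℝ 1 σ := by
    rw [image_segment, hl, hl, one_smul]
  have e2 : segment ℝ (h a) (h (σ • a)) = l '' segment ℝ (M 1) (M σ) := by
    rw [image_segment, hl, hl, ← hM, ← hM, one_smul]
  rw [e1, e2, ← himg, image_image, image_image]
  exact image_congr fun s _ => by rw [hl, hl, hM]

theorem convex_coord_preimage (i : Fin 3) {s : Set ℝ} (hs : Convex ℝ s) :
    Convex ℝ {x : E3 | x i ∈ s} := by
  intro x hx y hy a b ha hb hab
  have := hs hx hy ha hb hab
  simpa using this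

/-- The closed cube. -/
def cube : Set E3 := {x | ∀ i, |x i| ≤ 1}

/-- The open cube. -/
def openCube : Set E3 := {x | ∀ i, |x i| < 1}

theorem isClosed_cube : IsClosed cube := by
  have : cube = ⋂ i : Fin 3, {x : E3 | |x i| ≤ 1} := by ext; simp [cube]
  rw [this]
  exact isClosed_iInter fun i => isClosed_le (by fun_prop) continuous_const

theorem isOpen_openCube : IsOpen openCube := by
  have : openCube = ⋂ i : Fin 3, {x : E3 | |x i| < 1} := by ext; simp [openCube]
  rw [this]
  exact isOpen_iInter_of_finite fun i => isOpen_lt (by fun_prop) continuous_const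

theorem convex_cube : Convex ℝ cube := by
  have : cube = ⋂ i : Fin 3, {x : E3 | x i ∈ Icc (-1 : ℝ) 1} := by ext; simp [cube, abs_le]
  rw [this]
  exact convex_iInter fun i => convex_coord_preimage i (convex_Icc _ _)

theorem convex_openCube : Convex ℝ openCube := by
  have : openCube = ⋂ i : Fin 3, {x : E3 | x i ∈ Ioo (-1 : ℝ) 1} := by ext; simp [openCube, abs_lt]
  rw [this]
  exact convex_iInter fun i => convex_coord_preimage i (convex_Ioo _ _)

theorem isBounded_cube : Bornology.IsBounded cube := by
  rw [isBounded_iff_forall_norm_le]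
  refine ⟨3, fun x hx => ?_⟩
  have := E3.norm_le_sum x
  linarith [hx 0, hx 1, hx 2]

theorem interior_cube : interior cube = openCube := by
  apply Subset.antisymm
  · intro x hx i
    have h1 : ContinuousAt (fun t : ℝ => t • x) 1 := by fun_prop
    have h2 : ∀ᶠ t : ℝ in 𝓝 1, t • x ∈ interior cube := by
      apply h1.eventually
      simp only [one_smul]
      exact isOpen_interior.mem_nhds hx
    have h3 : ∀ᶠ t : ℝ in 𝓝[>] 1, t • x ∈ interior cube := h2.filter_mono nhdsWithin_le_nhds
    obtain ⟨t, ht, ht1⟩ := (h3.and self_mem_nhdsWithin).exists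
    have h4 := interior_subset ht i
    rw [PiLp.smul_apply, smul_eq_mul, abs_mul, abs_of_pos (one_pos.trans ht1)] at h4
    by_contra! hcon
    nlinarith
  · exact interior_maximal (fun x hx i => (hx i).le) isOpen_openCube

theorem eq_of_same_ray {a b o : E3} (ha : ‖a‖ = 1) (hb : ‖b‖ = 1) (ho : ‖o‖ < 1) {l : ℝ}
    (hl : 0 < l) (h : a - o = l • (b - o)) : a = b := by
  have key : ∀ a b : E3, ‖a‖ = 1 → ‖b‖ = 1 → ∀ l : ℝ, 0 < l → l < 1 → a - o ≠ l • (b - o) := by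
    intro a b ha hb l hl hl1 h
    have h1 : a = (1 - l) • o + l • b := by
      have : a = o + l • (b - o) := by rw [← h]; abel
      rw [this]; module
    have h2 := norm_add_le ((1 - l) • o) (l • b)
    rw [← h1, norm_smul, norm_smul, Real.norm_of_nonneg hl.le,
      Real.norm_of_nonneg (by linarith), ha, hb] at h2
    nlinarith
  rcases lt_trichotomy l 1 with h1 | rfl | h1
  · exact absurd h (key a b ha hb l hl h1)
  · rw [one_smul] at h
    exact sub_left_injective h
  · have : b - o = l⁻¹ • (a - o) := by
      rw [h, smul_smul, inv_mul_cancel₀ hl.ne', one_smul]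
    exact absurd this (key b a hb ha _ (inv_pos.2 hl) (inv_lt_one_of_one_lt₀ h1))

/-- An affine map of the ball into the cube which moves a point of the equator to the diagonal
and finitely many other points to the opposite side. -/
theorem exists_affine_of_pole (F : Set E3) (hF : F.Finite) (hF1 : ∀ a ∈ F, ‖a‖ = 1)
    (hq : !₂[-1, 0, 0] ∉ F) :
    ∃ (A : E3 ≃ₜ E3) (o : E3) (c k : ℝ), Isotopic A ∧
      (∀ x y (s : ℝ), A ((1 - s) • x + s • y) = (1 - s) • A x + s • A y) ∧ 0 < k ∧
      (∀ x, A x 2 = k * x 2) ∧ ‖o‖ < 1 ∧ A o = 0 ∧ (∀ x, ‖x‖ ≤ 1 → A x ∈ cube) ∧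
      0 < c ∧ A !₂[-1, 0, 0] = !₂[-c, -c, 0] ∧
      (∀ a ∈ F, |A a 1| < A a 0 ∧ |A a 2| < A a 0) ∧
      ∀ a ∈ F, ∀ b ∈ F, A a 1 * A b 0 = A b 1 * A a 0 → a = b := by
  have hco : ∀ a : E3, ‖a‖ ≤ 1 → ∀ i, |a i| ≤ 1 := fun a ha i =>
    (E3.abs_coord_le a i).trans ha
  have hsq : ∀ a : E3, ‖a‖ ^ 2 = a 0 ^ 2 + a 1 ^ 2 + a 2 ^ 2 := by
    intro a
    rw [EuclideanSpace.norm_sq_eq, Fin.sum_univ_three]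
    simp only [Real.norm_eq_abs, sq_abs]
  have hpos : ∀ a ∈ F, 0 < a 0 + 1 := by
    intro a ha
    have h1 := (abs_le.1 (hco a (hF1 a ha).le 0)).1
    rcases eq_or_lt_of_le h1 with h | h
    · exfalso
      apply hq
      have h2 := hsq a
      rw [hF1 a ha, ← h] at h2
      have h3 : a 1 = 0 := by nlinarith [sq_nonneg (a 1), sq_nonneg (a 2)]
      have h4 : a 2 = 0 := by nlinarith [sq_nonneg (a 1), sq_nonneg (a 2)]
      have : a = !₂[-1, 0, 0] := by ext <;> simp [← h, h3, h4]
      rwa [← this]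
    · linarith
  have hev : ∀ᶠ δ : ℝ in 𝓝[>] 0, ∀ a ∈ F, δ < a 0 + 1 :=
    (Filter.eventually_all_finite hF).2 fun a ha =>
      mem_of_superset (Ioo_mem_nhdsGT (hpos a ha)) fun δ hδ => hδ.2
  obtain ⟨δ, hδF, hδ0, hδ1⟩ := (hev.and (Ioo_mem_nhdsGT one_pos)).exists
  set L : ℝ := 8 / δ with hL
  have hL0 : 0 < L := by positivity
  have hLδ : L⁻¹ = δ / 8 := by rw [hL, inv_div]
  set τ : ℝ := 1 / (1 + L ^ 2) with hτ
  have hτ0 : 0 < τ := by positivity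
  have hτL : τ * (1 + L ^ 2) = 1 := by rw [hτ]; field_simp
  have hL8 : 8 < L := by rw [hL, lt_div_iff₀ hδ0]; linarith
  have hτδ : τ < δ / 8 := by
    rw [← hLδ, hτ, one_div]
    apply inv_strictAnti₀ hL0
    nlinarith
  let X : E3 → ℝ := fun a => a 0 + 1 - τ
  let o : E3 := !₂[-1 + τ, τ * L, 0]
  have ho : ‖o‖ < 1 := by
    have h1 := hsq o
    simp only [o] at h1
    simp at h1
    have : ‖o‖ ^ 2 < 1 := by
      rw [h1]
      nlinarith
    nlinarith [norm_nonneg o]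
  have hbad : (⋃ a ∈ F, ⋃ b ∈ F, {κ : ℝ | a ≠ b ∧
      (a 1 / L - τ + κ * a 2) * X b = (b 1 / L - τ + κ * b 2) * X a}).Finite := by
    refine hF.biUnion fun a ha => hF.biUnion fun b hb => Set.Subsingleton.finite ?_
    rintro κ ⟨hab, h1⟩ κ' ⟨-, h2⟩
    by_contra hκ
    apply hab
    have h3 : (κ - κ') * (a 2 * X b - b 2 * X a) = 0 := by linear_combination h1 - h2
    have h4 := (mul_eq_zero.1 h3).resolve_left (sub_ne_zero.2 hκ)
    have h5 : (a 1 / L - τ) * X b = (b 1 / L - τ) * X a := by linear_combination h1 - κ * h4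
    have hXa : 0 < X a := by simp only [X]; linarith [hδF a ha]
    have hXb : 0 < X b := by simp only [X]; linarith [hδF b hb]
    refine eq_of_same_ray (hF1 a ha) (hF1 b hb) ho (div_pos hXa hXb) ?_
    ext
    · simp [o]; field_simp; simp only [X]; ring
    · simp [o]
      field_simp
      field_simp at h5
      linear_combination h5
    · simp [o]; field_simp; linear_combination h4
  obtain ⟨κ, ⟨hκ0, hκδ⟩, hκ⟩ := ((Ioo_infinite (show (0 : ℝ) < δ / 8 by positivity)).sdiff
    hbad).nonempty
  simp only [mem_iUnion, not_exists, mem_ofPred_eq, not_and] at hκ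
  obtain ⟨A, hA, hAx⟩ := isotopic_affine (1 / 4) (1 / (4 * L)) (1 / (4 * L)) (κ / 4)
    ((1 - τ) / 4) (-τ / 4) 0 (by norm_num) (by positivity) (by positivity)
  have hA0 : ∀ x, A x 0 = X x / 4 := by intro x; rw [hAx]; simp [X]; ring
  have hA1 : ∀ x, A x 1 = (x 1 / L - τ + κ * x 2) / 4 := by
    intro x; rw [hAx]; simp; field_simp; ring
  have hA2 : ∀ x, A x 2 = 1 / (4 * L) * x 2 := by intro x; rw [hAx]; simp
  have habs : ∀ x : E3, ‖x‖ ≤ 1 → |A x 1| < 3 * δ / 32 ∧ |A x 2| < 3 * δ / 32 := by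
    intro x hx
    have h1 := abs_le.1 (hco x hx 1)
    have h2 := abs_le.1 (hco x hx 2)
    rw [hA1, hA2]
    have e1 : x 1 / L = x 1 * (δ / 8) := by rw [div_eq_mul_inv, hLδ]
    have e2 : 1 / (4 * L) = δ / 32 := by rw [one_div, mul_inv, hLδ]; ring
    rw [e1, e2, abs_lt, abs_lt]
    refine ⟨⟨?_, ?_⟩, ?_, ?_⟩ <;> nlinarith
  refine ⟨A, o, τ / 4, 1 / (4 * L), hA, ?_, by positivity, hA2, ho, ?_, ?_, by positivity, ?_, ?_, ?_⟩
  · intro x y s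
    rw [hAx, hAx, hAx]
    ext <;> simp <;> ring
  · rw [hAx]
    ext <;> simp [o] <;> field_simp <;> ring
  · intro x hx i
    obtain ⟨h1, h2⟩ := habs x hx
    have h0 := abs_le.1 (hco x hx 0)
    fin_cases i
    · change |A x 0| ≤ 1
      rw [hA0, abs_le]
      simp only [X]
      constructor <;> linarith
    · change |A x 1| ≤ 1
      linarith
    · change |A x 2| ≤ 1
      linarith
  · rw [hAx]
    ext <;> simp <;> ring
  · intro a ha
    obtain ⟨h1, h2⟩ := habs a (hF1 a ha).le
    have h0 := hδF a ha
    have : 3 * δ / 32 < A a 0 := by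
      rw [hA0]
      simp only [X]
      linarith
    exact ⟨h1.trans this, h2.trans this⟩
  · intro a ha b hb h
    by_contra hab
    apply hκ a ha b hb hab
    rw [hA1, hA1, hA0, hA0] at h
    linear_combination 16 * h

theorem exists_affine_of_equator (F : Set E3) (hF : F.Finite) (hF1 : ∀ a ∈ F, ‖a‖ = 1)
    (q : E3) (hqe : q ∈ equator) (hq : q ∉ F) :
    ∃ (A : E3 ≃ₜ E3) (o : E3) (c k : ℝ), Isotopic A ∧
      (∀ x y (s : ℝ), A ((1 - s) • x + s • y) = (1 - s) • A x + s • A y) ∧ 0 < k ∧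
      (∀ x, A x 2 = k * x 2) ∧ ‖o‖ < 1 ∧ A o = 0 ∧ (∀ x, ‖x‖ ≤ 1 → A x ∈ cube) ∧
      0 < c ∧ A q = !₂[-c, -c, 0] ∧
      (∀ a ∈ F, |A a 1| < A a 0 ∧ |A a 2| < A a 0) ∧
      ∀ a ∈ F, ∀ b ∈ F, A a 1 * A b 0 = A b 1 * A a 0 → a = b := by
  have hsq : ∀ a : E3, ‖a‖ ^ 2 = a 0 ^ 2 + a 1 ^ 2 + a 2 ^ 2 := by
    intro a
    rw [EuclideanSpace.norm_sq_eq, Fin.sum_univ_three]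
    simp only [Real.norm_eq_abs, sq_abs]
  obtain ⟨hq1, hq2⟩ := hqe
  have hqq : q 0 ^ 2 + q 1 ^ 2 = 1 := by
    have := hsq q
    rw [hq1, hq2] at this
    linarith
  obtain ⟨θ, hc, hs⟩ : ∃ θ : ℝ, Real.cos θ = - q 0 ∧ Real.sin θ = q 1 := by
    have hz : ‖(⟨-q 0, q 1⟩ : ℂ)‖ = 1 := by
      have h1 : ‖(⟨-q 0, q 1⟩ : ℂ)‖ ^ 2 = 1 := by
        rw [← Complex.normSq_eq_norm_sq, Complex.normSq_mk]; linarith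
      nlinarith [norm_nonneg (⟨-q 0, q 1⟩ : ℂ)]
    have hz0 : (⟨-q 0, q 1⟩ : ℂ) ≠ 0 := by
      intro h; rw [h, norm_zero] at hz; norm_num at hz
    refine ⟨Complex.arg ⟨-q 0, q 1⟩, ?_, ?_⟩
    · rw [Complex.cos_arg hz0, hz, div_one]
    · rw [Complex.sin_arg, hz, div_one]
  obtain ⟨ρ, hρ, hρx⟩ := isotopic_rotation θ
  have hρn : ∀ x, ‖ρ x‖ = ‖x‖ := by
    intro x
    have h1 := hsq (ρ x)
    have h2 := hsq x
    have h3 := Real.sin_sq_add_cos_sq θ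
    rw [hρx] at h1
    simp at h1
    rw [← hρx] at h1
    have : ‖ρ x‖ ^ 2 = ‖x‖ ^ 2 := by
      rw [h1, h2]
      linear_combination (x 0 ^ 2 + x 1 ^ 2) * h3
    exact (pow_left_inj₀ (norm_nonneg _) (norm_nonneg _) two_ne_zero).1 this
  have hρq : ρ q = !₂[-1, 0, 0] := by
    rw [hρx, hc, hs]
    ext <;> simp [hq2]
    · linarith
    · ring
  obtain ⟨A, o, c, k, h1, h2, h3, h4, h5, h6, h7, h8, h9, h10, h11⟩ :=
    exists_affine_of_pole (ρ '' F) (hF.image _)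
      (by rintro _ ⟨a, ha, rfl⟩; rw [hρn]; exact hF1 a ha)
      (by rintro ⟨a, ha, h⟩; rw [← hρq] at h; exact hq (ρ.injective h ▸ ha))
  refine ⟨ρ.trans A, ρ.symm o, c, k, hρ.trans h1, ?_, h3, ?_, ?_, ?_, ?_, h8, ?_, ?_, ?_⟩
  · intro x y s
    simp only [Homeomorph.trans_apply]
    rw [← h2]
    congr 1
    rw [hρx, hρx, hρx]
    ext <;> simp <;> ring
  · intro x
    rw [Homeomorph.trans_apply, h4, hρx]
    simp
  · rw [← hρn, Homeomorph.apply_symm_apply]; exact h5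
  · rw [Homeomorph.trans_apply, Homeomorph.apply_symm_apply]; exact h6
  · intro x hx
    exact h7 (ρ x) (by rw [hρn]; exact hx)
  · rw [Homeomorph.trans_apply, hρq]; exact h9
  · intro a ha
    exact h10 _ (mem_image_of_mem _ ha)
  · intro a ha b hb h
    exact ρ.injective (h11 _ (mem_image_of_mem _ ha) _ (mem_image_of_mem _ hb) h)

end

noncomputable section
open Set Filter Topology

/-- A tame tangle in the ball is isotopic to a polygonal tangle in the cube, whose ends are on
the right side of the cube. -/
theorem exists_cube_polygon (m : ℕ) (T : Set E3) (hT : IsTangle m T) (hTame : IsTame T)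
    (q : E3) (hqe : q ∈ equator) (hqT : q ∉ T) :
    ∃ (E : Finset ((E3 ⊕ E3) × (E3 ⊕ E3))) (p : E3 ⊕ E3 → E3) (H : E3 ≃ₜ E3), Isotopic H ∧
      H '' unitBall = cube ∧ H '' T = carrier E p ∧ Emb openCube E p ∧
      TangleCharts openCube (carrier E p) ∧
      (∀ v, Used E v → p v ∉ openCube → p v 0 = 1 ∧ |p v 1| < 1 ∧ |p v 2| < 1) ∧
      (∀ v v', Used E v → Used E v' → p v ∉ openCube → p v' ∉ openCube → p v 1 = p v' 1 →
        v = v') ∧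
      {v | Used E v ∧ p v ∉ openCube}.ncard = 2 * m ∧
      H '' upperHemisphere = {x ∈ frontier cube | 0 ≤ x 2} ∧ H q = !₂[-1, -1, 0] ∧
      (T ∩ Metric.sphere 0 1 ⊆ equator → ∀ v, Used E v → p v ∉ openCube → p v 2 = 0) := by
  classical
  obtain ⟨h0, E0, hh0, hh0fix, hh0T, hcl0, hE0, hD0, hB0, hcard⟩ := exists_polygon m T hT hTame
  set F : Set E3 := T ∩ Metric.sphere 0 1 with hFdef
  have hF1 : ∀ a ∈ F, ‖a‖ = 1 := fun a ha => mem_sphere_zero_iff_norm.1 ha.2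
  have hF : F.Finite := by
    rw [← hB0]
    refine ((E0.image Prod.fst ∪ E0.image Prod.snd).finite_toSet).subset ?_
    rintro v ⟨⟨e, he, rfl | rfl⟩, -⟩ <;> simp
    · exact Or.inl ⟨_, he⟩
    · exact Or.inr ⟨_, he⟩
  obtain ⟨A, o, c, k, hA, hAaff, hk, hA2, ho, hAo, hAcube, hc, hAq, hAcone, hAray⟩ :=
    exists_affine_of_equator F hF hF1 q hqe (fun h => hqT h.1)
  have hcl0' : ∀ v, Used E0 v → ‖(id v : E3)‖ ≤ 1 := by
    rintro v ⟨e, he, hev⟩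
    rw [← mem_closedBall_zero_iff]
    apply hcl0
    rw [mem_carrier]
    refine ⟨e, he, ?_⟩
    rcases hev with rfl | rfl
    · exact left_mem_segment _ _ _
    · exact right_mem_segment _ _ _
  obtain ⟨E, p', h1, hh1, hh1c, hE, hB, hinr, hstub⟩ := straighten hE0 hD0 hcl0' o ho
  have hh1' : Isotopic h1 := isotopic_of_eqOn_compl Metric.isBounded_ball h1 hh1
  -- boundary points
  have hbd : ∀ v, Used E v → p' v ∉ Metric.ball (0 : E3) 1 → p' v ∈ F := by
    intro v hv hvO
    have : v ∈ Sum.inr '' {v | Used E0 v ∧ id v ∉ Metric.ball (0 : E3) 1} := by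
      rw [← hB]; exact ⟨hv, hvO⟩
    obtain ⟨u, hu, rfl⟩ := this
    rw [hinr, ← hB0]
    exact hu
  have hbinj : ∀ v v', Used E v → Used E v' → p' v ∉ Metric.ball (0 : E3) 1 →
      p' v' ∉ Metric.ball (0 : E3) 1 → p' v = p' v' → v = v' := by
    intro v v' hv hv' hvO hvO' h
    have h2 : v ∈ Sum.inr '' {v | Used E0 v ∧ id v ∉ Metric.ball (0 : E3) 1} := by
      rw [← hB]; exact ⟨hv, hvO⟩
    have h3 : v' ∈ Sum.inr '' {v | Used E0 v ∧ id v ∉ Metric.ball (0 : E3) 1} := by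
      rw [← hB]; exact ⟨hv', hvO'⟩
    obtain ⟨u, hu, rfl⟩ := h2
    obtain ⟨u', hu', rfl⟩ := h3
    rw [hinr, hinr] at h
    exact congrArg _ h
  -- the affine image of the ball
  set C : Set E3 := A '' Metric.closedBall 0 1 with hCdef
  have hCconv : Convex ℝ C := by
    rintro _ ⟨x, hx, rfl⟩ _ ⟨y, hy, rfl⟩ a b ha hb hab
    have : a = 1 - b := by linarith
    subst this
    exact ⟨_, (convex_closedBall (0 : E3) 1) hx hy ha hb hab, hAaff x y b⟩
  have hCcomp : IsCompact C := (isCompact_closedBall _ _).image A.continuous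
  have hCint : interior C = A '' Metric.ball 0 1 := by
    rw [hCdef, ← A.image_interior, interior_closedBall _ one_ne_zero]
  have hC0 : C ∈ 𝓝 0 := by
    rw [mem_nhds_iff]
    refine ⟨_, interior_subset, isOpen_interior, ?_⟩
    rw [hCint]
    exact ⟨o, mem_ball_zero_iff.2 ho, hAo⟩
  have hCK : C ⊆ cube := by
    rintro _ ⟨x, hx, rfl⟩
    exact hAcube x (mem_closedBall_zero_iff.1 hx)
  have hgin : ∀ x ∈ Metric.ball (0 : E3) 1, gauge C (A x) < 1 := by
    intro x hx
    apply interior_subset_gauge_lt_one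
    rw [hCint]
    exact mem_image_of_mem _ hx
  -- choice of the collar
  let VE : Finset (E3 ⊕ E3) := E.image Prod.fst ∪ E.image Prod.snd
  have hVE : ∀ v, Used E v → v ∈ VE := by
    intro v hv
    simp only [VE, Finset.mem_union, Finset.mem_image]
    obtain ⟨e, he, rfl | rfl⟩ := hv
    · exact Or.inl ⟨e, he, rfl⟩
    · exact Or.inr ⟨e, he, rfl⟩
  have hev : ∀ᶠ η : ℝ in 𝓝[>] 0, ∀ v ∈ VE, p' v ∈ Metric.ball (0 : E3) 1 →
      gauge C (A (p' v)) ≤ 1 - η := by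
    rw [Filter.eventually_all_finset]
    intro v _
    by_cases hv : p' v ∈ Metric.ball (0 : E3) 1
    · filter_upwards [Ioo_mem_nhdsGT (sub_pos.2 (hgin _ hv))] with η hη _
      linarith [hη.2]
    · exact Eventually.of_forall fun η h => absurd h hv
  obtain ⟨η, hηV, hη0, hη1⟩ := (hev.and (Ioo_mem_nhdsGT one_pos)).exists
  obtain ⟨G, μ, hG, hGid, hGC, hμ, hGμ⟩ := exists_radial hCconv hCcomp.isClosed hC0
    hCcomp.isBounded convex_cube isClosed_cube isBounded_cube hCK hη0 hη1
  have hH : (A.trans G) '' Metric.closedBall 0 1 = cube := by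
    rw [← hGC, hCdef, image_image]; rfl
  have hHapp : ∀ x, (A.trans G) x = μ (A x) • A x := fun x => hGμ _
  have hHball : (A.trans G) '' Metric.ball 0 1 = openCube := by
    rw [← interior_closedBall (0 : E3) one_ne_zero, Homeomorph.image_interior, hH, interior_cube]
  have hHsph : (A.trans G) '' Metric.sphere 0 1 = frontier cube := by
    rw [← frontier_closedBall (0 : E3) one_ne_zero, Homeomorph.image_frontier, hH]
  have hmem : ∀ x, (A.trans G) x ∈ openCube ↔ x ∈ Metric.ball (0 : E3) 1 := by
    intro x
    rw [← hHball, (A.trans G).injective.mem_set_image]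
  have hmemc : ∀ x : E3, ‖x‖ ≤ 1 → (A.trans G) x ∈ cube := by
    intro x hx
    rw [← hH]; exact mem_image_of_mem _ (mem_closedBall_zero_iff.2 hx)
  have hGid' : ∀ v, Used E v → p' v ∈ Metric.ball (0 : E3) 1 → G (A (p' v)) = A (p' v) :=
    fun v hv h => hGid _ (hηV v (hVE v hv) h)
  have hAseg : ∀ x y, A '' segment ℝ x y = segment ℝ (A x) (A y) := by
    intro x y
    rw [segment_eq_image, segment_eq_image, image_image]
    exact image_congr fun s _ => hAaff x y s
  have hsegm : ∀ e ∈ E, (A.trans G) '' segment ℝ (p' e.1) (p' e.2) =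
      segment ℝ ((A.trans G) (p' e.1)) ((A.trans G) (p' e.2)) := by
    intro e he
    have : (A.trans G) '' segment ℝ (p' e.1) (p' e.2) =
        G '' segment ℝ (A (p' e.1)) (A (p' e.2)) := by
      rw [← hAseg, image_image]; rfl
    rw [this]
    rcases hstub e he with ⟨h1, h2⟩ | ⟨a, σ, hσ0, hσ1, ha, ha1, hb⟩
    · have h3 := hηV _ (hVE _ ⟨e, he, Or.inl rfl⟩) h1
      have h4 := hηV _ (hVE _ ⟨e, he, Or.inr rfl⟩) h2
      have h5 : ∀ x ∈ segment ℝ (A (p' e.1)) (A (p' e.2)), G x = x := by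
        intro x hx
        apply hGid
        exact (hCconv.setOfPred_gauge_le (mem_of_mem_nhds hC0) (absorbent_nhds_zero hC0)
          (1 - η)).segment_subset h3 h4 hx
      rw [image_congr h5, image_id']
      change _ = segment ℝ (G (A (p' e.1))) (G (A (p' e.2)))
      rw [h5 _ (left_mem_segment _ _ _), h5 _ (right_mem_segment _ _ _)]
    · have h3 : A (p' e.2) = σ • A (p' e.1) := by
        rw [hb, ha]
        have : o + σ • (a - o) = (1 - σ) • o + σ • a := by module
        rw [this, hAaff, hAo, smul_zero, zero_add]
      change _ = segment ℝ (G (A (p' e.1))) (G (A (p' e.2)))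
      rw [h3]
      exact radial_image_segment G μ hGμ _ σ hσ1.le
  have hemb : Emb openCube E fun v => (A.trans G) (p' v) :=
    hE.of_injective_map (A.trans G) (A.trans G).injective (fun x hx => (hmem x).2 hx) hsegm
      (fun _ _ => rfl)
  have hused : ∀ v, (A.trans G) (p' v) ∉ openCube ↔ p' v ∉ Metric.ball (0 : E3) 1 := fun v => by
    rw [hmem]
  have hface : ∀ a ∈ F, (A.trans G) a 0 = 1 ∧ |(A.trans G) a 1| < 1 ∧ |(A.trans G) a 2| < 1 := by
    intro a ha
    obtain ⟨i1, i2⟩ := hAcone a ha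
    have ha1 := hF1 a ha
    have j1 := hmemc a ha1.le
    have j2 : (A.trans G) a ∉ openCube := by
      rw [hmem, mem_ball_zero_iff, ha1]; exact lt_irrefl _
    have hm := hμ (A a)
    have hpos : 0 < A a 0 := (abs_nonneg _).trans_lt i1
    have e : ∀ i, (A.trans G) a i = μ (A a) * A a i := fun i => by rw [hHapp]; rfl
    have k0 : (A.trans G) a 0 ≤ 1 := (le_abs_self _).trans (j1 0)
    have k1 : |(A.trans G) a 1| < (A.trans G) a 0 := by
      rw [e, e, abs_mul, abs_of_pos hm]; exact mul_lt_mul_of_pos_left i1 hm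
    have k2 : |(A.trans G) a 2| < (A.trans G) a 0 := by
      rw [e, e, abs_mul, abs_of_pos hm]; exact mul_lt_mul_of_pos_left i2 hm
    have k3 : (A.trans G) a 0 = 1 := by
      by_contra hne
      apply j2
      have hlt := lt_of_le_of_ne k0 hne
      have hp : 0 < (A.trans G) a 0 := by rw [e]; positivity
      intro i
      fin_cases i
      · change |(A.trans G) a 0| < 1
        rw [abs_of_pos hp]; exact hlt
      · exact k1.trans hlt
      · exact k2.trans hlt
    rw [k3] at k1 k2
    exact ⟨k3, k1, k2⟩
  have hball' : (h0.trans (h1.trans (A.trans G))) '' unitBall = cube := by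
    have e0 : h0 '' unitBall = unitBall := by
      apply Subset.antisymm
      · rintro _ ⟨x, hx, rfl⟩
        by_contra hcon
        have h2 : 1 < ‖h0 x‖ := by simpa [unitBall] using hcon
        have h3 := h0.injective (hh0fix _ h2.le)
        rw [h3] at hcon
        exact hcon hx
      · intro x hx
        refine ⟨h0.symm x, ?_, h0.apply_symm_apply x⟩
        by_contra hcon
        have h2 : 1 < ‖h0.symm x‖ := by simpa [unitBall] using hcon
        have h3 := hh0fix _ h2.le
        rw [h0.apply_symm_apply] at h3
        rw [← h3] at hcon
        exact hcon hx
    have e1 : h1 '' unitBall = unitBall := by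
      have h2 := image_eq_of_eqOn_compl h1 hh1
      have h3 := h1.image_closure (Metric.ball 0 1)
      rw [h2, closure_ball (0 : E3) one_ne_zero] at h3
      exact h3
    have : (h0.trans (h1.trans (A.trans G))) '' unitBall =
        (A.trans G) '' (h1 '' (h0 '' unitBall)) := by
      rw [image_image, image_image]; rfl
    rw [this, e0, e1]
    exact hH
  have hT' : (h0.trans (h1.trans (A.trans G))) '' T =
      carrier E fun v => (A.trans G) (p' v) := by
    have : (h0.trans (h1.trans (A.trans G))) '' T = (A.trans G) '' (h1 '' (h0 '' T)) := by
      rw [image_image, image_image]; rfl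
    rw [this, hh0T, hh1c]
    simp only [carrier, image_iUnion₂]
    rw [iUnion₂_congr hsegm]
  have hopen' : (h0.trans (h1.trans (A.trans G))) '' Metric.ball 0 1 = openCube := by
    rw [← interior_closedBall (0 : E3) one_ne_zero, Homeomorph.image_interior]
    change interior (_ '' unitBall) = _
    rw [hball', interior_cube]
  have hcharts : TangleCharts openCube (carrier E fun v => (A.trans G) (p' v)) := by
    rw [← hT']
    refine hT.charts.image _ fun x _ => ?_
    rw [← hopen', Function.Injective.mem_set_image (Homeomorph.injective _)]
  refine ⟨E, fun v => (A.trans G) (p' v), h0.trans (h1.trans (A.trans G)),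
    hh0.trans (hh1'.trans (hA.trans hG)), hball', hT', hemb, hcharts, ?_, ?_, ?_, ?_, ?_, ?_⟩
  · intro v hv hvO
    exact hface _ (hbd v hv ((hused v).1 hvO))
  · intro v v' hv hv' hvO hvO' h
    have i1 := hbd v hv ((hused v).1 hvO)
    have i2 := hbd v' hv' ((hused v').1 hvO')
    refine hbinj v v' hv hv' ((hused v).1 hvO) ((hused v').1 hvO') ?_
    apply hAray _ i1 _ i2
    have e : ∀ a i, (A.trans G) a i = μ (A a) * A a i := fun a i => by rw [hHapp]; rfl
    have j1 := (hface _ i1).1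
    have j2 := (hface _ i2).1
    simp only [e] at h j1 j2
    have m1 := hμ (A (p' v))
    have m2 := hμ (A (p' v'))
    have : μ (A (p' v)) * μ (A (p' v')) * (A (p' v) 1 * A (p' v') 0) =
        μ (A (p' v)) * μ (A (p' v')) * (A (p' v') 1 * A (p' v) 0) := by
      linear_combination (μ (A (p' v')) * A (p' v') 0) * h + μ (A (p' v')) * A (p' v') 1 * j2
        - μ (A (p' v')) * A (p' v') 1 * j1
    exact mul_left_cancel₀ (mul_pos m1 m2).ne' this
  · have : {v | Used E v ∧ (A.trans G) (p' v) ∉ openCube} =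
        Sum.inr '' {v | Used E0 v ∧ id v ∉ Metric.ball (0 : E3) 1} := by
      rw [← hB]
      ext v
      simp only [mem_ofPred_eq, hused]
    rw [this, ncard_image_of_injective _ Sum.inr_injective, ← hcard, ← hB0]
    rfl
  · have hfix : ∀ x, ‖x‖ = 1 → (h0.trans (h1.trans (A.trans G))) x = (A.trans G) x := by
      intro x hx
      change (A.trans G) (h1 (h0 x)) = _
      rw [hh0fix x hx.ge, hh1 x (by rw [mem_ball_zero_iff, hx]; exact lt_irrefl _)]
    have hz : ∀ x, 0 ≤ (A.trans G) x 2 ↔ 0 ≤ x 2 := by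
      intro x
      have e : (A.trans G) x 2 = μ (A x) * k * x 2 := by rw [hHapp, mul_assoc, ← hA2]; rfl
      rw [e]
      exact mul_nonneg_iff_of_pos_left (mul_pos (hμ _) hk)
    ext y
    constructor
    · rintro ⟨x, ⟨hx, hx2⟩, rfl⟩
      rw [hfix x hx]
      refine ⟨?_, (hz x).2 hx2⟩
      rw [← hHsph]
      exact mem_image_of_mem _ (mem_sphere_zero_iff_norm.2 hx)
    · rintro ⟨hy, hy2⟩
      rw [← hHsph] at hy
      obtain ⟨x, hx, rfl⟩ := hy
      have hx1 := mem_sphere_zero_iff_norm.1 hx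
      exact ⟨x, ⟨hx1, (hz x).1 hy2⟩, hfix x hx1⟩
  · have hq1 := hqe.1
    change (A.trans G) (h1 (h0 q)) = _
    rw [hh0fix q hq1.ge, hh1 q (by rw [mem_ball_zero_iff, hq1]; exact lt_irrefl _)]
    have j1 := hmemc q hq1.le
    have j2 : (A.trans G) q ∉ openCube := by
      rw [hmem, mem_ball_zero_iff, hq1]; exact lt_irrefl _
    rw [hHapp, hAq] at j1 j2 ⊢
    set M := μ !₂[-c, -c, 0] with hM
    have hm : 0 < M := hμ _
    have k0 : M * c ≤ 1 := by
      have := j1 0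
      simp at this
      rwa [abs_of_pos hm, abs_of_pos hc] at this
    have k1 : M * c = 1 := by
      by_contra hne
      apply j2
      have hlt := lt_of_le_of_ne k0 hne
      intro i
      fin_cases i <;> simp [abs_of_pos hm, abs_of_pos hc, hlt]
    ext <;> simp [k1]
  · intro hFe v hv hvO
    have := (hFe (hbd v hv ((hused v).1 hvO))).2
    simp only [hHapp, PiLp.smul_apply, smul_eq_mul, hA2, this, mul_zero]

end

noncomputable section
open Set Filter Topology

/-! ### Grid diagrams and mosaics -/

/-- The labels of the vertices of a grid diagram: `hw j k` is the point of row `j` on the wall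
`x = k`, `vw i k` the point of column `i` on the wall `y = k`, and `hc i j`, `vc i j` are the
central points of the horizontal and of the vertical strand of a tile. -/
inductive GridLabel : Type
  | hw (j k : ℕ)
  | vw (i k : ℕ)
  | hc (i j : ℕ)
  | vc (i j : ℕ)

open GridLabel

/-- A grid diagram, given by the walls of tiles that it crosses, with heights. -/
structure GridData where
  n : ℕ
  HW : ℕ → ℕ → Prop
  VW : ℕ → ℕ → Prop
  Z : GridLabel → ℝ
  tile : ∀ i < n, ∀ j < n, ((HW j i ↔ HW j (i + 1)) ∧ (VW i j ↔ VW i (j + 1))) ∨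
    ((HW j i ↔ ¬ HW j (i + 1)) ∧ (VW i j ↔ ¬ VW i (j + 1)))
  Z_pos : ∀ l, 0 < Z l
  Z_lt : ∀ l, Z l < 1
  cross : ∀ i < n, ∀ j < n, HW j i → HW j (i + 1) → VW i j → VW i (j + 1) →
    Z (hc i j) ≠ Z (vc i j)
  west : ∀ j, ¬ HW j 0
  south : ∀ i, ¬ VW i 0
  north : ∀ i, ¬ VW i n
  east : ∀ j, HW j n → Z (hw j n) = 1 / 2

/-- The open box. -/
def openBox (n : ℕ) : Set E3 :=
  {x | x 0 ∈ Ioo (0 : ℝ) n ∧ x 1 ∈ Ioo (0 : ℝ) n ∧ x 2 ∈ Ioo (0 : ℝ) 1}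

theorem isOpen_openBox (n : ℕ) : IsOpen (openBox n) := by
  have h : ∀ i : Fin 3, Continuous fun x : E3 => x i := fun i => by fun_prop
  exact ((isOpen_Ioo.preimage (h 0)).inter
    ((isOpen_Ioo.preimage (h 1)).inter (isOpen_Ioo.preimage (h 2))))

theorem convex_openBox (n : ℕ) : Convex ℝ (openBox n) :=
  (convex_coord_preimage 0 (convex_Ioo _ _)).inter
    ((convex_coord_preimage 1 (convex_Ioo _ _)).inter (convex_coord_preimage 2 (convex_Ioo _ _)))

namespace GridData

variable (D : GridData)

open Classical in
/-- The two coordinates of the shift of the centre of a turning strand. -/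
def shift (i j : ℕ) : ℝ × ℝ :=
  if (D.HW j i ↔ D.HW j (i + 1)) then (0, 0) else
    (if D.HW j (i + 1) then 1 / 4 else -1 / 4, if D.VW i (j + 1) then 1 / 4 else -1 / 4)

/-- The tile contains a crossing. -/
def IsCrossing (i j : ℕ) : Prop := D.HW j i ∧ D.HW j (i + 1) ∧ D.VW i j

open Classical in
/-- The heights of the vertices in the realization of the mosaic. -/
def finalHeight : GridLabel → ℝ
  | hw _ _ => 1 / 2
  | vw _ _ => 1 / 2
  | hc i j => if D.IsCrossing i j then
      (if D.Z (vc i j) < D.Z (hc i j) then 3 / 4 else 1 / 4) else 1 / 2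
  | vc i j => if D.IsCrossing i j then
      (if D.Z (vc i j) < D.Z (hc i j) then 1 / 4 else 3 / 4) else 1 / 2

/-- The height of a vertex at time `t`. -/
def height (t : ℝ) (l : GridLabel) : ℝ := (1 - t) * D.Z l + t * D.finalHeight l

/-- The vertices at time `t`. -/
def pos (t : ℝ) : GridLabel → E3
  | hw j k => !₂[(k : ℝ), j + 1 / 2, D.height t (hw j k)]
  | vw i k => !₂[(i : ℝ) + 1 / 2, k, D.height t (vw i k)]
  | hc i j => !₂[(i : ℝ) + 1 / 2 + t * (D.shift i j).1, j + 1 / 2 + t * (D.shift i j).2,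
      D.height t (hc i j)]
  | vc i j => !₂[(i : ℝ) + 1 / 2, j + 1 / 2, D.height t (vc i j)]

/-- The strand of tile `(i, j)` connects to side `s`. -/
def Conn (i j : ℕ) : Side → Prop
  | .W => D.HW j i
  | .E => D.HW j (i + 1)
  | .S => D.VW i j
  | .N => D.VW i (j + 1)

/-- The vertex on a side of a tile. -/
def wall (i j : ℕ) : Side → GridLabel
  | .W => hw j i
  | .E => hw j (i + 1)
  | .S => vw i j
  | .N => vw i (j + 1)

open Classical in
/-- The central vertex of a tile that is joined to a side. -/
def center (i j : ℕ) : Side → GridLabel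
  | .W => hc i j
  | .E => hc i j
  | .S => if (D.HW j i ↔ D.HW j (i + 1)) then vc i j else hc i j
  | .N => if (D.HW j i ↔ D.HW j (i + 1)) then vc i j else hc i j

open Classical in
/-- The edges of a grid diagram. -/
def edges : Finset (GridLabel × GridLabel) :=
  (((Finset.range D.n ×ˢ Finset.range D.n) ×ˢ ({.W, .E, .S, .N} : Finset Side)).filter
    fun q => D.Conn q.1.1 q.1.2 q.2).image fun q => (wall q.1.1 q.1.2 q.2, D.center q.1.1 q.1.2 q.2)

theorem mem_edges {e : GridLabel × GridLabel} : e ∈ D.edges ↔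
    ∃ i j s, i < D.n ∧ j < D.n ∧ D.Conn i j s ∧ e = (wall i j s, D.center i j s) := by
  simp only [edges, Finset.mem_image, Finset.mem_filter, Finset.mem_product, Finset.mem_range]
  constructor
  · rintro ⟨⟨⟨i, j⟩, s⟩, ⟨⟨⟨hi, hj⟩, -⟩, hc⟩, rfl⟩
    exact ⟨i, j, s, hi, hj, hc, rfl⟩
  · rintro ⟨i, j, s, hi, hj, hc, rfl⟩
    refine ⟨⟨⟨i, j⟩, s⟩, ⟨⟨⟨hi, hj⟩, ?_⟩, hc⟩, rfl⟩
    cases s <;> simp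

/-- The direction of a side. -/
def dir : Side → ℝ × ℝ
  | .W => (-1, 0)
  | .E => (1, 0)
  | .S => (0, -1)
  | .N => (0, 1)

theorem shift_le (i j : ℕ) : |(D.shift i j).1| ≤ 1 / 4 ∧ |(D.shift i j).2| ≤ 1 / 4 := by
  unfold shift
  split_ifs <;> norm_num [abs_le]

theorem pos_wall (t : ℝ) (i j : ℕ) (s : Side) :
    (D.pos t (wall i j s)) 0 = i + 1 / 2 + (dir s).1 / 2 ∧
      (D.pos t (wall i j s)) 1 = j + 1 / 2 + (dir s).2 / 2 := by
  cases s <;> simp [wall, pos, dir] <;> ring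

theorem pos_center (t : ℝ) (i j : ℕ) (s : Side) :
    (D.pos t (D.center i j s)) 0 = i + 1 / 2 + t * (D.shift i j).1 ∧
      (D.pos t (D.center i j s)) 1 = j + 1 / 2 + t * (D.shift i j).2 := by
  cases s <;> simp only [center] <;> try split_ifs with h
  all_goals simp [pos]
  all_goals simp [shift, h]

theorem along_coord (t σ : ℝ) (i j : ℕ) (s : Side) :
    (along (D.pos t) (wall i j s, D.center i j s) σ) 0 =
      i + 1 / 2 + (1 - σ) * ((dir s).1 / 2) + σ * (t * (D.shift i j).1) ∧
    (along (D.pos t) (wall i j s, D.center i j s) σ) 1 =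
      j + 1 / 2 + (1 - σ) * ((dir s).2 / 2) + σ * (t * (D.shift i j).2) := by
  have h1 := D.pos_wall t i j s
  have h2 := D.pos_center t i j s
  constructor
  · simp only [along, PiLp.add_apply, PiLp.smul_apply, smul_eq_mul, h1.1, h2.1]; ring
  · simp only [along, PiLp.add_apply, PiLp.smul_apply, smul_eq_mul, h1.2, h2.2]; ring

theorem abs_dir_le (s : Side) : |(dir s).1| ≤ 1 ∧ |(dir s).2| ≤ 1 := by
  cases s <;> simp [dir]

theorem coord_bound {σ t d c : ℝ} (hσ : σ ∈ Icc (0 : ℝ) 1) (ht : t ∈ Icc (0 : ℝ) 1)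
    (hd : |d| ≤ 1) (hc : |c| ≤ 1 / 4) :
    |(1 - σ) * (d / 2) + σ * (t * c)| ≤ 1 / 2 - σ / 4 := by
  have h1 : |t * c| ≤ 1 / 4 := by
    rw [abs_mul, abs_of_nonneg ht.1]
    nlinarith [ht.1, ht.2, abs_nonneg c]
  rw [abs_le] at *
  constructor <;> nlinarith [hσ.1, hσ.2]

theorem along_mem (t σ : ℝ) (ht : t ∈ Icc (0 : ℝ) 1) (hσ : σ ∈ Icc (0 : ℝ) 1) (i j : ℕ)
    (s : Side) (x : E3) (hx : along (D.pos t) (wall i j s, D.center i j s) σ = x) :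
    |x 0 - (i + 1 / 2)| ≤ 1 / 2 - σ / 4 ∧ |x 1 - (j + 1 / 2)| ≤ 1 / 2 - σ / 4 := by
  subst hx
  obtain ⟨h1, h2⟩ := D.along_coord t σ i j s
  rw [h1, h2]
  constructor
  · convert coord_bound hσ ht (abs_dir_le s).1 (D.shift_le i j).1 using 2; ring
  · convert coord_bound hσ ht (abs_dir_le s).2 (D.shift_le i j).2 using 2; ring

theorem nat_eq_of_abs {x a b : ℝ} {i i' : ℕ} (h : |x - (i + 1 / 2)| ≤ 1 / 2 - a / 4)
    (h' : |x - (i' + 1 / 2)| ≤ 1 / 2 - b / 4) (ha : 0 < a) (hb : 0 ≤ b) : i = i' := by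
  rw [abs_le] at h h'
  have h1 : (i : ℝ) < i' + 1 := by linarith
  have h2 : (i' : ℝ) < i + 1 := by linarith
  norm_cast at h1 h2
  omega

theorem height_ne (i j : ℕ) (hi : i < D.n) (hj : j < D.n) (h1 : D.HW j i) (h2 : D.HW j (i + 1))
    (h3 : D.VW i j) (h4 : D.VW i (j + 1)) (t : ℝ) (ht : t ∈ Icc (0 : ℝ) 1) :
    D.height t (hc i j) ≠ D.height t (vc i j) := by
  have hX : D.IsCrossing i j := ⟨h1, h2, h3⟩
  have hne := D.cross i hi j hj h1 h2 h3 h4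
  simp only [height, finalHeight, hX, if_true]
  rcases lt_or_gt_of_ne hne with h | h
  · rw [if_neg (not_lt.2 h.le), if_neg (not_lt.2 h.le)]
    apply ne_of_lt
    nlinarith [ht.1, ht.2, mul_nonneg (sub_nonneg.2 ht.2) (sub_nonneg.2 h.le)]
  · rw [if_pos h, if_pos h]
    apply ne_of_gt
    nlinarith [ht.1, ht.2, mul_nonneg (sub_nonneg.2 ht.2) (sub_nonneg.2 h.le)]

theorem pos_wall_injective (t : ℝ) (i j i' j' : ℕ) (s s' : Side)
    (h : D.pos t (wall i j s) = D.pos t (wall i' j' s')) : wall i j s = wall i' j' s' := by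
  have key : ∀ j k i' k' : ℕ, ¬ ((k : ℝ) = i' + 1 / 2 ∧ (j : ℝ) + 1 / 2 = k') := by
    rintro j k i' k' ⟨h1, -⟩
    have : (2 * k : ℝ) = 2 * i' + 1 := by linarith
    norm_cast at this
    omega
  have hh : ∀ j k j' k' : ℕ, D.pos t (hw j k) = D.pos t (hw j' k') → hw j k = hw j' k' := by
    intro j k j' k' h
    have h0 := congrArg (fun x : E3 => x 0) h
    have h1 := congrArg (fun x : E3 => x 1) h
    simp [pos] at h0 h1
    rw [h0, h1]
  have hv : ∀ j k j' k' : ℕ, D.pos t (vw j k) = D.pos t (vw j' k') → vw j k = vw j' k' := by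
    intro j k j' k' h
    have h0 := congrArg (fun x : E3 => x 0) h
    have h1 := congrArg (fun x : E3 => x 1) h
    simp [pos] at h0 h1
    rw [h0, h1]
  have hhv : ∀ j k j' k' : ℕ, D.pos t (hw j k) ≠ D.pos t (vw j' k') := by
    intro j k j' k' h
    have h0 := congrArg (fun x : E3 => x 0) h
    have h1 := congrArg (fun x : E3 => x 1) h
    simp [pos] at h0 h1
    exact key j k j' k' ⟨by rw [h0]; norm_num, by rw [← h1]; norm_num⟩
  cases s <;> cases s' <;> simp only [wall] at h ⊢ <;>
    first | exact hh _ _ _ _ h | exact hv _ _ _ _ h | exact absurd h (hhv _ _ _ _) |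
      exact absurd h.symm (hhv _ _ _ _)

/-- Two strands of the same tile meet only in the centre. -/
theorem same_tile (t : ℝ) (ht : t ∈ Icc (0 : ℝ) 1) (i j : ℕ) (hi : i < D.n) (hj : j < D.n)
    (s s' : Side) (hs : D.Conn i j s) (hs' : D.Conn i j s') (hss : s ≠ s') (σ σ' : ℝ)
    (hσ : σ ∈ Icc (0 : ℝ) 1) (hσ' : σ' ∈ Icc (0 : ℝ) 1)
    (h : along (D.pos t) (wall i j s, D.center i j s) σ =
      along (D.pos t) (wall i j s', D.center i j s') σ') :
    σ = 1 ∧ σ' = 1 ∧ D.center i j s = D.center i j s' := by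
  have hz := congrArg (fun x : E3 => x 2) h
  obtain ⟨a0, a1⟩ := D.along_coord t σ i j s
  obtain ⟨b0, b1⟩ := D.along_coord t σ' i j s'
  rw [h, b0] at a0
  rw [h, b1] at a1
  clear b0 b1
  by_cases hst : D.HW j i ↔ D.HW j (i + 1)
  · have hsh : D.shift i j = (0, 0) := by simp [shift, hst]
    rw [hsh] at a0 a1
    have hst' : D.VW i j ↔ D.VW i (j + 1) := by
      rcases D.tile i hi j hj with h | h
      · exact h.2
      · tauto
    have hlt := fun h1 h2 h3 h4 => D.height_ne i j hi hj h1 h2 h3 h4 t ht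
    have e1 := hσ.1
    have e2 := hσ.2
    have e3 := hσ'.1
    have e4 := hσ'.2
    cases s <;> cases s' <;> simp only [dir, Conn, center, hst, if_true, hst'] at * <;>
      first
      | exact absurd rfl hss
      | exact ⟨by linarith, by linarith, by trivial⟩
      | (exfalso
         obtain rfl : σ = 1 := by linarith
         obtain rfl : σ' = 1 := by linarith
         rw [along_one, along_one] at hz
         simp [pos] at hz
         simp_all)
  · rcases D.tile i hi j hj with h' | ⟨h1, h2⟩
    · exact absurd h'.1 hst
    have e1 := hσ.1
    have e2 := hσ.2
    have e3 := hσ'.1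
    have e4 := hσ'.2
    simp only [shift, hst, if_false] at a0 a1
    cases s <;> cases s' <;> simp only [dir, Conn, center, hst, if_false] at * <;>
      first
      | exact absurd rfl hss
      | tauto
      | (simp only [hs, hs', h1, h2, not_true, not_false_eq_true, if_true, if_false, true_iff,
            iff_true, false_iff, iff_false, not_not] at *
         (try simp only [hs, hs', h1, h2, not_true, not_false_eq_true, if_true, if_false, true_iff,
            iff_true, false_iff, iff_false, not_not] at *)
         exact ⟨by linarith, by linarith, trivial⟩)

theorem finalHeight_mem (l : GridLabel) : 0 < D.finalHeight l ∧ D.finalHeight l < 1 := by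
  cases l <;> simp only [finalHeight] <;> (try split_ifs) <;> norm_num

theorem height_mem (l : GridLabel) {t : ℝ} (ht : t ∈ Icc (0 : ℝ) 1) :
    0 < D.height t l ∧ D.height t l < 1 := by
  obtain ⟨h1, h2⟩ := D.finalHeight_mem l
  have h3 := D.Z_pos l
  have h4 := D.Z_lt l
  have := (convex_Ioo (0 : ℝ) 1) ⟨h3, h4⟩ ⟨h1, h2⟩ (sub_nonneg.2 ht.2) ht.1 (by ring)
  simpa [height] using this

theorem pos_two (t : ℝ) (l : GridLabel) : (D.pos t l) 2 = D.height t l := by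
  cases l <;> simp [pos]

theorem mem_openBox_of_pos {t σ : ℝ} (ht : t ∈ Icc (0 : ℝ) 1) (hσ : σ ∈ Icc (0 : ℝ) 1)
    (h0 : 0 < σ) {i j : ℕ} (hi : i < D.n) (hj : j < D.n) (s : Side) :
    along (D.pos t) (wall i j s, D.center i j s) σ ∈ openBox D.n := by
  obtain ⟨h1, h2⟩ := D.along_mem t σ ht hσ i j s _ rfl
  rw [abs_le] at h1 h2
  have hi' : (i : ℝ) + 1 ≤ D.n := by exact_mod_cast hi
  have hj' : (j : ℝ) + 1 ≤ D.n := by exact_mod_cast hj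
  have hi0 : (0 : ℝ) ≤ i := by positivity
  have hj0 : (0 : ℝ) ≤ j := by positivity
  refine ⟨⟨by linarith, by linarith⟩, ⟨by linarith, by linarith⟩, ?_⟩
  have h3 := D.height_mem (wall i j s) ht
  have h4 := D.height_mem (D.center i j s) ht
  have := (convex_Ioo (0 : ℝ) 1) h3 h4 (sub_nonneg.2 hσ.2) hσ.1 (by ring)
  simpa only [along, PiLp.add_apply, PiLp.smul_apply, smul_eq_mul, pos_two] using this

theorem emb (t : ℝ) (ht : t ∈ Icc (0 : ℝ) 1) : Emb (openBox D.n) D.edges (D.pos t) := by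
  refine ⟨?_, ?_, ?_⟩
  · intro e he h
    obtain ⟨i, j, s, hi, hj, hs, rfl⟩ := D.mem_edges.1 he
    obtain ⟨h1, h2⟩ := D.along_mem t 1 ht (by simp) i j s _ (along_one _ _)
    obtain ⟨h3, h4⟩ := D.pos_wall t i j s
    simp only at h h1 h2
    rw [← h, h3] at h1
    rw [← h, h4] at h2
    rw [add_sub_cancel_left] at h1 h2
    cases s <;> first
      | (norm_num [dir, abs_le] at h1; done)
      | (norm_num [dir, abs_le] at h2; done)
  · intro e he e' he' hee x hx hx'
    obtain ⟨i, j, s, hi, hj, hs, rfl⟩ := D.mem_edges.1 he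
    obtain ⟨i', j', s', hi', hj', hs', rfl⟩ := D.mem_edges.1 he'
    obtain ⟨σ, hσ, hσx⟩ := mem_segment_iff_along.1 hx
    obtain ⟨σ', hσ', hσx'⟩ := mem_segment_iff_along.1 hx'
    obtain ⟨a0, a1⟩ := D.along_mem t σ ht hσ i j s x hσx
    obtain ⟨b0, b1⟩ := D.along_mem t σ' ht hσ' i' j' s' x hσx'
    by_cases h00 : σ = 0 ∧ σ' = 0
    · obtain ⟨rfl, rfl⟩ := h00
      rw [along_zero] at hσx hσx'
      have := D.pos_wall_injective t i j i' j' s s' (hσx.trans hσx'.symm)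
      exact ⟨wall i j s, Or.inl rfl, Or.inl this, hσx.symm⟩
    · have hij : i = i' ∧ j = j' := by
        by_cases h : σ = 0
        · have : 0 < σ' := lt_of_le_of_ne hσ'.1 fun h' => h00 ⟨h, h'.symm⟩
          exact ⟨(nat_eq_of_abs b0 a0 this hσ.1).symm, (nat_eq_of_abs b1 a1 this hσ.1).symm⟩
        · have : 0 < σ := lt_of_le_of_ne hσ.1 (Ne.symm h)
          exact ⟨nat_eq_of_abs a0 b0 this hσ'.1, nat_eq_of_abs a1 b1 this hσ'.1⟩
      obtain ⟨rfl, rfl⟩ := hij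
      have hss : s ≠ s' := fun h => hee (by rw [h])
      obtain ⟨rfl, rfl, hc⟩ := D.same_tile t ht i j hi hj s s' hs hs' hss σ σ' hσ hσ'
        (hσx.trans hσx'.symm)
      rw [along_one] at hσx
      exact ⟨D.center i j s, Or.inr rfl, Or.inr hc, hσx.symm⟩
  · intro e he x hx
    obtain ⟨i, j, s, hi, hj, hs, rfl⟩ := D.mem_edges.1 he
    rw [openSegment_eq_image] at hx
    obtain ⟨σ, hσ, rfl⟩ := hx
    exact D.mem_openBox_of_pos ht ⟨hσ.1.le, hσ.2.le⟩ hσ.1 hi hj s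

theorem used_cases {l : GridLabel} (hl : Used D.edges l) :
    (∀ t ∈ Icc (0 : ℝ) 1, D.pos t l ∈ openBox D.n) ∨ ∃ j, l = hw j D.n ∧ D.HW j D.n := by
  obtain ⟨e, he, hel⟩ := hl
  obtain ⟨i, j, s, hi, hj, hs, rfl⟩ := D.mem_edges.1 he
  have hi' : (i : ℝ) + 1 ≤ D.n := by exact_mod_cast hi
  have hj' : (j : ℝ) + 1 ≤ D.n := by exact_mod_cast hj
  have hi0 : (0 : ℝ) ≤ i := by positivity
  have hj0 : (0 : ℝ) ≤ j := by positivity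
  rcases hel with rfl | rfl
  · by_cases hE : s = .E ∧ i + 1 = D.n
    · obtain ⟨rfl, h⟩ := hE
      right
      refine ⟨j, by simp [wall, h], ?_⟩
      rw [← h]; exact hs
    · left
      intro t ht
      refine ⟨?_, ?_, by rw [pos_two]; exact D.height_mem _ ht⟩
      · rw [(D.pos_wall t i j s).1]
        cases s <;> simp only [dir]
        · constructor <;> linarith
        · constructor <;> linarith
        · have : i + 1 < D.n := lt_of_le_of_ne hi fun h => hE ⟨rfl, h⟩
          have : (i : ℝ) + 1 < D.n := by exact_mod_cast this
          constructor <;> linarith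
        · have : i ≠ 0 := by rintro rfl; exact D.west _ hs
          have : (1 : ℝ) ≤ i := by exact_mod_cast Nat.one_le_iff_ne_zero.2 this
          constructor <;> linarith
      · rw [(D.pos_wall t i j s).2]
        cases s <;> simp only [dir]
        · have : j + 1 ≠ D.n := by intro h; apply D.north i; rw [← h]; exact hs
          have : (j : ℝ) + 1 < D.n := by exact_mod_cast lt_of_le_of_ne hj this
          constructor <;> linarith
        · have : j ≠ 0 := by rintro rfl; exact D.south _ hs
          have : (1 : ℝ) ≤ j := by exact_mod_cast Nat.one_le_iff_ne_zero.2 this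
          constructor <;> linarith
        · constructor <;> linarith
        · constructor <;> linarith
  · left
    intro t ht
    have := D.mem_openBox_of_pos ht (σ := 1) (by simp) one_pos hi hj s
    rwa [along_one] at this

theorem moves : Moves (openBox D.n) D.edges (D.pos 0) (D.pos 1) := by
  apply moves_of_family (isOpen_openBox _) (convex_openBox _) D.pos
  · intro l _
    cases l <;> simp only [pos, height] <;> fun_prop
  · exact D.emb
  · intro l hl t ht t' ht' hlO
    rcases D.used_cases hl with h | ⟨j, rfl, hj⟩
    · exact absurd (h t ht) hlO
    · have := D.east j hj
      simp only [pos, height, finalHeight, this]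
      ext <;> simp
      ring

end GridData

open Classical in
/-- The tile with given connection points. -/
def tileOf (W E S ov : Prop) : Tile :=
  if W then (if E then (if S then (if ov then .T9 else .T10) else .T5) else
    if S then .T1 else .T4) else if E then (if S then .T2 else .T3) else
    if S then .T6 else .T0

namespace GridData

variable (D : GridData)

/-- The tile in column `i` and row `j`, counted from below. -/
def tileAt (i j : ℕ) : Tile :=
  tileOf (D.HW j i) (D.HW j (i + 1)) (D.VW i j) (D.Z (vc i j) < D.Z (hc i j))

theorem tileAt_connects {i j : ℕ} (hi : i < D.n) (hj : j < D.n) (s : Side) :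
    (D.tileAt i j).Connects s ↔ D.Conn i j s := by
  have h := D.tile i hi j hj
  unfold tileAt tileOf
  by_cases h1 : D.HW j i <;> by_cases h2 : D.HW j (i + 1) <;> by_cases h3 : D.VW i j <;>
    by_cases h4 : D.VW i (j + 1) <;> simp only [h1, h2, h3, h4, if_true, if_false] at h ⊢ <;>
    first
    | (exfalso; tauto)
    | (try split_ifs) <;> cases s <;> simp [Tile.Connects, Tile.strands, Conn, h1, h2, h3, h4]

/-- The part of the realization in a tile. -/
def tileSet (i j : ℕ) : Set E3 :=
  ⋃ (s : Side) (_ : D.Conn i j s), segment ℝ (D.pos 1 (wall i j s)) (D.pos 1 (D.center i j s))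

theorem carrier_eq (t : ℝ) : carrier D.edges (D.pos t) = ⋃ (i : Fin D.n) (j : Fin D.n) (s : Side)
    (_ : D.Conn i j s), segment ℝ (D.pos t (wall i j s)) (D.pos t (D.center i j s)) := by
  ext x
  simp only [mem_carrier, mem_edges, mem_iUnion]
  constructor
  · rintro ⟨e, ⟨i, j, s, hi, hj, hs, rfl⟩, hx⟩
    exact ⟨⟨i, hi⟩, ⟨j, hj⟩, s, hs, hx⟩
  · rintro ⟨i, j, s, hs, hx⟩
    exact ⟨_, ⟨i, j, s, i.2, j.2, hs, rfl⟩, hx⟩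

theorem iUnion_side (f : Side → Set E3) : ⋃ s, f s = f .W ∪ f .E ∪ f .S ∪ f .N := by
  ext x
  simp only [mem_iUnion, mem_union]
  constructor
  · rintro ⟨s, hs⟩
    cases s <;> tauto
  · rintro (((h | h) | h) | h) <;> exact ⟨_, h⟩

theorem tileSet_eq {i j : ℕ} (hi : i < D.n) (hj : j < D.n) :
    D.tileSet i j = (fun x => (!₂[(i : ℝ), (j : ℝ), 0] : E3) + x) '' (D.tileAt i j).realization := by
  have h := D.tile i hi j hj
  have w1 : (!₂[(i : ℝ), (j : ℝ), 0] : E3) + Side.point .W = D.pos 1 (hw j i) := by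
    ext <;> simp [Side.point, pos, height, finalHeight]
  have w2 : (!₂[(i : ℝ), (j : ℝ), 0] : E3) + Side.point .E = D.pos 1 (hw j (i + 1)) := by
    ext <;> simp [Side.point, pos, height, finalHeight]
  have w3 : (!₂[(i : ℝ), (j : ℝ), 0] : E3) + Side.point .S = D.pos 1 (vw i j) := by
    ext <;> simp [Side.point, pos, height, finalHeight]
  have w4 : (!₂[(i : ℝ), (j : ℝ), 0] : E3) + Side.point .N = D.pos 1 (vw i (j + 1)) := by
    ext <;> simp [Side.point, pos, height, finalHeight]
  have cH : ∀ h, (D.HW j i ↔ D.HW j (i + 1)) → D.finalHeight (hc i j) = h →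
      (!₂[(i : ℝ), (j : ℝ), 0] : E3) + !₂[(Side.point .W 0 + Side.point .E 0) / 2,
        (Side.point .W 1 + Side.point .E 1) / 2, h] = D.pos 1 (hc i j) := by
    rintro h hs rfl
    ext <;> simp [Side.point, pos, height, shift, hs]
  have cV : ∀ h, D.finalHeight (vc i j) = h →
      (!₂[(i : ℝ), (j : ℝ), 0] : E3) + !₂[(Side.point .N 0 + Side.point .S 0) / 2,
        (Side.point .N 1 + Side.point .S 1) / 2, h] = D.pos 1 (vc i j) := by
    rintro h rfl
    ext <;> simp [Side.point, pos, height]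
  have cc : ∀ (a b : Side), (dir a).1 + (dir b).1 = 4 * (D.shift i j).1 →
      (dir a).2 + (dir b).2 = 4 * (D.shift i j).2 → ¬ D.IsCrossing i j →
      (!₂[(i : ℝ), (j : ℝ), 0] : E3) + !₂[(Side.point a 0 + Side.point b 0) / 2,
        (Side.point a 1 + Side.point b 1) / 2, 1 / 2] = D.pos 1 (hc i j) := by
    intro a b h0 h1 hX
    have e : ∀ s : Side, Side.point s 0 = 1 / 2 + (dir s).1 / 2 ∧
        Side.point s 1 = 1 / 2 + (dir s).2 / 2 := by
      intro s; cases s <;> simp [Side.point, dir] <;> norm_num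
    ext <;> simp [(e a).1, (e b).1, (e a).2, (e b).2, pos, height, finalHeight, hX] <;> linarith
  unfold tileSet tileAt tileOf
  rw [iUnion_side]
  by_cases h1 : D.HW j i <;> by_cases h2 : D.HW j (i + 1) <;> by_cases h3 : D.VW i j <;>
    by_cases h4 : D.VW i (j + 1) <;> (try (exfalso; tauto)) <;>
    simp only [h1, h2, h3, h4, if_true, if_false] <;> (try split_ifs with h5) <;>
      simp only [Tile.realization, Tile.strands, strandSet, List.mem_cons, List.not_mem_nil,
        or_false, iUnion_iUnion_eq_left, iUnion_iUnion_eq_or_left, image_union, image_empty,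
        segment_translate_image, w1, w2, w3, w4, Conn, h1, h2, h3, h4, iUnion_true, iUnion_false,
        iUnion_of_empty, wall, center, union_empty, empty_union, if_true, if_false, iff_true,
        iff_false, true_iff, false_iff, not_true, not_false_iff, iUnion_empty]
  · rw [cH _ (by simp [h1, h2]) (by simp [finalHeight, IsCrossing, h1, h2, h3, h5]),
      cV _ (by simp [finalHeight, IsCrossing, h1, h2, h3, h5])]
    simp only [segment_symm ℝ (D.pos 1 (hc i j)), segment_symm ℝ (D.pos 1 (vc i j))]
    ext x
    simp only [mem_union]
    tauto
  · rw [cH _ (by simp [h1, h2]) (by simp [finalHeight, IsCrossing, h1, h2, h3, h5]),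
      cV _ (by simp [finalHeight, IsCrossing, h1, h2, h3, h5])]
    simp only [segment_symm ℝ (D.pos 1 (hc i j)), segment_symm ℝ (D.pos 1 (vc i j))]
    ext x
    simp only [mem_union]
    tauto
  · rw [cH _ (by simp [h1, h2]) (by simp [finalHeight, IsCrossing, h3])]
    simp only [segment_symm ℝ (D.pos 1 (hc i j))]
  · rw [cc .W .S (by norm_num [dir, shift, h1, h2]) (by norm_num [dir, shift, h1, h2, h4])
      (by simp [IsCrossing, h2])]
    simp only [segment_symm ℝ (D.pos 1 (hc i j))]
  · rw [cc .N .W (by norm_num [dir, shift, h1, h2]) (by norm_num [dir, shift, h1, h2, h4])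
      (by simp [IsCrossing, h2])]
    simp only [segment_symm ℝ (D.pos 1 (hc i j))]
    ac_rfl
  · rw [cc .S .E (by norm_num [dir, shift, h1, h2]) (by norm_num [dir, shift, h1, h2, h4])
      (by simp [IsCrossing, h1])]
    simp only [segment_symm ℝ (D.pos 1 (hc i j))]
    ac_rfl
  · rw [cc .E .N (by norm_num [dir, shift, h1, h2]) (by norm_num [dir, shift, h1, h2, h4])
      (by simp [IsCrossing, h1])]
    simp only [segment_symm ℝ (D.pos 1 (hc i j))]
  · rw [cV _ (by simp [finalHeight, IsCrossing, h1])]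
    simp only [segment_symm ℝ (D.pos 1 (vc i j))]
    ac_rfl

/-- The mosaic of a grid diagram. -/
def mosaic : Mosaic D.n := Matrix.of fun r c => D.tileAt c (Fin.rev r)

theorem mosaic_connects (r c : Fin D.n) (s : Side) :
    (D.mosaic r c).Connects s ↔ D.Conn c (Fin.rev r) s :=
  D.tileAt_connects c.2 (Fin.rev r).2 s

theorem isTangleMosaic : D.mosaic.IsTangleMosaic := by
  constructor
  · intro i j j' h
    rw [mosaic_connects, mosaic_connects]
    simp only [Conn, h]
  · intro i i' j h
    rw [mosaic_connects, mosaic_connects]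
    have : (Fin.rev i : ℕ) = (Fin.rev i' : ℕ) + 1 := by
      simp only [Fin.val_rev]
      have := i'.2
      omega
    simp only [Conn, this]

theorem ncard_boundaryPoints :
    D.mosaic.boundaryPoints.ncard = {j | j < D.n ∧ D.HW j D.n}.ncard := by
  symm
  have hn : ∀ j ∈ {j | j < D.n ∧ D.HW j D.n}, 0 < D.n := fun j hj => lt_of_le_of_lt (Nat.zero_le _) hj.1
  refine Set.ncard_congr (fun j hj => ((⟨j, hj.1⟩ : Fin D.n).rev,
    (⟨D.n - 1, Nat.sub_lt (hn j hj) one_pos⟩ : Fin D.n), Side.E)) ?_ ?_ ?_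
  · intro j hj
    refine ⟨?_, ?_⟩
    · have := hn j hj
      change D.n - 1 + 1 = D.n
      omega
    · rw [mosaic_connects]
      have : D.n - 1 + 1 = D.n := by have := hn j hj; omega
      simp only [Conn, Fin.rev_rev, this]
      exact hj.2
  · intro j j' hj hj' h
    simpa using h
  · rintro ⟨r, c, s⟩ ⟨h1, h2⟩
    rw [mosaic_connects] at h2
    simp only at h1 h2
    have hr : (Fin.rev r : ℕ) + 1 = D.n - r := by simp only [Fin.val_rev]; have := r.2; omega
    cases s
    · exfalso
      simp only [OnBoundary, Conn] at h1 h2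
      rw [hr, h1, Nat.sub_zero] at h2
      exact D.north _ h2
    · exfalso
      simp only [OnBoundary, Conn] at h1 h2
      have : (Fin.rev r : ℕ) = 0 := by have := r.2; omega
      rw [this] at h2
      exact D.south _ h2
    · simp only [OnBoundary, Conn] at h1 h2
      rw [h1] at h2
      refine ⟨(Fin.rev r : ℕ), ⟨(Fin.rev r).2, h2⟩, ?_⟩
      have : c = ⟨D.n - 1, Nat.sub_lt c.pos one_pos⟩ := by ext; simp; omega
      rw [this]
      simp only [Fin.eta, Fin.rev_rev]
    · exfalso
      simp only [OnBoundary, Conn] at h1 h2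
      rw [h1] at h2
      exact D.west _ h2

theorem realization_mosaic : D.mosaic.realization = carrier D.edges (D.pos 1) := by
  rw [carrier_eq]
  have key : ∀ i j : Fin D.n, (fun x => tileCorner i j + x) '' (D.mosaic i j).realization =
      D.tileSet j (Fin.rev i) := by
    intro i j
    rw [D.tileSet_eq j.2 (Fin.rev i).2]
    congr 1
    ext1 x
    congr 1
    have : ((Fin.rev i : ℕ) : ℝ) = D.n - 1 - i := by
      rw [Fin.val_rev, Nat.cast_sub (Nat.succ_le_of_lt i.2)]; push_cast; ring
    rw [this]
    rfl
  unfold Mosaic.realization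
  simp only [key, tileSet]
  rw [iUnion_comm]
  refine iUnion_congr fun i => ?_
  exact (Fin.revPerm (n := D.n)).surjective.iUnion_comp
    (fun j : Fin D.n => ⋃ (s : Side) (_ : D.Conn i j s),
      segment ℝ (D.pos 1 (wall i j s)) (D.pos 1 (D.center i j s)))

end GridData
end

noncomputable section
open Set Filter Topology

/-! ### General position -/

theorem exists_generic {ι : Type*} (S : Finset ι) (a b : ι → ℝ) (h : ∀ i ∈ S, a i ≠ 0 ∨ b i ≠ 0)
    {ε : ℝ} (hε : 0 < ε) : ∃ s ∈ Ioo 0 ε, ∀ i ∈ S, a i + s * b i ≠ 0 := by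
  have hbad : (⋃ i ∈ S, {s : ℝ | a i + s * b i = 0}).Finite := by
    refine S.finite_toSet.biUnion fun i hi => Set.Subsingleton.finite ?_
    intro s hs s' hs'
    simp only [mem_ofPred_eq] at hs hs'
    have h1 : (s - s') * b i = 0 := by linear_combination hs - hs'
    rcases mul_eq_zero.1 h1 with h2 | h2
    · exact sub_eq_zero.1 h2
    · rw [h2, mul_zero, add_zero] at hs
      rcases h i hi with h3 | h3
      · exact absurd hs h3
      · exact absurd h2 h3
  obtain ⟨s, hs, hsb⟩ := ((Ioo_infinite hε).sdiff hbad).nonempty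
  refine ⟨s, hs, fun i hi h0 => hsb ?_⟩
  simp only [mem_iUnion]
  exact ⟨i, hi, h0⟩

variable {V : Type*}

open Classical in
/-- The labels that occur in a polygon. -/
def verts (E : Finset (V × V)) : Finset V := E.image Prod.fst ∪ E.image Prod.snd

theorem mem_verts {E : Finset (V × V)} {v : V} : v ∈ verts E ↔ Used E v := by
  simp only [verts, Finset.mem_union, Finset.mem_image]
  constructor
  · rintro (⟨e, he, rfl⟩ | ⟨e, he, rfl⟩)
    · exact ⟨e, he, Or.inl rfl⟩
    · exact ⟨e, he, Or.inr rfl⟩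
  · rintro ⟨e, he, rfl | rfl⟩
    · exact Or.inl ⟨e, he, rfl⟩
    · exact Or.inr ⟨e, he, rfl⟩

theorem exists_injOn_pos (S : Finset V) : ∃ k : V → ℝ, InjOn k S ∧ ∀ v, 0 < k v := by
  classical
  refine ⟨fun v => (S.toList.idxOf v : ℝ) + 1, ?_, fun v => by positivity⟩
  intro v hv w hw h
  have h1 : S.toList.idxOf v = S.toList.idxOf w := by
    have : (S.toList.idxOf v : ℝ) = S.toList.idxOf w := by simpa using h
    exact_mod_cast this
  exact (List.idxOf_inj (Finset.mem_toList.2 hv)).1 h1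

theorem Emb.injOn {O : Set E3} {E : Finset (V × V)} {p : V → E3} (hE : Emb O E p) {v v' : V}
    (hv : Used E v) (hv' : Used E v') (h : p v = p v') : v = v' := by
  obtain ⟨e, he, hev⟩ := hv
  have hx : p v' ∈ segment ℝ (p e.1) (p e.2) := by
    rw [← h]
    rcases hev with rfl | rfl
    · exact left_mem_segment _ _ _
    · exact right_mem_segment _ _ _
  have := hE.inc_of_mem hv' he hx
  have hne := hE.ne e he
  rcases hev with rfl | rfl <;> rcases this with rfl | rfl
  · rfl
  · exact absurd h hne
  · exact absurd h.symm hne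
  · rfl

/-- General position with respect to one coordinate. -/
theorem Emb.exists_moves_coord {E : Finset (V × V)} {p : V → E3} (hE : Emb openCube E p)
    (d : E3) (i : Fin 3) (hd : d i = 1) {η : ℝ} (hη : 0 < η)
    (hb : ∀ v v', Used E v → Used E v' → p v ∉ openCube → p v' ∉ openCube → p v i = p v' i →
      v = v' ∨ i = 0) :
    ∃ (s : ℝ) (k : V → ℝ), (∀ v, Used E v → ‖(s * k v) • d‖ ≤ η) ∧
      (∀ v, p v ∉ openCube → k v = 0) ∧ Moves openCube E p (fun v => p v + (s * k v) • d) ∧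
      ∀ v v', Used E v → Used E v' → (p v + (s * k v) • d) i = (p v' + (s * k v') • d) i →
        v = v' ∨ (p v ∉ openCube ∧ p v' ∉ openCube ∧ i = 0) := by
  classical
  obtain ⟨k0, hk0, hk0p⟩ := exists_injOn_pos (verts E)
  let k : V → ℝ := fun v => if p v ∈ openCube then k0 v else 0
  obtain ⟨ε, hε, hper⟩ := hE.perturb isOpen_openCube convex_openCube
  obtain ⟨M, hM, hMb⟩ : ∃ M > 0, ∀ v ∈ verts E, |k v| * ‖d‖ ≤ M := by
    refine ⟨1 + ∑ v ∈ verts E, |k v| * ‖d‖, by positivity, fun v hv => ?_⟩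
    have := Finset.single_le_sum (f := fun v => |k v| * ‖d‖) (fun w _ => by positivity) hv
    linarith
  let S := ((verts E) ×ˢ (verts E)).filter fun q => q.1 ≠ q.2 ∧ ¬ (p q.1 ∉ openCube ∧
    p q.2 ∉ openCube ∧ i = 0)
  have hδ : 0 < min ε η / M := div_pos (lt_min hε hη) hM
  obtain ⟨s, hs, hsS⟩ := exists_generic S (fun q => p q.1 i - p q.2 i) (fun q => k q.1 - k q.2) (by
    rintro ⟨v, v'⟩ hq
    simp only [S, Finset.mem_filter, Finset.mem_product, mem_verts] at hq
    obtain ⟨⟨hv, hv'⟩, hne, hnb⟩ := hq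
    by_cases h1 : p v ∈ openCube
    · right
      by_cases h2 : p v' ∈ openCube
      · simp only [k, if_pos h1, if_pos h2]
        intro h
        exact hne (hk0 (mem_verts.2 hv) (mem_verts.2 hv') (sub_eq_zero.1 h))
      · simp only [k, if_pos h1, if_neg h2, sub_zero]
        exact (hk0p v).ne'
    · by_cases h2 : p v' ∈ openCube
      · right
        simp only [k, if_neg h1, if_pos h2, zero_sub, neg_ne_zero]
        exact (hk0p v').ne'
      · left
        intro h
        rcases hb v v' hv hv' h1 h2 (sub_eq_zero.1 h) with h3 | h3
        · exact hne h3
        · exact hnb ⟨h1, h2, h3⟩) hδ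
  have hsmall : ∀ v, Used E v → ‖(s * k v) • d‖ ≤ min ε η := by
    intro v hv
    have h1 := hMb v (mem_verts.2 hv)
    rw [norm_smul, Real.norm_eq_abs, abs_mul, abs_of_pos hs.1, mul_assoc]
    have h2 := hs.2
    rw [lt_div_iff₀ hM] at h2
    nlinarith [hs.1]
  have hk0' : ∀ v, p v ∉ openCube → k v = 0 := fun v hv => if_neg hv
  refine ⟨s, k, fun v hv => (hsmall v hv).trans (min_le_right _ _), hk0', ?_, ?_⟩
  · apply hper
    · intro v hv
      rw [add_sub_cancel_left]
      exact (hsmall v hv).trans (min_le_left _ _)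
    · intro v hv hvO
      simp only [hk0' v hvO, mul_zero, zero_smul, add_zero]
  · intro v v' hv hv' h
    by_contra! hcon
    have hq : (v, v') ∈ S := by
      simp only [S, Finset.mem_filter, Finset.mem_product, mem_verts]
      exact ⟨⟨hv, hv'⟩, hcon.1, fun h => hcon.2 h.1 h.2.1 h.2.2⟩
    apply hsS _ hq
    simp only [PiLp.add_apply, PiLp.smul_apply, smul_eq_mul, hd, mul_one] at h
    linarith

/-- After a small isotopy no edge is orthogonal to the first coordinate axis. -/
theorem Emb.exists_moves_transverse {E : Finset (V × V)} {p : V → E3} (hE : Emb openCube E p)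
    (hb : ∀ v, Used E v → p v ∉ openCube → p v 0 = 1) :
    ∃ p' : V → E3, Moves openCube E p p' ∧ (∀ v, p v ∉ openCube → p' v = p v) ∧
      (∀ e ∈ E, p' e.1 0 ≠ p' e.2 0) := by
  obtain ⟨s, k, -, hk, hm, hgen⟩ := hE.exists_moves_coord !₂[1, 0, 0] 0 (by simp) one_pos
    (fun v v' _ _ _ _ _ => Or.inr rfl)
  refine ⟨_, hm, fun v hv => by simp [hk v hv], fun e he h => ?_⟩
  rcases hgen e.1 e.2 ⟨e, he, Or.inl rfl⟩ ⟨e, he, Or.inr rfl⟩ h with h1 | ⟨h1, h2, -⟩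
  · exact hE.ne e he (by rw [h1])
  · have h3 := hb e.1 ⟨e, he, Or.inl rfl⟩ h1
    have h4 := hb e.2 ⟨e, he, Or.inr rfl⟩ h2
    have hmid : midpoint ℝ (p e.1) (p e.2) ∈ openCube := by
      apply hE.sub e he
      rw [openSegment_eq_image']
      refine ⟨1 / 2, by norm_num, ?_⟩
      rw [midpoint_eq_smul_add, invOf_eq_inv]
      module
    have h5 := hmid 0
    rw [midpoint_eq_smul_add] at h5
    simp [h3, h4] at h5
    norm_num at h5

end

noncomputable section
open Set Filter Topology

/-! ### Levels of a transverse polygon -/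

variable {V : Type*}

/-- The point of the line through the edge `e` whose first coordinate is `x`. -/
def level (p : V → E3) (e : V × V) (x : ℝ) : E3 :=
  along p e ((x - p e.1 0) / (p e.2 0 - p e.1 0))

/-- The edge `e` meets the plane of level `x`. -/
def Meets (p : V → E3) (e : V × V) (x : ℝ) : Prop := x ∈ uIcc (p e.1 0) (p e.2 0)

theorem Meets.of_mem {p : V → E3} {e : V × V} {x y z : ℝ} (hx : Meets p e x) (hz : Meets p e z)
    (h : y ∈ Icc x z) : Meets p e y := by
  exact ⟨hx.1.trans h.1, h.2.trans hz.2⟩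

theorem continuous_level (p : V → E3) (e : V × V) : Continuous (level p e) := by
  unfold level along
  fun_prop

theorem level_combo {p : V → E3} {e : V × V} (h : p e.1 0 ≠ p e.2 0) (τ α β : ℝ) :
    level p e ((1 - τ) * α + τ * β) = (1 - τ) • level p e α + τ • level p e β := by
  have h' : p e.2 0 - p e.1 0 ≠ 0 := sub_ne_zero.2 h.symm
  have : ((1 - τ) * α + τ * β - p e.1 0) / (p e.2 0 - p e.1 0) =
      (1 - τ) * ((α - p e.1 0) / (p e.2 0 - p e.1 0)) +
        τ * ((β - p e.1 0) / (p e.2 0 - p e.1 0)) := by field_simp; ring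
  unfold level along
  rw [this]
  module

theorem level_zero {p : V → E3} {e : V × V} (h : p e.1 0 ≠ p e.2 0) (x : ℝ) :
    level p e x 0 = x := by
  have h' : p e.2 0 - p e.1 0 ≠ 0 := sub_ne_zero.2 h.symm
  simp only [level, along, PiLp.add_apply, PiLp.smul_apply, smul_eq_mul]
  field_simp
  ring

theorem level_along {p : V → E3} {e : V × V} (h : p e.1 0 ≠ p e.2 0) (s : ℝ) :
    level p e (along p e s 0) = along p e s := by
  have h' : p e.2 0 - p e.1 0 ≠ 0 := sub_ne_zero.2 h.symm
  have : ((along p e s) 0 - p e.1 0) / (p e.2 0 - p e.1 0) = s := by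
    simp only [along, PiLp.add_apply, PiLp.smul_apply, smul_eq_mul]
    field_simp
    ring
  rw [level, this]

theorem Meets.param {p : V → E3} {e : V × V} (h : p e.1 0 ≠ p e.2 0) {x : ℝ} :
    Meets p e x ↔ (x - p e.1 0) / (p e.2 0 - p e.1 0) ∈ Icc (0 : ℝ) 1 := by
  rw [Meets]
  rcases lt_or_gt_of_ne h with h | h
  · rw [uIcc_of_le h.le, mem_Icc, mem_Icc, le_div_iff₀ (sub_pos.2 h), div_le_one (sub_pos.2 h)]
    constructor <;> rintro ⟨h1, h2⟩ <;> constructor <;> linarith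
  · rw [uIcc_of_ge h.le, mem_Icc, mem_Icc, le_div_iff_of_neg (sub_neg.2 h),
      div_le_one_of_neg (sub_neg.2 h)]
    constructor <;> rintro ⟨h1, h2⟩ <;> constructor <;> linarith

theorem mem_segment_iff_level {p : V → E3} {e : V × V} (h : p e.1 0 ≠ p e.2 0) {z : E3} :
    z ∈ segment ℝ (p e.1) (p e.2) ↔ Meets p e (z 0) ∧ level p e (z 0) = z := by
  rw [mem_segment_iff_along]
  constructor
  · rintro ⟨s, hs, rfl⟩
    refine ⟨(Meets.param h).2 ?_, level_along h s⟩
    have h' : p e.2 0 - p e.1 0 ≠ 0 := sub_ne_zero.2 h.symm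
    have : ((along p e s) 0 - p e.1 0) / (p e.2 0 - p e.1 0) = s := by
      simp only [along, PiLp.add_apply, PiLp.smul_apply, smul_eq_mul]
      field_simp
      ring
    rwa [this]
  · rintro ⟨h1, h2⟩
    exact ⟨_, (Meets.param h).1 h1, h2⟩

theorem level_mem {p : V → E3} {e : V × V} (h : p e.1 0 ≠ p e.2 0) {x : ℝ} (hx : Meets p e x) :
    level p e x ∈ segment ℝ (p e.1) (p e.2) := by
  rw [mem_segment_iff_level h, level_zero h]
  exact ⟨hx, rfl⟩

theorem mem_segment_level {p : V → E3} {e : V × V} (h : p e.1 0 ≠ p e.2 0) {α β : ℝ} (hαβ : α < β)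
    {z : E3} : z ∈ segment ℝ (level p e α) (level p e β) ↔
      z 0 ∈ Icc α β ∧ level p e (z 0) = z := by
  constructor
  · intro hz
    rw [segment_eq_image] at hz
    obtain ⟨τ, hτ, rfl⟩ := hz
    simp only
    rw [← level_combo h, level_zero h]
    refine ⟨⟨?_, ?_⟩, rfl⟩ <;> nlinarith [hτ.1, hτ.2]
  · rintro ⟨h1, h2⟩
    rw [segment_eq_image]
    refine ⟨(z 0 - α) / (β - α), ⟨div_nonneg (by linarith [h1.1]) (by linarith),
      (div_le_one (by linarith)).2 (by linarith [h1.2])⟩, ?_⟩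
    simp only
    rw [← level_combo h, ← h2, level_zero h]
    congr 1
    have : β - α ≠ 0 := by linarith
    field_simp
    ring

/-- The slab between the levels `α` and `β` is good with centre `m` and radius `r`: there are no
vertices strictly between the levels except for the level `m`, the edges through the slab move by
less than `r`, and edges with different centres are `2 * r` apart. -/
structure GoodSlab (E : Finset (V × V)) (p : V → E3) (α m β r : ℝ) : Prop where
  left : α < m
  right : m < β
  vert : ∀ v, Used E v → α < p v 0 → p v 0 < β → p v 0 = m
  near : ∀ e ∈ E, Meets p e m → ∀ j, j ≠ 0 →
    |level p e α j - level p e m j| < r ∧ |level p e β j - level p e m j| < r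
  far : ∀ e ∈ E, ∀ e' ∈ E, Meets p e m → Meets p e' m → level p e m ≠ level p e' m →
    ∃ j, j ≠ 0 ∧ 2 * r ≤ |level p e m j - level p e' m j|

section Good

variable {E : Finset (V × V)} {p : V → E3}

theorem exists_separation (htr : ∀ e ∈ E, p e.1 0 ≠ p e.2 0) (x : ℝ) :
    ∃ r > 0, ∀ e ∈ E, ∀ e' ∈ E, level p e x ≠ level p e' x →
      ∃ j, j ≠ 0 ∧ 2 * r ≤ |level p e x j - level p e' x j| := by
  have : ∀ᶠ r in 𝓝[>] (0 : ℝ), ∀ e ∈ E, ∀ e' ∈ E, level p e x ≠ level p e' x →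
      ∃ j, j ≠ 0 ∧ 2 * r ≤ |level p e x j - level p e' x j| := by
    refine (eventually_all_finset _).2 fun e he => (eventually_all_finset _).2 fun e' he' => ?_
    by_cases hne : level p e x = level p e' x
    · exact Eventually.of_forall fun _ h => absurd hne h
    have : ∃ j : Fin 3, j ≠ 0 ∧ level p e x j - level p e' x j ≠ 0 := by
      by_contra! hcon
      apply hne
      have h0 : level p e x 0 = level p e' x 0 := by
        rw [level_zero (htr e he), level_zero (htr e' he')]
      exact E3.ext h0 (sub_eq_zero.1 (hcon 1 (by decide))) (sub_eq_zero.1 (hcon 2 (by decide)))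
    obtain ⟨j, hj, hd⟩ := this
    filter_upwards [Ioo_mem_nhdsGT (show (0 : ℝ) < |level p e x j - level p e' x j| / 2 by positivity)]
      with r hr _
    exact ⟨j, hj, by linarith [hr.2]⟩
  obtain ⟨r, h1, h2⟩ := (this.and self_mem_nhdsWithin).exists
  exact ⟨r, h2, h1⟩

theorem eventually_level (x : ℝ) {r : ℝ} (hr : 0 < r) :
    ∀ᶠ y in 𝓝 x, ∀ e ∈ E, ∀ j, |level p e y j - level p e x j| < r := by
  refine (eventually_all_finset _).2 fun e he => ?_
  refine eventually_all.2 fun j => ?_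
  have : Continuous fun y => |level p e y j - level p e x j| := by
    have := continuous_level p e
    fun_prop
  refine this.tendsto' x 0 (by simp) |>.eventually_lt_const hr

theorem eventually_vert (x : ℝ) : ∀ᶠ y in 𝓝 x, ∀ v, Used E v →
    ¬ (x < p v 0 ∧ p v 0 ≤ y) ∧ ¬ (y ≤ p v 0 ∧ p v 0 < x) := by
  have : ∀ᶠ y in 𝓝 x, ∀ v ∈ verts E, ¬ (x < p v 0 ∧ p v 0 ≤ y) ∧ ¬ (y ≤ p v 0 ∧ p v 0 < x) := by
    refine (eventually_all_finset _).2 fun v _ => ?_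
    rcases lt_trichotomy x (p v 0) with h | h | h
    · filter_upwards [gt_mem_nhds h] with y hy
      exact ⟨fun h' => by linarith [h'.2], fun h' => by linarith [h'.2]⟩
    · exact Eventually.of_forall fun y => ⟨fun h' => by linarith [h'.1], fun h' => by linarith [h'.2]⟩
    · filter_upwards [lt_mem_nhds h] with y hy
      exact ⟨fun h' => by linarith [h'.1], fun h' => by linarith [h'.1]⟩
  filter_upwards [this] with y hy v hv using hy v (mem_verts.2 hv)

theorem eventually_goodSlab (htr : ∀ e ∈ E, p e.1 0 ≠ p e.2 0) (x : ℝ) :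
    ∃ r > 0, ∃ ε > 0, ∀ α ∈ Ioo (x - ε) x, ∀ β ∈ Ioo x (x + ε), GoodSlab E p α x β r := by
  obtain ⟨r, hr, hsep⟩ := exists_separation htr x
  obtain ⟨ε, hε, h⟩ := Metric.eventually_nhds_iff.1
    ((eventually_level (E := E) (p := p) x hr).and (eventually_vert (E := E) (p := p) x))
  refine ⟨r, hr, ε, hε, fun α hα β hβ => ?_⟩
  obtain ⟨a1, a2⟩ := h (y := α) (by rw [Real.dist_eq, abs_lt]; constructor <;> linarith [hα.1, hα.2])
  obtain ⟨b1, b2⟩ := h (y := β) (by rw [Real.dist_eq, abs_lt]; constructor <;> linarith [hβ.1, hβ.2])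
  refine ⟨hα.2, hβ.1, fun v hv h1 h2 => ?_, fun e he _ j _ => ⟨a1 e he j, b1 e he j⟩,
    fun e he e' he' _ _ => hsep e he e' he'⟩
  by_contra hne
  rcases lt_or_gt_of_ne hne with h3 | h3
  · exact (a2 v hv).2 ⟨h1.le, h3⟩
  · exact (b2 v hv).1 ⟨h3, h2.le⟩

/-- Near a level at which no two edges meet there are good slabs on each side. -/
theorem eventually_goodSlab_side (htr : ∀ e ∈ E, p e.1 0 ≠ p e.2 0) (x : ℝ)
    (hx : ∀ e ∈ E, ∀ e' ∈ E, Meets p e x → Meets p e' x → level p e x = level p e' x → e = e') :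
    ∃ r > 0, ∃ ε > 0, (∀ α ∈ Ioo (x - ε) x, GoodSlab E p α ((α + x) / 2) x r) ∧
      ∀ β ∈ Ioo x (x + ε), GoodSlab E p x ((x + β) / 2) β r := by
  obtain ⟨r, hr, hsep⟩ := exists_separation htr x
  obtain ⟨ε, hε, h⟩ := Metric.eventually_nhds_iff.1
    ((eventually_level (E := E) (p := p) x (show 0 < r / 4 by positivity)).and
      (eventually_vert (E := E) (p := p) x))
  have hab : ∀ a b c : ℝ, |a - c| < r / 4 → |b - c| < r / 4 → |a - b| < r / 2 := by
    intro a b c h1 h2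
    rw [abs_lt] at *
    constructor <;> linarith [h1.1, h1.2, h2.1, h2.2]
  have key : ∀ y m, |y - x| < ε → |m - x| < ε → (y < x → y ≤ m ∧ m ≤ x) → (x < y → x ≤ m ∧ m ≤ y) →
      y ≠ x →
      (∀ e ∈ E, ∀ j, |level p e y j - level p e m j| < r / 2) ∧
      (∀ e ∈ E, ∀ j, |level p e x j - level p e m j| < r / 2) ∧
      ∀ e ∈ E, ∀ e' ∈ E, Meets p e m → Meets p e' m → level p e m ≠ level p e' m →
        ∃ j, j ≠ 0 ∧ 2 * (r / 2) ≤ |level p e m j - level p e' m j| := by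
    intro y m hy hm hl hg hyx
    obtain ⟨y1, y2⟩ := h (y := y) (by rwa [Real.dist_eq])
    obtain ⟨m1, m2⟩ := h (y := m) (by rwa [Real.dist_eq])
    refine ⟨fun e he j => hab _ _ _ (y1 e he j) (m1 e he j),
      fun e he j => hab _ _ _ (by rw [sub_self, abs_zero]; linarith) (m1 e he j), ?_⟩
    intro e he e' he' hem hem' hne
    have hmx : ∀ e ∈ E, Meets p e m → Meets p e x := by
      intro e he hem
      by_contra hcon
      have hu1 : Used E e.1 := ⟨e, he, Or.inl rfl⟩
      have hu2 : Used E e.2 := ⟨e, he, Or.inr rfl⟩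
      have c1 := m2 _ hu1
      have c2 := m2 _ hu2
      rw [Meets, mem_uIcc] at hem hcon
      push Not at hcon c1 c2
      rcases hem with ⟨h1, h2⟩ | ⟨h1, h2⟩
      · by_cases hx1 : p e.1 0 ≤ x
        · have := hcon.1 hx1
          exact absurd (c2.2 h2) (not_le.2 this)
        · push Not at hx1
          exact absurd h1 (not_le.2 (c1.1 hx1))
      · by_cases hx1 : p e.2 0 ≤ x
        · have := hcon.2 hx1
          exact absurd (c1.2 h2) (not_le.2 this)
        · push Not at hx1
          exact absurd h1 (not_le.2 (c2.1 hx1))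
    have hxx : level p e x ≠ level p e' x := by
      intro hcon
      have := hx e he e' he' (hmx e he hem) (hmx e' he' hem') hcon
      exact hne (by rw [this])
    obtain ⟨j, hj, hd⟩ := hsep e he e' he' hxx
    refine ⟨j, hj, ?_⟩
    have t1 := m1 e he j
    have t2 := m1 e' he' j
    have t3 := abs_sub_abs_le_abs_sub (level p e x j - level p e' x j)
      (level p e m j - level p e' m j)
    have t4 : |level p e x j - level p e' x j - (level p e m j - level p e' m j)| ≤ r / 2 := by
      rw [abs_lt] at t1 t2
      rw [abs_le]
      constructor <;> linarith
    linarith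
  refine ⟨r / 2, by positivity, ε, hε, fun α hα => ?_, fun β hβ => ?_⟩
  · obtain ⟨k1, k2, k3⟩ := key α ((α + x) / 2)
      (by rw [abs_lt]; constructor <;> linarith [hα.1, hα.2])
      (by rw [abs_lt]; constructor <;> linarith [hα.1, hα.2])
      (fun _ => by constructor <;> linarith [hα.1, hα.2])
      (fun _ => by linarith [hα.1, hα.2]) hα.2.ne
    refine ⟨by linarith [hα.2], by linarith [hα.2], fun v hv h1 h2 => ?_,
      fun e he _ j _ => ⟨k1 e he j, k2 e he j⟩, k3⟩
    exact absurd ⟨h1.le, h2⟩ ((h (y := α)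
      (by rw [Real.dist_eq, abs_lt]; constructor <;> linarith [hα.1, hα.2])).2 v hv).2
  · obtain ⟨k1, k2, k3⟩ := key β ((x + β) / 2)
      (by rw [abs_lt]; constructor <;> linarith [hβ.1, hβ.2])
      (by rw [abs_lt]; constructor <;> linarith [hβ.1, hβ.2])
      (fun _ => by linarith [hβ.1, hβ.2])
      (fun _ => by constructor <;> linarith [hβ.1, hβ.2]) hβ.1.ne'
    refine ⟨by linarith [hβ.1], by linarith [hβ.1], fun v hv h1 h2 => ?_,
      fun e he _ j _ => ⟨k2 e he j, k1 e he j⟩, k3⟩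
    exact absurd ⟨h1, h2.le⟩ ((h (y := β)
      (by rw [Real.dist_eq, abs_lt]; constructor <;> linarith [hβ.1, hβ.2])).2 v hv).1

/-- The relation between the two levels of a good slab. -/
def GoodStep (E : Finset (V × V)) (p : V → E3) (α β : ℝ) : Prop :=
  ∃ m r, 0 < r ∧ GoodSlab E p α m β r

theorem reflTransGen_goodStep (htr : ∀ e ∈ E, p e.1 0 ≠ p e.2 0) {a b : ℝ} (hab : a < b)
    (ha : ∀ e ∈ E, ∀ e' ∈ E, Meets p e a → Meets p e' a → level p e a = level p e' a → e = e')
    (hb : ∀ e ∈ E, ∀ e' ∈ E, Meets p e b → Meets p e' b → level p e b = level p e' b → e = e')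
    (hv : ∀ e ∈ E, ∀ e' ∈ E, e ≠ e' → ∀ x, Meets p e x → Meets p e' x →
      level p e x = level p e' x → ∃ v, Used E v ∧ p v 0 = x) :
    Relation.ReflTransGen (GoodStep E p) a b := by
  let P : ℝ → Prop := fun x => ∀ e ∈ E, ∀ e' ∈ E, Meets p e x → Meets p e' x →
    level p e x = level p e' x → e = e'
  let S : Set ℝ := {s | s ∈ Icc a b ∧ P s ∧ Relation.ReflTransGen (GoodStep E p) a s}
  have haS : a ∈ S := ⟨⟨le_rfl, hab.le⟩, ha, .refl⟩
  have hbdd : BddAbove S := ⟨b, fun s hs => hs.1.2⟩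
  set x := sSup S with hxdef
  have hax : a ≤ x := le_csSup hbdd haS
  have hxb : x ≤ b := csSup_le ⟨a, haS⟩ fun s hs => hs.1.2
  have hsup : ∀ ε > 0, ∃ s ∈ S, s ∈ Ioc (x - ε) x := by
    intro ε hε
    obtain ⟨s, hs, h⟩ := exists_lt_of_lt_csSup ⟨a, haS⟩ (show x - ε < sSup S by linarith)
    exact ⟨s, hs, h, le_csSup hbdd hs⟩
  rcases eq_or_lt_of_le hxb with hxb | hxb
  · obtain ⟨r, hr, ε, hε, h1, -⟩ := eventually_goodSlab_side htr b hb
    obtain ⟨s, hs, hs1, hs2⟩ := hsup ε hε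
    rw [hxb] at hs1 hs2
    rcases eq_or_lt_of_le hs2 with h | h
    · exact h ▸ hs.2.2
    · exact hs.2.2.tail ⟨_, r, hr, h1 s ⟨hs1, h⟩⟩
  · exfalso
    have step : ∃ s ∈ S, ∃ ε > 0, ∀ β ∈ Ioo x (x + ε), GoodStep E p s β := by
      obtain ⟨r, hr, ε, hε, h1⟩ := eventually_goodSlab htr x
      obtain ⟨s, hs, hs1, hs2⟩ := hsup ε hε
      rcases eq_or_lt_of_le hs2 with h | h
      · obtain ⟨r, hr, ε, hε, -, h1⟩ := eventually_goodSlab_side htr x (h ▸ hs.2.1)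
        exact ⟨s, hs, ε, hε, fun β hβ => ⟨_, r, hr, h.symm ▸ h1 β hβ⟩⟩
      · exact ⟨s, hs, ε, hε, fun β hβ => ⟨x, r, hr, h1 s ⟨hs1, h⟩ β hβ⟩⟩
    obtain ⟨s, hs, ε, hε, h⟩ := step
    have hfin : ((fun v => p v 0) '' (verts E : Set V)).Finite := (verts E).finite_toSet.image _
    obtain ⟨β, hβ, hβv⟩ := ((Ioo_infinite (show x < min b (x + ε) from
      lt_min hxb (by linarith))).sdiff hfin).nonempty
    have hβb := hβ.2.trans_le (min_le_left _ _)
    have hβε := hβ.2.trans_le (min_le_right _ _)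
    have : β ∈ S := by
      refine ⟨⟨hax.trans hβ.1.le, hβb.le⟩, ?_, hs.2.2.tail (h β ⟨hβ.1, hβε⟩)⟩
      intro e he e' he' h1 h2 h3
      by_contra hne
      obtain ⟨v, hv1, hv2⟩ := hv e he e' he' hne β h1 h2 h3
      exact hβv ⟨v, Finset.mem_coe.2 (mem_verts.2 hv1), hv2⟩
    exact absurd (le_csSup hbdd this) (not_le.2 hβ.1)

theorem exists_levels_of_reflTransGen {a b : ℝ}
    (h : Relation.ReflTransGen (GoodStep E p) a b) :
    ∃ (N : ℕ) (U : ℕ → ℝ) (r : ℕ → ℝ), StrictMono U ∧ U 0 = a ∧ U (2 * N) = b ∧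
      ∀ i < N, 0 < r i ∧ GoodSlab E p (U (2 * i)) (U (2 * i + 1)) (U (2 * i + 2)) (r i) := by
  induction h with
  | refl =>
    refine ⟨0, fun i => a + i, fun _ => 1, ?_, by simp, by simp, by simp⟩
    intro i j hij
    have : (i : ℝ) < j := by exact_mod_cast hij
    simpa using this
  | @tail c d _ hcd ih =>
    obtain ⟨N, U, r, hU, h0, hN, hg⟩ := ih
    obtain ⟨m, ρ, hρ, hm⟩ := hcd
    let U' : ℕ → ℝ := fun i => if i ≤ 2 * N then U i else if i = 2 * N + 1 then m else
      d + ((i : ℝ) - (2 * N + 2))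
    have u1 : ∀ i, i ≤ 2 * N → U' i = U i := fun i hi => if_pos hi
    have u2 : U' (2 * N + 1) = m := by
      simp only [U']; rw [if_neg (by omega)]; simp
    have u3 : ∀ i, 2 * N + 2 ≤ i → U' i = d + ((i : ℝ) - (2 * N + 2)) := by
      intro i hi
      simp only [U']; rw [if_neg (by omega), if_neg (by omega)]
    have u4 : U' (2 * N + 2) = d := by rw [u3 _ le_rfl]; push_cast; ring
    refine ⟨N + 1, U', fun i => if i < N then r i else ρ, ?_, ?_, ?_, ?_⟩
    · refine strictMono_nat_of_lt_succ fun i => ?_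
      rcases lt_trichotomy i (2 * N) with hi | hi | hi
      · rw [u1 i hi.le, u1 (i + 1) hi]
        exact hU (Nat.lt_succ_self i)
      · rw [hi, u1 _ le_rfl, u2, hN]
        exact hm.left
      · rcases eq_or_lt_of_le (Nat.succ_le_of_lt hi) with hi | hi
        · rw [← hi, Nat.succ_eq_add_one, u2, u4]
          exact hm.right
        · rw [u3 i (by omega), u3 (i + 1) (by omega)]
          push_cast; linarith
    · rw [u1 0 (Nat.zero_le _), h0]
    · exact u4
    · intro i hi
      by_cases hiN : i < N
      · rw [u1 _ (by omega), u1 _ (by omega), u1 _ (by omega)]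
        simp only [if_pos hiN]
        exact hg i hiN
      · have : i = N := by omega
        subst this
        simp only [if_neg hiN]
        rw [u1 _ le_rfl, u2, u4, hN]
        exact ⟨hρ, hm⟩

end Good

end

noncomputable section
open Set Filter Topology

/-! ### Columns -/

theorem exists_index_Ioc {U : ℕ → ℝ} {M : ℕ} {x : ℝ} (h0 : U 0 < x) (hM : x ≤ U M) :
    ∃ j < M, U j < x ∧ x ≤ U (j + 1) := by
  induction M with
  | zero => linarith
  | succ M ih =>
    rcases le_or_gt x (U M) with h | h
    · obtain ⟨j, hj, h⟩ := ih h
      exact ⟨j, hj.trans (Nat.lt_succ_self M), h⟩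
    · exact ⟨M, Nat.lt_succ_self M, h, hM⟩

theorem exists_index_Ico {U : ℕ → ℝ} {M : ℕ} {x : ℝ} (h0 : U 0 ≤ x) (hM : x < U M) :
    ∃ j < M, U j ≤ x ∧ x < U (j + 1) := by
  induction M with
  | zero => linarith
  | succ M ih =>
    rcases lt_or_ge x (U M) with h | h
    · obtain ⟨j, hj, h⟩ := ih h
      exact ⟨j, hj.trans (Nat.lt_succ_self M), h⟩
    · exact ⟨M, Nat.lt_succ_self M, h, hM⟩

theorem Moves.apply {V : Type*} {O : Set E3} {E : Finset (V × V)} {p p' : V → E3}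
    (h : Moves O E p p') : ∃ H : E3 ≃ₜ E3, (∀ x, x ∉ O → H x = x) ∧
      (∀ v, Used E v → H (p v) = p' v) ∧ H '' carrier E p = carrier E p' := by
  obtain ⟨H, h1, h2⟩ := h
  refine ⟨H, h1, ?_, ?_⟩
  · rintro v ⟨e, he, rfl | rfl⟩
    · simpa [along_zero] using h2 e he 0 (by simp)
    · simpa [along_one] using h2 e he 1 (by simp)
  · ext y
    simp only [mem_image, mem_carrier, mem_segment_iff_along]
    constructor
    · rintro ⟨_, ⟨e, he, s, hs, rfl⟩, rfl⟩
      exact ⟨e, he, s, hs, (h2 e he s hs).symm⟩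
    · rintro ⟨e, he, s, hs, rfl⟩
      exact ⟨_, ⟨e, he, s, hs, rfl⟩, h2 e he s hs⟩

section Pieces

variable {V : Type*} {E : Finset (V × V)} {p : V → E3} {U : ℕ → ℝ} {M : ℕ} {O : Set E3}

open Classical in
/-- The pieces of the edges between consecutive levels. -/
def pieces (E : Finset (V × V)) (p : V → E3) (U : ℕ → ℝ) (M : ℕ) : Finset (E3 × E3) :=
  ((E ×ˢ Finset.range M).filter fun q => Meets p q.1 (U q.2) ∧ Meets p q.1 (U (q.2 + 1))).image
    fun q => (level p q.1 (U q.2), level p q.1 (U (q.2 + 1)))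

theorem mem_pieces {q : E3 × E3} : q ∈ pieces E p U M ↔ ∃ e ∈ E, ∃ j < M, Meets p e (U j) ∧
    Meets p e (U (j + 1)) ∧ q = (level p e (U j), level p e (U (j + 1))) := by
  simp only [pieces, Finset.mem_image, Finset.mem_filter, Finset.mem_product, Finset.mem_range]
  constructor
  · rintro ⟨⟨e, j⟩, ⟨⟨h1, h2⟩, h3, h4⟩, rfl⟩
    exact ⟨e, h1, j, h2, h3, h4, rfl⟩
  · rintro ⟨e, h1, j, h2, h3, h4, rfl⟩
    exact ⟨(e, j), ⟨⟨h1, h2⟩, h3, h4⟩, rfl⟩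

theorem emb_pieces (hE : Emb O E p) (htr : ∀ e ∈ E, p e.1 0 ≠ p e.2 0) (hU : StrictMono U)
    (hv : ∀ j < M, ∀ v, Used E v → ¬ (U j < p v 0 ∧ p v 0 < U (j + 1))) :
    Emb O (pieces E p U M) id := by
  refine ⟨?_, ?_, ?_⟩
  · intro q hq h
    obtain ⟨e, he, j, hj, -, -, rfl⟩ := mem_pieces.1 hq
    have := congrArg (fun x : E3 => x 0) h
    simp only [id, level_zero (htr e he)] at this
    exact (hU (Nat.lt_succ_self j)).ne this
  · intro q hq q' hq' hne x hx hx'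
    obtain ⟨e, he, j, hj, h1, h2, rfl⟩ := mem_pieces.1 hq
    obtain ⟨e', he', j', hj', h1', h2', rfl⟩ := mem_pieces.1 hq'
    simp only [id] at hx hx'
    rw [mem_segment_level (htr e he) (hU (Nat.lt_succ_self j))] at hx
    rw [mem_segment_level (htr e' he') (hU (Nat.lt_succ_self j'))] at hx'
    have key : (x 0 = U j ∨ x 0 = U (j + 1)) ∧ (x 0 = U j' ∨ x 0 = U (j' + 1)) := by
      rcases lt_trichotomy j j' with h | h | h
      · have h3 := hU.monotone (Nat.succ_le_of_lt h)
        exact ⟨Or.inr (le_antisymm hx.1.2 (h3.trans hx'.1.1)),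
          Or.inl (le_antisymm (hx.1.2.trans h3) hx'.1.1)⟩
      · subst h
        have hee : e ≠ e' := by rintro rfl; exact hne rfl
        obtain ⟨v, hev, -, hxv⟩ := hE.inter e he e' he' hee x
          ((mem_segment_iff_level (htr e he)).2 ⟨h1.of_mem h2 hx.1, hx.2⟩)
          ((mem_segment_iff_level (htr e' he')).2 ⟨h1'.of_mem h2' hx'.1, hx'.2⟩)
        have h3 := hv j hj v ⟨e, he, hev⟩
        rw [← hxv] at h3
        have : x 0 = U j ∨ x 0 = U (j + 1) := by
          rcases eq_or_lt_of_le hx.1.1 with h4 | h4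
          · exact Or.inl h4.symm
          · rcases eq_or_lt_of_le hx.1.2 with h5 | h5
            · exact Or.inr h5
            · exact absurd ⟨h4, h5⟩ h3
        exact ⟨this, this⟩
      · have h3 := hU.monotone (Nat.succ_le_of_lt h)
        exact ⟨Or.inl (le_antisymm (hx'.1.2.trans h3) hx.1.1),
          Or.inr (le_antisymm hx'.1.2 (h3.trans hx.1.1))⟩
    refine ⟨x, ?_, ?_, rfl⟩
    · rcases key.1 with h | h <;> rw [h] at hx
      · exact Or.inl hx.2.symm
      · exact Or.inr hx.2.symm
    · rcases key.2 with h | h <;> rw [h] at hx'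
      · exact Or.inl hx'.2.symm
      · exact Or.inr hx'.2.symm
  · intro q hq
    obtain ⟨e, he, j, hj, h1, h2, rfl⟩ := mem_pieces.1 hq
    simp only [id]
    refine Subset.trans ?_ (hE.sub e he)
    rw [openSegment_eq_image]
    rintro _ ⟨τ, hτ, rfl⟩
    simp only
    rw [← level_combo (htr e he)]
    have hz : (1 - τ) * U j + τ * U (j + 1) ∈ Ioo (U j) (U (j + 1)) := by
      have := hU (Nat.lt_succ_self j)
      constructor <;> nlinarith [hτ.1, hτ.2]
    have hm := level_mem (htr e he) (h1.of_mem h2 ⟨hz.1.le, hz.2.le⟩)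
    rw [← insert_endpoints_openSegment] at hm
    have hlt : ∀ v, p v 0 = (1 - τ) * U j + τ * U (j + 1) → Used E v → False := by
      intro v h3 h4
      exact hv j hj v h4 (h3 ▸ hz)
    rcases hm with hm | hm | hm
    · exact (hlt e.1 (by rw [← hm, level_zero (htr e he)]) ⟨e, he, Or.inl rfl⟩).elim
    · exact (hlt e.2 (by rw [← hm, level_zero (htr e he)]) ⟨e, he, Or.inr rfl⟩).elim
    · exact hm

theorem carrier_pieces (htr : ∀ e ∈ E, p e.1 0 ≠ p e.2 0) (hU : StrictMono U)
    (hv : ∀ j < M, ∀ v, Used E v → ¬ (U j < p v 0 ∧ p v 0 < U (j + 1)))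
    (hr : ∀ v, Used E v → U 0 ≤ p v 0 ∧ p v 0 ≤ U M) :
    carrier (pieces E p U M) id = carrier E p := by
  ext x
  constructor
  · intro hx
    obtain ⟨q, hq, hx⟩ := mem_carrier.1 hx
    obtain ⟨e, he, j, hj, h1, h2, rfl⟩ := mem_pieces.1 hq
    simp only [id] at hx
    rw [mem_segment_level (htr e he) (hU (Nat.lt_succ_self j))] at hx
    exact mem_carrier.2 ⟨e, he, (mem_segment_iff_level (htr e he)).2 ⟨h1.of_mem h2 hx.1, hx.2⟩⟩
  · intro hx
    obtain ⟨e, he, hx⟩ := mem_carrier.1 hx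
    rw [mem_segment_iff_level (htr e he)] at hx
    have hu1 : Used E e.1 := ⟨e, he, Or.inl rfl⟩
    have hu2 : Used E e.2 := ⟨e, he, Or.inr rfl⟩
    obtain ⟨v, v', hv1, hv2, hlt, hmeet⟩ : ∃ v v', Used E v ∧ Used E v' ∧ p v 0 < p v' 0 ∧
        ∀ x, Meets p e x ↔ x ∈ Icc (p v 0) (p v' 0) := by
      rcases lt_or_gt_of_ne (htr e he) with h | h
      · exact ⟨e.1, e.2, hu1, hu2, h, fun x => by rw [Meets, uIcc_of_le h.le]⟩
      · exact ⟨e.2, e.1, hu2, hu1, h, fun x => by rw [Meets, uIcc_of_ge h.le]⟩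
    have hx1 := (hmeet _).1 hx.1
    obtain ⟨j, hj, hxj, m1, m2⟩ : ∃ j < M, x 0 ∈ Icc (U j) (U (j + 1)) ∧ p v 0 < U (j + 1) ∧
        U j < p v' 0 := by
      rcases eq_or_lt_of_le hx1.1 with h | h
      · obtain ⟨j, hj, h1, h2⟩ := exists_index_Ico (U := U) (M := M) (x := x 0)
          ((hr v hv1).1.trans hx1.1) (by rw [← h]; exact hlt.trans_le (hr v' hv2).2)
        exact ⟨j, hj, ⟨h1, h2.le⟩, h ▸ h2, h1.trans_lt (h ▸ hlt)⟩
      · obtain ⟨j, hj, h1, h2⟩ := exists_index_Ioc (U := U) (M := M) (x := x 0)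
          ((hr v hv1).1.trans_lt h) (hx1.2.trans (hr v' hv2).2)
        exact ⟨j, hj, ⟨h1.le, h2⟩, h.trans_le h2, h1.trans_le hx1.2⟩
    have n1 := hv j hj v hv1
    have n2 := hv j hj v' hv2
    push Not at n1 n2
    have n1' : p v 0 ≤ U j := by
      by_contra! hcon
      exact absurd m1 (not_lt.2 (n1 hcon))
    have n2' := n2 m2
    have hUj := (hU (Nat.lt_succ_self j)).le
    refine mem_carrier.2 ⟨_, mem_pieces.2 ⟨e, he, j, hj, (hmeet _).2 ⟨n1', hUj.trans n2'⟩,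
      (hmeet _).2 ⟨n1'.trans hUj, n2'⟩, rfl⟩, ?_⟩
    exact (mem_segment_level (htr e he) (hU (Nat.lt_succ_self j))).2 ⟨hxj, hx.2⟩

end Pieces

/-- A system of columns: the column `k` runs from the row point `A k` to the row point `B k`
through the centre `C k`, in the slab between the levels `lo k` and `hi k` and in a box around `k`. -/
structure Columns (K : Finset E3) (A B C : E3 → E3) (lo hi r : E3 → ℝ) : Prop where
  bounds : ∀ k ∈ K, -1 ≤ lo k ∧ hi k ≤ 1
  center : ∀ k ∈ K, lo k < C k 0 ∧ C k 0 < hi k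
  endA : ∀ k ∈ K, A k 0 = lo k ∨ A k 0 = hi k
  endB : ∀ k ∈ K, B k 0 = lo k ∨ B k 0 = hi k
  lt : ∀ k ∈ K, A k 1 < B k 1
  box : ∀ k ∈ K, ∀ x, x = A k ∨ x = B k ∨ x = C k → ∀ j, j ≠ 0 → |x j - k j| < r k ∧ |x j| < 1
  sep : ∀ k ∈ K, ∀ k' ∈ K, k ≠ k' → hi k ≤ lo k' ∨ hi k' ≤ lo k ∨
    ∃ j, j ≠ 0 ∧ r k + r k' ≤ |k j - k' j|
  rows : ∀ k ∈ K, ∀ k' ∈ K, ∀ x x', x = A k ∨ x = B k → x' = A k' ∨ x' = B k' → x 1 = x' 1 → x = x'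

/-- The union of the columns. -/
def columnSet (K : Finset E3) (A B C : E3 → E3) : Set E3 :=
  ⋃ k ∈ K, segment ℝ (A k) (C k) ∪ segment ℝ (C k) (B k)

theorem exists_columns {V : Type*} {E : Finset (V × V)} {p : V → E3} (hE : Emb openCube E p)
    (hc : TangleCharts openCube (carrier E p)) (htr : ∀ e ∈ E, p e.1 0 ≠ p e.2 0)
    (hb : ∀ v, Used E v → p v ∉ openCube → p v 0 = 1 ∧ |p v 1| < 1 ∧ |p v 2| < 1)
    (hby : ∀ v v', Used E v → Used E v' → p v ∉ openCube → p v' ∉ openCube → p v 1 = p v' 1 →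
      v = v') :
    ∃ (K : Finset E3) (A B C : E3 → E3) (lo hi r : E3 → ℝ) (H : E3 ≃ₜ E3),
      Columns K A B C lo hi r ∧ (∀ x, x ∉ openCube → H x = x) ∧
      H '' carrier E p = columnSet K A B C := by
  classical
  -- the levels
  have hD := hE.deg hc
  have hlt1 : ∀ v, Used E v → -1 < p v 0 ∧ p v 0 ≤ 1 := by
    intro v hv
    by_cases h : p v ∈ openCube
    · have := abs_lt.1 (h 0)
      exact ⟨this.1, this.2.le⟩
    · rw [(hb v hv h).1]; norm_num
  have hbd1 : ∀ v, Used E v → p v 0 = 1 → p v ∉ openCube := by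
    intro v hv h1 h2
    have := abs_lt.1 (h2 0)
    linarith
  have hmeet : ∀ e ∈ E, ∀ e' ∈ E, e ≠ e' → ∀ x, Meets p e x → Meets p e' x →
      level p e x = level p e' x → ∃ v, Inc e v ∧ Inc e' v ∧ p v = level p e x ∧ p v 0 = x := by
    intro e he e' he' hee x h1 h2 h3
    obtain ⟨v, hv, hv', hxv⟩ := hE.inter e he e' he' hee (level p e x) (level_mem (htr e he) h1)
      (h3 ▸ level_mem (htr e' he') h2)
    exact ⟨v, hv, hv', hxv.symm, by rw [← hxv, level_zero (htr e he)]⟩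
  have hchain : Relation.ReflTransGen (GoodStep E p) (-1) 1 := by
    apply reflTransGen_goodStep htr (by norm_num)
    · intro e he e' he' h1
      exfalso
      have a1 := (hlt1 e.1 ⟨e, he, Or.inl rfl⟩).1
      have a2 := (hlt1 e.2 ⟨e, he, Or.inr rfl⟩).1
      rw [Meets, mem_uIcc] at h1
      rcases h1 with h | h <;> linarith [h.1, h.2]
    · intro e he e' he' h1 h2 h3
      by_contra hee
      obtain ⟨v, hv, hv', -, hv1⟩ := hmeet e he e' he' hee 1 h1 h2 h3
      have hu : Used E v := ⟨e, he, hv⟩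
      obtain ⟨g, hg, -, hg'⟩ := hD.one v hu (hbd1 v hu hv1)
      exact hee ((hg' e he hv).trans (hg' e' he' hv').symm)
    · intro e he e' he' hee x h1 h2 h3
      obtain ⟨v, hv, hv', -, hv1⟩ := hmeet e he e' he' hee x h1 h2 h3
      exact ⟨v, ⟨e, he, hv⟩, hv1⟩
  obtain ⟨N, U, r, hU, hU0, hUN, hgood⟩ := exists_levels_of_reflTransGen hchain
  have hvert : ∀ j < 2 * N, ∀ v, Used E v → ¬ (U j < p v 0 ∧ p v 0 < U (j + 1)) := by
    rintro j hj v hv ⟨h1, h2⟩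
    rcases Nat.even_or_odd' j with ⟨i, rfl | rfl⟩
    · have hg := (hgood i (by omega)).2
      have := hg.vert v hv h1 (h2.trans hg.right)
      exact absurd this h2.ne
    · have hg := (hgood i (by omega)).2
      have := hg.vert v hv (hg.left.trans h1) h2
      exact absurd this h1.ne'
  have hrange : ∀ v, Used E v → U 0 ≤ p v 0 ∧ p v 0 ≤ U (2 * N) := by
    intro v hv
    rw [hU0, hUN]
    exact ⟨(hlt1 v hv).1.le, (hlt1 v hv).2⟩
  set Q := pieces E p U (2 * N) with hQ
  have hQE : Emb openCube Q id := emb_pieces hE htr hU hvert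
  have hQc : carrier Q id = carrier E p := carrier_pieces htr hU hvert hrange
  have hQD : Deg openCube Q id := hQE.deg (hQc ▸ hc)
  have hQb : ∀ v, Used Q v → v ∉ openCube → ∃ v', Used E v' ∧ p v' = v := by
    intro v hv hvO
    have : v ∈ carrier E p := hQc ▸ hv.mem_carrier
    obtain ⟨e, he, hve⟩ := mem_carrier.1 this
    rw [← insert_endpoints_openSegment] at hve
    rcases hve with rfl | rfl | hve
    · exact ⟨_, ⟨e, he, Or.inl rfl⟩, rfl⟩
    · exact ⟨_, ⟨e, he, Or.inr rfl⟩, rfl⟩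
    · exact absurd (hE.sub e he hve) hvO
  have hQb1 : ∀ v, Used Q v → v ∉ openCube → v 0 = 1 ∧ |v 1| < 1 ∧ |v 2| < 1 := by
    intro v hv hvO
    obtain ⟨v', hv', rfl⟩ := hQb v hv hvO
    exact hb v' hv' hvO
  -- the centres
  let K : Finset E3 := (verts Q).filter fun c => ∃ i < N, c 0 = U (2 * i + 1)
  have hK : ∀ c, c ∈ K ↔ Used Q c ∧ ∃ i < N, c 0 = U (2 * i + 1) := by
    intro c
    simp only [K, Finset.mem_filter, mem_verts]
  have hidx : ∀ c, ∃ i, c ∈ K → i < N ∧ c 0 = U (2 * i + 1) := by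
    intro c
    by_cases h : c ∈ K
    · obtain ⟨-, i, hi⟩ := (hK c).1 h
      exact ⟨i, fun _ => hi⟩
    · exact ⟨0, fun h' => absurd h' h⟩
  choose ix hix using hidx
  have hpiece : ∀ c ∈ K, ∀ q ∈ Q, Inc q c → ∃ d, (q = (c, d) ∨ q = (d, c)) ∧ Used Q d ∧
      ((q = (d, c) ∧ d 0 = U (2 * ix c)) ∨ (q = (c, d) ∧ d 0 = U (2 * ix c + 2))) ∧
      ∀ j, j ≠ 0 → |d j - c j| < r (ix c) := by
    intro c hcK q hq hqc
    obtain ⟨hi, hc0⟩ := hix c hcK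
    obtain ⟨e, he, j, hj, h1, h2, rfl⟩ := mem_pieces.1 hq
    have hg := (hgood _ hi).2
    generalize ix c = i at hi hc0 hg ⊢
    rcases hqc with h | h
    · change c = level p e (U j) at h
      have hj' : j = 2 * i + 1 := by
        apply hU.injective
        rw [← hc0, h, level_zero (htr e he)]
      subst hj'
      refine ⟨level p e (U (2 * i + 1 + 1)), Or.inl (by rw [← h]), ⟨_, hq, Or.inr rfl⟩,
        Or.inr ⟨by rw [← h], level_zero (htr e he) _⟩, fun j hj => ?_⟩
      have := (hg.near e he h1 j hj).2
      rwa [← h] at this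
    · change c = level p e (U (j + 1)) at h
      have hj' : j = 2 * i := by
        have : j + 1 = 2 * i + 1 := by
          apply hU.injective
          rw [← hc0, h, level_zero (htr e he)]
        omega
      subst hj'
      refine ⟨level p e (U (2 * i)), Or.inr (by rw [← h]), ⟨_, hq, Or.inl rfl⟩,
        Or.inl ⟨by rw [← h], level_zero (htr e he) _⟩, fun j hj => ?_⟩
      have := (hg.near e he h2 j hj).1
      rwa [← h] at this
  have hKO : ∀ c ∈ K, c ∈ openCube := by
    intro c hcK
    by_contra hcO
    obtain ⟨hi, hc0⟩ := hix c hcK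
    have h1 := (hQb1 c ((hK c).1 hcK).1 hcO).1
    rw [hc0, ← hUN] at h1
    have := hU.injective h1
    omega
  have hends : ∀ c, ∃ d d' : E3, c ∈ K → d ≠ d' ∧ Used Q d ∧ Used Q d' ∧
      (d 0 = U (2 * ix c) ∨ d 0 = U (2 * ix c + 2)) ∧
      (d' 0 = U (2 * ix c) ∨ d' 0 = U (2 * ix c + 2)) ∧
      (∀ j, j ≠ 0 → |d j - c j| < r (ix c)) ∧ (∀ j, j ≠ 0 → |d' j - c j| < r (ix c)) ∧
      ((c, d) ∈ Q ∨ (d, c) ∈ Q) ∧ ((c, d') ∈ Q ∨ (d', c) ∈ Q) ∧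
      ∀ g ∈ Q, Inc g c → (g = (c, d) ∨ g = (d, c)) ∨ (g = (c, d') ∨ g = (d', c)) := by
    intro c
    by_cases hcK : c ∈ K
    · obtain ⟨q, hq, q', hq', hne, hqc, hqc', hall⟩ := hQD.two c ((hK c).1 hcK).1 (hKO c hcK)
      obtain ⟨d, h1, h2, h3, h4⟩ := hpiece c hcK q hq hqc
      obtain ⟨d', h1', h2', h3', h4'⟩ := hpiece c hcK q' hq' hqc'
      refine ⟨d, d', fun _ => ⟨?_, h2, h2', h3.imp And.right And.right,
        h3'.imp And.right And.right, h4, h4', ?_, ?_, ?_⟩⟩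
      · rintro rfl
        have : U (2 * ix c) ≠ U (2 * ix c + 2) := fun h => by
          have := hU.injective h
          omega
        rcases h3 with ⟨a, b⟩ | ⟨a, b⟩ <;> rcases h3' with ⟨a', b'⟩ | ⟨a', b'⟩
        · exact hne (a.trans a'.symm)
        · exact this (b.symm.trans b')
        · exact this (b'.symm.trans b)
        · exact hne (a.trans a'.symm)
      · rcases h1 with h | h <;> rw [← h] <;> simp [hq]
      · rcases h1' with h | h <;> rw [← h] <;> simp [hq']
      · intro g hg hgc
        rcases hall g hg hgc with rfl | rfl
        · exact Or.inl h1
        · exact Or.inr h1'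
    · exact ⟨0, 0, fun h => absurd h hcK⟩
  choose D D' hDD using hends
  -- general position
  obtain ⟨η, hη, hηr⟩ : ∃ η > 0, ∀ c ∈ K, ∀ j, j ≠ 0 →
      |D c j - c j| + η < r (ix c) ∧ |D' c j - c j| + η < r (ix c) ∧ η < r (ix c) := by
    have : ∀ᶠ η in 𝓝[>] (0 : ℝ), ∀ c ∈ K, ∀ j : Fin 3, j ≠ 0 →
      |D c j - c j| + η < r (ix c) ∧ |D' c j - c j| + η < r (ix c) ∧ η < r (ix c) := by
      refine (eventually_all_finset _).2 fun c hcK => eventually_all.2 fun j => ?_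
      by_cases hj : j = 0
      · exact Eventually.of_forall fun _ h => absurd hj h
      obtain ⟨-, -, -, -, -, h1, h2, -⟩ := hDD c hcK
      have h3 := (hgood _ (hix c hcK).1).1
      filter_upwards [Ioo_mem_nhdsGT (sub_pos.2 (h1 j hj)), Ioo_mem_nhdsGT (sub_pos.2 (h2 j hj)),
        Ioo_mem_nhdsGT h3] with η a b c _
      exact ⟨by linarith [a.2], by linarith [b.2], c.2⟩
    obtain ⟨η, h1, h2⟩ := (this.and self_mem_nhdsWithin).exists
    exact ⟨η, h2, h1⟩
  obtain ⟨s, κ, hsm, hκ, hmv, hgen⟩ := hQE.exists_moves_coord !₂[0, 1, 0] 1 (by simp) hη (by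
    intro v v' hv hv' h1 h2 h3
    obtain ⟨a, ha, rfl⟩ := hQb v hv h1
    obtain ⟨a', ha', rfl⟩ := hQb v' hv' h2
    left
    rw [hby a a' ha ha' h1 h2 h3])
  set w : E3 → E3 := fun v => id v + (s * κ v) • (!₂[0, 1, 0] : E3) with hw
  have hw0 : ∀ v, w v 0 = v 0 := by intro v; simp [hw]
  have hwd : ∀ v, Used Q v → ∀ j, |w v j - v j| ≤ η := by
    intro v hv j
    have h1 := (E3.abs_coord_le ((s * κ v) • (!₂[0, 1, 0] : E3)) j).trans (hsm v hv)
    have h2 : w v j - v j = ((s * κ v) • (!₂[0, 1, 0] : E3)) j := by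
      simp only [hw, id, PiLp.add_apply]; ring
    rwa [h2]
  have hy : ∀ v v', Used Q v → Used Q v' → w v 1 = w v' 1 → v = v' := by
    intro v v' hv hv' h
    rcases hgen v v' hv hv' h with h | ⟨-, -, h⟩
    · exact h
    · exact absurd h (by decide)
  obtain ⟨H, hH1, hH2, hH3⟩ := hmv.apply
  have hwO : ∀ v, Used Q v → ∀ j, j ≠ 0 → |w v j| < 1 := by
    intro v hv j hj
    by_cases hvO : v ∈ openCube
    · have : w v ∈ openCube := by
        rw [← hH2 v hv, ← image_eq_of_eqOn_compl H hH1]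
        exact mem_image_of_mem _ hvO
      exact this j
    · have h1 : w v = v := by simp [hw, hκ v hvO]
      rw [h1]
      obtain ⟨-, h2, h3⟩ := hQb1 v hv hvO
      fin_cases j
      · exact absurd rfl hj
      · exact h2
      · exact h3
  have hbox : ∀ c v, Used Q v → (∀ j, j ≠ 0 → |v j - c j| + η < r (ix c)) → ∀ j, j ≠ 0 →
      |w v j - c j| < r (ix c) ∧ |w v j| < 1 := by
    intro c v hv h j hj
    refine ⟨?_, hwO v hv j hj⟩
    have h1 := hwd v hv j
    have h2 := abs_add_le (w v j - v j) (v j - c j)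
    rw [sub_add_sub_cancel] at h2
    linarith [h j hj]
  have hDy : ∀ c ∈ K, w (D c) 1 ≠ w (D' c) 1 := by
    intro c hcK h
    obtain ⟨h1, h2, h3, -⟩ := hDD c hcK
    exact h1 (hy _ _ h2 h3 h)
  let A : E3 → E3 := fun c => if w (D c) 1 < w (D' c) 1 then w (D c) else w (D' c)
  let B : E3 → E3 := fun c => if w (D c) 1 < w (D' c) 1 then w (D' c) else w (D c)
  have hAB : ∀ c, (A c = w (D c) ∧ B c = w (D' c)) ∨ (A c = w (D' c) ∧ B c = w (D c)) := by
    intro c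
    simp only [A, B]
    split_ifs <;> simp
  have hrow : ∀ k ∈ K, ∀ x, x = A k ∨ x = B k → ∃ v, Used Q v ∧ x = w v ∧
      (v 0 = U (2 * ix k) ∨ v 0 = U (2 * ix k + 2)) ∧
      (∀ j, j ≠ 0 → |v j - k j| + η < r (ix k)) := by
    intro k hk x hx
    obtain ⟨-, h1, h2, h3, h4, -⟩ := hDD k hk
    have h5 := hηr k hk
    have : x = w (D k) ∨ x = w (D' k) := by
      rcases hAB k with ⟨a, b⟩ | ⟨a, b⟩ <;> rw [a, b] at hx <;> tauto
    rcases this with rfl | rfl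
    · exact ⟨_, h1, rfl, h3, fun j hj => (h5 j hj).1⟩
    · exact ⟨_, h2, rfl, h4, fun j hj => (h5 j hj).2.1⟩
  refine ⟨K, A, B, w, fun c => U (2 * ix c), fun c => U (2 * ix c + 2), fun c => r (ix c), H,
    ⟨?_, ?_, ?_, ?_, ?_, ?_, ?_, ?_⟩, hH1, ?_⟩
  · intro k hk
    obtain ⟨hi, -⟩ := hix k hk
    rw [← hU0, ← hUN]
    exact ⟨hU.monotone (Nat.zero_le _), hU.monotone (by omega)⟩
  · intro k hk
    obtain ⟨hi, h⟩ := hix k hk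
    rw [hw0, h]
    exact ⟨hU (by omega), hU (by omega)⟩
  · intro k hk
    obtain ⟨v, -, h1, h2, -⟩ := hrow k hk _ (Or.inl rfl)
    rw [h1, hw0]; exact h2
  · intro k hk
    obtain ⟨v, -, h1, h2, -⟩ := hrow k hk _ (Or.inr rfl)
    rw [h1, hw0]; exact h2
  · intro k hk
    have := hDy k hk
    simp only [A, B]
    split_ifs with h
    · exact h
    · exact lt_of_le_of_ne (not_lt.1 h) this.symm
  · intro k hk x hx j hj
    have : x = w k ∨ (x = A k ∨ x = B k) := by tauto
    rcases this with rfl | h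
    · refine hbox k k ((hK k).1 hk).1 (fun j hj => ?_) j hj
      rw [sub_self, abs_zero, zero_add]
      exact (hηr k hk j hj).2.2
    · obtain ⟨v, h1, rfl, -, h2⟩ := hrow k hk x h
      exact hbox k v h1 h2 j hj
  · intro k hk k' hk' hne
    obtain ⟨hi, h⟩ := hix k hk
    obtain ⟨hi', h'⟩ := hix k' hk'
    rcases lt_trichotomy (ix k) (ix k') with hlt | heq | hlt
    · exact Or.inl (hU.monotone (by omega))
    · right; right
      have hlev : ∀ c ∈ K, ix c = ix k → ∃ e ∈ E, Meets p e (U (2 * ix k + 1)) ∧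
          c = level p e (U (2 * ix k + 1)) := by
        intro c hcK hci
        obtain ⟨-, hc0⟩ := hix c hcK
        obtain ⟨q, hq, hqc⟩ := ((hK c).1 hcK).1
        obtain ⟨e, he, j, hj, h1, h2, rfl⟩ := mem_pieces.1 hq
        rw [hci] at hc0
        rcases hqc with h | h
        · have : c 0 = U j := by rw [h, level_zero (htr e he)]
          rw [← hc0, this]
          exact ⟨e, he, h1, h⟩
        · have : c 0 = U (j + 1) := by rw [h, level_zero (htr e he)]
          rw [← hc0, this]
          exact ⟨e, he, h2, h⟩
      obtain ⟨e, he, hem, hke⟩ := hlev k hk rfl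
      obtain ⟨e', he', hem', hke'⟩ := hlev k' hk' heq.symm
      have hfar := (hgood _ hi).2.far e he e' he' hem hem' (by rw [← hke, ← hke']; exact hne)
      rw [← hke, ← hke'] at hfar
      obtain ⟨j, hj, hd⟩ := hfar
      refine ⟨j, hj, ?_⟩
      simp only
      rw [← heq]
      linarith
    · exact Or.inr (Or.inl (hU.monotone (by omega)))
  · intro k hk k' hk' x x' hx hx' h
    obtain ⟨v, hv, rfl, -⟩ := hrow k hk x hx
    obtain ⟨v', hv', rfl, -⟩ := hrow k' hk' x' hx'
    rw [hy v v' hv hv' h]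
  · rw [← hQc, hH3]
    have hseg : ∀ k, segment ℝ (A k) (w k) ∪ segment ℝ (w k) (B k) =
        segment ℝ (w k) (w (D k)) ∪ segment ℝ (w k) (w (D' k)) := by
      intro k
      rcases hAB k with ⟨a, b⟩ | ⟨a, b⟩ <;> rw [a, b, segment_symm ℝ _ (w k)]
      rw [union_comm]
    ext x
    simp only [columnSet, mem_iUnion, exists_prop, hseg]
    constructor
    · intro hx
      obtain ⟨q, hq, hx⟩ := mem_carrier.1 hx
      obtain ⟨c, hcK, hqc⟩ : ∃ c ∈ K, Inc q c := by
        obtain ⟨e, he, j, hj, h1, h2, rfl⟩ := mem_pieces.1 hq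
        rcases Nat.even_or_odd' j with ⟨i, rfl | rfl⟩
        · exact ⟨_, (hK _).2 ⟨⟨_, hq, Or.inr rfl⟩, i, by omega, level_zero (htr e he) _⟩, Or.inr rfl⟩
        · exact ⟨_, (hK _).2 ⟨⟨_, hq, Or.inl rfl⟩, i, by omega, level_zero (htr e he) _⟩, Or.inl rfl⟩
      refine ⟨c, hcK, ?_⟩
      obtain ⟨-, -, -, -, -, -, -, -, -, hall⟩ := hDD c hcK
      rcases hall q hq hqc with (rfl | rfl) | (rfl | rfl)
      · exact Or.inl hx
      · exact Or.inl (segment_symm ℝ _ (w c) ▸ hx)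
      · exact Or.inr hx
      · exact Or.inr (segment_symm ℝ _ (w c) ▸ hx)
    · rintro ⟨k, hk, hx⟩
      obtain ⟨-, -, -, -, -, -, -, h1, h2, -⟩ := hDD k hk
      rw [mem_carrier]
      rcases hx with hx | hx
      · rcases h1 with h | h
        · exact ⟨_, h, hx⟩
        · exact ⟨_, h, segment_symm ℝ _ (w k) ▸ hx⟩
      · rcases h2 with h | h
        · exact ⟨_, h, hx⟩
        · exact ⟨_, h, segment_symm ℝ _ (w k) ▸ hx⟩

end

noncomputable section
open Set Filter Topology

/-! ### Stairs -/

theorem exists_injOn_mem_Ioo {ι : Type*} (K : Finset ι) (lo hi : ι → ℝ)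
    (h : ∀ k ∈ K, lo k < hi k) : ∃ x : ι → ℝ, (∀ k ∈ K, x k ∈ Ioo (lo k) (hi k)) ∧ InjOn x K := by
  classical
  induction K using Finset.induction_on with
  | empty => exact ⟨fun _ => 0, by simp, by simp⟩
  | insert a K ha ih =>
    obtain ⟨x, hx, hinj⟩ := ih fun k hk => h k (Finset.mem_insert_of_mem hk)
    obtain ⟨c, hc, hcx⟩ := ((Ioo_infinite (h a (Finset.mem_insert_self a K))).sdiff
      (K.finite_toSet.image x)).nonempty
    have hne : ∀ k ∈ K, k ≠ a := fun k hk hka => ha (hka ▸ hk)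
    refine ⟨Function.update x a c, fun k hk => ?_, ?_⟩
    · rcases Finset.mem_insert.1 hk with rfl | hk
      · rwa [Function.update_self]
      · rw [Function.update_of_ne (hne k hk)]
        exact hx k hk
    · rw [Finset.coe_insert]
      intro k hk k' hk' hkk
      rcases hk with rfl | hk <;> rcases hk' with rfl | hk'
      · rfl
      · rw [Function.update_self, Function.update_of_ne (hne k' hk')] at hkk
        exact absurd ⟨k', hk', hkk.symm⟩ hcx
      · rw [Function.update_self, Function.update_of_ne (hne k hk)] at hkk
        exact absurd ⟨k, hk, hkk⟩ hcx
      · rw [Function.update_of_ne (hne k' hk'), Function.update_of_ne (hne k hk)] at hkk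
        exact hinj hk hk' hkk

/-- The labels of stairs: row points, and two nodes for each column. -/
abbrev StairLabel : Type := E3 ⊕ (E3 × Bool)

/-- The positions of the vertices of stairs with given nodes. -/
def stairPos (q : E3 × Bool → E3) : StairLabel → E3 := Sum.elim id q

open Classical in
/-- The edges of stairs. -/
def stairEdges (K : Finset E3) (A B : E3 → E3) : Finset (StairLabel × StairLabel) :=
  K.biUnion fun k => {(Sum.inl (A k), Sum.inr (k, false)),
    (Sum.inr (k, false), Sum.inr (k, true)), (Sum.inr (k, true), Sum.inl (B k))}

theorem mem_stairEdges {K : Finset E3} {A B : E3 → E3} {e : StairLabel × StairLabel} :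
    e ∈ stairEdges K A B ↔ ∃ k ∈ K, e = (Sum.inl (A k), Sum.inr (k, false)) ∨
      e = (Sum.inr (k, false), Sum.inr (k, true)) ∨ e = (Sum.inr (k, true), Sum.inl (B k)) := by
  simp [stairEdges]

theorem coord_mem_of_mem_segment {a b x : E3} (hx : x ∈ segment ℝ a b) (j : Fin 3) {s : Set ℝ}
    (hs : Convex ℝ s) (ha : a j ∈ s) (hb : b j ∈ s) : x j ∈ s :=
  (convex_coord_preimage j hs).segment_subset ha hb hx

theorem eq_of_mem_segment_of_level {a q x : E3} {lo hi : ℝ} (ha : a 0 = lo ∨ a 0 = hi)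
    (hq : lo < q 0 ∧ q 0 < hi) (hx : x ∈ segment ℝ a q) (hx0 : x 0 = lo ∨ x 0 = hi) : x = a := by
  rw [segment_eq_image'] at hx
  obtain ⟨s, hs, rfl⟩ := hx
  simp only [PiLp.add_apply, PiLp.smul_apply, PiLp.sub_apply, smul_eq_mul] at hx0
  have h0 : s = 0 := by
    have h1 := hs.1
    have h2 := hs.2
    by_contra hs0
    have h3 : 0 < s := lt_of_le_of_ne h1 (Ne.symm hs0)
    rcases ha with h | h <;> rw [h] at hx0 <;> rcases hx0 with h4 | h4 <;> nlinarith
  simp [h0]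

/-- The nodes of stairs are admissible. -/
structure StairNodes (K : Finset E3) (A B : E3 → E3) (lo hi r : E3 → ℝ) (q : E3 × Bool → E3) :
    Prop where
  level : ∀ k ∈ K, ∀ b, lo k < q (k, b) 0 ∧ q (k, b) 0 < hi k
  box : ∀ k ∈ K, ∀ b, ∀ j, j ≠ 0 → |q (k, b) j - k j| < r k ∧ |q (k, b) j| < 1
  ne : ∀ k ∈ K, q (k, false) ≠ q (k, true)
  lower : ∀ k ∈ K, ∀ x ∈ segment ℝ (A k) (q (k, false)),
    x ∈ segment ℝ (q (k, false)) (q (k, true)) → x = q (k, false)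
  upper : ∀ k ∈ K, ∀ x ∈ segment ℝ (q (k, false)) (q (k, true)),
    x ∈ segment ℝ (q (k, true)) (B k) → x = q (k, true)
  outer : ∀ k ∈ K, ∀ x ∈ segment ℝ (A k) (q (k, false)), x ∉ segment ℝ (q (k, true)) (B k)

section Stairs

variable {K : Finset E3} {A B C : E3 → E3} {lo hi r : E3 → ℝ} {q q' : E3 × Bool → E3}

theorem StairNodes.emb (h : Columns K A B C lo hi r) (hq : StairNodes K A B lo hi r q) :
    Emb openCube (stairEdges K A B) (stairPos q) := by
  have hends : ∀ k ∈ K, (lo k ≤ A k 0 ∧ A k 0 ≤ hi k) ∧ lo k ≤ B k 0 ∧ B k 0 ≤ hi k := by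
    intro k hk
    have hlt := (h.center k hk).1.trans (h.center k hk).2
    constructor
    · rcases h.endA k hk with h1 | h1 <;> rw [h1] <;> constructor <;> linarith
    · rcases h.endB k hk with h1 | h1 <;> rw [h1] <;> constructor <;> linarith
  have hboxA : ∀ k ∈ K, ∀ j, j ≠ 0 → |A k j - k j| < r k ∧ |A k j| < 1 :=
    fun k hk j hj => h.box k hk _ (Or.inl rfl) j hj
  have hboxB : ∀ k ∈ K, ∀ j, j ≠ 0 → |B k j - k j| < r k ∧ |B k j| < 1 :=
    fun k hk j hj => h.box k hk _ (Or.inr (Or.inl rfl)) j hj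
  have hconv : ∀ c ρ : ℝ, Convex ℝ {y : ℝ | |y - c| < ρ} := by
    intro c ρ
    have : {y : ℝ | |y - c| < ρ} = Metric.ball c ρ := by ext; simp [Real.dist_eq]
    rw [this]
    exact convex_ball c ρ
  have hin : ∀ k ∈ K, ∀ e, (e = (Sum.inl (A k), Sum.inr (k, false)) ∨
      e = (Sum.inr (k, false), Sum.inr (k, true)) ∨ e = (Sum.inr (k, true), Sum.inl (B k))) →
      ∀ x ∈ segment ℝ (stairPos q e.1) (stairPos q e.2),
      (lo k ≤ x 0 ∧ x 0 ≤ hi k) ∧ (∀ j, j ≠ 0 → |x j - k j| < r k) ∧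
      ((x 0 = lo k ∨ x 0 = hi k) → ∃ v, (v = A k ∨ v = B k) ∧ Inc e (Sum.inl v) ∧ x = v) := by
    intro k hk e he x hx
    have hl0 := hq.level k hk false
    have hl1 := hq.level k hk true
    obtain ⟨hA, hB⟩ := hends k hk
    rcases he with rfl | rfl | rfl
    · refine ⟨coord_mem_of_mem_segment hx 0 (convex_Icc _ _) hA ⟨hl0.1.le, hl0.2.le⟩,
        fun j hj => coord_mem_of_mem_segment hx j (hconv _ _) (hboxA k hk j hj).1
          (hq.box k hk false j hj).1, fun hx0 => ⟨A k, Or.inl rfl, Or.inl rfl, ?_⟩⟩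
      exact eq_of_mem_segment_of_level (h.endA k hk) hl0 hx hx0
    · refine ⟨coord_mem_of_mem_segment hx 0 (convex_Icc _ _) ⟨hl0.1.le, hl0.2.le⟩
        ⟨hl1.1.le, hl1.2.le⟩, fun j hj => coord_mem_of_mem_segment hx j (hconv _ _)
        (hq.box k hk false j hj).1 (hq.box k hk true j hj).1, fun hx0 => ?_⟩
      have : x 0 ∈ Ioo (lo k) (hi k) := coord_mem_of_mem_segment hx 0 (convex_Ioo _ _) hl0 hl1
      rcases hx0 with h0 | h0 <;> rw [h0] at this
      · exact absurd this.1 (lt_irrefl _)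
      · exact absurd this.2 (lt_irrefl _)
    · refine ⟨coord_mem_of_mem_segment hx 0 (convex_Icc _ _) ⟨hl1.1.le, hl1.2.le⟩ hB,
        fun j hj => coord_mem_of_mem_segment hx j (hconv _ _) (hq.box k hk true j hj).1
          (hboxB k hk j hj).1, fun hx0 => ⟨B k, Or.inr rfl, Or.inr rfl, ?_⟩⟩
      rw [segment_symm] at hx
      exact eq_of_mem_segment_of_level (h.endB k hk) hl1 hx hx0
  have hcross : ∀ k ∈ K, ∀ k' ∈ K, ∀ e e', (e = (Sum.inl (A k), Sum.inr (k, false)) ∨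
      e = (Sum.inr (k, false), Sum.inr (k, true)) ∨ e = (Sum.inr (k, true), Sum.inl (B k))) →
      (e' = (Sum.inl (A k'), Sum.inr (k', false)) ∨
      e' = (Sum.inr (k', false), Sum.inr (k', true)) ∨ e' = (Sum.inr (k', true), Sum.inl (B k'))) →
      ∀ x ∈ segment ℝ (stairPos q e.1) (stairPos q e.2),
      x ∈ segment ℝ (stairPos q e'.1) (stairPos q e'.2) → hi k ≤ lo k' →
      ∃ v, Inc e v ∧ Inc e' v ∧ x = stairPos q v := by
    intro k hk k' hk' e e' he he' x hx hx' hle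
    obtain ⟨a1, -, a3⟩ := hin k hk e he x hx
    obtain ⟨b1, -, b3⟩ := hin k' hk' e' he' x hx'
    obtain ⟨v, hv, hev, hxv⟩ := a3 (Or.inr (le_antisymm a1.2 (hle.trans b1.1)))
    obtain ⟨v', hv', hev', hxv'⟩ := b3 (Or.inl (le_antisymm (a1.2.trans hle) b1.1))
    refine ⟨Sum.inl v, hev, ?_, hxv⟩
    rwa [← hxv, hxv']
  refine ⟨?_, ?_, ?_⟩
  · intro e he
    obtain ⟨k, hk, rfl | rfl | rfl⟩ := mem_stairEdges.1 he
    · intro h0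
      have h1 : A k 0 = q (k, false) 0 := congrArg (fun x : E3 => x 0) h0
      have := hq.level k hk false
      rcases h.endA k hk with h2 | h2 <;> linarith
    · exact hq.ne k hk
    · intro h0
      have h1 : q (k, true) 0 = B k 0 := congrArg (fun x : E3 => x 0) h0
      have := hq.level k hk true
      rcases h.endB k hk with h2 | h2 <;> linarith
  · intro e he e' he' hee x hx hx'
    obtain ⟨k, hk, hek⟩ := mem_stairEdges.1 he
    obtain ⟨k', hk', hek'⟩ := mem_stairEdges.1 he'
    by_cases hkk : k = k'
    · subst hkk
      rcases hek with rfl | rfl | rfl <;> rcases hek' with rfl | rfl | rfl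
      · exact absurd rfl hee
      · exact ⟨_, Or.inr rfl, Or.inl rfl, hq.lower k hk x hx hx'⟩
      · exact absurd hx' (hq.outer k hk x hx)
      · exact ⟨_, Or.inl rfl, Or.inr rfl, hq.lower k hk x hx' hx⟩
      · exact absurd rfl hee
      · exact ⟨_, Or.inr rfl, Or.inl rfl, hq.upper k hk x hx hx'⟩
      · exact absurd hx (hq.outer k hk x hx')
      · exact ⟨_, Or.inl rfl, Or.inr rfl, hq.upper k hk x hx' hx⟩
      · exact absurd rfl hee
    · rcases h.sep k hk k' hk' hkk with hs | hs | ⟨j, hj, hs⟩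
      · exact hcross k hk k' hk' e e' hek hek' x hx hx' hs
      · obtain ⟨v, h1, h2, h3⟩ := hcross k' hk' k hk e' e hek' hek x hx' hx hs
        exact ⟨v, h2, h1, h3⟩
      · exfalso
        have h1 := (hin k hk e hek x hx).2.1 j hj
        have h2 := (hin k' hk' e' hek' x hx').2.1 j hj
        have h3 := abs_sub_le (k j) (x j) (k' j)
        rw [abs_sub_comm] at h1
        linarith
  · intro e he x hx
    obtain ⟨k, hk, hek⟩ := mem_stairEdges.1 he
    have hl0 := hq.level k hk false
    have hl1 := hq.level k hk true
    obtain ⟨hA, hB⟩ := hends k hk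
    have hbd := h.bounds k hk
    have hone : ∀ j, {y : ℝ | |y| < 1} = {y : ℝ | |y - (0 : E3) j| < 1} := by intro j; simp
    have hother : ∀ j, j ≠ 0 → |x j| < 1 := by
      intro j hj
      have hx1 := openSegment_subset_segment _ _ _ hx
      have hc : Convex ℝ {y : ℝ | |y| < 1} := hone j ▸ hconv _ _
      rcases hek with rfl | rfl | rfl
      · exact coord_mem_of_mem_segment hx1 j hc (hboxA k hk j hj).2 (hq.box k hk false j hj).2
      · exact coord_mem_of_mem_segment hx1 j hc (hq.box k hk false j hj).2
          (hq.box k hk true j hj).2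
      · exact coord_mem_of_mem_segment hx1 j hc (hq.box k hk true j hj).2 (hboxB k hk j hj).2
    have hzero : |x 0| < 1 := by
      rw [openSegment_eq_image] at hx
      obtain ⟨s, hs, rfl⟩ := hx
      simp only [PiLp.add_apply, PiLp.smul_apply, smul_eq_mul]
      rw [abs_lt]
      have h1 := hs.1
      have h2 : 0 < 1 - s := sub_pos.2 hs.2
      rcases hek with rfl | rfl | rfl <;>
        simp only [stairPos, Sum.elim_inl, Sum.elim_inr, id] <;> constructor <;> nlinarith
    intro j
    by_cases hj : j = 0
    · rw [hj]; exact hzero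
    · exact hother j hj

theorem segment_union_midpoint (a b : E3) :
    segment ℝ a (midpoint ℝ a b) ∪ segment ℝ (midpoint ℝ a b) b = segment ℝ a b := by
  have hm := midpoint_mem_segment (𝕜 := ℝ) a b
  apply Subset.antisymm
  · exact union_subset ((convex_segment a b).segment_subset (left_mem_segment _ _ _) hm)
      ((convex_segment a b).segment_subset hm (right_mem_segment _ _ _))
  · intro x hx
    rw [segment_eq_image] at hx
    obtain ⟨s, hs, rfl⟩ := hx
    rcases le_total s (1 / 2) with h | h
    · left
      rw [segment_eq_image]
      refine ⟨2 * s, ⟨by linarith [hs.1], by linarith⟩, ?_⟩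
      simp only [midpoint_eq_smul_add, invOf_eq_inv]
      module
    · right
      rw [segment_eq_image]
      refine ⟨2 * s - 1, ⟨by linarith, by linarith [hs.2]⟩, ?_⟩
      simp only [midpoint_eq_smul_add, invOf_eq_inv]
      module

/-- Nodes of which the second one is the midpoint between the first one and the end. -/
structure MidNodes (K : Finset E3) (B : E3 → E3) (lo hi r : E3 → ℝ) (q : E3 × Bool → E3) :
    Prop where
  level : ∀ k ∈ K, lo k < q (k, false) 0 ∧ q (k, false) 0 < hi k
  box : ∀ k ∈ K, ∀ j, j ≠ 0 → |q (k, false) j - k j| < r k ∧ |q (k, false) j| < 1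
  mid : ∀ k ∈ K, q (k, true) = midpoint ℝ (q (k, false)) (B k)

theorem midpoint_apply_coord (a b : E3) (j : Fin 3) : (midpoint ℝ a b) j = (a j + b j) / 2 := by
  rw [midpoint_eq_smul_add, invOf_eq_inv]
  simp only [PiLp.add_apply, PiLp.smul_apply, smul_eq_mul]
  ring

theorem MidNodes.stairNodes (h : Columns K A B C lo hi r) (hq : MidNodes K B lo hi r q) :
    StairNodes K A B lo hi r q := by
  have hmid : ∀ k ∈ K, ∀ j, q (k, true) j = (q (k, false) j + B k j) / 2 := by
    intro k hk j
    rw [hq.mid k hk, midpoint_apply_coord]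
  have hBne : ∀ k ∈ K, B k 0 - q (k, false) 0 ≠ 0 := by
    intro k hk
    have := hq.level k hk
    rcases h.endB k hk with h1 | h1 <;> rw [h1]
    · linarith
    · exact (sub_pos.2 this.2).ne'
  have hhalf : ∀ k ∈ K, ∀ x ∈ segment ℝ (q (k, true)) (B k),
      ∃ s : ℝ, 1 / 2 ≤ s ∧ s ≤ 1 ∧ x = q (k, false) + s • (B k - q (k, false)) := by
    intro k hk x hx
    rw [hq.mid k hk, segment_eq_image] at hx
    obtain ⟨s, hs, rfl⟩ := hx
    refine ⟨(1 + s) / 2, by linarith [hs.1], by linarith [hs.2], ?_⟩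
    simp only [midpoint_eq_smul_add, invOf_eq_inv]
    module
  have hhalf' : ∀ k ∈ K, ∀ x ∈ segment ℝ (q (k, false)) (q (k, true)),
      ∃ s : ℝ, 0 ≤ s ∧ s ≤ 1 / 2 ∧ x = q (k, false) + s • (B k - q (k, false)) := by
    intro k hk x hx
    rw [hq.mid k hk, segment_eq_image] at hx
    obtain ⟨s, hs, rfl⟩ := hx
    refine ⟨s / 2, by linarith [hs.1], by linarith [hs.2], ?_⟩
    simp only [midpoint_eq_smul_add, invOf_eq_inv]
    module
  have hmeet : ∀ k ∈ K, ∀ x ∈ segment ℝ (A k) (q (k, false)), ∀ s : ℝ, 0 ≤ s →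
      x = q (k, false) + s • (B k - q (k, false)) → s = 0 := by
    intro k hk x hx s hs hxs
    rw [segment_symm, segment_eq_image'] at hx
    obtain ⟨s', hs', rfl⟩ := hx
    have h1 : s' • (A k - q (k, false)) = s • (B k - q (k, false)) := add_left_cancel hxs
    have h2 := congrArg (fun x : E3 => x 0) h1
    have h3 := congrArg (fun x : E3 => x 1) h1
    simp only [PiLp.smul_apply, PiLp.sub_apply, smul_eq_mul] at h2 h3
    have hl := hq.level k hk
    have hlt := h.lt k hk
    have h0 := hs'.1
    have heq : A k 0 = B k 0 → s = 0 := by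
      intro he
      rw [he] at h2
      have : s' = s := mul_right_cancel₀ (hBne k hk) h2
      rw [this] at h3
      have h4 : s * (B k 1 - A k 1) = 0 := by linarith
      exact (mul_eq_zero.1 h4).resolve_right (sub_pos.2 hlt).ne'
    rcases h.endA k hk with ha | ha <;> rcases h.endB k hk with hb | hb
    · exact heq (ha.trans hb.symm)
    · rw [ha, hb] at h2
      by_contra hne
      have : 0 < s := lt_of_le_of_ne hs (Ne.symm hne)
      nlinarith
    · rw [ha, hb] at h2
      by_contra hne
      have : 0 < s := lt_of_le_of_ne hs (Ne.symm hne)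
      nlinarith
    · exact heq (ha.trans hb.symm)
  refine ⟨?_, ?_, ?_, ?_, ?_, ?_⟩
  · intro k hk b
    have := hq.level k hk
    cases b
    · exact this
    · rw [hmid k hk]
      rcases h.endB k hk with h1 | h1 <;> rw [h1] <;> constructor <;> linarith
  · intro k hk b j hj
    have h1 := hq.box k hk j hj
    have h2 := h.box k hk (B k) (Or.inr (Or.inl rfl)) j hj
    cases b
    · exact h1
    · rw [hmid k hk, abs_lt, abs_lt]
      rw [abs_lt, abs_lt] at h1 h2
      refine ⟨⟨?_, ?_⟩, ?_, ?_⟩ <;> linarith [h1.1.1, h1.1.2, h1.2.1, h1.2.2, h2.1.1, h2.1.2, h2.2.1, h2.2.2]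
  · intro k hk h0
    have := congrArg (fun x : E3 => x 0) h0
    simp only at this
    rw [hmid k hk] at this
    exact hBne k hk (by linarith)
  · intro k hk x hx hx'
    obtain ⟨s, h1, h2, h3⟩ := hhalf' k hk x hx'
    rw [hmeet k hk x hx s h1 h3] at h3
    simpa using h3
  · intro k hk x hx hx'
    obtain ⟨s, h1, h2, h3⟩ := hhalf' k hk x hx
    obtain ⟨s', h1', h2', h3'⟩ := hhalf k hk x hx'
    have h4 := congrArg (fun x : E3 => x 0) (h3.symm.trans h3')
    simp only [PiLp.add_apply, PiLp.smul_apply, PiLp.sub_apply, smul_eq_mul] at h4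
    have h5 : s = s' := mul_right_cancel₀ (hBne k hk) (add_left_cancel h4)
    have h6 : s = 1 / 2 := by linarith
    rw [h3, h6, hq.mid k hk, midpoint_eq_smul_add, invOf_eq_inv]
    module
  · intro k hk x hx hx'
    obtain ⟨s, h1, h2, h3⟩ := hhalf k hk x hx'
    have := hmeet k hk x hx s (by linarith) h3
    linarith

/-- Nodes for which the second coordinate increases along the columns. -/
structure MonoNodes (K : Finset E3) (A B : E3 → E3) (lo hi r : E3 → ℝ) (q : E3 × Bool → E3) :
    Prop where
  level : ∀ k ∈ K, ∀ b, lo k < q (k, b) 0 ∧ q (k, b) 0 < hi k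
  box : ∀ k ∈ K, ∀ b, ∀ j, j ≠ 0 → |q (k, b) j - k j| < r k ∧ |q (k, b) j| < 1
  mono : ∀ k ∈ K, A k 1 ≤ q (k, false) 1 ∧ q (k, false) 1 < q (k, true) 1 ∧ q (k, true) 1 ≤ B k 1

theorem MonoNodes.stairNodes (hq : MonoNodes K A B lo hi r q) :
    StairNodes K A B lo hi r q := by
  have h1 : ∀ k ∈ K, ∀ x ∈ segment ℝ (A k) (q (k, false)), x 1 ≤ q (k, false) 1 := by
    intro k hk x hx
    exact coord_mem_of_mem_segment hx 1 (convex_Iic _) (hq.mono k hk).1 (mem_Iic.2 le_rfl)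
  have h3 : ∀ k ∈ K, ∀ x ∈ segment ℝ (q (k, true)) (B k), q (k, true) 1 ≤ x 1 := by
    intro k hk x hx
    exact coord_mem_of_mem_segment hx 1 (convex_Ici _) (mem_Ici.2 le_rfl) (hq.mono k hk).2.2
  refine ⟨hq.level, hq.box, fun k hk h0 => ?_, fun k hk x hx hx' => ?_, fun k hk x hx hx' => ?_,
    fun k hk x hx hx' => ?_⟩
  · have := (hq.mono k hk).2.1
    rw [h0] at this
    exact lt_irrefl _ this
  · have h := h1 k hk x hx
    rw [segment_eq_image'] at hx'
    obtain ⟨s, hs, rfl⟩ := hx'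
    simp only [PiLp.add_apply, PiLp.smul_apply, PiLp.sub_apply, smul_eq_mul] at h
    have h4 := (hq.mono k hk).2.1
    have : s = 0 := by
      have := hs.1
      by_contra hne
      have : 0 < s := lt_of_le_of_ne hs.1 (Ne.symm hne)
      nlinarith
    simp [this]
  · have h := h3 k hk x hx'
    rw [segment_symm, segment_eq_image'] at hx
    obtain ⟨s, hs, rfl⟩ := hx
    simp only [PiLp.add_apply, PiLp.smul_apply, PiLp.sub_apply, smul_eq_mul] at h
    have h4 := (hq.mono k hk).2.1
    have : s = 0 := by
      by_contra hne
      have : 0 < s := lt_of_le_of_ne hs.1 (Ne.symm hne)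
      nlinarith
    simp [this]
  · have := h1 k hk x hx
    have := h3 k hk x hx'
    linarith [(hq.mono k hk).2.1]

theorem moves_stairs (h : Columns K A B C lo hi r)
    (hq : ∀ t ∈ Icc (0 : ℝ) 1, StairNodes K A B lo hi r fun l => (1 - t) • q l + t • q' l) :
    Moves openCube (stairEdges K A B) (stairPos q) (stairPos q') := by
  have := moves_of_family isOpen_openCube convex_openCube (E := stairEdges K A B)
    (fun t => stairPos fun l => (1 - t) • q l + t • q' l) ?_ (fun t ht => (hq t ht).emb h) ?_
  · simpa using this
  · rintro (v | l) -
    · exact continuous_const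
    · simp only [stairPos, Sum.elim_inr]; fun_prop
  · rintro (v | ⟨k, b⟩) hv t ht t' ht' hvO
    · rfl
    · exfalso
      apply hvO
      have hk : k ∈ K := by
        obtain ⟨e, he, hev⟩ := hv
        obtain ⟨k', hk', rfl | rfl | rfl⟩ := mem_stairEdges.1 he <;>
          rcases hev with hev | hev <;> simp only [Sum.inr.injEq, Prod.mk.injEq, reduceCtorEq] at hev <;>
          exact hev.1 ▸ hk'
      have h1 := (hq t ht).level k hk b
      have h2 := h.bounds k hk
      intro j
      by_cases hj : j = 0
      · rw [hj, abs_lt]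
        exact ⟨h2.1.trans_lt h1.1, h1.2.trans_le h2.2⟩
      · exact ((hq t ht).box k hk b j hj).2

theorem combo_mem_Ioo {t a b l u : ℝ} (ht : t ∈ Icc (0 : ℝ) 1) (ha : l < a ∧ a < u)
    (hb : l < b ∧ b < u) : l < (1 - t) * a + t * b ∧ (1 - t) * a + t * b < u := by
  have := (convex_Ioo l u) ha hb (sub_nonneg.2 ht.2) ht.1 (by ring)
  simpa using this

theorem combo_box {t a b c ρ : ℝ} (ht : t ∈ Icc (0 : ℝ) 1) (ha : |a - c| < ρ ∧ |a| < 1)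
    (hb : |b - c| < ρ ∧ |b| < 1) :
    |(1 - t) * a + t * b - c| < ρ ∧ |(1 - t) * a + t * b| < 1 := by
  simp only [abs_lt] at *
  have h1 := combo_mem_Ioo (a := a) (b := b) (l := c - ρ) (u := c + ρ) ht
    ⟨by linarith [ha.1.1], by linarith [ha.1.2]⟩ ⟨by linarith [hb.1.1], by linarith [hb.1.2]⟩
  have h2 := combo_mem_Ioo ht ha.2 hb.2
  exact ⟨⟨by linarith, by linarith⟩, h2⟩

theorem MidNodes.combo (hq : MidNodes K B lo hi r q) (hq' : MidNodes K B lo hi r q') {t : ℝ}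
    (ht : t ∈ Icc (0 : ℝ) 1) : MidNodes K B lo hi r fun l => (1 - t) • q l + t • q' l := by
  refine ⟨fun k hk => ?_, fun k hk j hj => ?_, fun k hk => ?_⟩
  · simpa using combo_mem_Ioo ht (hq.level k hk) (hq'.level k hk)
  · simpa using combo_box ht (hq.box k hk j hj) (hq'.box k hk j hj)
  · rw [hq.mid k hk, hq'.mid k hk, midpoint_eq_smul_add, midpoint_eq_smul_add,
      midpoint_eq_smul_add, invOf_eq_inv]
    module

theorem MonoNodes.combo (hq : MonoNodes K A B lo hi r q) (hq' : MonoNodes K A B lo hi r q') {t : ℝ}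
    (ht : t ∈ Icc (0 : ℝ) 1) : MonoNodes K A B lo hi r fun l => (1 - t) • q l + t • q' l := by
  refine ⟨fun k hk b => ?_, fun k hk b j hj => ?_, fun k hk => ?_⟩
  · simpa using combo_mem_Ioo ht (hq.level k hk b) (hq'.level k hk b)
  · simpa using combo_box ht (hq.box k hk b j hj) (hq'.box k hk b j hj)
  · obtain ⟨a1, a2, a3⟩ := hq.mono k hk
    obtain ⟨b1, b2, b3⟩ := hq'.mono k hk
    simp only [PiLp.add_apply, PiLp.smul_apply, smul_eq_mul]
    have h1 := ht.1
    have h2 := sub_nonneg.2 ht.2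
    refine ⟨by nlinarith, ?_, by nlinarith⟩
    rcases eq_or_lt_of_le h1 with h | h
    · rw [← h]; simpa using a2
    · nlinarith

/-- The nodes of the rectangular stairs. -/
def rectNodes (A B : E3 → E3) (x : E3 → ℝ) : E3 × Bool → E3 :=
  fun l => if l.2 then !₂[x l.1, B l.1 1, B l.1 2] else !₂[x l.1, A l.1 1, A l.1 2]

theorem exists_stairs (h : Columns K A B C lo hi r) :
    ∃ x : E3 → ℝ, (∀ k ∈ K, x k ∈ Ioo (lo k) (hi k)) ∧ InjOn x K ∧
      Emb openCube (stairEdges K A B) (stairPos (rectNodes A B x)) ∧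
      ∃ H : E3 ≃ₜ E3, (∀ x, x ∉ openCube → H x = x) ∧
        H '' columnSet K A B C = carrier (stairEdges K A B) (stairPos (rectNodes A B x)) := by
  obtain ⟨x, hx, hxi⟩ := exists_injOn_mem_Ioo K lo hi
    fun k hk => (h.center k hk).1.trans (h.center k hk).2
  let q0 : E3 × Bool → E3 := fun l => if l.2 then midpoint ℝ (C l.1) (B l.1) else C l.1
  let c : E3 → E3 := fun k => !₂[C k 0, (A k 1 + B k 1) / 2, (A k 2 + B k 2) / 2]
  let q1 : E3 × Bool → E3 := fun l => if l.2 then midpoint ℝ (c l.1) (B l.1) else c l.1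
  have hboxA : ∀ k ∈ K, ∀ j, j ≠ 0 → |A k j - k j| < r k ∧ |A k j| < 1 :=
    fun k hk j hj => h.box k hk _ (Or.inl rfl) j hj
  have hboxB : ∀ k ∈ K, ∀ j, j ≠ 0 → |B k j - k j| < r k ∧ |B k j| < 1 :=
    fun k hk j hj => h.box k hk _ (Or.inr (Or.inl rfl)) j hj
  have hcj : ∀ k j, j ≠ 0 → c k j = (1 - 1 / 2) * A k j + (1 / 2) * B k j := by
    intro k j hj
    fin_cases j
    · exact absurd rfl hj
    · simp [c]; ring
    · simp [c]; ring
  have hm0 : MidNodes K B lo hi r q0 :=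
    ⟨fun k hk => h.center k hk, fun k hk j hj => h.box k hk _ (Or.inr (Or.inr rfl)) j hj,
      fun k hk => rfl⟩
  have hm1 : MidNodes K B lo hi r q1 := by
    refine ⟨fun k hk => ?_, fun k hk j hj => ?_, fun k hk => rfl⟩
    · simpa [q1, c] using h.center k hk
    · simp only [q1, Bool.false_eq_true, if_false, hcj k j hj]
      exact combo_box (by norm_num) (hboxA k hk j hj) (hboxB k hk j hj)
  have hn1 : MonoNodes K A B lo hi r q1 := by
    have hs := hm1.stairNodes h
    refine ⟨hs.level, hs.box, fun k hk => ?_⟩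
    have := h.lt k hk
    simp only [q1, Bool.false_eq_true, if_false, if_true, midpoint_apply_coord,
      hcj k 1 (by decide)]
    refine ⟨?_, ?_, ?_⟩ <;> linarith
  have hn2 : MonoNodes K A B lo hi r (rectNodes A B x) := by
    refine ⟨fun k hk b => ?_, fun k hk b j hj => ?_, fun k hk => ?_⟩
    · cases b <;> simpa [rectNodes] using hx k hk
    · have h1 := hboxA k hk j hj
      have h2 := hboxB k hk j hj
      fin_cases j
      · exact absurd rfl hj
      · cases b
        · simpa [rectNodes] using h1
        · simpa [rectNodes] using h2
      · cases b
        · simpa [rectNodes] using h1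
        · simpa [rectNodes] using h2
    · simpa [rectNodes] using h.lt k hk
  have hmv := (moves_stairs h fun t ht => (hm0.combo hm1 ht).stairNodes h).trans
    (moves_stairs h fun t ht => (hn1.combo hn2 ht).stairNodes)
  obtain ⟨H, hH, hHc⟩ := hmv.exists_image
  refine ⟨x, hx, hxi, hn2.stairNodes.emb h, H, hH, ?_⟩
  rw [← hHc]
  congr 1
  ext y
  have hu : ∀ k, segment ℝ (C k) (B k) = segment ℝ (C k) (midpoint ℝ (C k) (B k)) ∪
      segment ℝ (midpoint ℝ (C k) (B k)) (B k) := fun k => (segment_union_midpoint _ _).symm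
  simp only [columnSet, mem_iUnion, exists_prop, mem_carrier, mem_stairEdges, hu]
  constructor
  · rintro ⟨k, hk, hy | hy | hy⟩
    · exact ⟨_, ⟨k, hk, Or.inl rfl⟩, hy⟩
    · exact ⟨_, ⟨k, hk, Or.inr (Or.inl rfl)⟩, hy⟩
    · exact ⟨_, ⟨k, hk, Or.inr (Or.inr rfl)⟩, hy⟩
  · rintro ⟨e, ⟨k, hk, rfl | rfl | rfl⟩, hy⟩
    · exact ⟨k, hk, Or.inl hy⟩
    · exact ⟨k, hk, Or.inr (Or.inl hy)⟩
    · exact ⟨k, hk, Or.inr (Or.inr hy)⟩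

end Stairs

end

noncomputable section
open Set Filter Topology

/-! ### Reparametrization of the axes -/

/-- The piecewise linear extension of a sequence. -/
def piecewiseLinear (σ : ℤ → ℝ) (u : ℝ) : ℝ := σ ⌊u⌋ + Int.fract u * (σ (⌊u⌋ + 1) - σ ⌊u⌋)

theorem piecewiseLinear_add (σ : ℤ → ℝ) (m : ℤ) {t : ℝ} (ht : t ∈ Icc (0 : ℝ) 1) :
    piecewiseLinear σ (m + t) = (1 - t) * σ m + t * σ (m + 1) := by
  rcases eq_or_lt_of_le ht.2 with h | h
  · subst h
    have h1 : ⌊(m : ℝ) + 1⌋ = m + 1 := by simp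
    simp [piecewiseLinear, h1]
  · have h1 : ⌊(m : ℝ) + t⌋ = m := by
      rw [Int.floor_eq_iff]; constructor <;> linarith [ht.1]
    have h2 : Int.fract ((m : ℝ) + t) = t := by rw [Int.fract, h1]; ring
    rw [piecewiseLinear, h1, h2]; ring

theorem strictMono_piecewiseLinear {σ : ℤ → ℝ} (hσ : StrictMono σ) :
    StrictMono (piecewiseLinear σ) := by
  intro u v huv
  have hlow : ∀ u, σ ⌊u⌋ ≤ piecewiseLinear σ u ∧ piecewiseLinear σ u < σ (⌊u⌋ + 1) := by
    intro u
    have h1 := hσ (Int.lt_succ ⌊u⌋)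
    have h2 := Int.fract_nonneg u
    have h3 := Int.fract_lt_one u
    unfold piecewiseLinear
    constructor <;> nlinarith
  rcases eq_or_lt_of_le (Int.floor_le_floor huv.le) with h | h
  · have h1 := hσ (Int.lt_succ ⌊v⌋)
    have h2 : Int.fract u < Int.fract v := by
      rw [Int.fract, Int.fract, h]; linarith
    unfold piecewiseLinear
    rw [h]
    nlinarith
  · exact ((hlow u).2.trans_le (hσ.monotone (Int.add_one_le_of_lt h))).trans_le (hlow v).1

theorem surjective_piecewiseLinear {σ : ℤ → ℝ} (hσ : StrictMono σ)
    (hb : ∀ y, ∃ m, σ m ≤ y) (ha : ∀ y, ∃ m, y < σ m) :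
    Function.Surjective (piecewiseLinear σ) := by
  intro y
  obtain ⟨b, hb'⟩ := ha y
  obtain ⟨m, hm, hmax⟩ := Int.exists_greatest_of_bdd (P := fun m => σ m ≤ y)
    ⟨b, fun z hz => hσ.le_iff_le.1 (hz.trans hb'.le)⟩ (hb y)
  have h1 : y < σ (m + 1) := by
    by_contra! hcon
    have := hmax _ hcon
    omega
  have h2 := hσ (Int.lt_succ m)
  refine ⟨m + (y - σ m) / (σ (m + 1) - σ m), ?_⟩
  rw [piecewiseLinear_add σ m ⟨div_nonneg (by linarith) (by linarith),
    (div_le_one (by linarith)).2 (by linarith)⟩]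
  have : σ (m + 1) - σ m ≠ 0 := by linarith
  field_simp
  ring

/-- Finitely many points in an interval become the centres of unit intervals after a
piecewise linear change of coordinates. -/
theorem exists_axis (S : Finset ℝ) (hS : ∀ s ∈ S, s ∈ Ioo (-1 : ℝ) 1) (n : ℕ) (hn : 0 < n)
    (hSn : S.card ≤ n) :
    ∃ (θ : ℝ ≃o ℝ) (ρ : ℝ → ℕ), θ 0 = -1 ∧ θ n = 1 ∧
      (∀ s ∈ S, ρ s < n ∧ θ (ρ s + 1 / 2) = s) ∧
      ∀ (m : ℕ) (t : ℝ), t ∈ Icc (0 : ℝ) 1 →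
        θ ((m + t) / 2) = (1 - t) * θ (m / 2) + t * θ ((m + 1) / 2) := by
  classical
  obtain ⟨S', hSS', hS'I, hcard⟩ : ∃ S' : Finset ℝ, S ⊆ S' ∧ (∀ s ∈ S', s ∈ Ioo (-1 : ℝ) 1) ∧
      S'.card = n := by
    obtain ⟨F, hF, hFc⟩ := ((Ioo_infinite (show (-1 : ℝ) < 1 by norm_num)).sdiff
      S.finite_toSet).exists_subset_card_eq (n - S.card)
    refine ⟨S ∪ F, Finset.subset_union_left, ?_, ?_⟩
    · intro s hs
      rcases Finset.mem_union.1 hs with h | h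
      · exact hS s h
      · exact (hF h).1
    · rw [Finset.card_union_of_disjoint, hFc]
      · omega
      · rw [Finset.disjoint_left]
        intro s h1 h2
        exact (hF h2).2 h1
  let f := S'.orderEmbOfFin hcard
  have hfI : ∀ i, f i ∈ Ioo (-1 : ℝ) 1 := fun i => hS'I _ (S'.orderEmbOfFin_mem hcard i)
  let s : ℕ → ℝ := fun i => if h : i < n then f ⟨i, h⟩ else 0
  have hs : ∀ i, i < n → s i ∈ Ioo (-1 : ℝ) 1 := by
    intro i hi
    simp only [s, dif_pos hi]
    exact hfI _
  have hsm : ∀ i, i + 1 < n → s i < s (i + 1) := by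
    intro i hi
    simp only [s, dif_pos hi, dif_pos (Nat.lt_of_succ_lt hi)]
    exact f.strictMono (Fin.mk_lt_mk.2 (Nat.lt_succ_self i))
  let σ : ℤ → ℝ := fun i => if i < 0 then -2 - s 0 + (i + 1) else
    if i < n then s i.toNat else 2 - s (n - 1) + (i - n)
  have σneg : ∀ i : ℤ, i < 0 → σ i = -2 - s 0 + (i + 1) := fun i hi => if_pos hi
  have σmid : ∀ i : ℕ, i < n → σ i = s i := by
    intro i hi
    simp only [σ]
    rw [if_neg (by omega), if_pos (by omega)]
    simp
  have σbig : ∀ i : ℤ, (n : ℤ) ≤ i → σ i = 2 - s (n - 1) + (i - n) := by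
    intro i hi
    simp only [σ]
    rw [if_neg (by omega), if_neg (by omega)]
  have h0 := hs 0 hn
  have hn1 := hs (n - 1) (by omega)
  have hσ : StrictMono σ := by
    refine strictMono_int_of_lt_succ fun i => ?_
    rcases lt_or_ge i 0 with hi | hi
    · rw [σneg i hi]
      rcases eq_or_lt_of_le (Int.add_one_le_of_lt hi) with h | h
      · rw [h]
        have := σmid 0 hn
        simp only [Nat.cast_zero] at this
        have h' : i = -1 := by omega
        rw [this, h']
        push_cast
        linarith [h0.1]
      · rw [σneg _ h]
        push_cast
        linarith
    · lift i to ℕ using hi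
      rcases lt_trichotomy (i + 1) n with h | h | h
      · rw [σmid i (by omega)]
        have := σmid (i + 1) h
        push_cast at this
        rw [this]
        exact hsm i h
      · rw [σmid i (by omega), σbig _ (by omega)]
        have : n - 1 = i := by omega
        rw [this] at hn1 ⊢
        push_cast [← h]
        linarith [hn1.2]
      · rw [σbig _ (by omega), σbig _ (by omega)]
        push_cast
        linarith
  have hsurj := surjective_piecewiseLinear hσ
    (fun y => by
      obtain ⟨N, hN⟩ := exists_nat_gt (-y)
      refine ⟨-N - 1, ?_⟩
      rw [σneg _ (by omega)]
      push_cast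
      linarith [h0.1])
    (fun y => by
      obtain ⟨N, hN⟩ := exists_nat_gt y
      refine ⟨N + n, ?_⟩
      rw [σbig _ (by omega)]
      push_cast
      linarith [hn1.2])
  let P := (strictMono_piecewiseLinear hσ).orderIsoOfSurjective _ hsurj
  have hP : ∀ u, P u = piecewiseLinear σ u := fun u => rfl
  let θ : ℝ ≃o ℝ := (OrderIso.addRight (-1 / 2 : ℝ)).trans P
  have hθ : ∀ u, θ u = piecewiseLinear σ (u + -1 / 2) := fun u => rfl
  have hcomb : ∀ (m : ℤ) (t : ℝ), t ∈ Icc (0 : ℝ) 1 →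
      θ (m + 1 / 2 + t) = (1 - t) * σ m + t * σ (m + 1) := by
    intro m t ht
    rw [hθ, ← piecewiseLinear_add σ m ht]
    congr 1
    ring
  have hrank : ∀ x ∈ S', ∃ i, i < n ∧ s i = x := by
    intro x hx
    have : x ∈ Set.range f := by
      rw [Finset.range_orderEmbOfFin]; exact hx
    obtain ⟨i, rfl⟩ := this
    exact ⟨i, i.2, by simp [s]⟩
  have hrank' : ∀ x, ∃ i, x ∈ S' → i < n ∧ s i = x := by
    intro x
    by_cases hx : x ∈ S'
    · obtain ⟨i, hi⟩ := hrank x hx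
      exact ⟨i, fun _ => hi⟩
    · exact ⟨0, fun h => absurd h hx⟩
  choose ρ hρ using hrank'
  refine ⟨θ, ρ, ?_, ?_, ?_, ?_⟩
  · have := hcomb (-1) (1 / 2) (by norm_num)
    have h2 := σmid 0 hn
    have h3 := σneg (-1) (by norm_num)
    norm_num at this h2 h3
    rw [this, h2, h3]
    ring
  · have := hcomb ((n : ℤ) - 1) (1 / 2) (by norm_num)
    have h2 := σmid (n - 1) (by omega)
    have h3 := σbig n le_rfl
    have h4 : ((n - 1 : ℕ) : ℤ) = n - 1 := by omega
    rw [h4] at h2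
    rw [sub_add_cancel, h2, h3] at this
    push_cast at this
    have h5 : (n : ℝ) - 1 + 1 / 2 + 1 / 2 = n := by ring
    rw [h5] at this
    rw [this]
    ring
  · intro x hx
    obtain ⟨h1, h2⟩ := hρ x (hSS' hx)
    refine ⟨h1, ?_⟩
    have := hcomb (ρ x) 0 (by norm_num)
    rw [σmid _ h1] at this
    simp only [add_zero, sub_zero, one_mul, zero_mul, Int.cast_natCast] at this
    rw [this, h2]
  · intro m t ht
    obtain ⟨M, δ, hδ, hM⟩ : ∃ (M : ℤ) (δ : ℝ), (δ = 0 ∨ δ = 1 / 2) ∧ (m : ℝ) / 2 = M + 1 / 2 + δ := by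
      rcases Nat.even_or_odd' m with ⟨i, rfl | rfl⟩
      · exact ⟨i - 1, 1 / 2, Or.inr rfl, by push_cast; ring⟩
      · exact ⟨i, 0, Or.inl rfl, by push_cast; ring⟩
    have hδ' : 0 ≤ δ ∧ δ ≤ 1 / 2 := by rcases hδ with h | h <;> rw [h] <;> norm_num
    have e1 : ((m : ℝ) + t) / 2 = M + 1 / 2 + (δ + t / 2) := by rw [← add_assoc, ← hM]; ring
    have e2 : ((m : ℝ) + 1) / 2 = M + 1 / 2 + (δ + 1 / 2) := by rw [← add_assoc, ← hM]; ring
    rw [e1, e2, hM, hcomb M _ ⟨by linarith [ht.1], by linarith [ht.2]⟩,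
      hcomb M _ ⟨by linarith, by linarith⟩, hcomb M _ ⟨by linarith, by linarith⟩]
    ring

/-! ### Heights of endpoints -/

theorem exists_continuous_through (S : Finset ℝ) (v : ℝ → ℝ) (hv : ∀ y ∈ S, v y ∈ Ioo (0 : ℝ) 1) :
    ∃ s : ℝ → ℝ, Continuous s ∧ (∀ y, s y ∈ Ioo (0 : ℝ) 1) ∧ (∀ y ∈ S, s y = v y) ∧
      ((∀ y ∈ S, v y = 1 / 2) → ∀ y, s y = 1 / 2) := by
  classical
  induction S using Finset.induction_on with
  | empty => exact ⟨fun _ => 1 / 2, continuous_const, fun _ => by norm_num, by simp, fun _ _ => rfl⟩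
  | insert a S ha ih =>
    obtain ⟨s, hs, hsI, hsv, hsc⟩ := ih fun y hy => hv y (Finset.mem_insert_of_mem hy)
    obtain ⟨ε, hε, hεS⟩ : ∃ ε > 0, ∀ y ∈ S, ε ≤ |y - a| := by
      have : ∀ᶠ ε in 𝓝[>] (0 : ℝ), ∀ y ∈ S, ε ≤ |y - a| := by
        refine (eventually_all_finset _).2 fun y hy => ?_
        have : 0 < |y - a| := abs_pos.2 (sub_ne_zero.2 fun h => ha (h ▸ hy))
        filter_upwards [Ioo_mem_nhdsGT this] with ε hε using hε.2.le
      obtain ⟨ε, h1, h2⟩ := (this.and self_mem_nhdsWithin).exists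
      exact ⟨ε, h2, h1⟩
    let b : ℝ → ℝ := fun y => max 0 (1 - |y - a| / ε)
    have hb : ∀ y, 0 ≤ b y ∧ b y ≤ 1 := fun y =>
      ⟨le_max_left _ _, max_le zero_le_one (by have : 0 ≤ |y - a| / ε := by positivity
                                               linarith)⟩
    refine ⟨fun y => (1 - b y) * s y + b y * v a, ?_, fun y => ?_, fun y hy => ?_, fun hc y => ?_⟩
    · simp only [b]; fun_prop
    · have := (convex_Ioo (0 : ℝ) 1) (hsI y) (hv a (Finset.mem_insert_self a S))
        (sub_nonneg.2 (hb y).2) (hb y).1 (by ring)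
      simpa using this
    · rcases Finset.mem_insert.1 hy with rfl | hy
      · simp [b]
      · have : b y = 0 := by
          have h1 : 1 ≤ |y - a| / ε := (one_le_div hε).2 (hεS y hy)
          simp only [b]
          exact max_eq_left (by linarith)
        simp [this, hsv y hy]
    · simp only [hsc (fun y hy => hc y (Finset.mem_insert_of_mem hy)) y,
        hc a (Finset.mem_insert_self a S)]
      ring

/-- The tent function with peak at `s`. -/
def tent (s z : ℝ) : ℝ := max 0 (min (z / s) ((1 - z) / (1 - s)))

theorem tent_mem {s : ℝ} (hs : s ∈ Ioo (0 : ℝ) 1) (z : ℝ) : 0 ≤ tent s z ∧ tent s z ≤ 1 := by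
  have h1 := hs.1
  have h2 : 0 < 1 - s := sub_pos.2 hs.2
  refine ⟨le_max_left _ _, max_le zero_le_one ?_⟩
  rcases le_total z s with h | h
  · exact (min_le_left _ _).trans ((div_le_one h1).2 h)
  · exact (min_le_right _ _).trans ((div_le_one h2).2 (by linarith))

theorem tent_peak {s : ℝ} (hs : s ∈ Ioo (0 : ℝ) 1) : tent s s = 1 := by
  rw [tent, div_self hs.1.ne', div_self (sub_pos.2 hs.2).ne']
  norm_num

theorem tent_eq_zero {s z : ℝ} (hs : s ∈ Ioo (0 : ℝ) 1) (hz : z ≤ 0 ∨ 1 ≤ z) : tent s z = 0 := by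
  have h2 : 0 < 1 - s := sub_pos.2 hs.2
  refine max_eq_left ?_
  rcases hz with h | h
  · exact (min_le_left _ _).trans (div_nonpos_of_nonpos_of_nonneg h hs.1.le)
  · exact (min_le_right _ _).trans (div_nonpos_of_nonpos_of_nonneg (by linarith) h2.le)

theorem tent_sub_le {s z z' : ℝ} (hs : s ∈ Ioo (0 : ℝ) 1) (h : z ≤ z') :
    tent s z' ≤ tent s z + (z' - z) / s ∧ tent s z ≤ tent s z' + (z' - z) / (1 - s) := by
  have h1 := hs.1
  have h2 : 0 < 1 - s := sub_pos.2 hs.2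
  have h3 : 0 ≤ (z' - z) / s := div_nonneg (by linarith) h1.le
  have h4 : 0 ≤ (z' - z) / (1 - s) := div_nonneg (by linarith) h2.le
  have e1 : z' / s = z / s + (z' - z) / s := by ring
  have e2 : (1 - z') / (1 - s) = (1 - z) / (1 - s) - (z' - z) / (1 - s) := by ring
  unfold tent
  rw [e1, e2]
  generalize z / s = a at *
  generalize (1 - z) / (1 - s) = b at *
  generalize (z' - z) / s = c at *
  generalize (z' - z) / (1 - s) = d at *
  constructor
  · refine max_le (by linarith [le_max_left 0 (min a b)]) ?_
    have := le_max_right 0 (min a b)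
    have h5 : min (a + c) (b - d) ≤ min a b + c := by
      rw [← min_add_add_right]
      exact min_le_min le_rfl (by linarith)
    linarith
  · refine max_le (by linarith [le_max_left 0 (min (a + c) (b - d))]) ?_
    have := le_max_right 0 (min (a + c) (b - d))
    have h5 : min a b ≤ min (a + c) (b - d) + d := by
      rw [← min_add_add_right]
      exact min_le_min (by linarith) (by linarith)
    linarith

/-- The vertical map which moves the height `s` to a height nearer to `1 / 2`. -/
def lift (s τ z : ℝ) : ℝ := z + τ * (1 / 2 - s) * tent s z

theorem strictMono_lift {s τ : ℝ} (hs : s ∈ Ioo (0 : ℝ) 1) (hτ : τ ∈ Icc (0 : ℝ) 1) :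
    StrictMono (lift s τ) := by
  intro z z' h
  obtain ⟨h1, h2⟩ := tent_sub_le hs h.le
  have hs1 := hs.1
  have hs2 : 0 < 1 - s := sub_pos.2 hs.2
  set c := τ * (1 / 2 - s) with hc
  have hc1 : 0 < s + c := by
    rw [hc]; nlinarith [hτ.1, hτ.2]
  have hc2 : s + c < 1 := by
    rw [hc]; nlinarith [hτ.1, hτ.2]
  have hd : 0 < z' - z := sub_pos.2 h
  unfold lift
  rw [← hc]
  rcases le_total 0 c with h0 | h0
  · have h3 : c * tent s z ≤ c * (tent s z' + (z' - z) / (1 - s)) := mul_le_mul_of_nonneg_left h2 h0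
    have h4 : c * ((z' - z) / (1 - s)) < z' - z := by
      rw [mul_div_assoc', div_lt_iff₀ hs2]
      nlinarith
    linarith
  · have h3 : c * (tent s z + (z' - z) / s) ≤ c * tent s z' := mul_le_mul_of_nonpos_left h1 h0
    have h4 : -(c * ((z' - z) / s)) < z' - z := by
      rw [mul_div_assoc', ← neg_div, div_lt_iff₀ hs1]
      nlinarith
    linarith

theorem exists_lift (n : ℕ) (s : ℝ → ℝ) (hs : Continuous s) (hsI : ∀ y, s y ∈ Ioo (0 : ℝ) 1) :
    ∃ H : E3 ≃ₜ E3, Isotopic H ∧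
      ∀ x, H x = !₂[x 0, x 1, lift (s (x 1)) (max 0 (1 - 2 * |(n : ℝ) - x 0|)) (x 2)] := by
  have hτ : ∀ x : ℝ, max 0 (1 - 2 * |(n : ℝ) - x|) ∈ Icc (0 : ℝ) 1 := fun x =>
    ⟨le_max_left _ _, max_le zero_le_one (by linarith [abs_nonneg ((n : ℝ) - x)])⟩
  have hcont : Continuous fun x : ℝ × ℝ × ℝ =>
      lift (s x.2.1) (max 0 (1 - 2 * |(n : ℝ) - x.1|)) x.2.2 := by
    unfold lift tent
    have h1 : Continuous fun x : ℝ × ℝ × ℝ => s x.2.1 := hs.comp (by fun_prop)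
    have h2 : ∀ x : ℝ × ℝ × ℝ, s x.2.1 ≠ 0 := fun x => (hsI _).1.ne'
    have h3 : ∀ x : ℝ × ℝ × ℝ, 1 - s x.2.1 ≠ 0 := fun x => (sub_pos.2 (hsI _).2).ne'
    have h4 : Continuous fun x : ℝ × ℝ × ℝ => x.2.2 / s x.2.1 :=
      (by fun_prop : Continuous fun x : ℝ × ℝ × ℝ => x.2.2).div h1 h2
    have h5 : Continuous fun x : ℝ × ℝ × ℝ => (1 - x.2.2) / (1 - s x.2.1) :=
      (by fun_prop : Continuous fun x : ℝ × ℝ × ℝ => 1 - x.2.2).div (by fun_prop) h3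
    fun_prop
  have hbd : ∀ s ∈ Ioo (0 : ℝ) 1, ∀ τ ∈ Icc (0 : ℝ) 1, ∀ z, |lift s τ z - z| ≤ 1 := by
    intro s hs τ hτ z
    obtain ⟨h1, h2⟩ := tent_mem hs z
    have h3 : |1 / 2 - s| ≤ 1 := by rw [abs_le]; constructor <;> linarith [hs.1, hs.2]
    unfold lift
    rw [add_sub_cancel_left, abs_mul, abs_mul, abs_of_nonneg hτ.1, abs_of_nonneg h1]
    have h4 : τ * |1 / 2 - s| ≤ 1 := mul_le_one₀ hτ.2 (abs_nonneg _) h3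
    exact mul_le_one₀ h4 h1 h2
  refine exists_homeomorph_of_bounded _ ?_ ⟨?_, ?_⟩ 1 ?_
  · have := hcont.comp (by fun_prop : Continuous fun x : E3 => (x 0, x 1, x 2))
    have h2 : Continuous fun x : E3 =>
      lift (s (x 1)) (max 0 (1 - 2 * |(n : ℝ) - x 0|)) (x 2) := this
    fun_prop
  · intro x y h
    have h0 : x 0 = y 0 := by simpa using congrArg (fun x : E3 => x 0) h
    have h1 : x 1 = y 1 := by simpa using congrArg (fun x : E3 => x 1) h
    have h2 := congrArg (fun x : E3 => x 2) h
    simp [h0, h1] at h2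
    exact E3.ext h0 h1 ((strictMono_lift (hsI _) (by simpa using hτ (y 0))).injective h2)
  · intro y
    have hc : Continuous (lift (s (y 1)) (max 0 (1 - 2 * |(n : ℝ) - y 0|))) :=
      hcont.comp (by fun_prop : Continuous fun z : ℝ => (y 0, y 1, z))
    have hsurj : Function.Surjective (lift (s (y 1)) (max 0 (1 - 2 * |(n : ℝ) - y 0|))) := by
      have hb := hbd _ (hsI (y 1)) _ (hτ (y 0))
      refine hc.surjective ?_ ?_
      · refine tendsto_atTop_mono (fun z => ?_) (tendsto_atTop_add_const_right _ (-1) tendsto_id)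
        have := abs_le.1 (hb z)
        simp only [id]
        linarith [this.1]
      · refine tendsto_atBot_mono (fun z => ?_) (tendsto_atBot_add_const_right _ 1 tendsto_id)
        have := abs_le.1 (hb z)
        simp only [id]
        linarith [this.2]
    obtain ⟨z, hz⟩ := hsurj (y 2)
    refine ⟨!₂[y 0, y 1, z], ?_⟩
    ext <;> simp
    simpa using hz
  · intro x
    have h1 := E3.norm_le_sum
      (!₂[x 0, x 1, lift (s (x 1)) (max 0 (1 - 2 * |(n : ℝ) - x 0|)) (x 2)] - x)
    have h2 := hbd _ (hsI (x 1)) _ (hτ (x 0)) (x 2)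
    simp at h1 h2
    linarith

end

noncomputable section
open Set Filter Topology

/-! ### Grid diagrams from rows and columns -/

/-- The combinatorial type and the heights of a grid diagram: the row `j` goes from the column `L j`
to the column `R j`, or to the boundary if `R j = n`; the column `i` goes from the row `lo i` to
the row `up i`. -/
structure GridShape (n : ℕ) (Row Col : ℕ → Prop) (L R lo up : ℕ → ℕ) (rz : ℕ → ℝ)
    (cz : ℕ → ℝ → ℝ) : Prop where
  row : ∀ j, Row j → L j < R j ∧ R j ≤ n ∧ j < n
  col : ∀ i, Col i → lo i < up i ∧ up i < n ∧ i < n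
  corner : ∀ i j, i < n → j < n →
    ((Row j ∧ (i = L j ∨ i = R j)) ↔ (Col i ∧ (j = lo i ∨ j = up i)))
  rz_mem : ∀ j, Row j → rz j ∈ Ioo (0 : ℝ) 1
  cz_mem : ∀ i, Col i → ∀ y ∈ Icc ((lo i : ℝ) + 1 / 2) (up i + 1 / 2), cz i y ∈ Ioo (0 : ℝ) 1
  affine : ∀ i, Col i → ∀ (m : ℕ) (t : ℝ), t ∈ Icc (0 : ℝ) 1 →
    cz i ((m + t) / 2) = (1 - t) * cz i (m / 2) + t * cz i ((m + 1) / 2)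
  turn : ∀ i j, Row j → Col i → (i = L j ∨ i = R j) → cz i (j + 1 / 2) = rz j
  cross : ∀ i j, Row j → Col i → L j < i → i < R j → lo i < j → j < up i →
    rz j ≠ cz i (j + 1 / 2)

/-- The height profile of the last half tile. -/
def ramp (n : ℕ) (x : ℝ) : ℝ := max 0 (1 - 2 * |(n : ℝ) - x|)

/-- The rows of a grid diagram, with their ends raised or lowered to the height `1 / 2`. -/
def rowSet (n : ℕ) (Row : ℕ → Prop) (L R : ℕ → ℕ) (rz : ℕ → ℝ) : Set E3 :=
  {v | ∃ j, Row j ∧ v 1 = j + 1 / 2 ∧ (L j : ℝ) + 1 / 2 ≤ v 0 ∧ v 0 ≤ R j + 1 / 2 ∧ v 0 ≤ n ∧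
    v 2 = rz j + ramp n (v 0) * (1 / 2 - rz j)}

/-- The columns of a grid diagram. -/
def colSet (Col : ℕ → Prop) (lo up : ℕ → ℕ) (cz : ℕ → ℝ → ℝ) : Set E3 :=
  {v | ∃ i, Col i ∧ v 0 = i + 1 / 2 ∧ (lo i : ℝ) + 1 / 2 ≤ v 1 ∧ v 1 ≤ up i + 1 / 2 ∧
    v 2 = cz i (v 1)}

theorem mem_segment_half_zero {a a' b z z' : ℝ} (ha : a' = a + 1 / 2) {v : E3} :
    v ∈ segment ℝ (!₂[a, b, z] : E3) !₂[a', b, z'] ↔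
      v 1 = b ∧ a ≤ v 0 ∧ v 0 ≤ a' ∧ v 2 = z + 2 * (v 0 - a) * (z' - z) := by
  subst ha
  rw [segment_eq_image']
  constructor
  · rintro ⟨s, hs, rfl⟩
    have := hs.1
    have := hs.2
    simp
    exact ⟨by linarith, by linarith, Or.inl (by ring)⟩
  · rintro ⟨h1, h2, h3, h4⟩
    refine ⟨2 * (v 0 - a), ⟨by linarith, by linarith⟩, ?_⟩
    ext <;> simp
    · ring
    · exact h1.symm
    · rw [h4]

theorem mem_segment_half_one {a b b' z z' : ℝ} (hb : b' = b + 1 / 2) {v : E3} :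
    v ∈ segment ℝ (!₂[a, b, z] : E3) !₂[a, b', z'] ↔
      v 0 = a ∧ b ≤ v 1 ∧ v 1 ≤ b' ∧ v 2 = z + 2 * (v 1 - b) * (z' - z) := by
  subst hb
  rw [segment_eq_image']
  constructor
  · rintro ⟨s, hs, rfl⟩
    have := hs.1
    have := hs.2
    simp
    exact ⟨by linarith, by linarith, Or.inl (by ring)⟩
  · rintro ⟨h1, h2, h3, h4⟩
    refine ⟨2 * (v 1 - b), ⟨by linarith, by linarith⟩, ?_⟩
    ext <;> simp
    · exact h1.symm
    · ring
    · rw [h4]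

theorem exists_half_tile {n a b : ℕ} (hab : a < b) (hb : b ≤ n) {v : ℝ} (h1 : (a : ℝ) + 1 / 2 ≤ v)
    (h2 : v ≤ b + 1 / 2) (h3 : v ≤ n) :
    ∃ i < n, ((a < i ∧ i ≤ b) ∧ (i : ℝ) ≤ v ∧ v ≤ i + 1 / 2) ∨
      ((a < i + 1 ∧ i + 1 ≤ b) ∧ (i : ℝ) + 1 / 2 ≤ v ∧ v ≤ i + 1) := by
  rcases eq_or_lt_of_le h1 with h | h
  · exact ⟨a, by omega, Or.inr ⟨⟨by omega, by omega⟩, h.le, by linarith⟩⟩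
  obtain ⟨i, hi, hi1, hi2⟩ := exists_index_Ioc (U := fun i => (i : ℝ)) (M := n) (x := v)
    (by push_cast; have : (0 : ℝ) ≤ a := by positivity
        linarith) h3
  push_cast at hi2
  refine ⟨i, hi, ?_⟩
  rcases le_or_gt v (i + 1 / 2) with h4 | h4
  · left
    refine ⟨⟨?_, ?_⟩, hi1.le, h4⟩
    · have : (a : ℝ) < i := by linarith
      exact_mod_cast this
    · have : (i : ℝ) < b + 1 := by linarith
      have : i < b + 1 := by exact_mod_cast this
      omega
  · right
    refine ⟨⟨?_, ?_⟩, h4.le, hi2⟩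
    · have : (a : ℝ) < i + 1 := by linarith
      exact_mod_cast this
    · have : (i : ℝ) < b := by linarith
      have : i < b := by exact_mod_cast this
      omega

theorem half_tile_bounds {n a b i : ℕ} (hi : i < n) {v : ℝ}
    (h : ((a < i ∧ i ≤ b) ∧ (i : ℝ) ≤ v ∧ v ≤ i + 1 / 2) ∨
      ((a < i + 1 ∧ i + 1 ≤ b) ∧ (i : ℝ) + 1 / 2 ≤ v ∧ v ≤ i + 1)) :
    (a : ℝ) + 1 / 2 ≤ v ∧ v ≤ b + 1 / 2 ∧ v ≤ n := by
  have hn : (i : ℝ) + 1 ≤ n := by exact_mod_cast hi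
  rcases h with ⟨⟨h1, h2⟩, h3, h4⟩ | ⟨⟨h1, h2⟩, h3, h4⟩
  · have h1' : (a : ℝ) + 1 ≤ i := by exact_mod_cast h1
    have h2' : (i : ℝ) ≤ b := by exact_mod_cast h2
    refine ⟨?_, ?_, ?_⟩ <;> linarith
  · have h1' : (a : ℝ) + 1 ≤ i + 1 := by exact_mod_cast h1
    have h2' : (i : ℝ) + 1 ≤ b := by exact_mod_cast h2
    refine ⟨?_, ?_, ?_⟩ <;> linarith

open GridLabel

open Classical in
/-- A number if it lies strictly between `0` and `1`, and `1 / 2` otherwise. -/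
def clampHeight (z : ℝ) : ℝ := if z ∈ Ioo (0 : ℝ) 1 then z else 1 / 2

theorem clampHeight_mem (z : ℝ) : clampHeight z ∈ Ioo (0 : ℝ) 1 := by
  unfold clampHeight
  split_ifs with h
  · exact h
  · norm_num

theorem clampHeight_eq {z : ℝ} (h : z ∈ Ioo (0 : ℝ) 1) : clampHeight z = z := if_pos h

namespace GridShape

variable {n : ℕ} {Row Col : ℕ → Prop} {L R lo up : ℕ → ℕ} {rz : ℕ → ℝ} {cz : ℕ → ℝ → ℝ}

/-- The heights of the vertices. -/
def startHeight (n : ℕ) (rz : ℕ → ℝ) (cz : ℕ → ℝ → ℝ) : GridLabel → ℝ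
  | hw j k => if k = n then 1 / 2 else clampHeight (rz j)
  | vw i k => clampHeight (cz i k)
  | hc _ j => clampHeight (rz j)
  | vc i j => clampHeight (cz i (j + 1 / 2))

theorem startHeight_mem (l : GridLabel) : startHeight n rz cz l ∈ Ioo (0 : ℝ) 1 := by
  cases l <;> simp only [startHeight]
  · split_ifs
    · norm_num
    · exact clampHeight_mem _
  all_goals exact clampHeight_mem _

theorem cz_center (h : GridShape n Row Col L R lo up rz cz) {i j : ℕ} (hi : Col i)
    (h1 : lo i ≤ j) (h2 : j ≤ up i) : cz i (j + 1 / 2) ∈ Ioo (0 : ℝ) 1 := by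
  refine h.cz_mem i hi _ ⟨?_, ?_⟩
  · have : (lo i : ℝ) ≤ j := by exact_mod_cast h1
    linarith
  · have : (j : ℝ) ≤ up i := by exact_mod_cast h2
    linarith

theorem cz_wall (h : GridShape n Row Col L R lo up rz cz) {i j : ℕ} (hi : Col i)
    (h1 : lo i < j) (h2 : j ≤ up i) : cz i j ∈ Ioo (0 : ℝ) 1 := by
  refine h.cz_mem i hi _ ⟨?_, ?_⟩
  · have : (lo i : ℝ) + 1 ≤ j := by exact_mod_cast h1
    linarith
  · have : (j : ℝ) ≤ up i := by exact_mod_cast h2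
    linarith

/-- The grid diagram of a shape. -/
def data (h : GridShape n Row Col L R lo up rz cz) : GridData where
  n := n
  HW j i := Row j ∧ L j < i ∧ i ≤ R j
  VW i j := Col i ∧ lo i < j ∧ j ≤ up i
  Z := startHeight n rz cz
  tile i hi j hj := by
    have hc := h.corner i j hi hj
    by_cases hR : Row j <;> by_cases hC : Col i
    · have h1 := h.row j hR
      have h2 := h.col i hC
      simp only [hR, hC, true_and] at hc ⊢
      omega
    · have h1 := h.row j hR
      simp only [hR, hC, true_and, false_and, iff_false, and_true] at hc ⊢
      omega
    · have h2 := h.col i hC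
      simp only [hR, hC, true_and, false_and, false_iff] at hc ⊢
      omega
    · simp [hR, hC]
  Z_pos l := (startHeight_mem l).1
  Z_lt l := (startHeight_mem l).2
  cross i hi j hj h1 h2 h3 h4 := by
    have h5 := h.cz_center h3.1 (j := j) (by omega) (by omega)
    simp only [startHeight]
    rw [clampHeight_eq (h.rz_mem j h1.1), clampHeight_eq h5]
    exact h.cross i j h1.1 h3.1 h1.2.1 (by omega) h3.2.1 (by omega)
  west j := by simp
  south i := by simp
  north i := by
    rintro ⟨h1, -, h3⟩
    have := h.col i h1
    omega
  east j _ := by simp [startHeight]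

theorem pos_center (h : GridShape n Row Col L R lo up rz cz) {i j : ℕ} (hi : i < n) (hj : j < n)
    (hC : Col i) (h1 : lo i ≤ j) (h2 : j ≤ up i) (s : Side) (hs : s = .S ∨ s = .N) :
    h.data.pos 0 (h.data.center i j s) = !₂[(i : ℝ) + 1 / 2, j + 1 / 2, cz i (j + 1 / 2)] := by
  have hcz := h.cz_center hC h1 h2
  have hd : h.data.center i j s =
      open Classical in if (h.data.HW j i ↔ h.data.HW j (i + 1)) then vc i j else hc i j := by
    rcases hs with rfl | rfl <;> rfl
  rw [hd]
  split_ifs with hh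
  · have : h.data.Z (vc i j) = cz i (j + 1 / 2) := clampHeight_eq hcz
    simp [GridData.pos, GridData.height, this]
  · have h3 : Row j ∧ (i = L j ∨ i = R j) := by
      change ¬ ((Row j ∧ L j < i ∧ i ≤ R j) ↔ (Row j ∧ L j < i + 1 ∧ i + 1 ≤ R j)) at hh
      by_cases hR : Row j
      · refine ⟨hR, ?_⟩
        simp only [hR, true_and] at hh
        omega
      · simp [hR] at hh
    have h4 := h.turn i j h3.1 hC h3.2
    have : h.data.Z (hc i j) = cz i (j + 1 / 2) := by
      rw [h4]; exact clampHeight_eq (h.rz_mem j h3.1)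
    simp [GridData.pos, GridData.height, this]

theorem carrier_data (h : GridShape n Row Col L R lo up rz cz) :
    carrier h.data.edges (h.data.pos 0) = rowSet n Row L R rz ∪ colSet Col lo up cz := by
  have hwest : ∀ i j, i < n → Row j → ∀ v : E3,
      v ∈ segment ℝ (h.data.pos 0 (hw j i)) (h.data.pos 0 (hc i j)) ↔
        v 1 = j + 1 / 2 ∧ ((i : ℝ) ≤ v 0 ∧ v 0 ≤ i + 1 / 2) ∧
          v 2 = rz j + ramp n (v 0) * (1 / 2 - rz j) := by
    intro i j hi hR v
    have e1 : h.data.pos 0 (hw j i) = !₂[(i : ℝ), j + 1 / 2, rz j] := by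
      have : h.data.Z (hw j i) = rz j := by
        change (if i = n then 1 / 2 else clampHeight (rz j)) = rz j
        rw [if_neg hi.ne, clampHeight_eq (h.rz_mem j hR)]
      simp [GridData.pos, GridData.height, this]
    have e2 : h.data.pos 0 (hc i j) = !₂[(i : ℝ) + 1 / 2, j + 1 / 2, rz j] := by
      have : h.data.Z (hc i j) = rz j := clampHeight_eq (h.rz_mem j hR)
      simp [GridData.pos, GridData.height, this]
    rw [e1, e2, mem_segment_half_zero rfl, and_assoc]
    refine and_congr_right fun _ => and_congr_right fun h1 => and_congr_right fun h2 => ?_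
    have hn : (i : ℝ) + 1 ≤ n := by exact_mod_cast hi
    have : ramp n (v 0) = 0 := by
      apply max_eq_left
      rw [abs_of_nonneg (by linarith)]
      linarith
    rw [this, sub_self, mul_zero, zero_mul]
  have heast : ∀ i j, i < n → Row j → ∀ v : E3,
      v ∈ segment ℝ (h.data.pos 0 (hw j (i + 1))) (h.data.pos 0 (hc i j)) ↔
        v 1 = j + 1 / 2 ∧ ((i : ℝ) + 1 / 2 ≤ v 0 ∧ v 0 ≤ i + 1) ∧
          v 2 = rz j + ramp n (v 0) * (1 / 2 - rz j) := by
    intro i j hi hR v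
    have e2 : h.data.pos 0 (hc i j) = !₂[(i : ℝ) + 1 / 2, j + 1 / 2, rz j] := by
      have : h.data.Z (hc i j) = rz j := clampHeight_eq (h.rz_mem j hR)
      simp [GridData.pos, GridData.height, this]
    by_cases hin : i + 1 = n
    · have hn : (n : ℝ) = i + 1 := by rw [← hin]; push_cast; ring
      have e1 : h.data.pos 0 (hw j (i + 1)) = !₂[(i : ℝ) + 1, j + 1 / 2, 1 / 2] := by
        have : h.data.Z (hw j (i + 1)) = 1 / 2 := if_pos hin
        simp [GridData.pos, GridData.height, this]
      rw [e1, e2, segment_symm, mem_segment_half_zero (by ring), and_assoc]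
      refine and_congr_right fun _ => and_congr_right fun h1 => and_congr_right fun h2 => ?_
      have : ramp n (v 0) = 2 * (v 0 - (i + 1 / 2)) := by
        rw [ramp, hn, abs_of_nonneg (by linarith), max_eq_right (by linarith)]
        ring
      rw [this]
    · have e1 : h.data.pos 0 (hw j (i + 1)) = !₂[(i : ℝ) + 1, j + 1 / 2, rz j] := by
        have : h.data.Z (hw j (i + 1)) = rz j := by
          change (if i + 1 = n then 1 / 2 else clampHeight (rz j)) = rz j
          rw [if_neg hin, clampHeight_eq (h.rz_mem j hR)]
        simp [GridData.pos, GridData.height, this]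
      rw [e1, e2, segment_symm, mem_segment_half_zero (by ring), and_assoc]
      refine and_congr_right fun _ => and_congr_right fun h1 => and_congr_right fun h2 => ?_
      have hn : (i : ℝ) + 1 + 1 ≤ n := by
        have : i + 1 + 1 ≤ n := by omega
        exact_mod_cast this
      have : ramp n (v 0) = 0 := by
        apply max_eq_left
        rw [abs_of_nonneg (by linarith)]
        linarith
      rw [this, sub_self, mul_zero, zero_mul]
  have hsouth : ∀ i j, i < n → j < n → h.data.VW i j → ∀ v : E3,
      v ∈ segment ℝ (h.data.pos 0 (vw i j)) (h.data.pos 0 (h.data.center i j .S)) ↔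
        v 0 = i + 1 / 2 ∧ ((j : ℝ) ≤ v 1 ∧ v 1 ≤ j + 1 / 2) ∧ v 2 = cz i (v 1) := by
    rintro i j hi hj ⟨hC, h1, h2⟩ v
    have e1 : h.data.pos 0 (vw i j) = !₂[(i : ℝ) + 1 / 2, j, cz i j] := by
      have : h.data.Z (vw i j) = cz i j := clampHeight_eq (h.cz_wall hC h1 h2)
      simp [GridData.pos, GridData.height, this]
    rw [e1, h.pos_center hi hj hC h1.le h2 .S (Or.inl rfl), mem_segment_half_one rfl, and_assoc]
    refine and_congr_right fun _ => and_congr_right fun h3 => and_congr_right fun h4 => ?_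
    have := h.affine i hC (2 * j) (2 * (v 1 - j)) ⟨by linarith, by linarith⟩
    push_cast at this
    have r1 : (2 * (j : ℝ) + 2 * (v 1 - j)) / 2 = v 1 := by ring
    have r2 : 2 * (j : ℝ) / 2 = j := by ring
    have r3 : (2 * (j : ℝ) + 1) / 2 = j + 1 / 2 := by ring
    rw [r1, r2, r3] at this
    rw [this]
    constructor <;> intro h5 <;> rw [h5] <;> ring
  have hnorth : ∀ i j, i < n → j < n → h.data.VW i (j + 1) → ∀ v : E3,
      v ∈ segment ℝ (h.data.pos 0 (vw i (j + 1))) (h.data.pos 0 (h.data.center i j .N)) ↔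
        v 0 = i + 1 / 2 ∧ ((j : ℝ) + 1 / 2 ≤ v 1 ∧ v 1 ≤ j + 1) ∧ v 2 = cz i (v 1) := by
    rintro i j hi hj ⟨hC, h1, h2⟩ v
    have e1 : h.data.pos 0 (vw i (j + 1)) = !₂[(i : ℝ) + 1 / 2, j + 1, cz i (j + 1)] := by
      have h5 := h.cz_wall hC h1 h2
      have : h.data.Z (vw i (j + 1)) = cz i (j + 1) := by
        change clampHeight (cz i ((j + 1 : ℕ) : ℝ)) = _
        rw [clampHeight_eq h5]; push_cast; rfl
      simp [GridData.pos, GridData.height, this]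
    rw [e1, h.pos_center hi hj hC (by omega) (by omega) .N (Or.inr rfl), segment_symm,
      mem_segment_half_one (by ring), and_assoc]
    refine and_congr_right fun _ => and_congr_right fun h3 => and_congr_right fun h4 => ?_
    have := h.affine i hC (2 * j + 1) (2 * (v 1 - (j + 1 / 2))) ⟨by linarith, by linarith⟩
    push_cast at this
    have r1 : (2 * (j : ℝ) + 1 + 2 * (v 1 - (j + 1 / 2))) / 2 = v 1 := by ring
    have r2 : (2 * (j : ℝ) + 1) / 2 = j + 1 / 2 := by ring
    have r3 : (2 * (j : ℝ) + 1 + 1) / 2 = j + 1 := by ring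
    rw [r1, r2, r3] at this
    rw [this]
    constructor <;> intro h5 <;> rw [h5] <;> ring
  ext v
  rw [mem_carrier]
  constructor
  · rintro ⟨e, he, hv⟩
    obtain ⟨i, j, s, hi, hj, hs, rfl⟩ := h.data.mem_edges.1 he
    change i < n at hi
    change j < n at hj
    cases s
    · right
      obtain ⟨h1, h2, h3⟩ := (hnorth i j hi hj hs v).1 hv
      obtain ⟨h4, h5, -⟩ := half_tile_bounds hj (Or.inr ⟨hs.2, h2⟩)
      exact ⟨i, hs.1, h1, h4, h5, h3⟩
    · right
      obtain ⟨h1, h2, h3⟩ := (hsouth i j hi hj hs v).1 hv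
      obtain ⟨h4, h5, -⟩ := half_tile_bounds hj (Or.inl ⟨hs.2, h2⟩)
      exact ⟨i, hs.1, h1, h4, h5, h3⟩
    · left
      obtain ⟨h1, h2, h3⟩ := (heast i j hi hs.1 v).1 hv
      obtain ⟨h4, h5, h6⟩ := half_tile_bounds hi (Or.inr ⟨hs.2, h2⟩)
      exact ⟨j, hs.1, h1, h4, h5, h6, h3⟩
    · left
      obtain ⟨h1, h2, h3⟩ := (hwest i j hi hs.1 v).1 hv
      obtain ⟨h4, h5, h6⟩ := half_tile_bounds hi (Or.inl ⟨hs.2, h2⟩)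
      exact ⟨j, hs.1, h1, h4, h5, h6, h3⟩
  · rintro (⟨j, hR, h1, h2, h3, h4, h5⟩ | ⟨i, hC, h1, h2, h3, h4⟩)
    · obtain ⟨hLR, hRn, hjn⟩ := h.row j hR
      obtain ⟨i, hi, ⟨h6, h7⟩ | ⟨h6, h7⟩⟩ := exists_half_tile hLR hRn h2 h3 h4
      · exact ⟨_, h.data.mem_edges.2 ⟨i, j, .W, hi, hjn, ⟨hR, h6⟩, rfl⟩,
          (hwest i j hi hR v).2 ⟨h1, h7, h5⟩⟩
      · exact ⟨_, h.data.mem_edges.2 ⟨i, j, .E, hi, hjn, ⟨hR, h6⟩, rfl⟩,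
          (heast i j hi hR v).2 ⟨h1, h7, h5⟩⟩
    · obtain ⟨hlu, hun, hin⟩ := h.col i hC
      have hv1 : v 1 ≤ n := by
        have : (up i : ℝ) + 1 ≤ n := by exact_mod_cast hun
        linarith
      obtain ⟨j, hj, ⟨h6, h7⟩ | ⟨h6, h7⟩⟩ := exists_half_tile hlu hun.le h2 h3 hv1
      · exact ⟨_, h.data.mem_edges.2 ⟨i, j, .S, hin, hj, ⟨hC, h6⟩, rfl⟩,
          (hsouth i j hin hj ⟨hC, h6⟩ v).2 ⟨h1, h7, h4⟩⟩
      · exact ⟨_, h.data.mem_edges.2 ⟨i, j, .N, hin, hj, ⟨hC, h6⟩, rfl⟩,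
          (hnorth i j hin hj ⟨hC, h6⟩ v).2 ⟨h1, h7, h4⟩⟩

end GridShape

end

noncomputable section
open Set Filter Topology

/-! ### Rows and columns of rectangular stairs -/

theorem mem_segment_foot {w v : E3} {x : ℝ} : v ∈ segment ℝ w (!₂[x, w 1, w 2] : E3) ↔
    v 1 = w 1 ∧ v 2 = w 2 ∧ v 0 ∈ uIcc x (w 0) := by
  have h1 : v 0 ∈ uIcc x (w 0) ↔ v 0 ∈ segment ℝ (w 0) x := by
    rw [segment_eq_uIcc, uIcc_comm]
  rw [h1, segment_eq_image', segment_eq_image']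
  constructor
  · rintro ⟨s, hs, rfl⟩
    refine ⟨by simp, by simp, s, hs, by simp⟩
  · rintro ⟨h2, h3, s, hs, h4⟩
    refine ⟨s, hs, ?_⟩
    refine E3.ext ?_ ?_ ?_
    · simpa using h4
    · simpa using h2.symm
    · simpa using h3.symm

/-- The height of the segment from `a` to `b` as a function of the second coordinate. -/
def columnHeight (a b : E3) (y : ℝ) : ℝ := a 2 + (y - a 1) / (b 1 - a 1) * (b 2 - a 2)

theorem columnHeight_combo (a b : E3) (y z t : ℝ) :
    columnHeight a b ((1 - t) * y + t * z) = (1 - t) * columnHeight a b y + t * columnHeight a b z := by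
  unfold columnHeight
  rw [div_mul_eq_mul_div, div_mul_eq_mul_div, div_mul_eq_mul_div]
  ring

theorem columnHeight_left (a b : E3) : columnHeight a b (a 1) = a 2 := by simp [columnHeight]

theorem columnHeight_right {a b : E3} (h : a 1 < b 1) : columnHeight a b (b 1) = b 2 := by
  rw [columnHeight, div_self (sub_pos.2 h).ne']; ring

theorem columnHeight_mem {a b : E3} (h : a 1 < b 1) {s : Set ℝ} (hs : Convex ℝ s) (ha : a 2 ∈ s)
    (hb : b 2 ∈ s) {y : ℝ} (hy : y ∈ Icc (a 1) (b 1)) : columnHeight a b y ∈ s := by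
  have h1 : 0 < b 1 - a 1 := sub_pos.2 h
  have h2 : (y - a 1) / (b 1 - a 1) ∈ Icc (0 : ℝ) 1 :=
    ⟨div_nonneg (by linarith [hy.1]) h1.le, (div_le_one h1).2 (by linarith [hy.2])⟩
  have := hs ha hb (sub_nonneg.2 h2.2) h2.1 (by ring)
  convert this using 1
  simp only [columnHeight, smul_eq_mul]
  ring

theorem mem_segment_column {a b v : E3} {x : ℝ} (h : a 1 < b 1) :
    v ∈ segment ℝ (!₂[x, a 1, a 2] : E3) !₂[x, b 1, b 2] ↔
      v 0 = x ∧ v 1 ∈ Icc (a 1) (b 1) ∧ v 2 = columnHeight a b (v 1) := by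
  have h1 : 0 < b 1 - a 1 := sub_pos.2 h
  rw [segment_eq_image']
  constructor
  · rintro ⟨s, hs, rfl⟩
    have := hs.1
    have := hs.2
    refine ⟨by simp, ?_, ?_⟩
    · simp
      constructor <;> nlinarith
    · simp [columnHeight]
      left
      field_simp
  · rintro ⟨h2, h3, h4⟩
    refine ⟨(v 1 - a 1) / (b 1 - a 1), ⟨div_nonneg (by linarith [h3.1]) h1.le,
      (div_le_one h1).2 (by linarith [h3.2])⟩, ?_⟩
    refine E3.ext ?_ ?_ ?_
    · simp [h2]
    · simp; field_simp; ring
    · rw [h4]; simp [columnHeight]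

/-- The column `k` ends in the row `w`. -/
def Incident (A B : E3 → E3) (k w : E3) : Prop := A k = w ∨ B k = w

section Stairs

variable {K : Finset E3} {A B C : E3 → E3} {lo hi r : E3 → ℝ} {x : E3 → ℝ}

open Classical in
/-- The horizontal edge of stairs in the row `w` at the column `k`. -/
def rowEdge (A B : E3 → E3) (k w : E3) : StairLabel × StairLabel :=
  if A k = w then (Sum.inl (A k), Sum.inr (k, false)) else (Sum.inr (k, true), Sum.inl (B k))

theorem rowEdge_spec {k w : E3} (hk : k ∈ K) (hw : Incident A B k w) :
    rowEdge A B k w ∈ stairEdges K A B ∧ Inc (rowEdge A B k w) (Sum.inl w) ∧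
    segment ℝ (stairPos (rectNodes A B x) (rowEdge A B k w).1)
      (stairPos (rectNodes A B x) (rowEdge A B k w).2) = segment ℝ w !₂[x k, w 1, w 2] := by
  unfold rowEdge
  split_ifs with h
  · refine ⟨mem_stairEdges.2 ⟨k, hk, Or.inl rfl⟩, Or.inl (by rw [h]), ?_⟩
    simp [stairPos, rectNodes, h]
  · have h' : B k = w := hw.resolve_left h
    refine ⟨mem_stairEdges.2 ⟨k, hk, Or.inr (Or.inr rfl)⟩, Or.inr (by rw [h']), ?_⟩
    rw [segment_symm]
    simp [stairPos, rectNodes, h']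

theorem mem_carrier_stairs {v : E3} :
    v ∈ carrier (stairEdges K A B) (stairPos (rectNodes A B x)) ↔
      (∃ w, ∃ k ∈ K, Incident A B k w ∧ v ∈ segment ℝ w !₂[x k, w 1, w 2]) ∨
      ∃ k ∈ K, v ∈ segment ℝ (!₂[x k, A k 1, A k 2] : E3) !₂[x k, B k 1, B k 2] := by
  rw [mem_carrier]
  constructor
  · rintro ⟨e, he, hv⟩
    obtain ⟨k, hk, rfl | rfl | rfl⟩ := mem_stairEdges.1 he
    · exact Or.inl ⟨A k, k, hk, Or.inl rfl, by simpa [stairPos, rectNodes] using hv⟩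
    · exact Or.inr ⟨k, hk, by simpa [stairPos, rectNodes] using hv⟩
    · refine Or.inl ⟨B k, k, hk, Or.inr rfl, ?_⟩
      rw [segment_symm]
      simpa [stairPos, rectNodes] using hv
  · rintro (⟨w, k, hk, hw, hv⟩ | ⟨k, hk, hv⟩)
    · obtain ⟨h1, -, h3⟩ := rowEdge_spec (x := x) hk hw
      exact ⟨_, h1, h3 ▸ hv⟩
    · exact ⟨_, mem_stairEdges.2 ⟨k, hk, Or.inr (Or.inl rfl)⟩, by simpa [stairPos, rectNodes] using hv⟩

theorem eq_rowEdge (h : Columns K A B C lo hi r) {g : StairLabel × StairLabel}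
    (hg : g ∈ stairEdges K A B) {w : E3} (hw : Inc g (Sum.inl w)) :
    ∃ k ∈ K, Incident A B k w ∧ g = rowEdge A B k w := by
  obtain ⟨k, hk, rfl | rfl | rfl⟩ := mem_stairEdges.1 hg
  · have : A k = w := by rcases hw with h | h <;> simp at h; exact h.symm
    exact ⟨k, hk, Or.inl this, by rw [rowEdge, if_pos this]⟩
  · rcases hw with h | h <;> simp at h
  · have : B k = w := by rcases hw with h | h <;> simp at h; exact h.symm
    have h2 : A k ≠ w := by
      intro h3
      have := h.lt k hk
      rw [h3, ‹B k = w›] at this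
      exact lt_irrefl _ this
    exact ⟨k, hk, Or.inr this, by rw [rowEdge, if_neg h2]⟩

variable (h : Columns K A B C lo hi r) (hx : ∀ k ∈ K, x k ∈ Ioo (lo k) (hi k))
include h hx

theorem x_mem {k : E3} (hk : k ∈ K) : x k ∈ Ioo (-1 : ℝ) 1 :=
  ⟨(h.bounds k hk).1.trans_lt (hx k hk).1, (hx k hk).2.trans_le (h.bounds k hk).2⟩

variable (hE : Emb openCube (stairEdges K A B) (stairPos (rectNodes A B x)))
  (hc : TangleCharts openCube (carrier (stairEdges K A B) (stairPos (rectNodes A B x))))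
  (hb : ∀ v ∈ carrier (stairEdges K A B) (stairPos (rectNodes A B x)), v ∉ openCube → v 0 = 1)
include hE hc hb

theorem row_ends {w : E3} (hw : ∃ k ∈ K, Incident A B k w) :
    (w ∈ openCube ∧ ∃ k ∈ K, ∃ k' ∈ K, Incident A B k w ∧ Incident A B k' w ∧ x k < w 0 ∧
      w 0 < x k' ∧ ∀ l ∈ K, Incident A B l w → l = k ∨ l = k') ∨
    (w ∉ openCube ∧ w 0 = 1 ∧ ∃ k ∈ K, Incident A B k w ∧ ∀ l ∈ K, Incident A B l w → l = k) := by
  set p := stairPos (rectNodes A B x) with hp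
  have hD := hE.deg hc
  have hused : Used (stairEdges K A B) (Sum.inl w) := by
    obtain ⟨k, hk, hkw⟩ := hw
    obtain ⟨h1, h2, -⟩ := rowEdge_spec (x := x) hk hkw
    exact ⟨_, h1, h2⟩
  have hpw : p (Sum.inl w) = w := rfl
  by_cases hwO : w ∈ openCube
  · left
    refine ⟨hwO, ?_⟩
    obtain ⟨e, he, e', he', hne, hew, hew', hall⟩ := hD.two (Sum.inl w) hused hwO
    obtain ⟨k, hk, hkw, rfl⟩ := eq_rowEdge h he hew
    obtain ⟨k', hk', hkw', rfl⟩ := eq_rowEdge h he' hew'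
    have hkk : k ≠ k' := by rintro rfl; exact hne rfl
    have hxw : ∀ k ∈ K, Incident A B k w → x k ≠ w 0 := by
      intro k hk hkw h0
      obtain ⟨h1, -, h3⟩ := rowEdge_spec (x := x) hk hkw
      have h2 := hE.ne _ h1
      have h4 : (!₂[x k, w 1, w 2] : E3) = w := E3.ext (by simp [h0]) (by simp) (by simp)
      rw [h4, segment_same] at h3
      have h5 : p (rowEdge A B k w).1 ∈ ({w} : Set E3) := h3 ▸ left_mem_segment _ _ _
      have h6 : p (rowEdge A B k w).2 ∈ ({w} : Set E3) := h3 ▸ right_mem_segment _ _ _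
      exact h2 (h5.trans h6.symm)
    have key : ∀ k ∈ K, ∀ k' ∈ K, k ≠ k' → Incident A B k w → Incident A B k' w →
        rowEdge A B k w ≠ rowEdge A B k' w → x k' ∉ uIcc (x k) (w 0) := by
      intro k hk k' hk' hkk hkw hkw' hne hmem
      obtain ⟨h1, h2, h3⟩ := rowEdge_spec (x := x) hk hkw
      obtain ⟨h1', h2', h3'⟩ := rowEdge_spec (x := x) hk' hkw'
      have := hE.inter_eq h1 h1' hne h2 h2' (x := !₂[x k', w 1, w 2])
        (by rw [h3, mem_segment_foot]; exact ⟨by simp, by simp, by simpa using hmem⟩)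
        (by rw [h3']; exact right_mem_segment _ _ _)
      have h4 := congrArg (fun x : E3 => x 0) this
      simp [stairPos] at h4
      exact hxw k' hk' hkw' h4
    have n1 := key k hk k' hk' hkk hkw hkw' hne
    have n2 := key k' hk' k hk hkk.symm hkw' hkw hne.symm
    have m1 := hxw k hk hkw
    have m2 := hxw k' hk' hkw'
    rw [mem_uIcc] at n1 n2
    push Not at n1 n2
    have hall' : ∀ l ∈ K, Incident A B l w → l = k ∨ l = k' := by
      intro l hl hlw
      obtain ⟨h1, h2, h3⟩ := rowEdge_spec (x := x) hl hlw
      have hinj : ∀ k, rowEdge A B l w = rowEdge A B k w → l = k := by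
        intro k h0
        unfold rowEdge at h0
        split_ifs at h0 <;> simp at h0
        · exact h0.2
        · exact h0.1
      exact (hall _ h1 h2).imp (hinj k) (hinj k')
    rcases lt_or_gt_of_ne m1 with q1 | q1 <;> rcases lt_or_gt_of_ne m2 with q2 | q2
    · exfalso
      rcases le_total (x k) (x k') with q | q
      · linarith [n1.1 q]
      · linarith [n2.1 q]
    · exact ⟨k, hk, k', hk', hkw, hkw', q1, q2, hall'⟩
    · exact ⟨k', hk', k, hk, hkw', hkw, q2, q1, fun l hl hlw => (hall' l hl hlw).symm⟩
    · exfalso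
      rcases le_total (x k) (x k') with q | q
      · linarith [n2.2 q1.le]
      · linarith [n1.2 q2.le]
  · right
    refine ⟨hwO, hb w (hused.mem_carrier) hwO, ?_⟩
    obtain ⟨e, he, hew, hall⟩ := hD.one (Sum.inl w) hused hwO
    obtain ⟨k, hk, hkw, rfl⟩ := eq_rowEdge h he hew
    refine ⟨k, hk, hkw, fun l hl hlw => ?_⟩
    obtain ⟨h1, h2, h3⟩ := rowEdge_spec (x := x) hl hlw
    have h0 := hall _ h1 h2
    unfold rowEdge at h0
    split_ifs at h0 <;> simp at h0
    · exact h0.2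
    · exact h0.1

/-- The columns at which a row starts and ends. -/
theorem row_data {θ : ℝ ≃o ℝ} {n : ℕ} {ι : E3 → ℕ} (hn : θ n = 1)
    (hι : ∀ k ∈ K, ι k < n ∧ θ (ι k + 1 / 2) = x k) {w : E3} (hw : ∃ k ∈ K, Incident A B k w) :
    ∃ L R : ℕ, L < R ∧ R ≤ n ∧ (R = n ↔ w ∉ openCube) ∧
      (∀ i < n, (i = L ∨ i = R) ↔ ∃ k ∈ K, Incident A B k w ∧ ι k = i) ∧
      ∀ t : ℝ, (∃ k ∈ K, Incident A B k w ∧ t ∈ uIcc (x k) (w 0)) ↔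
        θ (L + 1 / 2) ≤ t ∧ t ≤ θ (R + 1 / 2) ∧ t ≤ 1 := by
  rcases row_ends h hx hE hc hb hw with ⟨hwO, k, hk, k', hk', hkw, hkw', h1, h2, hall⟩ |
    ⟨hwO, hw1, k, hk, hkw, hall⟩
  · obtain ⟨i1, i2⟩ := hι k hk
    obtain ⟨i1', i2'⟩ := hι k' hk'
    have hlt : ι k < ι k' := by
      have : θ (ι k + 1 / 2) < θ (ι k' + 1 / 2) := by rw [i2, i2']; exact h1.trans h2
      rw [θ.lt_iff_lt] at this
      have h3 : (ι k : ℝ) < ι k' := by linarith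
      exact_mod_cast h3
    refine ⟨ι k, ι k', hlt, i1'.le, iff_of_false i1'.ne (not_not.2 hwO), fun i hi => ?_,
      fun t => ?_⟩
    · constructor
      · rintro (rfl | rfl)
        · exact ⟨k, hk, hkw, rfl⟩
        · exact ⟨k', hk', hkw', rfl⟩
      · rintro ⟨l, hl, hlw, rfl⟩
        rcases hall l hl hlw with rfl | rfl
        · exact Or.inl rfl
        · exact Or.inr rfl
    · rw [i2, i2']
      constructor
      · rintro ⟨l, hl, hlw, ht⟩
        have h3 := (x_mem h hx hk').2
        rcases hall l hl hlw with rfl | rfl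
        · rw [uIcc_of_le h1.le] at ht
          refine ⟨ht.1, ?_, ?_⟩ <;> linarith [ht.2]
        · rw [uIcc_of_ge h2.le] at ht
          refine ⟨?_, ht.2, ?_⟩ <;> linarith [ht.1, ht.2]
      · rintro ⟨h3, h4, -⟩
        rcases le_total t (w 0) with h5 | h5
        · exact ⟨k, hk, hkw, by rw [uIcc_of_le h1.le]; exact ⟨h3, h5⟩⟩
        · exact ⟨k', hk', hkw', by rw [uIcc_of_ge h2.le]; exact ⟨h5, h4⟩⟩
  · obtain ⟨i1, i2⟩ := hι k hk
    have hx1 := (x_mem h hx hk).2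
    refine ⟨ι k, n, i1, le_rfl, iff_of_true rfl hwO, fun i hi => ?_, fun t => ?_⟩
    · constructor
      · rintro (rfl | rfl)
        · exact ⟨k, hk, hkw, rfl⟩
        · exact absurd hi (lt_irrefl _)
      · rintro ⟨l, hl, hlw, rfl⟩
        rw [hall l hl hlw]
        exact Or.inl rfl
    · rw [i2]
      have h3 : (1 : ℝ) < θ (n + 1 / 2) := by
        rw [← hn]; exact θ.strictMono (by linarith)
      constructor
      · rintro ⟨l, hl, hlw, ht⟩
        rw [hall l hl hlw, hw1, uIcc_of_le hx1.le] at ht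
        exact ⟨ht.1, ht.2.trans h3.le, ht.2⟩
      · rintro ⟨h4, h5, h6⟩
        exact ⟨k, hk, hkw, by rw [hw1, uIcc_of_le hx1.le]; exact ⟨h4, h6⟩⟩

end Stairs

end

noncomputable section
open Set Filter Topology

/-! ### The grid diagram of rectangular stairs -/

/-- The polygon `S` in the cube is the grid diagram with the given shape, in the coordinates given by
two subdivisions of the interval `[-1, 1]`. -/
structure GridPolygon (S : Set E3) (n : ℕ) (Row Col : ℕ → Prop) (L R lo up : ℕ → ℕ) (rz : ℕ → ℝ)
    (cz : ℕ → ℝ → ℝ) (θ ψ : ℝ ≃o ℝ) : Prop where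
  shape : GridShape n Row Col L R lo up rz cz
  pos : 0 < n
  left : θ 0 = -1
  right : θ n = 1
  bottom : ψ 0 = -1
  top : ψ n = 1
  mem : ∀ v, v ∈ S ↔
    (∃ j, Row j ∧ v 1 = ψ (j + 1 / 2) ∧ θ (L j + 1 / 2) ≤ v 0 ∧ v 0 ≤ θ (R j + 1 / 2) ∧ v 0 ≤ 1 ∧
      v 2 = 2 * rz j - 1) ∨
    ∃ i, Col i ∧ v 0 = θ (i + 1 / 2) ∧ ψ (lo i + 1 / 2) ≤ v 1 ∧ v 1 ≤ ψ (up i + 1 / 2) ∧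
      v 2 = 2 * cz i (ψ.symm (v 1)) - 1

theorem exists_gridPolygon {K : Finset E3} {A B C : E3 → E3} {lo hi r : E3 → ℝ} {x : E3 → ℝ}
    (h : Columns K A B C lo hi r) (hx : ∀ k ∈ K, x k ∈ Ioo (lo k) (hi k)) (hxi : InjOn x K)
    (hE : Emb openCube (stairEdges K A B) (stairPos (rectNodes A B x)))
    (hc : TangleCharts openCube (carrier (stairEdges K A B) (stairPos (rectNodes A B x))))
    (hb : ∀ v ∈ carrier (stairEdges K A B) (stairPos (rectNodes A B x)), v ∉ openCube → v 0 = 1) :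
    ∃ n Row Col L R lo' up rz cz θ ψ,
      GridPolygon (carrier (stairEdges K A B) (stairPos (rectNodes A B x))) n Row Col L R lo' up rz cz
        θ ψ := by
  classical
  let Rs : E3 → Prop := fun w => ∃ k ∈ K, Incident A B k w
  let Rf : Finset E3 := K.image A ∪ K.image B
  have hRf : ∀ w, w ∈ Rf ↔ Rs w := by
    intro w
    simp only [Rf, Rs, Incident, Finset.mem_union, Finset.mem_image]
    constructor
    · rintro (⟨k, hk, h⟩ | ⟨k, hk, h⟩)
      · exact ⟨k, hk, Or.inl h⟩
      · exact ⟨k, hk, Or.inr h⟩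
    · rintro ⟨k, hk, h | h⟩
      · exact Or.inl ⟨k, hk, h⟩
      · exact Or.inr ⟨k, hk, h⟩
  have hRbox : ∀ w, Rs w → ∀ i, i ≠ 0 → w i ∈ Ioo (-1 : ℝ) 1 := by
    rintro w ⟨k, hk, hw⟩ i hi
    exact abs_lt.1 (h.box k hk w (hw.elim (fun h => Or.inl h.symm) fun h => Or.inr (Or.inl h.symm))
      i hi).2
  have hRinj : ∀ w w', Rs w → Rs w' → w 1 = w' 1 → w = w' := by
    rintro w w' ⟨k, hk, hw⟩ ⟨k', hk', hw'⟩ h1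
    exact h.rows k hk k' hk' w w' (hw.imp Eq.symm Eq.symm) (hw'.imp Eq.symm Eq.symm) h1
  have hRA : ∀ k ∈ K, Rs (A k) := fun k hk => ⟨k, hk, Or.inl rfl⟩
  have hRB : ∀ k ∈ K, Rs (B k) := fun k hk => ⟨k, hk, Or.inr rfl⟩
  set n : ℕ := K.card + Rf.card + 1 with hn
  obtain ⟨θ, ρ, θ0, θn, hρ, -⟩ := exists_axis (K.image x) (by
    intro s hs
    obtain ⟨k, hk, rfl⟩ := Finset.mem_image.1 hs
    exact x_mem h hx hk) n (Nat.succ_pos _) (Finset.card_image_le.trans (by omega))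
  obtain ⟨ψ, σ, ψ0, ψn, hσ, hψ⟩ := exists_axis (Rf.image fun w => w 1) (by
    intro s hs
    obtain ⟨w, hw, rfl⟩ := Finset.mem_image.1 hs
    exact hRbox w ((hRf w).1 hw) 1 (by decide)) n (Nat.succ_pos _)
    (Finset.card_image_le.trans (by omega))
  let ι : E3 → ℕ := fun k => ρ (x k)
  let κ : E3 → ℕ := fun w => σ (w 1)
  have hι : ∀ k ∈ K, ι k < n ∧ θ (ι k + 1 / 2) = x k :=
    fun k hk => hρ _ (Finset.mem_image_of_mem _ hk)
  have hκ : ∀ w, Rs w → κ w < n ∧ ψ (κ w + 1 / 2) = w 1 :=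
    fun w hw => hσ _ (Finset.mem_image_of_mem (fun w : E3 => w 1) ((hRf w).2 hw))
  have hιi : ∀ k ∈ K, ∀ k' ∈ K, ι k = ι k' → k = k' := by
    intro k hk k' hk' h0
    exact hxi hk hk' (by rw [← (hι k hk).2, ← (hι k' hk').2, h0])
  have hκi : ∀ w w', Rs w → Rs w' → κ w = κ w' → w = w' := by
    intro w w' hw hw' h0
    exact hRinj w w' hw hw' (by rw [← (hκ w hw).2, ← (hκ w' hw').2, h0])
  have hκlt : ∀ w w', Rs w → Rs w' → (κ w < κ w' ↔ w 1 < w' 1) := by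
    intro w w' hw hw'
    rw [← (hκ w hw).2, ← (hκ w' hw').2, ψ.lt_iff_lt, add_lt_add_iff_right, Nat.cast_lt]
  let Row : ℕ → Prop := fun j => ∃ w, Rs w ∧ κ w = j
  let Col : ℕ → Prop := fun i => ∃ k ∈ K, ι k = i
  have hrow : ∀ j, ∃ w, Row j → Rs w ∧ κ w = j := by
    intro j
    by_cases hj : Row j
    · obtain ⟨w, hw⟩ := hj
      exact ⟨w, fun _ => hw⟩
    · exact ⟨0, fun h => absurd h hj⟩
  choose ω hω using hrow
  have hcol : ∀ i, ∃ k, Col i → k ∈ K ∧ ι k = i := by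
    intro i
    by_cases hi : Col i
    · obtain ⟨k, hk⟩ := hi
      exact ⟨k, fun _ => hk⟩
    · exact ⟨0, fun h => absurd h hi⟩
  choose γ hγ using hcol
  have hωκ : ∀ w, Rs w → ω (κ w) = w := by
    intro w hw
    obtain ⟨h1, h2⟩ := hω (κ w) ⟨w, hw, rfl⟩
    exact hκi _ _ h1 hw h2
  have hγι : ∀ k ∈ K, γ (ι k) = k := by
    intro k hk
    obtain ⟨h1, h2⟩ := hγ (ι k) ⟨k, hk, rfl⟩
    exact hιi _ h1 _ hk h2
  have hdata : ∀ w, ∃ L R : ℕ, Rs w → L < R ∧ R ≤ n ∧ (R = n ↔ w ∉ openCube) ∧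
      (∀ i < n, (i = L ∨ i = R) ↔ ∃ k ∈ K, Incident A B k w ∧ ι k = i) ∧
      ∀ t : ℝ, (∃ k ∈ K, Incident A B k w ∧ t ∈ uIcc (x k) (w 0)) ↔
        θ (L + 1 / 2) ≤ t ∧ t ≤ θ (R + 1 / 2) ∧ t ≤ 1 := by
    intro w
    by_cases hw : Rs w
    · obtain ⟨L, R, h0⟩ := row_data h hx hE hc hb θn hι hw
      exact ⟨L, R, fun _ => h0⟩
    · exact ⟨0, 0, fun h => absurd h hw⟩
  choose L R hLR using hdata
  let height : ℕ → ℝ → ℝ := fun i y => columnHeight (A (γ i)) (B (γ i)) (ψ y)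
  have hend : ∀ k ∈ K, ∀ w, Incident A B k w → columnHeight (A k) (B k) (w 1) = w 2 := by
    rintro k hk w (rfl | rfl)
    · exact columnHeight_left _ _
    · exact columnHeight_right (h.lt k hk)
  refine ⟨n, Row, Col, fun j => L (ω j), fun j => R (ω j), fun i => κ (A (γ i)),
    fun i => κ (B (γ i)), fun j => (ω j 2 + 1) / 2, fun i y => (height i y + 1) / 2, θ, ψ,
    ⟨?_, ?_, ?_, ?_, ?_, ?_, ?_, ?_⟩, Nat.succ_pos _, θ0, θn, ψ0, ψn, ?_⟩
  · intro j hj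
    obtain ⟨h1, h2⟩ := hω j hj
    exact ⟨(hLR _ h1).1, (hLR _ h1).2.1, h2 ▸ (hκ _ h1).1⟩
  · intro i hi
    obtain ⟨h1, h2⟩ := hγ i hi
    exact ⟨(hκlt _ _ (hRA _ h1) (hRB _ h1)).2 (h.lt _ h1), (hκ _ (hRB _ h1)).1, h2 ▸ (hι _ h1).1⟩
  · intro i j hi hj
    constructor
    · rintro ⟨hrj, h0⟩
      obtain ⟨h1, h2⟩ := hω j hrj
      obtain ⟨k, hk, hkw, rfl⟩ := ((hLR _ h1).2.2.2.1 i hi).1 h0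
      refine ⟨⟨k, hk, rfl⟩, ?_⟩
      rw [hγι k hk]
      rcases hkw with h3 | h3
      · exact Or.inl (by rw [h3, h2])
      · exact Or.inr (by rw [h3, h2])
    · rintro ⟨hci, h0⟩
      obtain ⟨h1, h2⟩ := hγ i hci
      have : ∀ w, Incident A B (γ i) w → j = κ w → Row j ∧ (i = L (ω j) ∨ i = R (ω j)) := by
        rintro w hw rfl
        have hRw : Rs w := ⟨_, h1, hw⟩
        refine ⟨⟨w, hRw, rfl⟩, ?_⟩
        rw [hωκ w hRw]
        exact ((hLR w hRw).2.2.2.1 i hi).2 ⟨_, h1, hw, h2⟩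
      rcases h0 with h0 | h0
      · exact this _ (Or.inl rfl) h0
      · exact this _ (Or.inr rfl) h0
  · intro j hj
    have := hRbox _ (hω j hj).1 2 (by decide)
    constructor <;> linarith [this.1, this.2]
  · intro i hi y hy
    obtain ⟨h1, h2⟩ := hγ i hi
    have := columnHeight_mem (h.lt _ h1) (convex_Ioo (-1 : ℝ) 1) (hRbox _ (hRA _ h1) 2 (by decide))
      (hRbox _ (hRB _ h1) 2 (by decide)) (y := ψ y)
      ⟨by rw [← (hκ _ (hRA _ h1)).2]; exact ψ.monotone hy.1,
        by rw [← (hκ _ (hRB _ h1)).2]; exact ψ.monotone hy.2⟩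
    constructor <;> simp only [height] <;> linarith [this.1, this.2]
  · intro i _ m t ht
    simp only [height]
    rw [hψ m t ht, columnHeight_combo]
    ring
  · intro i j hrj hci h0
    obtain ⟨h1, h2⟩ := hω j hrj
    obtain ⟨h3, h4⟩ := hγ i hci
    obtain ⟨k, hk, hkw, rfl⟩ := ((hLR _ h1).2.2.2.1 i (h4 ▸ (hι _ h3).1)).1 h0
    simp only [height]
    rw [hγι k hk, ← hend k hk _ hkw, ← (hκ _ h1).2, h2]
  · intro i j hrj hci hLi hiR hlo hup heq
    obtain ⟨h1, h2⟩ := hω j hrj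
    obtain ⟨h3, h4⟩ := hγ i hci
    set w := ω j
    set k := γ i
    have hw1 : ψ (j + 1 / 2) = w 1 := by rw [← h2]; exact (hκ _ h1).2
    have hxk : θ (i + 1 / 2) = x k := by rw [← h4]; exact (hι _ h3).2
    obtain ⟨l, hl, hlw, ht⟩ := ((hLR _ h1).2.2.2.2 (x k)).2 (by
      rw [← hxk]
      refine ⟨θ.monotone ?_, θ.monotone ?_, ?_⟩
      · have : (L w : ℝ) < i := by exact_mod_cast hLi
        linarith
      · have : (i : ℝ) < R w := by exact_mod_cast hiR
        linarith
      · rw [hxk]; exact (x_mem h hx h3).2.le)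
    obtain ⟨e1, -, e3⟩ := rowEdge_spec (x := x) hl hlw
    have hlo' : A k 1 < w 1 := (hκlt _ _ (hRA _ h3) h1).1 (by rw [h2]; exact hlo)
    have hup' : w 1 < B k 1 := (hκlt _ _ h1 (hRB _ h3)).1 (by rw [h2]; exact hup)
    simp only [height] at heq
    rw [hw1] at heq
    obtain ⟨u, hu, hu', -⟩ := hE.inter (Sum.inr (k, false), Sum.inr (k, true))
      (mem_stairEdges.2 ⟨k, h3, Or.inr (Or.inl rfl)⟩) _ e1 (by
        unfold rowEdge; split_ifs <;> simp) !₂[x k, w 1, w 2]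
      (by
        have : segment ℝ (stairPos (rectNodes A B x) (Sum.inr (k, false)))
            (stairPos (rectNodes A B x) (Sum.inr (k, true))) =
            segment ℝ (!₂[x k, A k 1, A k 2] : E3) !₂[x k, B k 1, B k 2] := by
          simp [stairPos, rectNodes]
        rw [this, mem_segment_column (h.lt k h3)]
        refine ⟨by simp, by simpa using ⟨hlo'.le, hup'.le⟩, ?_⟩
        simp
        linarith)
      (by
        rw [e3, mem_segment_foot]
        exact ⟨by simp, by simp, by simpa using ht⟩)
    have hlk : l = k := by
      unfold rowEdge at hu'
      rcases hu with rfl | rfl <;> split_ifs at hu' <;> rcases hu' with h5 | h5 <;> simp at h5 <;>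
        exact h5.symm
    rw [hlk] at hlw
    rcases hlw with h5 | h5
    · rw [h5] at hlo'; exact lt_irrefl _ hlo'
    · rw [h5] at hup'; exact lt_irrefl _ hup'
  · intro v
    rw [mem_carrier_stairs]
    refine or_congr ⟨?_, ?_⟩ ⟨?_, ?_⟩
    · rintro ⟨w, k, hk, hkw, hv⟩
      have hw : Rs w := ⟨k, hk, hkw⟩
      obtain ⟨h1, h2, h3⟩ := mem_segment_foot.1 hv
      obtain ⟨h4, h5, h6⟩ := ((hLR w hw).2.2.2.2 (v 0)).1 ⟨k, hk, hkw, h3⟩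
      refine ⟨κ w, ⟨w, hw, rfl⟩, ?_⟩
      rw [hωκ w hw]
      exact ⟨by rw [h1, (hκ w hw).2], h4, h5, h6, by rw [h2]; ring⟩
    · rintro ⟨j, hj, h1, h2, h3, h4, h5⟩
      obtain ⟨h6, h7⟩ := hω j hj
      obtain ⟨k, hk, hkw, ht⟩ := ((hLR _ h6).2.2.2.2 (v 0)).2 ⟨h2, h3, h4⟩
      refine ⟨ω j, k, hk, hkw, mem_segment_foot.2 ⟨?_, by rw [h5]; ring, ht⟩⟩
      rw [h1, ← (hκ _ h6).2, h7]
    · rintro ⟨k, hk, hv⟩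
      obtain ⟨h1, h2, h3⟩ := (mem_segment_column (h.lt k hk)).1 hv
      refine ⟨ι k, ⟨k, hk, rfl⟩, ?_⟩
      simp only [height]
      rw [hγι k hk]
      refine ⟨by rw [h1, (hι k hk).2], ?_, ?_, ?_⟩
      · rw [(hκ _ (hRA k hk)).2]; exact h2.1
      · rw [(hκ _ (hRB k hk)).2]; exact h2.2
      · rw [OrderIso.apply_symm_apply, h3]; ring
    · rintro ⟨i, hi, h1, h2, h3, h4⟩
      obtain ⟨h6, h7⟩ := hγ i hi
      refine ⟨γ i, h6, (mem_segment_column (h.lt _ h6)).2 ⟨?_, ⟨?_, ?_⟩, ?_⟩⟩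
      · rw [h1, ← (hι _ h6).2, h7]
      · rw [(hκ _ (hRA _ h6)).2] at h2; exact h2
      · rw [(hκ _ (hRB _ h6)).2] at h3; exact h3
      · simp only [height] at h4
        rw [OrderIso.apply_symm_apply] at h4
        linarith

end

noncomputable section
open Set Filter Topology

/-! ### From grid diagrams to mosaics -/

theorem openBox_subset_box (n : ℕ) : openBox n ⊆ box n := fun _ hx =>
  ⟨Ioo_subset_Icc_self hx.1, Ioo_subset_Icc_self hx.2.1, Ioo_subset_Icc_self hx.2.2⟩

theorem isBounded_openBox (n : ℕ) : Bornology.IsBounded (openBox n) := by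
  rw [isBounded_iff_forall_norm_le]
  refine ⟨n + n + 1, fun x hx => ?_⟩
  have := E3.norm_le_sum x
  have h0 := abs_of_pos hx.1.1
  have h1 := abs_of_pos hx.2.1.1
  have h2 := abs_of_pos hx.2.2.1
  linarith [hx.1.2, hx.2.1.2, hx.2.2.2]

theorem disjoint_frontier_openBox {n : ℕ} {x : E3} (hx : x ∈ frontier (box n)) : x ∉ openBox n :=
  fun h => hx.2 ((isOpen_openBox n).subset_interior_iff.2 (openBox_subset_box n) h)

theorem ramp_mem (n : ℕ) (x : ℝ) : ramp n x ∈ Icc (0 : ℝ) 1 :=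
  ⟨le_max_left _ _, max_le zero_le_one (by linarith [abs_nonneg ((n : ℝ) - x)])⟩

theorem ramp_eq_zero {n : ℕ} {x : ℝ} (h : x ≤ n - 1 / 2) : ramp n x = 0 := by
  refine max_eq_left ?_
  rw [abs_of_nonneg (by linarith)]
  linarith

theorem lift_zero (s z : ℝ) : lift s 0 z = z := by simp [lift]

theorem lift_mem_Icc {s τ : ℝ} (hs : s ∈ Ioo (0 : ℝ) 1) (hτ : τ ∈ Icc (0 : ℝ) 1) {z : ℝ} :
    lift s τ z ∈ Icc (0 : ℝ) 1 ↔ z ∈ Icc (0 : ℝ) 1 := by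
  have h0 : lift s τ 0 = 0 := by rw [lift, tent_eq_zero hs (Or.inl le_rfl)]; ring
  have h1 : lift s τ 1 = 1 := by rw [lift, tent_eq_zero hs (Or.inr le_rfl)]; ring
  have h := strictMono_lift hs hτ
  rw [mem_Icc, mem_Icc]
  nth_rewrite 1 [← h0]
  nth_rewrite 1 [← h1]
  rw [h.le_iff_le, h.le_iff_le]

theorem lift_eq_iff {s τ : ℝ} (hs : s ∈ Ioo (0 : ℝ) 1) (hτ : τ ∈ Icc (0 : ℝ) 1) {z : ℝ} :
    lift s τ z = s + τ * (1 / 2 - s) ↔ z = s := by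
  have h : lift s τ s = s + τ * (1 / 2 - s) := by rw [lift, tent_peak hs, mul_one]
  rw [← h]
  exact (strictMono_lift hs hτ).injective.eq_iff

namespace GridPolygon

variable {S : Set E3} {n : ℕ} {Row Col : ℕ → Prop} {L R lo up : ℕ → ℕ} {rz : ℕ → ℝ}
  {cz : ℕ → ℝ → ℝ} {θ ψ : ℝ ≃o ℝ}

theorem boundary (g : GridPolygon S n Row Col L R lo up rz cz θ ψ) :
    {v | v ∈ S ∧ v ∉ openCube} =
      (fun j : ℕ => (!₂[1, ψ (j + 1 / 2), 2 * rz j - 1] : E3)) '' {j | Row j ∧ R j = n} := by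
  have hθ : ∀ t : ℝ, 0 < t → -1 < θ t := fun t ht => by
    rw [← g.left]; exact θ.strictMono ht
  have hθ' : ∀ t : ℝ, t < n → θ t < 1 := fun t ht => by
    rw [← g.right]; exact θ.strictMono ht
  have hψ : ∀ t : ℝ, 0 < t → -1 < ψ t := fun t ht => by
    rw [← g.bottom]; exact ψ.strictMono ht
  have hψ' : ∀ t : ℝ, t < n → ψ t < 1 := fun t ht => by
    rw [← g.top]; exact ψ.strictMono ht
  have hhalf : ∀ i : ℕ, i < n → (i : ℝ) + 1 / 2 < n := fun i hi => by
    have : (i : ℝ) + 1 ≤ n := by exact_mod_cast hi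
    linarith
  have hpos : ∀ i : ℕ, (0 : ℝ) < i + 1 / 2 := fun i => by positivity
  have hcube : ∀ v : E3, v ∈ openCube ↔ |v 0| < 1 ∧ |v 1| < 1 ∧ |v 2| < 1 := fun v =>
    Fin.forall_fin_succ.trans (and_congr Iff.rfl Fin.forall_fin_two)
  ext v
  constructor
  · rintro ⟨hv, hvO⟩
    rcases (g.mem v).1 hv with ⟨j, hj, h1, h2, h3, h4, h5⟩ | ⟨i, hi, h1, h2, h3, h4⟩
    · obtain ⟨r1, r2, r3⟩ := g.shape.row j hj
      have hz := g.shape.rz_mem j hj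
      have hv0 : v 0 = 1 := by
        by_contra h0
        refine hvO ((hcube v).2 ⟨abs_lt.2 ⟨(hθ _ (hpos _)).trans_le h2, lt_of_le_of_ne h4 h0⟩, ?_, ?_⟩)
        · rw [h1]; exact abs_lt.2 ⟨hψ _ (hpos _), hψ' _ (hhalf _ r3)⟩
        · rw [h5]; exact abs_lt.2 ⟨by linarith [hz.1], by linarith [hz.2]⟩
      refine ⟨j, ⟨hj, ?_⟩, E3.ext (by simp [hv0]) (by simp [h1]) (by simp [h5])⟩
      by_contra h0
      have := hθ' _ (hhalf _ (lt_of_le_of_ne r2 h0))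
      linarith
    · exfalso
      obtain ⟨c1, c2, c3⟩ := g.shape.col i hi
      have hy : ψ.symm (v 1) ∈ Icc ((lo i : ℝ) + 1 / 2) (up i + 1 / 2) :=
        ⟨ψ.le_symm_apply.2 h2, ψ.symm_apply_le.2 h3⟩
      have hz := g.shape.cz_mem i hi _ hy
      refine hvO ((hcube v).2 ⟨?_, ?_, ?_⟩)
      · rw [h1]; exact abs_lt.2 ⟨hθ _ (hpos _), hθ' _ (hhalf _ c3)⟩
      · exact abs_lt.2 ⟨(hψ _ (hpos _)).trans_le h2, h3.trans_lt (hψ' _ (hhalf _ c2))⟩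
      · rw [h4]; exact abs_lt.2 ⟨by linarith [hz.1], by linarith [hz.2]⟩
  · rintro ⟨j, ⟨hj, hRj⟩, rfl⟩
    obtain ⟨r1, r2, r3⟩ := g.shape.row j hj
    refine ⟨(g.mem _).2 (Or.inl ⟨j, hj, by simp, ?_, ?_, by simp, by simp⟩), fun h0 => ?_⟩
    · simpa using (hθ' _ (hhalf _ (hRj ▸ r1))).le
    · have : θ n ≤ θ (R j + 1 / 2) := θ.monotone (by rw [hRj]; linarith)
      rw [g.right] at this
      simpa using this
    · have := ((hcube _).1 h0).1
      simp at this

theorem ncard_boundary (g : GridPolygon S n Row Col L R lo up rz cz θ ψ) :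
    g.shape.data.mosaic.boundaryPoints.ncard = {v | v ∈ S ∧ v ∉ openCube}.ncard := by
  rw [g.shape.data.ncard_boundaryPoints, g.boundary, ncard_image_of_injective]
  · congr 1
    ext j
    constructor
    · rintro ⟨-, h1, -, h3⟩
      exact ⟨h1, le_antisymm (g.shape.row j h1).2.1 h3⟩
    · rintro ⟨h1, h2⟩
      obtain ⟨r1, r2, r3⟩ := g.shape.row j h1
      exact ⟨r3, h1, h2 ▸ r1, h2.ge⟩
  · intro j j' h
    have := congrArg (fun v : E3 => v 1) h
    simpa using this

theorem exists_mosaic (g : GridPolygon S n Row Col L R lo up rz cz θ ψ) :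
    ∃ M : Mosaic n, M.IsTangleMosaic ∧
      M.boundaryPoints.ncard = {v | v ∈ S ∧ v ∉ openCube}.ncard ∧
      ∃ H : E3 ≃ₜ E3, Isotopic H ∧ H '' cube = box n ∧ H '' S = M.realization ∧
        ((∀ v ∈ S, v ∉ openCube → v 2 = 0) →
          H '' {x | x ∈ frontier cube ∧ 0 ≤ x 2} = upperBoundary n ∧
          H !₂[-1, -1, 0] = !₂[0, 0, 1 / 2]) := by
  classical
  refine ⟨g.shape.data.mosaic, g.shape.data.isTangleMosaic, g.ncard_boundary, ?_⟩
  obtain ⟨K1, hK1, hK1v⟩ := isotopic_prod θ.symm ψ.symm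
  obtain ⟨K2, hK2, hK2v⟩ := isotopic_affine 1 1 (1 / 2) 0 0 0 (1 / 2) one_pos one_pos (by norm_num)
  have hΨ : ∀ v, K2 (K1 v) = !₂[θ.symm (v 0), ψ.symm (v 1), (v 2 + 1) / 2] := by
    intro v
    rw [hK2v, hK1v]
    refine E3.ext (by simp) (by simp) ?_
    simp
    ring
  obtain ⟨s, hs, hsI, hsv, hsc⟩ := exists_continuous_through
    (((Finset.range n).filter fun j => Row j ∧ R j = n).image fun j : ℕ => (j : ℝ) + 1 / 2)
    (fun y => rz ⌊y⌋₊) (by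
      intro y hy
      obtain ⟨j, hj, rfl⟩ := Finset.mem_image.1 hy
      have : ⌊(j : ℝ) + 1 / 2⌋₊ = j := by
        rw [Nat.floor_eq_iff (by positivity)]; constructor <;> linarith
      rw [this]
      exact g.shape.rz_mem j (Finset.mem_filter.1 hj).2.1)
  have hfl : ∀ j : ℕ, ⌊(j : ℝ) + 1 / 2⌋₊ = j := fun j => by
    rw [Nat.floor_eq_iff (by positivity)]; constructor <;> linarith
  have hsr : ∀ j, Row j → R j = n → s (j + 1 / 2) = rz j := by
    intro j hj hR
    have := hsv (j + 1 / 2) (Finset.mem_image_of_mem _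
      (Finset.mem_filter.2 ⟨Finset.mem_range.2 (g.shape.row j hj).2.2, hj, hR⟩))
    rwa [hfl] at this
  obtain ⟨Ω, hΩ, hΩv⟩ := exists_lift n s hs hsI
  obtain ⟨M, hM, -, hM2⟩ := g.shape.data.moves.apply
  have hM' : ∀ x, x ∉ openBox n → M x = x := hM
  set G : E3 ≃ₜ E3 := (K1.trans K2).trans Ω with hG
  have hGv : ∀ v, G v = !₂[θ.symm (v 0), ψ.symm (v 1),
      lift (s (ψ.symm (v 1))) (ramp n (θ.symm (v 0))) ((v 2 + 1) / 2)] := by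
    intro v
    show Ω (K2 (K1 v)) = _
    rw [hΩv, hΨ]
    simp [ramp]
  have hGS : G '' S = rowSet n Row L R rz ∪ colSet Col lo up cz := by
    have key : ∀ v, v ∈ S ↔ G v ∈ rowSet n Row L R rz ∪ colSet Col lo up cz := by
      intro v
      rw [g.mem, hGv]
      refine or_congr (exists_congr fun j => and_congr_right fun hj => ?_)
        (exists_congr fun i => and_congr_right fun hi => ?_)
      · simp only [Matrix.cons_val, PiLp.toLp_apply, Matrix.cons_val_zero, Matrix.cons_val_one]
        rw [← ψ.symm_apply_eq, ← θ.le_symm_apply, ← θ.symm_apply_le,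
          show v 0 ≤ 1 ↔ θ.symm (v 0) ≤ n by rw [θ.symm_apply_le, g.right]]
        refine and_congr_right fun h1 => and_congr_right fun _ => and_congr_right fun h3 =>
          and_congr_right fun _ => ?_
        rw [h1]
        by_cases hR : R j = n
        · rw [hsr j hj hR, lift_eq_iff (g.shape.rz_mem j hj) (ramp_mem _ _)]
          constructor <;> intro h <;> linarith
        · have h6 : (R j : ℝ) + 1 ≤ n := by
            exact_mod_cast lt_of_le_of_ne (g.shape.row j hj).2.1 hR
          rw [ramp_eq_zero (by linarith), lift_zero]
          constructor <;> intro h <;> linarith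
      · simp only [Matrix.cons_val, PiLp.toLp_apply, Matrix.cons_val_zero, Matrix.cons_val_one]
        rw [← θ.symm_apply_eq, ← ψ.le_symm_apply, ← ψ.symm_apply_le]
        refine and_congr_right fun h1 => and_congr_right fun _ => and_congr_right fun h3 => ?_
        have h6 : (i : ℝ) + 1 ≤ n := by exact_mod_cast (g.shape.col i hi).2.2
        rw [h1, ramp_eq_zero (by linarith), lift_zero]
        constructor <;> intro h <;> linarith
    ext y
    constructor
    · rintro ⟨v, hv, rfl⟩
      exact (key v).1 hv
    · intro hy
      obtain ⟨v, rfl⟩ := G.surjective y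
      exact ⟨v, (key v).2 hy, rfl⟩
  have hGcube : G '' cube = box n := by
    have key : ∀ v, v ∈ cube ↔ G v ∈ box n := by
      intro v
      have hcube : v ∈ cube ↔ |v 0| ≤ 1 ∧ |v 1| ≤ 1 ∧ |v 2| ≤ 1 :=
        Fin.forall_fin_succ.trans (and_congr Iff.rfl Fin.forall_fin_two)
      rw [hcube, hGv]
      simp only [box, mem_ofPred_eq, Matrix.cons_val, PiLp.toLp_apply, Matrix.cons_val_zero,
        Matrix.cons_val_one]
      rw [lift_mem_Icc (hsI _) (ramp_mem _ _)]
      refine and_congr ?_ (and_congr ?_ ?_)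
      · rw [abs_le, mem_Icc, θ.le_symm_apply, θ.symm_apply_le, g.left, g.right]
      · rw [abs_le, mem_Icc, ψ.le_symm_apply, ψ.symm_apply_le, g.bottom, g.top]
      · rw [abs_le, mem_Icc]
        constructor <;> rintro ⟨h1, h2⟩ <;> constructor <;> linarith
    ext y
    constructor
    · rintro ⟨v, hv, rfl⟩
      exact (key v).1 hv
    · intro hy
      obtain ⟨v, rfl⟩ := G.surjective y
      exact ⟨v, (key v).2 hy, rfl⟩
  have hMbox : M '' box n = box n :=
    image_eq_of_eqOn_compl M fun x hx => hM' x fun h => hx (openBox_subset_box n h)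
  refine ⟨G.trans M, ((hK1.trans hK2).trans hΩ).trans
    (isotopic_of_eqOn_compl (isBounded_openBox n) M hM'), ?_, ?_, fun hz => ?_⟩
  · show (M ∘ G) '' cube = _
    rw [image_comp, hGcube, hMbox]
  · show (M ∘ G) '' S = _
    rw [image_comp, hGS, ← g.shape.carrier_data, hM2]
    exact g.shape.data.realization_mosaic.symm
  · have hs2 : ∀ y, s y = 1 / 2 := by
      refine hsc fun y hy => ?_
      obtain ⟨j, hj, rfl⟩ := Finset.mem_image.1 hy
      rw [hfl]
      have hmem : (!₂[1, ψ (j + 1 / 2), 2 * rz j - 1] : E3) ∈ {v | v ∈ S ∧ v ∉ openCube} := by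
        rw [g.boundary]
        exact mem_image_of_mem _ (Finset.mem_filter.1 hj).2
      have := hz _ hmem.1 hmem.2
      simp at this
      linarith
    have hG2 : ∀ v, G v = !₂[θ.symm (v 0), ψ.symm (v 1), (v 2 + 1) / 2] := by
      intro v
      rw [hGv, hs2]
      simp [lift]
    have hfr : G '' frontier cube = frontier (box n) := by rw [G.image_frontier, hGcube]
    have hMG : ∀ x ∈ frontier cube, M (G x) = G x := fun x hx =>
      hM' _ (disjoint_frontier_openBox (hfr ▸ mem_image_of_mem _ hx))
    constructor
    · ext y
      constructor
      · rintro ⟨x, ⟨hx, hx2⟩, rfl⟩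
        show M (G x) ∈ _
        rw [hMG x hx]
        refine ⟨hfr ▸ mem_image_of_mem _ hx, ?_⟩
        rw [hG2]
        simp
        linarith
      · rintro ⟨hy, hy2⟩
        obtain ⟨x, hx, rfl⟩ := hfr.symm ▸ hy
        refine ⟨x, ⟨hx, ?_⟩, hMG x hx⟩
        rw [hG2] at hy2
        simp at hy2
        linarith
    · have h0 : G !₂[-1, -1, 0] = !₂[0, 0, 1 / 2] := by
        rw [hG2]
        refine E3.ext ?_ ?_ ?_
        · simp [θ.symm_apply_eq, g.left]
        · simp [ψ.symm_apply_eq, g.bottom]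
        · simp
      show M (G _) = _
      rw [h0]
      apply hM'
      intro h
      have := h.1.1
      simp at this

end GridPolygon

end

noncomputable section
open Set Filter Topology

/-! ### Representation of tangles by mosaics -/

theorem mem_iff_of_eqOn_compl {O : Set E3} {h : E3 ≃ₜ E3} (hid : ∀ x, x ∉ O → h x = x) (x : E3) :
    h x ∈ O ↔ x ∈ O := by
  nth_rewrite 1 [← image_eq_of_eqOn_compl h hid]
  exact h.injective.mem_set_image

theorem openCube_subset_cube : openCube ⊆ cube := fun _ hx i => (hx i).le

theorem disjoint_frontier_openCube {x : E3} (hx : x ∈ frontier cube) : x ∉ openCube :=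
  fun h => hx.2 (interior_cube.symm ▸ h)

theorem Emb.mem_carrier_compl {V : Type*} {O : Set E3} {E : Finset (V × V)} {p : V → E3}
    (hE : Emb O E p) {x : E3} (hx : x ∈ carrier E p) (hxO : x ∉ O) : ∃ v, Used E v ∧ x = p v := by
  obtain ⟨e, he, hxe⟩ := mem_carrier.1 hx
  by_cases h1 : x = p e.1
  · exact ⟨_, ⟨e, he, Or.inl rfl⟩, h1⟩
  by_cases h2 : x = p e.2
  · exact ⟨_, ⟨e, he, Or.inr rfl⟩, h2⟩
  · exact absurd (hE.sub e he (mem_openSegment_of_ne_left_right (Ne.symm h1) (Ne.symm h2) hxe)) hxO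

/-- A polygon in the cube can be moved to a grid diagram. -/
theorem Emb.exists_gridPolygon {V : Type*} {E : Finset (V × V)} {p : V → E3}
    (hE : Emb openCube E p) (hc : TangleCharts openCube (carrier E p))
    (hb : ∀ v, Used E v → p v ∉ openCube → p v 0 = 1 ∧ |p v 1| < 1 ∧ |p v 2| < 1)
    (hby : ∀ v v', Used E v → Used E v' → p v ∉ openCube → p v' ∉ openCube → p v 1 = p v' 1 →
      v = v') :
    ∃ (S : Set E3) (N : E3 ≃ₜ E3), (∀ x, x ∉ openCube → N x = x) ∧ N '' carrier E p = S ∧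
      ∃ n Row Col L R lo up rz cz θ ψ, GridPolygon S n Row Col L R lo up rz cz θ ψ := by
  obtain ⟨p', hmv, hfix, htr⟩ := hE.exists_moves_transverse fun v hv h => (hb v hv h).1
  obtain ⟨N₁, hN₁, hN₁v, hN₁c⟩ := hmv.apply
  have hout : ∀ v, Used E v → p' v ∉ openCube → p v ∉ openCube := by
    intro v hv h h'
    rw [← hN₁v v hv, mem_iff_of_eqOn_compl hN₁] at h
    exact h h'
  have hc₁ : TangleCharts openCube (carrier E p') :=
    hN₁c ▸ hc.image N₁ fun x _ => mem_iff_of_eqOn_compl hN₁ x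
  obtain ⟨K, A, B, C, lo, hi, r, N₂, hK, hN₂, hN₂c⟩ := exists_columns (hmv.emb hE) hc₁ htr
    (fun v hv h => by
      rw [hfix v (hout v hv h)]
      exact hb v hv (hout v hv h))
    (fun v v' hv hv' h h' h1 => by
      rw [hfix v (hout v hv h), hfix v' (hout v' hv' h')] at h1
      exact hby v v' hv hv' (hout v hv h) (hout v' hv' h') h1)
  obtain ⟨x, hx, hxi, hEx, N₃, hN₃, hN₃c⟩ := exists_stairs hK
  have hc₃ : TangleCharts openCube (carrier (stairEdges K A B) (stairPos (rectNodes A B x))) := by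
    rw [← hN₃c, ← hN₂c]
    exact (hc₁.image N₂ fun x _ => mem_iff_of_eqOn_compl hN₂ x).image N₃
      fun x _ => mem_iff_of_eqOn_compl hN₃ x
  have hN : ∀ x, x ∉ openCube → ((N₁.trans N₂).trans N₃) x = x := by
    intro x hx
    show N₃ (N₂ (N₁ x)) = x
    rw [hN₁ x hx, hN₂ x hx, hN₃ x hx]
  have hNc : ((N₁.trans N₂).trans N₃) '' carrier E p =
      carrier (stairEdges K A B) (stairPos (rectNodes A B x)) := by
    show (N₃ ∘ N₂ ∘ N₁) '' carrier E p = _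
    rw [image_comp, image_comp, hN₁c, hN₂c, hN₃c]
  refine ⟨_, (N₁.trans N₂).trans N₃, hN, hNc, _root_.exists_gridPolygon hK hx hxi hEx hc₃ ?_⟩
  rintro v hv hvO
  rw [← hNc] at hv
  obtain ⟨u, hu, rfl⟩ := hv
  rw [mem_iff_of_eqOn_compl hN] at hvO
  rw [hN u hvO]
  obtain ⟨w, hw, rfl⟩ := hE.mem_carrier_compl hu hvO
  exact (hb w hw hvO).1

theorem exists_mosaic_of_tangle (m : ℕ) (T : Set E3) (hT : IsTangle m T) (hTame : IsTame T) (q : E3)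
    (hqe : q ∈ equator) (hqT : q ∉ T) :
    ∃ n : ℕ, 0 < n ∧ ∃ M : Mosaic n, M.IsTangleMosaic ∧ M.boundaryPoints.ncard = 2 * m ∧
      ∃ H : E3 ≃ₜ E3, Isotopic H ∧ H '' unitBall = box n ∧ H '' T = M.realization ∧
        (T ∩ Metric.sphere 0 1 ⊆ equator →
          H '' upperHemisphere = upperBoundary n ∧ H q = !₂[0, 0, 1 / 2]) := by
  obtain ⟨E, p, H, hH, hHball, hHT, hE, hc, hb, hby, hcard, hHup, hHq, heq⟩ :=
    exists_cube_polygon m T hT hTame q hqe hqT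
  obtain ⟨S, N, hN, rfl, n, Row, Col, L, R, lo, up, rz, cz, θ, ψ, g⟩ :=
    hE.exists_gridPolygon hc hb hby
  obtain ⟨M, hM, hMcard, G, hG, hGcube, hGS, hGup⟩ := g.exists_mosaic
  have hbd : {v | v ∈ N '' carrier E p ∧ v ∉ openCube} = p '' {v | Used E v ∧ p v ∉ openCube} := by
    ext v
    constructor
    · rintro ⟨⟨u, hu, rfl⟩, hv⟩
      rw [mem_iff_of_eqOn_compl hN] at hv
      rw [hN u hv]
      obtain ⟨w, hw, rfl⟩ := hE.mem_carrier_compl hu hv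
      exact ⟨w, ⟨hw, hv⟩, rfl⟩
    · rintro ⟨w, ⟨hw, hwO⟩, rfl⟩
      exact ⟨⟨p w, hw.mem_carrier, hN _ hwO⟩, hwO⟩
  have hfr : ∀ x ∈ frontier cube, N x = x := fun x hx => hN x (disjoint_frontier_openCube hx)
  refine ⟨n, g.pos, M, hM, ?_, (H.trans N).trans G, (hH.trans (isotopic_of_eqOn_compl
    (isBounded_cube.subset openCube_subset_cube) N hN)).trans hG, ?_, ?_, fun hTe => ?_⟩
  · rw [hMcard, hbd, InjOn.ncard_image, hcard]
    exact fun v hv v' hv' h => hE.injOn hv.1 hv'.1 h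
  · show (G ∘ N ∘ H) '' _ = _
    rw [image_comp, image_comp, hHball, image_eq_of_eqOn_compl N
      (fun x hx => hN x fun h => hx (openCube_subset_cube h)), hGcube]
  · show (G ∘ N ∘ H) '' _ = _
    rw [image_comp, image_comp, hHT, hGS]
  · have hz : ∀ v ∈ N '' carrier E p, v ∉ openCube → v 2 = 0 := by
      intro v hv hvO
      obtain ⟨w, ⟨hw, hwO⟩, rfl⟩ := hbd.subset ⟨hv, hvO⟩
      exact heq hTe w hw hwO
    obtain ⟨h1, h2⟩ := hGup hz
    constructor
    · show (G ∘ N ∘ H) '' _ = _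
      rw [image_comp, image_comp, hHup, ← h1]
      congr 1
      exact (image_congr fun x hx => hfr x hx.1).trans (image_id' _)
    · show G (N (H q)) = _
      rw [hHq, hN, h2]
      intro h
      have := h 0
      simp at this

theorem IsTangle.finite_boundary {m : ℕ} {T : Set E3} (hT : IsTangle m T) :
    (T ∩ Metric.sphere 0 1).Finite := by
  obtain ⟨c, f, -, rfl, -, hf⟩ := hT
  refine ((finite_range fun i : Fin m => f (Sum.inl (i, 0))).union
    (finite_range fun i : Fin m => f (Sum.inl (i, 1)))).subset ?_
  rintro _ ⟨⟨x, rfl⟩, hx⟩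
  obtain ⟨i, rfl | rfl⟩ := (hf x).1 (mem_sphere_zero_iff_norm.1 hx)
  · exact Or.inl ⟨i, rfl⟩
  · exact Or.inr ⟨i, rfl⟩

theorem infinite_equator : equator.Infinite := by
  have : InjOn (fun t : ℝ => (!₂[t, √(1 - t ^ 2), 0] : E3)) (Ioo 0 1) := by
    intro t _ t' _ h
    simpa using congrArg (fun x : E3 => x 0) h
  refine ((Ioo_infinite (zero_lt_one' ℝ)).image this).mono ?_
  rintro _ ⟨t, ht, rfl⟩
  have h1 : 0 ≤ 1 - t ^ 2 := by nlinarith [ht.1, ht.2]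
  refine ⟨?_, by simp⟩
  rw [EuclideanSpace.norm_eq, Fin.sum_univ_three]
  simp [Real.sq_sqrt h1]

end

theorem mainTheorem11 (m : ℕ) (T : Set E3) (hT : IsTangle m T) (hTame : IsTame T) :
    (∃ n : ℕ, 0 < n ∧ ∃ L : Mosaic n,
      L.IsTangleMosaic ∧ L.boundaryPoints.ncard = 2 * m ∧ L.Represents T) ∧
    (T ∩ Metric.sphere 0 1 ⊆ equator → ∀ p ∈ equator, p ∉ T →
      ∃ n : ℕ, 0 < n ∧ ∃ L : Mosaic n,
        L.IsTangleMosaic ∧ L.boundaryPoints.ncard = 2 * m ∧ L.RepresentsFrom T p) := by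
  constructor
  · obtain ⟨q, hqe, hqT⟩ := (infinite_equator.sdiff hT.finite_boundary).nonempty
    obtain ⟨n, hn, L, hL, hcard, H, ⟨Φ, rfl⟩, h1, h2, -⟩ := exists_mosaic_of_tangle m T hT hTame q
      hqe fun h => hqT ⟨h, mem_sphere_zero_iff_norm.2 hqe.1⟩
    exact ⟨n, hn, L, hL, hcard, Φ, h1, h2⟩
  · intro hTe p hp hpT
    obtain ⟨n, hn, L, hL, hcard, H, ⟨Φ, rfl⟩, h1, h2, h3⟩ :=
      exists_mosaic_of_tangle m T hT hTame p hp hpT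
    exact ⟨n, hn, L, hL, hcard, Φ, h1, h2, (h3 hTe).1, (h3 hTe).2⟩
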